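/- **Setting.** Consider the normal form of the folded saddle-node (type II) $$\dot x=\epsilon\,(y-(\mu+1)z+F),\qquad \dot y=\epsilon\,(\tfrac12\mu+G),\qquad \dot z=x+z^2+zH,$$ where $F,G,H$ are functions of $(x,y,z,\epsilon,\mu)$ near the origin, smooth in all variables and analytic in $(x,y,z)$, with a radius of convergence that is uniform in $(\epsilon,\mu)$ near $0$, and $$F=\mathcal O(x,\epsilon,(|y|+|z|)^2),\quad G=\mathcal O(x,y,z,\epsilon),\quad H=\mathcal O(xz,xy,z^2,\epsilon).$$ Put $a_1=\partial_yG(0)$, $a_2=\partial_zG(0)$ and suppose that $\lambda:=a_1+a_2\neq0$. In the scaling chart $x=r_2^2x_2,\ y=r_2y_2,\ z=r_2z_2,\ \epsilon=r_2^2$, and after division of the right hand side by $r_2$, the system reads $$\dot x_2=y_2-(\mu+1)z_2+r_2^{-1}F,\qquad \dot y_2=\tfrac12\mu+G,\qquad \dot z_2=x_2+z_2^2+r_2^{-1}z_2H,\tag{1}$$ with $F,G,H$ evaluated at $(r_2^2x_2,r_2y_2,r_2z_2,r_2^2,\mu)$; it extends continuously to $r_2=0$. Write $\mu=r_2\mu_2$.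 **Definition of $\overline\mu_2$.** Let $k\in\mathbb N$. There are $\nu,\delta,R>0$ and locally invariant curves (slow manifolds) of (1) of the form $(x_2,z_2)=m(y_2,r_2,\mu_2)$, $|y_2|\le\nu$, for $0\le r_2\le R$, $|\mu_2|\le\delta$, where $m(y_2,0,\mu_2)=(-y_2^2,y_2)$ and $m(\cdot,r_2,\mu_2)$ is a power series in $y_2$, absolutely convergent on the closed disc of radius $\nu$, which is $C^k$ in $(r_2,\mu_2)$ in the weighted $\ell^1$-norm $\sum_n|m_n|\nu^n$. Let $\tilde u=(x_2,z_2)-m(y_2,r_2,\mu_2)$. For $h>0$ follow the solution of (1) with $\tilde u(0)=(-h,0)$, $y_2(0)=y_2$ until its first return, at the time $T$, to $\{\tilde u_2=0,\ \tilde u_1<0\}$, and put $$\Delta_1=\tilde u_1(T)+h,\qquad \Delta_2=\int_0^T\frac{\dot y_2(t)}{r_2}\,dt,\qquad \widehat\Delta(h,y_2,r_2,\mu_2)=(h^{-1}\Delta_1,\Delta_2),$$ where $\dot y_2/r_2$ is continued to $r_2=0$ as $\tfrac12\mu_2+a_1y_2+a_2z_2$. For every $h_1>0$ there are $\eta,r_0>0$,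 with $\eta<\nu$, $\eta\le\delta$ and $r_0\le R$, such that $\widehat\Delta$ is defined for $0<h\le h_1$, $|y_2|,|\mu_2|\le\eta$, $0\le r_2\le r_0$ and extends to $h=0$ as a $C^k$ function, and there are $C^k$ functions $\overline y_2(h,r_2)$, $\overline\mu_2(h,r_2)$ on $[0,h_1]\times[0,r_0]$ with $$\widehat\Delta(h,\overline y_2(h,r_2),r_2,\overline\mu_2(h,r_2))=0,\qquad \overline y_2(h,0)=\overline\mu_2(h,0)=0,$$ which give the only zeros of $\widehat\Delta$ with $0\le h\le h_1$, $|y_2|,|\mu_2|\le\eta$, $0\le r_2\le r_0$. **Corollary.** Let $\mu_H(r_2):=r_2\,\overline\mu_2(0,r_2)$. After decreasing $r_0$ if necessary, for every $0<r_2\le r_0$ the system (1) undergoes a Hopf bifurcation at $\mu=\mu_H(r_2)$, at the point of the slow manifold with $y_2=\overline y_2(0,r_2)$. That is, this point is an equilibrium at which (1) is smooth in $(x_2,y_2,z_2,\mu)$; its linearization has a simple pair of eigenvalues $\pm i\omega$, $\omega>0$, and no other eigenvalue on the imaginary axis; along the smooth branch of equilibria through it, parametrized by $\mu$, the eigenvalue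 that continues $i\omega$ crosses the imaginary axis with nonzero speed at $\mu=\mu_H(r_2)$; and a continuous one-parameter family of periodic orbits, of minimal periods tending to $2\pi/\omega$ and along parameter values $\mu$ tending to $\mu_H(r_2)$, bifurcates from it. The bifurcation is singular (a zero-Hopf bifurcation in the limit): the eigenvalues at $\mu=\mu_H(r_2)$ are $\pm i\omega(r_2)$ and $\kappa(r_2)$ with $\omega(r_2)=1+\mathcal O(r_2)$ and $\kappa(r_2)=r_2(\lambda+\mathcal O(r_2))$ real, and for $r_2=\mu=0$ the eigenvalues at the origin are $\pm i,0$. -/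

import Mathlib

open Set Filter Topology MeasureTheory
open scoped ContDiff

namespace DudCanard

noncomputable section

/-! Hopf bifurcations of one-parameter families of vector fields -/

/-- The complex eigenvalues, with algebraic multiplicity, of a real endomorphism. -/
def eigenvalues {E : Type*} [NormedAddCommGroup E] [NormedSpace ℝ E] [FiniteDimensional ℝ E]
    (A : E →L[ℝ] E) : Multiset ℂ :=
  ((A : E →ₗ[ℝ] E).charpoly.map (algebraMap ℝ ℂ)).roots

/-- The family `p' = X μ p` undergoes a Hopf bifurcation at the parameter value `μ₀` and the
equilibrium `p₀`, with frequency `θ`. -/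
structure IsHopfBifurcation {E : Type*} [NormedAddCommGroup E] [NormedSpace ℝ E]
    [FiniteDimensional ℝ E] (X : ℝ → E → E) (μ₀ : ℝ) (p₀ : E) (θ : ℝ) : Prop where
  frequency_pos : 0 < θ
  smooth : ContDiffAt ℝ ∞ (fun q : ℝ × E => X q.1 q.2) (μ₀, p₀)
  equilibrium : X μ₀ p₀ = 0
  /-- `iθ` is an algebraically simple eigenvalue (hence so is `-iθ`). -/
  simple : (eigenvalues (fderiv ℝ (X μ₀) p₀)).count (θ * Complex.I) = 1
  /-- There are no other eigenvalues on the imaginary axis. -/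
  others : ∀ z ∈ eigenvalues (fderiv ℝ (X μ₀) p₀),
    z ≠ θ * Complex.I → z ≠ -(θ * Complex.I) → z.re ≠ 0
  /-- Along the branch of equilibria through `p₀`, the eigenvalue `σ` that continues `iθ` crosses
  the imaginary axis with nonzero speed. -/
  crossing : ∃ (p : ℝ → E) (σ : ℝ → ℂ),
    ContDiffAt ℝ ∞ p μ₀ ∧ ContDiffAt ℝ ∞ σ μ₀ ∧ p μ₀ = p₀ ∧ σ μ₀ = θ * Complex.I ∧
    (∀ᶠ μ in 𝓝 μ₀, X μ (p μ) = 0 ∧ σ μ ∈ eigenvalues (fderiv ℝ (X μ) (p μ))) ∧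
    (deriv σ μ₀).re ≠ 0
  /-- A continuous one-parameter family of periodic orbits `γ s`, of minimal period `T s`, of
  `X (M s)`, emanates from the equilibrium at `s = 0`. -/
  cycles : ∃ (s₀ : ℝ) (M T : ℝ → ℝ) (γ : ℝ → ℝ → E), 0 < s₀ ∧
    ContinuousOn M (Ico 0 s₀) ∧ ContinuousOn T (Ico 0 s₀) ∧
    ContinuousOn (fun q : ℝ × ℝ => γ q.1 q.2) (Ico 0 s₀ ×ˢ univ) ∧
    M 0 = μ₀ ∧ T 0 = 2 * Real.pi / θ ∧ (∀ t, γ 0 t = p₀) ∧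
    ∀ s ∈ Ioo 0 s₀, 0 < T s ∧
      (∀ t, HasDerivAt (γ s) (X (M s) (γ s t)) t) ∧
      (∀ t, γ s (t + T s) = γ s t) ∧
      ∀ t ∈ Ioo 0 (T s), γ s t ≠ γ s 0

/-! The functions of the normal form -/

/-- Functions of `(x, y, z, ε, μ)` near the origin that are smooth, and analytic in the phase space
variables `(x, y, z)` with a radius of convergence that is uniform in `(ε, μ)`: there is an extension
to complex `(x, y, z)` near the origin that is smooth, and holomorphic in `(x, y, z)`. -/
def AnalyticInSpace (F : ℝ → ℝ → ℝ → ℝ → ℝ → ℝ) : Prop :=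
  ∃ ρ > 0, ∃ Φ : (ℂ × ℂ × ℂ) × (ℝ × ℝ) → ℂ,
    ContDiffOn ℝ ∞ Φ (Metric.ball 0 ρ) ∧
    (∀ a ∈ Metric.ball (0 : ℝ × ℝ) ρ,
      DifferentiableOn ℂ (fun w : ℂ × ℂ × ℂ => Φ (w, a)) (Metric.ball 0 ρ)) ∧
    ∀ x y z ε μ : ℝ, |x| < ρ → |y| < ρ → |z| < ρ → |ε| < ρ → |μ| < ρ →
      Φ (((x : ℂ), (y : ℂ), (z : ℂ)), (ε, μ)) = (F x y z ε μ : ℂ)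

/-- `F = O(x, ε, (|y| + |z|)²)`. -/
def OrderF (F : ℝ → ℝ → ℝ → ℝ → ℝ → ℝ) : Prop :=
  (fun (x, y, z, ε, μ) => F x y z ε μ) =O[𝓝 (0 : ℝ × ℝ × ℝ × ℝ × ℝ)]
    fun (x, y, z, ε, _) => |x| + |ε| + (|y| + |z|) ^ 2

/-- `G = O(x, y, z, ε)`. -/
def OrderG (G : ℝ → ℝ → ℝ → ℝ → ℝ → ℝ) : Prop :=
  (fun (x, y, z, ε, μ) => G x y z ε μ) =O[𝓝 (0 : ℝ × ℝ × ℝ × ℝ × ℝ)]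
    fun (x, y, z, ε, _) => |x| + |y| + |z| + |ε|

/-- `H = O(xz, xy, z², ε)`. -/
def OrderH (H : ℝ → ℝ → ℝ → ℝ → ℝ → ℝ) : Prop :=
  (fun (x, y, z, ε, μ) => H x y z ε μ) =O[𝓝 (0 : ℝ × ℝ × ℝ × ℝ × ℝ)]
    fun (x, y, z, ε, _) => |x * z| + |x * y| + z ^ 2 + |ε|

/-- `a₁ = ∂G/∂y` at the origin. -/
def a₁ (G : ℝ → ℝ → ℝ → ℝ → ℝ → ℝ) : ℝ := deriv (fun y => G 0 y 0 0 0) 0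

/-- `a₂ = ∂G/∂z` at the origin. -/
def a₂ (G : ℝ → ℝ → ℝ → ℝ → ℝ → ℝ) : ℝ := deriv (fun z => G 0 0 z 0 0) 0

/-- `λ = a₁ + a₂`. -/
def lam (G : ℝ → ℝ → ℝ → ℝ → ℝ → ℝ) : ℝ := a₁ G + a₂ G

/-! The scaling chart -/

/-- The vector field of the normal form
`x' = ε (y - (μ+1) z + F)`, `y' = ε (μ/2 + G)`, `z' = x + z² + z H`. -/
def fastField (F G H : ℝ → ℝ → ℝ → ℝ → ℝ → ℝ) (ε μ : ℝ) : ℝ × ℝ × ℝ → ℝ × ℝ × ℝ :=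
  fun (x, y, z) =>
    (ε * (y - (μ + 1) * z + F x y z ε μ), ε * (μ / 2 + G x y z ε μ), x + z ^ 2 + z * H x y z ε μ)

/-- The system in the scaling chart `x = r² x₂, y = r y₂, z = r z₂, ε = r²`, after division of the
right hand side by `r`. For `r = 0` the quotients `F / r` and `H / r` are read as `0`, which is their
limit as `r → 0` if `F` and `H` have the orders above. -/
def chartField (F G H : ℝ → ℝ → ℝ → ℝ → ℝ → ℝ) (r μ : ℝ) : ℝ × ℝ × ℝ → ℝ × ℝ × ℝ :=
  fun (x, y, z) =>
    (y - (μ + 1) * z + F (r ^ 2 * x) (r * y) (r * z) (r ^ 2) μ / r,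
     μ / 2 + G (r ^ 2 * x) (r * y) (r * z) (r ^ 2) μ,
     x + z ^ 2 + z * (H (r ^ 2 * x) (r * y) (r * z) (r ^ 2) μ / r))

/-- For `r ≠ 0` the chart system is the pull-back of the normal form under the chart, divided
by `r`. -/
theorem fastField_eq_chartField (F G H : ℝ → ℝ → ℝ → ℝ → ℝ → ℝ) {r : ℝ} (hr : r ≠ 0)
    (μ x y z : ℝ) :
    fastField F G H (r ^ 2) μ (r ^ 2 * x, r * y, r * z) =
      (r ^ 2 * (r * (chartField F G H r μ (x, y, z)).1),
       r * (r * (chartField F G H r μ (x, y, z)).2.1),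
       r * (r * (chartField F G H r μ (x, y, z)).2.2)) := by
  simp only [fastField, chartField, Prod.mk.injEq]
  refine ⟨?_, ?_, ?_⟩ <;> field_simp

/-- The slow velocity `y₂' / r` of the chart system with `μ = r μ₂`, continued to `r = 0`. This is
the expression `μ₂ / 2 + λ y₂ + P₂`. -/
def slowRate (G : ℝ → ℝ → ℝ → ℝ → ℝ → ℝ) (r μ₂ : ℝ) : ℝ × ℝ × ℝ → ℝ :=
  fun (x, y, z) =>
    μ₂ / 2 + (if r = 0 then a₁ G * y + a₂ G * z
      else G (r ^ 2 * x) (r * y) (r * z) (r ^ 2) (r * μ₂) / r)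

/-! The slow manifold -/

/-- The point `(m₁(y), y, m₂(y))` of the graph `(x₂, z₂) = m(y₂, r, μ₂)`. -/
def graphPt (m : ℝ → ℝ → ℝ → ℝ × ℝ) (r μ₂ y : ℝ) : ℝ × ℝ × ℝ :=
  ((m y r μ₂).1, y, (m y r μ₂).2)

/-- The graphs `(x₂, z₂) = m(y₂, r, μ₂)`, `|y₂| ≤ ν`, are slow manifolds of the chart system with
`μ = r μ₂`, for all `0 ≤ r ≤ R` and `|μ₂| ≤ δ`. -/
structure IsSlowManifold (F G H : ℝ → ℝ → ℝ → ℝ → ℝ → ℝ) (k : ℕ) (ν δ R : ℝ)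
    (m : ℝ → ℝ → ℝ → ℝ × ℝ) : Prop where
  /-- `m(·, r, μ₂)` is a power series in `y₂` that converges absolutely on the closed disc of
  radius `ν`, and it is `C^k` in `(r, μ₂)` as an element of the Banach space of such power series,
  `c` being normed by `∑ |c n| ν ^ n`; here `b n = ν ^ n * c n`. -/
  series : ∃ b : ℝ × ℝ → lp (fun _ : ℕ => ℝ × ℝ) 1,
    ContDiffOn ℝ k b (Icc 0 R ×ˢ Icc (-δ) δ) ∧
    ∀ y ∈ Icc (-ν) ν, ∀ r ∈ Icc 0 R, ∀ μ₂ ∈ Icc (-δ) δ,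
      HasSum (fun n : ℕ => (y / ν) ^ n • b (r, μ₂) n) (m y r μ₂)
  /-- For `r = 0` the graph lies in the critical manifold `x₂ = -y₂², z₂ = y₂`. -/
  critical : ∀ y ∈ Icc (-ν) ν, ∀ μ₂ ∈ Icc (-δ) δ, m y 0 μ₂ = (-y ^ 2, y)
  /-- The vector field is tangent to the graph, which is thus locally invariant. -/
  invariant : ∀ y ∈ Ioo (-ν) ν, ∀ r ∈ Icc 0 R, ∀ μ₂ ∈ Icc (-δ) δ,
    chartField F G H r (r * μ₂) (graphPt m r μ₂ y) =
      (chartField F G H r (r * μ₂) (graphPt m r μ₂ y)).2.1 • deriv (graphPt m r μ₂) y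

/-- The straightened coordinates `ũ = (x₂, z₂) - m(y₂, r, μ₂)` of a point of the chart. -/
def straight (m : ℝ → ℝ → ℝ → ℝ × ℝ) (r μ₂ : ℝ) : ℝ × ℝ × ℝ → ℝ × ℝ :=
  fun (x, y, z) => (x, z) - m y r μ₂

/-! The return map to `{ũ₂ = 0, ũ₁ < 0}` and the Melnikov functions -/

/-- `φ` is the solution of the chart system with `μ = r μ₂` that starts at `ũ = (-h, 0)`, `y₂ = y`,
stays in the region `|y₂| ≤ ν`, and returns to the half-plane `{ũ₂ = 0, ũ₁ < 0}` for the first time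
at the time `T > 0`. -/
structure IsReturn (F G H : ℝ → ℝ → ℝ → ℝ → ℝ → ℝ) (ν : ℝ) (m : ℝ → ℝ → ℝ → ℝ × ℝ)
    (h y r μ₂ T : ℝ) (φ : ℝ → ℝ × ℝ × ℝ) : Prop where
  time_pos : 0 < T
  solves : ∀ t ∈ Icc 0 T,
    HasDerivWithinAt φ (chartField F G H r (r * μ₂) (φ t)) (Icc 0 T) t
  region : ∀ t ∈ Icc 0 T, (φ t).2.1 ∈ Icc (-ν) ν
  start_y : (φ 0).2.1 = y
  start_u : straight m r μ₂ (φ 0) = (-h, 0)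
  return_snd : (straight m r μ₂ (φ T)).2 = 0
  return_fst : (straight m r μ₂ (φ T)).1 < 0
  first : ∀ t ∈ Ioo 0 T,
    ¬ ((straight m r μ₂ (φ t)).2 = 0 ∧ (straight m r μ₂ (φ t)).1 < 0)

/-- The box `0 ≤ h ≤ h₁`, `|y₂| ≤ η`, `0 ≤ r ≤ r₀`, `|μ₂| ≤ η`. -/
def box (h₁ η r₀ : ℝ) : Set (ℝ × ℝ × ℝ × ℝ) :=
  Icc 0 h₁ ×ˢ Icc (-η) η ×ˢ Icc 0 r₀ ×ˢ Icc (-η) η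

/-- `D` is the Melnikov function `Δ̂ = (h⁻¹ Δ₁, Δ₂)` on a box: for `h > 0`,
`Δ₁ = ũ₁(T) - ũ₁(0) = ũ₁(T) + h` is the displacement of the return map and
`Δ₂ = ∫₀ᵀ (μ₂ / 2 + λ y₂ + P₂) dt` (so that `y₂(T) - y₂(0) = r Δ₂`), both along the solution with
`ũ(0) = (-h, 0)`, `y₂(0) = y`; and `D` is the `C^k` extension of this to `h = 0`. -/
structure IsMelnikov (F G H : ℝ → ℝ → ℝ → ℝ → ℝ → ℝ) (k : ℕ) (ν : ℝ)
    (m : ℝ → ℝ → ℝ → ℝ × ℝ) (h₁ η r₀ : ℝ) (D : ℝ × ℝ × ℝ × ℝ → ℝ × ℝ) : Prop where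
  smooth : ContDiffOn ℝ k D (box h₁ η r₀)
  displacement : ∀ h y r μ₂, (h, y, r, μ₂) ∈ box h₁ η r₀ → 0 < h →
    ∃ (T : ℝ) (φ : ℝ → ℝ × ℝ × ℝ), IsReturn F G H ν m h y r μ₂ T φ ∧
      D (h, y, r, μ₂) = (h⁻¹ * ((straight m r μ₂ (φ T)).1 + h), ∫ t in (0 : ℝ)..T,
        slowRate G r μ₂ (φ t))

/-- `(Y, M) = (ȳ₂, μ̄₂)` are `C^k` functions of `(h, r)` that solve `Δ̂(h, ȳ₂, r, μ̄₂) = 0`, vanish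
for `r = 0`, and give the only zeros of `Δ̂` in the box. -/
structure IsZeroBranch (k : ℕ) (h₁ η r₀ : ℝ) (D : ℝ × ℝ × ℝ × ℝ → ℝ × ℝ) (Y M : ℝ → ℝ → ℝ) :
    Prop where
  smooth_Y : ContDiffOn ℝ k (fun q : ℝ × ℝ => Y q.1 q.2) (Icc 0 h₁ ×ˢ Icc 0 r₀)
  smooth_M : ContDiffOn ℝ k (fun q : ℝ × ℝ => M q.1 q.2) (Icc 0 h₁ ×ˢ Icc 0 r₀)
  Y_zero : ∀ h ∈ Icc 0 h₁, Y h 0 = 0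
  M_zero : ∀ h ∈ Icc 0 h₁, M h 0 = 0
  mem_box : ∀ h ∈ Icc 0 h₁, ∀ r ∈ Icc 0 r₀, (h, Y h r, r, M h r) ∈ box h₁ η r₀
  root : ∀ h ∈ Icc 0 h₁, ∀ r ∈ Icc 0 r₀, D (h, Y h r, r, M h r) = 0
  unique : ∀ h y r μ₂, (h, y, r, μ₂) ∈ box h₁ η r₀ → D (h, y, r, μ₂) = 0 → y = Y h r ∧ μ₂ = M h r

end

end DudCanard

/-!
After the blow-up to the chart, the functions of the normal form are divisible by `r²`
(`exists_rescaled`), so that the chart system is `x' = y - (r μ₂ + 1) z + r f`,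
`y' = r (μ₂ / 2 + a₁ y + a₂ z + r g)`, `z' = x + z² + r z h` with smooth `f`, `g`, `h` (`ChartData`).
For `r = 0` the parabola `(x, z) = (-y², y)` consists of equilibria, and the normal eigenvalues at
the origin are `± i`.

*The slow manifold.* Since the parabola is not normally hyperbolic, analyticity replaces a graph
transform. For a manifold `(-y², y) + r v` invariance reads `(λ r y ∂_y - A) v = …` with the
rotation generator `A`. On power series in `y` the operator on the left multiplies the `n`-th
coefficient by `n λ r - A`, and its inverse is bounded in all derivatives with respect to `r` if the
`j`-th derivative of the `n`-th coefficient is measured with the weight `(n + 1) ^ (-j)`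
(`jetNorm_resolvent_le`). With these weights the power series form a Banach algebra (`paramSeries`),
in which the invariance equations are solved by a contraction (`exists_slow_fixedPoint`,
`exists_slowManifold`).

*The Melnikov function.* In coordinates in which the slow manifold is `u = 0` (`StraightChart`),
polar coordinates `u = h eˡ (-cos ψ, -sin ψ)` with the angle as independent variable remove the
singularity at `h = 0`, and the first return is the solution at `ψ = 2π`. It depends smoothly on all
parameters by the implicit function theorem in a space of continuous functions
(`exists_smooth_solutions`). For `r = y = 0` the system `u' = (-u₂, u₁ + u₂²)` conserves
`e^{2 u₁} (u₁ + u₂² - 1/2)`, so that the orbits in question are closed. There the derivative of the Melnikov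
function with respect to `(y, μ₂)` is triangular with nonzero diagonal: `μ₂` only shifts the slow
variable, by `μ₂ T / 2`, and the variational equation for `l` has a source term `2 y sin² ψ / Q²`,
with the angular velocity `Q`, of constant sign (`melnikov_limit`). The implicit function theorem,
applied uniformly on the compact interval `[0, h₁]`, gives the zero branch (`exists_zeroBranch`,
`exists_isMelnikov`).

*The Hopf bifurcation.* On the slow manifold, equilibria are zeros of the slow velocity `g`, and
there the linearization is block triangular with the blocks `r ∂g/∂y` and `∂U/∂u`
(`charCoeff_equilibrium`). The equations `g = 0` and `tr ∂U/∂u = 0` define a curve over `r`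
(`exists_hopf_curve`). On this curve the blown-up linear flow closes up after one turn, so that the
Melnikov function vanishes at `h = 0` (`exists_isPolar_equilibrium`), and by uniqueness the curve is
the end `h = 0` of the zero branch. The real part of the eigenvalue along the branch of equilibria
is half the trace, and its derivative is a nonzero multiple of the Jacobian determinant `hopfJac`
(`exists_crossing`). The closed orbits that belong to the zeros with `h > 0` are the bifurcating
family (`exists_cycles`); their continuity up to `h = 0`, including that of the period, is the
continuity of the blown-up solutions.
-/


open Set Filter Topology MeasureTheory
open scoped ContDiff

namespace DudCanard

noncomputable section

section

/-! ### Superposition operators, parametric integrals and cut-offs -/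

section Superposition

variable {K : Type} [TopologicalSpace K] [CompactSpace K]
  {E F : Type} [NormedAddCommGroup E] [NormedSpace ℝ E] [NormedAddCommGroup F] [NormedSpace ℝ F]

/-- Pointwise application of a continuous family of operators, as a bilinear operation. -/
def pointwiseApply (K : Type) [TopologicalSpace K] [CompactSpace K]
    (E F : Type) [NormedAddCommGroup E] [NormedSpace ℝ E] [NormedAddCommGroup F]
    [NormedSpace ℝ F] : C(K, E →L[ℝ] F) →L[ℝ] C(K, E) →L[ℝ] C(K, F) :=
  LinearMap.mkContinuous₂
    (LinearMap.mk₂ ℝ (fun (A : C(K, E →L[ℝ] F)) (v : C(K, E)) =>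
        (⟨fun κ => A κ (v κ), by fun_prop⟩ : C(K, F)))
      (fun _ _ _ => by ext; simp) (fun _ _ _ => by ext; simp)
      (fun _ _ _ => by ext; simp) (fun _ _ _ => by ext; simp)) 1
    (fun A v => by
      rw [one_mul, ContinuousMap.norm_le _ (by positivity)]
      intro κ
      exact ((A κ).le_opNorm _).trans
        (mul_le_mul (A.norm_coe_le_norm κ) (v.norm_coe_le_norm κ) (norm_nonneg _) (by positivity)))

@[simp] theorem pointwiseApply_apply (A : C(K, E →L[ℝ] F)) (v : C(K, E)) (κ : K) :
    pointwiseApply K E F A v κ = A κ (v κ) := rfl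

/-- The derivative of a superposition operator is pointwise application of the derivative of the
function that induces it. -/
theorem hasFDerivAt_postcomp (f : C(E, F)) (f' : C(E, E →L[ℝ] F))
    (hf : ∀ x, HasFDerivAt f (f' x) x) (u : C(K, E)) :
    HasFDerivAt (fun u : C(K, E) => f.comp u) (pointwiseApply K E F (f'.comp u)) u := by
  rw [hasFDerivAt_iff_isLittleO, Asymptotics.isLittleO_iff]
  intro ε hε
  have hcont : ContinuousAt (fun w : C(K, E) => f'.comp w) u :=
    (ContinuousMap.continuous_postcomp f').continuousAt
  obtain ⟨δ, hδ, hb⟩ := (Metric.continuousAt_iff (α := C(K, E)) (β := C(K, E →L[ℝ] F))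
    (f := fun w : C(K, E) => f'.comp w)).1 hcont ε hε
  filter_upwards [Metric.ball_mem_nhds u hδ] with w hw
  rw [ContinuousMap.norm_le _ (by positivity)]
  intro κ
  have hseg : ∀ x ∈ segment ℝ (u κ) (w κ), ‖f' x - f' (u κ)‖ ≤ ε := by
    rintro x hx
    rw [segment_eq_image'] at hx
    obtain ⟨s, hs, rfl⟩ := hx
    have h1 : dist (u + s • (w - u)) u < δ := by
      rw [dist_eq_norm, add_sub_cancel_left, norm_smul, Real.norm_of_nonneg hs.1]
      have : ‖w - u‖ < δ := by rwa [← dist_eq_norm]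
      nlinarith [hs.2, norm_nonneg (w - u), hs.1]
    have h2 := hb h1
    rw [← dist_eq_norm]
    exact ((ContinuousMap.dist_apply_le_dist (f := f'.comp (u + s • (w - u)))
      (g := f'.comp u) κ).trans h2.le)
  have := Convex.norm_image_sub_le_of_norm_hasFDerivWithin_le' (f := f) (f' := f')
    (φ := f' (u κ)) (fun x _ => (hf x).hasFDerivWithinAt) hseg (convex_segment _ _)
    (left_mem_segment ℝ _ _) (right_mem_segment ℝ _ _)
  refine this.trans ?_
  exact mul_le_mul_of_nonneg_left ((w - u).norm_coe_le_norm κ) hε.le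

/-- Superposition operators on spaces of continuous functions are as smooth as the function that
induces them. -/
theorem contDiff_postcomp {n : ℕ} (f : C(E, F)) (hf : ContDiff ℝ n f) :
    ContDiff ℝ n (fun u : C(K, E) => f.comp u) := by
  induction n generalizing F with
  | zero => exact contDiff_zero.2 (ContinuousMap.continuous_postcomp f)
  | succ n ih =>
    have h1 : ContDiff ℝ n (fderiv ℝ f) := hf.fderiv_right (by norm_cast)
    have hd : Differentiable ℝ f := hf.differentiable (by norm_cast)
    rw [show ((n + 1 : ℕ) : ℕ∞ω) = (n : ℕ∞ω) + 1 by norm_cast, contDiff_succ_iff_hasFDerivAt]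
    refine ⟨fun u => pointwiseApply K E F
      ((⟨fderiv ℝ f, h1.continuous⟩ : C(E, E →L[ℝ] F)).comp u), ?_,
      fun u => hasFDerivAt_postcomp f _ (fun x => (hd x).hasFDerivAt) u⟩
    exact (pointwiseApply K E F).contDiff.comp (ih ⟨fderiv ℝ f, h1.continuous⟩ h1)

end Superposition

/-- Integration over an interval as a continuous linear functional on continuous functions. -/
def integralCLM (a b : ℝ) (hab : a ≤ b) (F : Type) [NormedAddCommGroup F] [NormedSpace ℝ F] :
    C(Icc a b, F) →L[ℝ] F :=
  LinearMap.mkContinuous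
    { toFun := fun g => ∫ t in a..b, IccExtend hab g t
      map_add' := fun g₁ g₂ => by
        rw [← intervalIntegral.integral_add]
        · rfl
        · exact (g₁.continuous.Icc_extend' (h := hab)).intervalIntegrable _ _
        · exact (g₂.continuous.Icc_extend' (h := hab)).intervalIntegrable _ _
      map_smul' := fun c g => by
        rw [RingHom.id_apply, ← intervalIntegral.integral_smul]
        rfl } |b - a|
    (fun g => by
      rw [mul_comm]
      exact intervalIntegral.norm_integral_le_of_norm_le_const
        (fun t _ => g.norm_coe_le_norm _))

theorem integralCLM_apply (a b : ℝ) (hab : a ≤ b) {F : Type} [NormedAddCommGroup F]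
    [NormedSpace ℝ F] (g : C(Icc a b, F)) :
    integralCLM a b hab F g = ∫ t in a..b, IccExtend hab g t := rfl

/-- The family `κ ↦ f (φ κ, e)` of continuous functions on a compact space depends smoothly on the
parameter `e`. -/
theorem contDiff_superposition_param {K : Type} [TopologicalSpace K] [CompactSpace K]
    {X E F : Type} [NormedAddCommGroup X] [NormedSpace ℝ X] [NormedAddCommGroup E]
    [NormedSpace ℝ E] [NormedAddCommGroup F] [NormedSpace ℝ F] {n : ℕ} (φ : C(K, X))
    (f : C(X × E, F)) (hf : ContDiff ℝ n f) :
    ContDiff ℝ n (fun e => f.comp (φ.prodMk (ContinuousMap.const K e))) := by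
  refine (contDiff_postcomp f hf).comp ?_
  have : (fun e => φ.prodMk (ContinuousMap.const K e)) = fun e =>
      (φ.prodMk (ContinuousMap.const K 0)) +
      ((ContinuousLinearMap.inr ℝ X E).compLeftContinuous ℝ K) (ContinuousMap.const _ e) := by
    ext e t <;> simp
  rw [this]
  refine contDiff_const.add ((ContinuousLinearMap.contDiff _).comp ?_)
  let L : E →L[ℝ] C(K, E) := LinearMap.mkContinuous
    { toFun := fun e => ContinuousMap.const _ e
      map_add' := fun _ _ => rfl
      map_smul' := fun _ _ => rfl } 1 (fun e => by
        rw [one_mul, ContinuousMap.norm_le _ (norm_nonneg _)]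
        intro _
        exact le_rfl)
  exact L.contDiff

/-- Integrals over the unit interval depend smoothly on parameters. -/
theorem contDiff_integral_param {E F : Type} [NormedAddCommGroup E] [NormedSpace ℝ E]
    [NormedAddCommGroup F] [NormedSpace ℝ F] {n : ℕ} {f : ℝ × E → F} (hf : ContDiff ℝ n f) :
    ContDiff ℝ n (fun e => ∫ t in (0 : ℝ)..1, f (t, e)) := by
  have h := (integralCLM 0 1 zero_le_one F).contDiff.comp
    (contDiff_superposition_param (K := Icc (0 : ℝ) 1) ⟨Subtype.val, continuous_subtype_val⟩
      ⟨f, hf.continuous⟩ hf)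
  convert h using 1
  ext e
  simp only [Function.comp, integralCLM_apply]
  refine intervalIntegral.integral_congr fun t ht => ?_
  rw [uIcc_of_le zero_le_one] at ht
  simp [IccExtend_of_mem _ _ ht]

/-- Division by a coordinate: a function of class `C^{n+1}` that vanishes with its first argument is
the product of that argument and a function of class `C^n`. -/
theorem exists_eq_smul_of_eq_zero {E F : Type} [NormedAddCommGroup E] [NormedSpace ℝ E]
    [NormedAddCommGroup F] [NormedSpace ℝ F] [CompleteSpace F] {g : ℝ × E → F}
    (h0 : ∀ e, g (0, e) = 0) : ∃ g₁ : ℝ × E → F,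
      (∀ n : ℕ, ContDiff ℝ (n + 1) g → ContDiff ℝ n g₁) ∧
      (ContDiff ℝ 1 g → (∀ r e, g (r, e) = r • g₁ (r, e)) ∧
        ∀ e, g₁ (0, e) = fderiv ℝ g (0, e) (1, 0)) := by
  refine ⟨fun q => ∫ t in (0 : ℝ)..1, fderiv ℝ g (t * q.1, q.2) (1, 0), ?_, ?_⟩
  · intro n hg
    have : ContDiff ℝ n (fun p : ℝ × (ℝ × E) => fderiv ℝ g (p.1 * p.2.1, p.2.2) (1, 0)) := by
      have h1 : ContDiff ℝ n (fderiv ℝ g) := hg.fderiv_right le_rfl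
      exact (h1.comp (by fun_prop : ContDiff ℝ n
        (fun p : ℝ × (ℝ × E) => (p.1 * p.2.1, p.2.2)))).clm_apply contDiff_const
    exact contDiff_integral_param this
  · intro hg
    refine ⟨fun r e => ?_, fun e => by simp⟩
    have hd : Differentiable ℝ g := hg.differentiable one_ne_zero
    have hc : Continuous (fderiv ℝ g) := hg.continuous_fderiv one_ne_zero
    have hder : ∀ t ∈ uIcc (0 : ℝ) 1, HasDerivAt (fun t => g (t * r, e))
        (r • fderiv ℝ g (t * r, e) (1, 0)) t := by
      intro t _
      have h2 : HasDerivAt (fun t : ℝ => (t * r, e)) (r, 0) t := by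
        have := ((hasDerivAt_id t).mul_const r).prodMk (hasDerivAt_const t e)
        simpa using this
      have h3 := (hd (t * r, e)).hasFDerivAt.comp_hasDerivAt t h2
      have h4 : ((r, 0) : ℝ × E) = r • ((1, 0) : ℝ × E) := by simp
      rw [h4, map_smul] at h3
      exact h3
    have h5 := intervalIntegral.integral_eq_sub_of_hasDerivAt hder
      (Continuous.intervalIntegrable (by fun_prop) _ _)
    simp only [one_mul, zero_mul, h0, sub_zero] at h5
    rw [← h5, intervalIntegral.integral_smul]

/-- Division by a coordinate for functions of class `C^∞`. -/
theorem exists_smooth_eq_smul_of_eq_zero {E F : Type} [NormedAddCommGroup E] [NormedSpace ℝ E]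
    [NormedAddCommGroup F] [NormedSpace ℝ F] [CompleteSpace F] {g : ℝ × E → F}
    (hg : ContDiff ℝ ∞ g) (h0 : ∀ e, g (0, e) = 0) : ∃ g₁ : ℝ × E → F, ContDiff ℝ ∞ g₁ ∧
      (∀ r e, g (r, e) = r • g₁ (r, e)) ∧ ∀ e, g₁ (0, e) = fderiv ℝ g (0, e) (1, 0) := by
  obtain ⟨g₁, h1, h2⟩ := exists_eq_smul_of_eq_zero h0
  have h3 := h2 (hg.of_le (by exact_mod_cast le_top))
  refine ⟨g₁, contDiff_infty.2 fun n => h1 n (hg.of_le (by exact_mod_cast le_top)), h3.1, h3.2⟩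

/-- A cut-off of the identity of the real line: smooth, compactly supported, bounded by `2`, and
equal to the identity on `[-1, 1]`. -/
theorem exists_cutoff_id : ∃ θ : ℝ → ℝ, ContDiff ℝ ∞ θ ∧ HasCompactSupport θ ∧
    (∀ x, |x| ≤ 1 → θ x = x) ∧ ∀ x, |θ x| ≤ 2 := by
  let b : ContDiffBump (0 : ℝ) := ⟨1, 2, one_pos, one_lt_two⟩
  refine ⟨fun x => b x * x, b.contDiff.mul contDiff_id, b.hasCompactSupport.mul_right, ?_, ?_⟩
  · intro x hx
    simp [b.one_of_mem_closedBall (x := x) (by simpa [b] using hx)]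
  · intro x
    simp only [abs_mul, abs_of_nonneg b.nonneg]
    by_cases h : |x| ≤ 2
    · nlinarith [b.le_one (x := x), b.nonneg (x := x), abs_nonneg x]
    · rw [b.zero_of_le_dist (by simpa [b] using (not_le.1 h).le)]
      simp

end

section

/-! ### Power series expansion on polydiscs -/

/-- The interval of angles. -/
abbrev Angle : Type := Icc (0 : ℝ) (2 * Real.pi)

/-- Integration over the first angle. -/
def integrateAngle (Y : Type) [TopologicalSpace Y] [CompactSpace Y] :
    C(Angle × Y, ℂ) →L[ℝ] C(Y, ℂ) :=
  (integralCLM 0 (2 * Real.pi) Real.two_pi_pos.le C(Y, ℂ)).comp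
    (LinearMap.mkContinuous
      ({ toFun := fun g => g.curry
         map_add' := fun _ _ => rfl
         map_smul' := fun _ _ => rfl } : C(Angle × Y, ℂ) →ₗ[ℝ] C(Angle, C(Y, ℂ))) 1
      (fun g => by
        rw [one_mul, ContinuousMap.norm_le _ (norm_nonneg _)]
        intro a
        rw [ContinuousMap.norm_le _ (norm_nonneg _)]
        intro y
        exact g.norm_coe_le_norm (a, y)))

theorem integrateAngle_apply {Y : Type} [TopologicalSpace Y] [CompactSpace Y]
    (g : C(Angle × Y, ℂ)) (y : Y) : integrateAngle Y g y =
      ∫ t in (0 : ℝ)..(2 * Real.pi), IccExtend Real.two_pi_pos.le (fun a => g (a, y)) t := by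
  have h := (ContinuousMap.evalCLM ℝ y : C(Y, ℂ) →L[ℝ] ℂ).intervalIntegral_comp_comm
    (μ := volume) (a := 0) (b := 2 * Real.pi)
    (f := IccExtend Real.two_pi_pos.le g.curry)
    ((g.curry.continuous.Icc_extend' (h := Real.two_pi_pos.le)).intervalIntegrable _ _)
  refine Eq.trans ?_ h.symm
  rfl

theorem norm_integrateAngle_le {Y : Type} [TopologicalSpace Y] [CompactSpace Y]
    (g : C(Angle × Y, ℂ)) : ‖integrateAngle Y g‖ ≤ 2 * Real.pi * ‖g‖ := by
  rw [ContinuousMap.norm_le _ (by positivity)]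
  intro y
  rw [integrateAngle_apply]
  have := intervalIntegral.norm_integral_le_of_norm_le_const (a := 0) (b := 2 * Real.pi)
    (C := ‖g‖) (f := IccExtend Real.two_pi_pos.le (fun a => g (a, y)))
    (fun t _ => g.norm_coe_le_norm _)
  refine this.trans_eq ?_
  rw [sub_zero, abs_of_pos Real.two_pi_pos, mul_comm]

/-- The mean value over the torus. -/
def torusMean : C(Angle × Angle × Angle × Unit, ℂ) →L[ℝ] ℂ :=
  ((2 * Real.pi) ^ 3)⁻¹ • (ContinuousMap.evalCLM ℝ () : C(Unit, ℂ) →L[ℝ] ℂ) ∘L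
    (integrateAngle Unit ∘L integrateAngle (Angle × Unit) ∘L integrateAngle (Angle × Angle × Unit))

theorem norm_torusMean_le (g : C(Angle × Angle × Angle × Unit, ℂ)) : ‖torusMean g‖ ≤ ‖g‖ := by
  have h1 := norm_integrateAngle_le g
  have h2 := norm_integrateAngle_le (integrateAngle _ g)
  have h3 := norm_integrateAngle_le (integrateAngle _ (integrateAngle _ g))
  have h4 := (integrateAngle _ (integrateAngle _ (integrateAngle _ g))).norm_coe_le_norm ()
  have hp := Real.pi_pos
  simp only [torusMean, smul_apply, ContinuousLinearMap.comp_apply, norm_smul]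
  rw [Real.norm_of_nonneg (by positivity), inv_mul_le_iff₀ (by positivity)]
  refine h4.trans (h3.trans ?_)
  calc _ ≤ 2 * Real.pi * (2 * Real.pi * (2 * Real.pi * ‖g‖)) := by gcongr; exact h2.trans (by gcongr)
    _ = _ := by ring

/-- Cauchy's formula on the unit disc. -/
theorem integral_cauchy_kernel {f : ℂ → ℂ} (hf : DifferentiableOn ℂ f (Metric.closedBall 0 1))
    {x : ℂ} (hx : ‖x‖ < 1) : ∫ t in (0 : ℝ)..(2 * Real.pi),
      f (Complex.exp (t * Complex.I)) * (1 - x * Complex.exp (-(t * Complex.I)))⁻¹ =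
      2 * Real.pi * f x := by
  have h := (hf.diffContOnCl_ball (by rfl)).circleIntegral_sub_inv_smul (w := x)
    (by simpa using hx)
  simp only [circleIntegral, deriv_circleMap, circleMap, zero_add, Complex.ofReal_one, one_mul,
    smul_eq_mul] at h
  have h2 : ∀ t : ℝ, Complex.exp (t * Complex.I) * Complex.I *
      ((Complex.exp (t * Complex.I) - x)⁻¹ * f (Complex.exp (t * Complex.I))) =
      Complex.I * (f (Complex.exp (t * Complex.I)) *
        (1 - x * Complex.exp (-(t * Complex.I)))⁻¹) := by
    intro t
    have h3 : Complex.exp (t * Complex.I) - x =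
        Complex.exp (t * Complex.I) * (1 - x * Complex.exp (-(t * Complex.I))) := by
      rw [Complex.exp_neg]
      field_simp
    rw [h3, mul_inv]
    field_simp
  simp only [h2, intervalIntegral.integral_const_mul] at h
  have h4 := mul_left_cancel₀ Complex.I_ne_zero (h.trans (by ring :
    _ = Complex.I * (2 * Real.pi * f x)))
  exact h4

/-- The function `e^{-iθ}` of the angle selected by `a`. -/
def phase {Y : Type} [TopologicalSpace Y] (a : C(Y, Angle)) : C(Y, ℂ) :=
  ⟨fun y => Complex.exp (-(((a y : ℝ) : ℂ) * Complex.I)), by fun_prop⟩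

theorem norm_phase_le {Y : Type} [TopologicalSpace Y] [CompactSpace Y] (a : C(Y, Angle)) :
    ‖phase a‖ ≤ 1 := by
  rw [ContinuousMap.norm_le _ zero_le_one]
  intro y
  simp only [phase, ContinuousMap.coe_mk, ← neg_mul, ← Complex.ofReal_neg,
    Complex.norm_exp_ofReal_mul_I, le_refl]

/-- The Cauchy kernel `1 / (1 - x e^{-iθ})` as a sum of a geometric series. -/
theorem hasSum_kernel {Y : Type} [TopologicalSpace Y] [CompactSpace Y] (a : C(Y, Angle)) {x : ℂ}
    (hx : ‖x‖ < 1) : ∃ k : C(Y, ℂ),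
      (∀ y, k y = (1 - x * Complex.exp (-(((a y : ℝ) : ℂ) * Complex.I)))⁻¹) ∧
      HasSum (fun n : ℕ => (x • phase a) ^ n) k ∧ Summable (fun n : ℕ => ‖(x • phase a) ^ n‖) := by
  have hq : ‖x • phase a‖ < 1 := by
    rw [norm_smul]
    nlinarith [norm_phase_le a, norm_nonneg x, norm_nonneg (phase a)]
  have hs : Summable (fun n : ℕ => ‖(x • phase a) ^ n‖) := by
    refine Summable.of_nonneg_of_le (fun n => norm_nonneg _) (fun n => ?_)
      (summable_geometric_of_lt_one (norm_nonneg x) hx)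
    rw [ContinuousMap.norm_le _ (by positivity)]
    intro y
    have := (phase a).norm_coe_le_norm y
    simp only [ContinuousMap.pow_apply, ContinuousMap.smul_apply, norm_pow, norm_smul]
    gcongr
    nlinarith [norm_phase_le a, norm_nonneg x, norm_nonneg (phase a)]
  refine ⟨∑' n : ℕ, (x • phase a) ^ n, fun y => ?_, hs.of_norm.hasSum, hs⟩
  have h1 : HasSum (fun n : ℕ => ((x • phase a) ^ n) y) ((∑' n : ℕ, (x • phase a) ^ n) y) :=
    hs.of_norm.hasSum.mapL (ContinuousMap.evalCLM ℂ y)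
  have h2 := hasSum_geometric_of_norm_lt_one
    (lt_of_le_of_lt ((x • phase a).norm_coe_le_norm y) hq)
  exact h1.unique (by simpa [phase] using h2)

/-- The coordinate functions of the torus. -/
def torusPhase : Fin 3 → C(Angle × Angle × Angle × Unit, ℂ)
  | 0 => phase ⟨fun a => a.1, by fun_prop⟩
  | 1 => phase ⟨fun a => a.2.1, by fun_prop⟩
  | 2 => phase ⟨fun a => a.2.2.1, by fun_prop⟩

/-- The embedding of the torus into `ℂ³`. -/
def torusEmb : C(Angle × Angle × Angle × Unit, ℂ × ℂ × ℂ) :=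
  ⟨fun a => (Complex.exp ((a.1 : ℝ) * Complex.I), Complex.exp ((a.2.1 : ℝ) * Complex.I),
    Complex.exp ((a.2.2.1 : ℝ) * Complex.I)), by fun_prop⟩

theorem torusMean_smul (c : ℂ) (g : C(Angle × Angle × Angle × Unit, ℂ)) :
    torusMean (c • g) = c * torusMean g := by
  have h : ∀ (Y : Type) [TopologicalSpace Y] [CompactSpace Y] (g : C(Angle × Y, ℂ)),
      integrateAngle Y (c • g) = c • integrateAngle Y g := by
    intro Y _ _ g
    ext y
    simp only [integrateAngle_apply, ContinuousMap.smul_apply, smul_eq_mul]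
    rw [← intervalIntegral.integral_const_mul]
    rfl
  simp only [torusMean, smul_apply, ContinuousLinearMap.comp_apply, h]
  simp only [ContinuousMap.evalCLM_apply, ContinuousMap.smul_apply, Complex.real_smul, smul_eq_mul]
  ring

/-- The Cauchy integral formula on the polydisc: the mean over the torus of `g` times the three
Cauchy kernels is the value of `g` inside. -/
theorem torusMean_cauchy {g : ℂ × ℂ × ℂ → ℂ}
    (hg : ∀ w : ℂ × ℂ × ℂ, ‖w.1‖ ≤ 1 → ‖w.2.1‖ ≤ 1 → ‖w.2.2‖ ≤ 1 → DifferentiableAt ℂ g w)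
    {x y z : ℂ} (hx : ‖x‖ < 1) (hy : ‖y‖ < 1) (hz : ‖z‖ < 1)
    (P : C(Angle × Angle × Angle × Unit, ℂ))
    (hP : ∀ a, P a = g (torusEmb a) * (1 - x * Complex.exp (-(((a.1 : ℝ) : ℂ) * Complex.I)))⁻¹ *
      ((1 - y * Complex.exp (-(((a.2.1 : ℝ) : ℂ) * Complex.I)))⁻¹ *
      (1 - z * Complex.exp (-(((a.2.2.1 : ℝ) : ℂ) * Complex.I)))⁻¹)) :
    torusMean P = g (x, y, z) := by
  have hn : ∀ t : ℝ, ‖Complex.exp (t * Complex.I)‖ ≤ 1 := fun t =>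
    (Complex.norm_exp_ofReal_mul_I t).le
  have e1 : ∀ a, integrateAngle _ P a = 2 * Real.pi *
      (g (x, Complex.exp ((a.1 : ℝ) * Complex.I), Complex.exp ((a.2.1 : ℝ) * Complex.I)) *
      (1 - y * Complex.exp (-(((a.1 : ℝ) : ℂ) * Complex.I)))⁻¹ *
      (1 - z * Complex.exp (-(((a.2.1 : ℝ) : ℂ) * Complex.I)))⁻¹) := by
    intro a
    have h := integral_cauchy_kernel (f := fun ξ => g (ξ, Complex.exp ((a.1 : ℝ) * Complex.I),
      Complex.exp ((a.2.1 : ℝ) * Complex.I))) (fun ξ hξ => by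
        have := hg (ξ, Complex.exp ((a.1 : ℝ) * Complex.I), Complex.exp ((a.2.1 : ℝ) * Complex.I))
          (by simpa using hξ) (hn _) (hn _)
        exact (this.comp ξ (by fun_prop)).differentiableWithinAt) hx
    rw [mul_assoc (g _), ← mul_assoc (2 * (Real.pi : ℂ)), ← h,
      ← intervalIntegral.integral_mul_const, integrateAngle_apply]
    refine intervalIntegral.integral_congr fun t ht => ?_
    rw [uIcc_of_le Real.two_pi_pos.le] at ht
    rw [IccExtend_of_mem _ _ ht, hP]
    rfl
  have e2 : ∀ a, integrateAngle _ (integrateAngle _ P) a = 2 * Real.pi * (2 * Real.pi) *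
      (g (x, y, Complex.exp ((a.1 : ℝ) * Complex.I)) *
      (1 - z * Complex.exp (-(((a.1 : ℝ) : ℂ) * Complex.I)))⁻¹) := by
    intro a
    have h := integral_cauchy_kernel (f := fun ξ => g (x, ξ,
      Complex.exp ((a.1 : ℝ) * Complex.I))) (fun ξ hξ => by
        have := hg (x, ξ, Complex.exp ((a.1 : ℝ) * Complex.I))
          hx.le (by simpa using hξ) (hn _)
        exact (this.comp ξ (by fun_prop)).differentiableWithinAt) hy
    rw [← mul_assoc _ (g _), mul_assoc _ _ (g _), ← h, mul_assoc,
      ← intervalIntegral.integral_mul_const, ← intervalIntegral.integral_const_mul,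
      integrateAngle_apply]
    refine intervalIntegral.integral_congr fun t ht => ?_
    rw [uIcc_of_le Real.two_pi_pos.le] at ht
    rw [IccExtend_of_mem _ _ ht, e1]
  have e3 : integrateAngle _ (integrateAngle _ (integrateAngle _ P)) () =
      2 * Real.pi * (2 * Real.pi) * (2 * Real.pi * g (x, y, z)) := by
    have h := integral_cauchy_kernel (f := fun ξ => g (x, y, ξ)) (fun ξ hξ => by
        have := hg (x, y, ξ) hx.le hy.le (by simpa using hξ)
        exact (this.comp ξ (by fun_prop)).differentiableWithinAt) hz
    rw [← h, ← intervalIntegral.integral_const_mul, integrateAngle_apply]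
    refine intervalIntegral.integral_congr fun t ht => ?_
    rw [uIcc_of_le Real.two_pi_pos.le] at ht
    rw [IccExtend_of_mem _ _ ht, e2]
  simp only [torusMean, smul_apply, ContinuousLinearMap.comp_apply, ContinuousMap.evalCLM_apply]
  have hpi : (Real.pi : ℂ) ≠ 0 := by exact_mod_cast Real.pi_ne_zero
  rw [e3, Complex.real_smul]
  push_cast
  field_simp

/-- A holomorphic function on the closed unit polydisc is the sum of its Fourier series, read as a
power series. -/
theorem hasSum_torus {g : ℂ × ℂ × ℂ → ℂ} (hc : Continuous g)
    (hg : ∀ w : ℂ × ℂ × ℂ, ‖w.1‖ ≤ 1 → ‖w.2.1‖ ≤ 1 → ‖w.2.2‖ ≤ 1 → DifferentiableAt ℂ g w)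
    {x y z : ℂ} (hx : ‖x‖ < 1) (hy : ‖y‖ < 1) (hz : ‖z‖ < 1) :
    HasSum (fun i : ℕ × ℕ × ℕ => torusMean ((⟨g, hc⟩ : C(ℂ × ℂ × ℂ, ℂ)).comp torusEmb *
      (torusPhase 0 ^ i.1 * (torusPhase 1 ^ i.2.1 * torusPhase 2 ^ i.2.2))) *
      (x ^ i.1 * (y ^ i.2.1 * z ^ i.2.2))) (g (x, y, z)) := by
  obtain ⟨k₁, e₁, s₁, n₁⟩ := hasSum_kernel (Y := Angle × Angle × Angle × Unit)
    ⟨fun a => a.1, by fun_prop⟩ hx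
  obtain ⟨k₂, e₂, s₂, n₂⟩ := hasSum_kernel (Y := Angle × Angle × Angle × Unit)
    ⟨fun a => a.2.1, by fun_prop⟩ hy
  obtain ⟨k₃, e₃, s₃, n₃⟩ := hasSum_kernel (Y := Angle × Angle × Angle × Unit)
    ⟨fun a => a.2.2.1, by fun_prop⟩ hz
  -- expand the three Cauchy kernels in geometric series and integrate termwise
  have n₂₃ := n₂.mul_norm n₃
  have h := (s₁.mul (s₂.mul s₃ n₂₃.of_norm) (n₁.mul_norm n₂₃).of_norm).mul_left
    ((⟨g, hc⟩ : C(ℂ × ℂ × ℂ, ℂ)).comp torusEmb)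
  have h' := h.mapL torusMean
  rw [torusMean_cauchy hg hx hy hz _ (fun a => by
    simp only [ContinuousMap.mul_apply, e₁, e₂, e₃, ContinuousMap.comp_apply, ContinuousMap.coe_mk]
    ring)] at h'
  refine h'.congr_fun fun i => ?_
  rw [mul_comm, ← torusMean_smul]
  congr 1
  ext a
  simp only [ContinuousMap.smul_apply, ContinuousMap.mul_apply, ContinuousMap.comp_apply,
    ContinuousMap.coe_mk, ContinuousMap.pow_apply, smul_eq_mul, mul_pow, torusPhase]
  ring

end

section

/-! ### Functions of the normal form in the scaling chart -/

/-- A function that is smooth on a ball agrees on a smaller ball with a globally smooth one. -/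
theorem exists_contDiff_extension {E F : Type} [NormedAddCommGroup E] [NormedSpace ℝ E]
    [FiniteDimensional ℝ E] [NormedAddCommGroup F] [NormedSpace ℝ F] {ρ : ℝ} (hρ : 0 < ρ)
    {n : ℕ∞} {Φ : E → F} (hΦ : ContDiffOn ℝ n Φ (Metric.ball 0 ρ)) :
    ∃ Ψ : E → F, ContDiff ℝ n Ψ ∧ ∀ q ∈ Metric.ball (0 : E) (ρ / 3), Ψ q = Φ q := by
  let b : ContDiffBump (0 : E) := ⟨ρ / 3, ρ / 2, by positivity, by linarith⟩
  refine ⟨fun q => b q • Φ q, ?_, fun q hq => ?_⟩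
  · rw [contDiff_iff_contDiffAt]
    intro q
    by_cases hq : q ∈ Metric.ball (0 : E) ρ
    · exact b.contDiff.contDiffAt.smul (hΦ.contDiffAt (Metric.isOpen_ball.mem_nhds hq))
    · have hq' : q ∈ (Metric.closedBall (0 : E) (ρ / 2))ᶜ := by
        simp only [Metric.mem_ball, not_lt, mem_compl_iff, Metric.mem_closedBall, not_le] at hq ⊢
        linarith
      refine (contDiffAt_const (c := (0 : F))).congr_of_eventuallyEq ?_
      filter_upwards [Metric.isClosed_closedBall.isOpen_compl.mem_nhds hq'] with w hw
      rw [b.zero_of_le_dist (by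
        simp only [mem_compl_iff, Metric.mem_closedBall, not_le] at hw
        exact hw.le), zero_smul]
  · simp only
    rw [b.one_of_mem_closedBall (Metric.ball_subset_closedBall hq), one_smul]

/-- In the scaling chart, a function of the normal form whose value and whose derivatives with
respect to `y`, `z` and `μ` vanish at the origin is divisible by `r²`. The quotient is smooth, and
it is a power series in the chart variables whose coefficients are smooth functions of the parameters,
with derivatives that are bounded uniformly in the index. -/
theorem exists_rescaled {F : ℝ → ℝ → ℝ → ℝ → ℝ → ℝ} (hF : AnalyticInSpace F)
    (h0 : F 0 0 0 0 0 = 0) (hy : HasDerivAt (fun y => F 0 y 0 0 0) 0 0)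
    (hz : HasDerivAt (fun z => F 0 0 z 0 0) 0 0) (hμ : HasDerivAt (fun μ => F 0 0 0 0 μ) 0 0) :
    ∃ ρ : ℝ, 0 < ρ ∧ ρ ≤ 1 ∧ ∃ f : ℝ × ℝ × ℝ × ℝ × ℝ → ℝ, ContDiff ℝ ∞ f ∧
      (∀ r μ x y z : ℝ, |r ^ 2 * x| < ρ → |r * y| < ρ → |r * z| < ρ → |r ^ 2| < ρ → |r * μ| < ρ →
        F (r ^ 2 * x) (r * y) (r * z) (r ^ 2) (r * μ) = r ^ 2 * f (r, μ, x, y, z)) ∧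
      ∃ c : ℕ × ℕ × ℕ → ℝ × ℝ → ℝ, (∀ i, ContDiff ℝ ∞ (c i)) ∧
        (∀ j : ℕ, ∃ C, ∀ i, ∀ p ∈ Metric.closedBall (0 : ℝ × ℝ) 1,
          ‖iteratedFDeriv ℝ j (c i) p‖ ≤ C) ∧
        ∀ r μ : ℝ, r ≠ 0 → |r| < ρ → |μ| < 1 → ∀ x y z : ℝ, |x| < 1 → |y| < 1 → |z| < 1 →
          HasSum (fun i => c i (r, μ) * (x ^ i.1 * (y ^ i.2.1 * z ^ i.2.2))) (f (r, μ, x, y, z)) := by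
  obtain ⟨ρ₀, hρ₀, Φ, hΦ, hol, hreal⟩ := hF
  obtain ⟨Φ', hΦ', hEq⟩ := exists_contDiff_extension hρ₀ hΦ
  set ρ := min (ρ₀ / 3) 1 with hρdef
  have hρ : 0 < ρ := by positivity
  have hmem : ∀ (w : ℂ × ℂ × ℂ) (a : ℝ × ℝ), ‖w.1‖ < ρ → ‖w.2.1‖ < ρ → ‖w.2.2‖ < ρ →
      |a.1| < ρ → |a.2| < ρ → (w, a) ∈ Metric.ball (0 : (ℂ × ℂ × ℂ) × (ℝ × ℝ)) (ρ₀ / 3) := by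
    intro w a h1 h2 h3 h4 h5
    have : ρ ≤ ρ₀ / 3 := min_le_left _ _
    rw [mem_ball_zero_iff, Prod.norm_def, Prod.norm_def, Prod.norm_def, Prod.norm_def]
    simp only [Real.norm_eq_abs, sup_lt_iff]
    exact ⟨⟨h1.trans_le this, h2.trans_le this, h3.trans_le this⟩, h4.trans_le this,
      h5.trans_le this⟩
  have hΦreal : ∀ x y z ε μ : ℝ, |x| < ρ → |y| < ρ → |z| < ρ → |ε| < ρ → |μ| < ρ →
      Φ' ((x, y, z), (ε, μ)) = (F x y z ε μ : ℂ) := by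
    intro x y z ε μ h1 h2 h3 h4 h5
    rw [hEq _ (hmem _ _ (by simpa using h1) (by simpa using h2) (by simpa using h3) h4 h5)]
    have : ρ < ρ₀ := (min_le_left _ _).trans_lt (by linarith)
    exact hreal x y z ε μ (h1.trans this) (h2.trans this) (h3.trans this) (h4.trans this)
      (h5.trans this)
  have hΦhol : ∀ (w : ℂ × ℂ × ℂ) (a : ℝ × ℝ), ‖w.1‖ < ρ → ‖w.2.1‖ < ρ → ‖w.2.2‖ < ρ →
      |a.1| < ρ → |a.2| < ρ → DifferentiableAt ℂ (fun w => Φ' (w, a)) w := by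
    intro w a h1 h2 h3 h4 h5
    have hm := hmem w a h1 h2 h3 h4 h5
    have hm' : w ∈ Metric.ball 0 ρ₀ ∧ a ∈ Metric.ball 0 ρ₀ := by
      have := Metric.ball_subset_ball (by linarith : ρ₀ / 3 ≤ ρ₀) hm
      simpa [mem_ball_zero_iff, Prod.norm_def (x := (w, a))] using this
    have hd := (hol a hm'.2).differentiableAt (Metric.isOpen_ball.mem_nhds hm'.1)
    refine hd.congr_of_eventuallyEq ?_
    have : ∀ᶠ w' in 𝓝 w, (w', a) ∈ Metric.ball (0 : (ℂ × ℂ × ℂ) × (ℝ × ℝ)) (ρ₀ / 3) :=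
      (Continuous.prodMk_left a).continuousAt.eventually_mem (Metric.isOpen_ball.mem_nhds hm)
    filter_upwards [this] with w' hw'
    exact hEq _ hw'
  have hdΦ : Differentiable ℝ Φ' := hΦ'.differentiable (by simp)
  -- the derivative of `Φ'` at the origin is complex linear in the space variables
  have key : ∀ (v : ℂ × ℂ × ℂ) (y : ℂ), HasDerivAt (fun t : ℝ => Φ' (((t : ℂ) • v), 0)) 0 0 →
      fderiv ℝ Φ' 0 (y • v, 0) = 0 := by
    intro v y hv
    have h1 : DifferentiableAt ℂ (fun ξ : ℂ => Φ' (ξ • v, 0)) 0 := by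
      have := hΦhol 0 0 (by simpa using hρ) (by simpa using hρ) (by simpa using hρ)
        (by simpa using hρ) (by simpa using hρ)
      exact DifferentiableAt.comp (g := fun w => Φ' (w, 0)) (0 : ℂ) (by simpa using this)
        (by fun_prop)
    have h2 := h1.hasDerivAt
    have h3 : deriv (fun ξ : ℂ => Φ' (ξ • v, 0)) 0 = 0 :=
      (HasDerivAt.comp_ofReal (z := 0) (by rw [Complex.ofReal_zero]; exact h2)).unique hv
    rw [h3] at h2
    have h4 := h2.hasFDerivAt.restrictScalars ℝ
    have h5 : HasFDerivAt (fun ξ : ℂ => Φ' (ξ • v, (0 : ℝ × ℝ)))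
        ((fderiv ℝ Φ' 0).comp ((ContinuousLinearMap.inl ℝ (ℂ × ℂ × ℂ) (ℝ × ℝ)).comp
          ((ContinuousLinearMap.smulRight (1 : ℂ →L[ℂ] ℂ) v).restrictScalars ℝ))) 0 := by
      have h6 : HasFDerivAt (fun ξ : ℂ => (ξ • v, (0 : ℝ × ℝ)))
          ((ContinuousLinearMap.inl ℝ (ℂ × ℂ × ℂ) (ℝ × ℝ)).comp
          ((ContinuousLinearMap.smulRight (1 : ℂ →L[ℂ] ℂ) v).restrictScalars ℝ)) 0 :=
        ((ContinuousLinearMap.inl ℝ (ℂ × ℂ × ℂ) (ℝ × ℝ)).comp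
          ((ContinuousLinearMap.smulRight (1 : ℂ →L[ℂ] ℂ) v).restrictScalars ℝ)).hasFDerivAt
      refine HasFDerivAt.comp (g := Φ') (0 : ℂ) ?_ h6
      have e0 : ((0 : ℂ) • v, (0 : ℝ × ℝ)) = 0 := by ext <;> simp
      rw [e0]
      exact (hdΦ 0).hasFDerivAt
    have := congrArg (fun L : ℂ →L[ℝ] ℂ => L y) (h5.unique h4)
    simpa using this
  have hsmall : ∀ᶠ t in 𝓝 (0 : ℝ), |t| < ρ := by
    have : Tendsto (fun t : ℝ => |t|) (𝓝 0) (𝓝 |0|) := continuous_abs.tendsto 0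
    exact this.eventually_lt_const (by simpa using hρ)
  have hρ0 : |(0 : ℝ)| < ρ := by simpa using hρ
  have hgrad : ∀ (y z : ℂ) (μ : ℝ), fderiv ℝ Φ' 0 ((0, y, z), (0, μ)) = 0 := by
    intro y z μ
    have e : (((0, y, z), (0, μ)) : (ℂ × ℂ × ℂ) × (ℝ × ℝ)) =
        (y • ((0, 1, 0) : ℂ × ℂ × ℂ), 0) + (z • ((0, 0, 1) : ℂ × ℂ × ℂ), 0) +
          μ • (0, (0, 1)) := by simp
    rw [e, map_add, map_add, map_smul, key _ y, key _ z]
    · have h1 : HasDerivAt (fun t : ℝ => Φ' (t • ((0 : ℂ × ℂ × ℂ), ((0, 1) : ℝ × ℝ)))) 0 0 := by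
        refine (hμ.ofReal_comp.congr_of_eventuallyEq ?_).congr_deriv (by simp)
        filter_upwards [hsmall] with t ht
        rw [← hΦreal 0 0 0 0 t hρ0 hρ0 hρ0 hρ0 ht]
        congr 1
        ext <;> simp
      have h2 : HasDerivAt (fun t : ℝ => Φ' (t • ((0 : ℂ × ℂ × ℂ), ((0, 1) : ℝ × ℝ))))
          (fderiv ℝ Φ' 0 (0, (0, 1))) 0 := by
        refine HasFDerivAt.comp_hasDerivAt (l := Φ') (0 : ℝ) ?_ ((hasDerivAt_id (0 : ℝ)).smul_const
          ((0 : ℂ × ℂ × ℂ), ((0, 1) : ℝ × ℝ)) |>.congr_deriv (one_smul _ _))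
        simpa using (hdΦ 0).hasFDerivAt
      rw [h2.unique h1]
      simp
    · refine (hz.ofReal_comp.congr_of_eventuallyEq ?_).congr_deriv (by simp)
      filter_upwards [hsmall] with t ht
      rw [← hΦreal 0 0 t 0 0 hρ0 hρ0 ht hρ0 hρ0]
      congr 1
      ext <;> simp
    · refine (hy.ofReal_comp.congr_of_eventuallyEq ?_).congr_deriv (by simp)
      filter_upwards [hsmall] with t ht
      rw [← hΦreal 0 t 0 0 0 hρ0 ht hρ0 hρ0 hρ0]
      congr 1
      ext <;> simp
  -- division by `r²`
  let Ψ₀ : ℝ × (ℝ × ℂ × ℂ × ℂ) → ℂ := fun q =>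
    Φ' ((q.1 ^ 2 • q.2.2.1, q.1 • q.2.2.2.1, q.1 • q.2.2.2.2), (q.1 ^ 2, q.1 * q.2.1))
  have hΨ₀ : ContDiff ℝ ∞ Ψ₀ := hΦ'.comp (by fun_prop)
  have hΦ00 : Φ' 0 = 0 := by
    have := hΦreal 0 0 0 0 0 hρ0 hρ0 hρ0 hρ0 hρ0
    rw [h0, Complex.ofReal_zero] at this
    exact this
  obtain ⟨Ψ₁, hΨ₁, e₁, d₁⟩ := exists_smooth_eq_smul_of_eq_zero hΨ₀ (fun e => by
    simp only [Ψ₀]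
    rw [← hΦ00]
    congr 1
    ext <;> simp)
  obtain ⟨Ψ₂, hΨ₂, e₂, -⟩ := exists_smooth_eq_smul_of_eq_zero hΨ₁ (fun e => by
    rw [d₁]
    have h1 : HasDerivAt (fun r : ℝ => (((r ^ 2 • e.2.1, r • e.2.2.1, r • e.2.2.2),
        (r ^ 2, r * e.1)) : (ℂ × ℂ × ℂ) × (ℝ × ℝ))) ((0, e.2.2.1, e.2.2.2), (0, e.1)) 0 := by
      have p2 : HasDerivAt (fun r : ℝ => r ^ 2) 0 0 := by simpa using hasDerivAt_pow 2 (0 : ℝ)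
      have p1 := hasDerivAt_id (0 : ℝ)
      have := ((p2.smul_const e.2.1).prodMk ((p1.smul_const e.2.2.1).prodMk
        (p1.smul_const e.2.2.2))).prodMk (p2.prodMk (p1.mul_const e.1))
      simpa using this
    have h2 : HasDerivAt (fun r : ℝ => Ψ₀ (r, e)) (fderiv ℝ Φ' 0
        ((0, e.2.2.1, e.2.2.2), (0, e.1))) 0 := by
      refine HasFDerivAt.comp_hasDerivAt (l := Φ') (0 : ℝ) ?_ h1
      have e0 : (((0 : ℝ) ^ 2 • e.2.1, (0 : ℝ) • e.2.2.1, (0 : ℝ) • e.2.2.2),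
          ((0 : ℝ) ^ 2, (0 : ℝ) * e.1)) = (0 : (ℂ × ℂ × ℂ) × (ℝ × ℝ)) := by ext <;> simp
      rw [e0]
      exact (hdΦ 0).hasFDerivAt
    have h3 : HasDerivAt (fun r : ℝ => Ψ₀ (r, e)) (fderiv ℝ Ψ₀ (0, e) (1, 0)) 0 :=
      HasFDerivAt.comp_hasDerivAt (l := Ψ₀) (0 : ℝ)
        ((hΨ₀.differentiable (by simp)) (0, e)).hasFDerivAt
        ((hasDerivAt_id (0 : ℝ)).prodMk (hasDerivAt_const (0 : ℝ) e))
    rw [h3.unique h2, hgrad])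
  have e₃ : ∀ r e, Ψ₀ (r, e) = r ^ 2 • Ψ₂ (r, e) := by
    intro r e
    rw [e₁, e₂, smul_smul, sq]
  refine ⟨ρ, hρ, min_le_right _ _, fun q => (Ψ₂ (q.1, (q.2.1, q.2.2.1, q.2.2.2.1, q.2.2.2.2))).re,
    ?_, ?_, ?_⟩
  · refine Complex.reCLM.contDiff.comp (hΨ₂.comp ?_)
    have := Complex.ofRealCLM.contDiff (n := ∞)
    have h1 : ContDiff ℝ ∞ (fun q : ℝ × ℝ × ℝ × ℝ × ℝ => (q.2.2.1 : ℂ)) := this.comp (by fun_prop)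
    have h2 : ContDiff ℝ ∞ (fun q : ℝ × ℝ × ℝ × ℝ × ℝ => (q.2.2.2.1 : ℂ)) := this.comp (by fun_prop)
    have h3 : ContDiff ℝ ∞ (fun q : ℝ × ℝ × ℝ × ℝ × ℝ => (q.2.2.2.2 : ℂ)) := this.comp (by fun_prop)
    fun_prop
  · intro r μ x y z h1 h2 h3 h4 h5
    have h6 := hΦreal _ _ _ _ _ h1 h2 h3 h4 h5
    have h7 := e₃ r (μ, x, y, z)
    have h8 : Ψ₀ (r, (μ, x, y, z)) = (F (r ^ 2 * x) (r * y) (r * z) (r ^ 2) (r * μ) : ℂ) := by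
      rw [← h6]
      simp [Ψ₀]
    rw [h8] at h7
    have := congrArg Complex.re h7
    rwa [Complex.ofReal_re, Complex.smul_re, smul_eq_mul] at this
  · have hcont : ∀ p : ℝ × ℝ, Continuous (fun w : ℂ × ℂ × ℂ => Ψ₂ (p.1, (p.2, w))) := fun p =>
      hΨ₂.continuous.comp (by fun_prop)
    let N : ℝ × ℝ → C(Angle × Angle × Angle × Unit, ℂ) := fun p =>
      (⟨_, hcont p⟩ : C(ℂ × ℂ × ℂ, ℂ)).comp torusEmb
    have hN : ContDiff ℝ ∞ N := by
      refine contDiff_infty.2 fun n => ?_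
      have := contDiff_superposition_param (n := n) torusEmb
        (⟨fun q : (ℂ × ℂ × ℂ) × (ℝ × ℝ) => Ψ₂ (q.2.1, (q.2.2, q.1)),
          hΨ₂.continuous.comp (by fun_prop)⟩) ((hΨ₂.of_le (by exact_mod_cast le_top)).comp
            (by fun_prop))
      exact this
    let E : ℕ × ℕ × ℕ → C(Angle × Angle × Angle × Unit, ℂ) := fun i =>
      torusPhase 0 ^ i.1 * (torusPhase 1 ^ i.2.1 * torusPhase 2 ^ i.2.2)
    have hE : ∀ i, ‖E i‖ ≤ 1 := by
      intro i
      rw [ContinuousMap.norm_le _ zero_le_one]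
      intro y
      have h1 : ∀ (a : Fin 3) (n : ℕ), ‖torusPhase a y ^ n‖ ≤ 1 := by
        intro a n
        rw [norm_pow]
        refine pow_le_one₀ (norm_nonneg _) (((torusPhase a).norm_coe_le_norm y).trans ?_)
        fin_cases a <;> exact norm_phase_le _
      simp only [E, ContinuousMap.mul_apply, ContinuousMap.pow_apply, norm_mul]
      exact mul_le_one₀ (h1 _ _) (by positivity) (mul_le_one₀ (h1 _ _) (norm_nonneg _) (h1 _ _))
    let L : ℕ × ℕ × ℕ → C(Angle × Angle × Angle × Unit, ℂ) →L[ℝ] ℝ := fun i =>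
      LinearMap.mkContinuous
        (Complex.reLm ∘ₗ (torusMean : _ →ₗ[ℝ] ℂ) ∘ₗ LinearMap.mulRight ℝ (E i)) 1 (fun g => by
          rw [one_mul]
          refine (Complex.abs_re_le_norm _).trans ((norm_torusMean_le _).trans ?_)
          refine (norm_mul_le _ _).trans ?_
          nlinarith [hE i, norm_nonneg g])
    have hL : ∀ i, ‖L i‖ ≤ 1 := fun i => LinearMap.mkContinuous_norm_le _ zero_le_one _
    refine ⟨fun i p => L i (N p), fun i => (L i).contDiff.comp hN, fun j => ?_, ?_⟩
    · have hb : Continuous (iteratedFDeriv ℝ j N) := hN.continuous_iteratedFDeriv (by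
        exact_mod_cast le_top)
      obtain ⟨C, hC⟩ := (isCompact_closedBall (0 : ℝ × ℝ) 1).exists_bound_of_continuousOn
        hb.continuousOn
      refine ⟨C, fun i p hp => ?_⟩
      have := (L i).norm_iteratedFDeriv_comp_left (f := N) (x := p) (n := j) (N := ∞)
        hN.contDiffAt (by exact_mod_cast le_top)
      refine this.trans ((mul_le_of_le_one_left (norm_nonneg _) (hL i)).trans (hC p hp))
    · intro r μ hr hrρ hμ1 x y z hx hy hz
      have hr1 : |r| < 1 := hrρ.trans_le (min_le_right _ _)
      have h1 := hasSum_torus (hcont (r, μ)) (fun w w1 w2 w3 => ?_)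
        (x := (x : ℂ)) (y := (y : ℂ)) (z := (z : ℂ)) (by simpa using hx) (by simpa using hy)
        (by simpa using hz)
      · have h2 := h1.mapL Complex.reCLM
        refine h2.congr_fun fun i => ?_
        simp only [Complex.reCLM_apply]
        rw [← Complex.ofReal_pow, ← Complex.ofReal_pow, ← Complex.ofReal_pow, ← Complex.ofReal_mul,
          ← Complex.ofReal_mul, Complex.re_mul_ofReal]
        rfl
      · have h3 : (fun w : ℂ × ℂ × ℂ => Ψ₂ (r, (μ, w))) = fun w =>
            ((r : ℂ) ^ 2)⁻¹ * Φ' (((r : ℂ) ^ 2 * w.1, (r : ℂ) * w.2.1, (r : ℂ) * w.2.2),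
              (r ^ 2, r * μ)) := by
          ext w
          have := e₃ r (μ, w)
          have hr' : (r : ℂ) ≠ 0 := by exact_mod_cast hr
          rw [Complex.real_smul, Complex.ofReal_pow] at this
          rw [eq_inv_mul_iff_mul_eq₀ (pow_ne_zero 2 hr'), ← this]
          simp [Ψ₀]
        rw [h3]
        have hsq : r ^ 2 < ρ := by
          have : r ^ 2 = |r| * |r| := by rw [← sq, sq_abs]
          nlinarith [abs_nonneg r]
        have hb : ∀ ξ : ℂ, ‖ξ‖ ≤ 1 → ‖(r : ℂ) * ξ‖ < ρ := by
          intro ξ hξ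
          rw [norm_mul, Complex.norm_real, Real.norm_eq_abs]
          nlinarith [abs_nonneg r, norm_nonneg ξ]
        have hd := hΦhol ((r : ℂ) ^ 2 * w.1, (r : ℂ) * w.2.1, (r : ℂ) * w.2.2) (r ^ 2, r * μ)
          (by
            rw [norm_mul, norm_pow, Complex.norm_real, Real.norm_eq_abs, sq_abs]
            nlinarith [sq_nonneg r, norm_nonneg w.1]) (hb _ w2) (hb _ w3)
          (by rwa [abs_of_nonneg (sq_nonneg r)])
          (by rw [abs_mul]; nlinarith [abs_nonneg r, abs_nonneg μ])
        refine DifferentiableAt.const_mul ?_ _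
        exact DifferentiableAt.comp (g := fun w => Φ' (w, (r ^ 2, r * μ))) w hd (by fun_prop)

end

section

open scoped ENNReal Nat

/-! ### A Banach algebra of power series whose coefficients depend smoothly on parameters -/

/-- The weighted norm of the `k`-jet of a function of the two parameters. The weight of the `j`-th
derivative decreases with the index `n` like `(n + 1) ^ (-j)`, so that functions of `n r` are bounded
uniformly in `n`. -/
def jetNorm (k n : ℕ) (f : ℝ × ℝ → ℝ) : ℝ≥0∞ :=
  ∑ j ∈ Finset.range (k + 1), ENNReal.ofReal (j ! * (n + 1) ^ j : ℝ)⁻¹ *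
    ⨆ p, ‖iteratedFDeriv ℝ j f p‖ₑ

variable {k n : ℕ} {f g : ℝ × ℝ → ℝ}

/-- The norm controls the derivatives, with constants that grow like `(n + 1) ^ j`. -/
theorem enorm_iteratedFDeriv_le {j : ℕ} (hj : j ≤ k) (p : ℝ × ℝ) :
    ‖iteratedFDeriv ℝ j f p‖ₑ ≤ ENNReal.ofReal (j ! * (n + 1) ^ j : ℝ) * jetNorm k n f := by
  have h : ENNReal.ofReal (j ! * (n + 1) ^ j : ℝ)⁻¹ * ‖iteratedFDeriv ℝ j f p‖ₑ ≤ jetNorm k n f :=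
    (mul_le_mul_right (le_iSup (fun p => ‖iteratedFDeriv ℝ j f p‖ₑ) p) _).trans
      (Finset.single_le_sum (f := fun j => ENNReal.ofReal (j ! * (n + 1) ^ j : ℝ)⁻¹ *
        ⨆ p, ‖iteratedFDeriv ℝ j f p‖ₑ) (fun _ _ => zero_le) (Finset.mem_range_succ_iff.2 hj))
  have hpos : (0 : ℝ) < j ! * (n + 1) ^ j := by positivity
  calc ‖iteratedFDeriv ℝ j f p‖ₑ = ENNReal.ofReal (j ! * (n + 1) ^ j : ℝ) *
        (ENNReal.ofReal (j ! * (n + 1) ^ j : ℝ)⁻¹ * ‖iteratedFDeriv ℝ j f p‖ₑ) := by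
        rw [← mul_assoc, ← ENNReal.ofReal_mul hpos.le, mul_inv_cancel₀ hpos.ne', ENNReal.ofReal_one,
          one_mul]
    _ ≤ _ := mul_le_mul_right h _

theorem enorm_apply_le_jetNorm (p : ℝ × ℝ) : ‖f p‖ₑ ≤ jetNorm k n f := by
  have := enorm_iteratedFDeriv_le (k := k) (n := n) (f := f) (Nat.zero_le k) p
  simpa [enorm_eq_nnnorm, ← norm_toNNReal] using this

theorem jetNorm_le_of_bound {C : ℝ} (hf : ∀ j ≤ k, ∀ p,
    ‖iteratedFDeriv ℝ j f p‖ ≤ C * (j ! * (n + 1) ^ j)) :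
    jetNorm k n f ≤ ENNReal.ofReal ((k + 1) * C) := by
  have hC : 0 ≤ C := by simpa using (norm_nonneg _).trans (hf 0 (Nat.zero_le _) 0)
  have h : ∀ j ∈ Finset.range (k + 1), ENNReal.ofReal (j ! * (n + 1) ^ j : ℝ)⁻¹ *
      ⨆ p, ‖iteratedFDeriv ℝ j f p‖ₑ ≤ ENNReal.ofReal C := by
    intro j hj
    have hpos : (0 : ℝ) < j ! * (n + 1) ^ j := by positivity
    have h1 : ⨆ p, ‖iteratedFDeriv ℝ j f p‖ₑ ≤ ENNReal.ofReal (C * (j ! * (n + 1) ^ j)) := by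
      refine iSup_le fun p => ?_
      rw [← ofReal_norm]
      exact ENNReal.ofReal_le_ofReal (hf j (Finset.mem_range_succ_iff.1 hj) p)
    refine (mul_le_mul_right h1 _).trans ?_
    rw [← ENNReal.ofReal_mul (by positivity)]
    refine ENNReal.ofReal_le_ofReal (le_of_eq ?_)
    field_simp
  refine (Finset.sum_le_card_nsmul _ _ _ h).trans ?_
  rw [Finset.card_range, nsmul_eq_mul, ENNReal.ofReal_mul (by positivity)]
  gcongr
  rw [show ((k : ℝ) + 1) = ((k + 1 : ℕ) : ℝ) by push_cast; ring, ENNReal.ofReal_natCast]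

theorem jetNorm_zero : jetNorm k n 0 = 0 := by
  have := jetNorm_le_of_bound (k := k) (n := n) (f := 0) (C := 0) (fun j _ p => by
    have : iteratedFDeriv ℝ j (0 : ℝ × ℝ → ℝ) p = 0 := by
      exact congrFun (iteratedFDeriv_fun_zero (𝕜 := ℝ) (E := ℝ × ℝ) (F := ℝ) (n := j)) p
    simp [this])
  simpa using this

theorem jetNorm_neg : jetNorm k n (-f) = jetNorm k n f := by
  simp only [jetNorm, iteratedFDeriv_neg_apply, enorm_neg]

theorem jetNorm_add_le (hf : ContDiff ℝ k f) (hg : ContDiff ℝ k g) :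
    jetNorm k n (f + g) ≤ jetNorm k n f + jetNorm k n g := by
  rw [jetNorm, jetNorm, jetNorm, ← Finset.sum_add_distrib]
  refine Finset.sum_le_sum fun j hj => ?_
  rw [← mul_add]
  refine mul_le_mul_right (iSup_le fun p => ?_) _
  have hj' : ((j : ℕ) : ℕ∞ω) ≤ k := by exact_mod_cast Finset.mem_range_succ_iff.1 hj
  rw [iteratedFDeriv_add_apply (hf.of_le hj').contDiffAt (hg.of_le hj').contDiffAt]
  rw [← ofReal_norm]
  refine (ENNReal.ofReal_le_ofReal (norm_add_le _ _)).trans ?_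
  rw [ENNReal.ofReal_add (norm_nonneg _) (norm_nonneg _), ofReal_norm, ofReal_norm]
  exact add_le_add (le_iSup (fun p => ‖iteratedFDeriv ℝ j f p‖ₑ) p)
    (le_iSup (fun p => ‖iteratedFDeriv ℝ j g p‖ₑ) p)

/-- The weights are submultiplicative, hence so are the norms. -/
theorem jetNorm_mul_le {a b : ℕ} (ha : a ≤ n) (hb : b ≤ n) (hf : ContDiff ℝ k f)
    (hg : ContDiff ℝ k g) : jetNorm k n (f * g) ≤ jetNorm k a f * jetNorm k b g := by
  set A : ℕ → ℝ≥0∞ := fun j => ENNReal.ofReal (j ! * (a + 1) ^ j : ℝ)⁻¹ *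
    ⨆ p, ‖iteratedFDeriv ℝ j f p‖ₑ with hA
  set B : ℕ → ℝ≥0∞ := fun j => ENNReal.ofReal (j ! * (b + 1) ^ j : ℝ)⁻¹ *
    ⨆ p, ‖iteratedFDeriv ℝ j g p‖ₑ with hB
  have h1 : ∀ j ∈ Finset.range (k + 1), ENNReal.ofReal (j ! * (n + 1) ^ j : ℝ)⁻¹ *
      ⨆ p, ‖iteratedFDeriv ℝ j (f * g) p‖ₑ ≤ ∑ i ∈ Finset.range (j + 1), A i * B (j - i) := by
    intro j hj
    have hj' : ((j : ℕ) : ℕ∞ω) ≤ k := by exact_mod_cast Finset.mem_range_succ_iff.1 hj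
    rw [ENNReal.mul_iSup]
    refine iSup_le fun p => ?_
    -- the Leibniz rule; the factorials in the weights cancel the binomial coefficients
    have h2 := norm_iteratedFDeriv_mul_le (𝕜 := ℝ) (N := k) hf hg p (n := j) hj'
    rw [← ofReal_norm, ← ENNReal.ofReal_mul (by positivity)]
    refine (ENNReal.ofReal_le_ofReal (mul_le_mul_of_nonneg_left h2 (by positivity))).trans ?_
    rw [Finset.mul_sum, ENNReal.ofReal_sum_of_nonneg (fun i _ => by positivity)]
    refine Finset.sum_le_sum fun i hi => ?_
    have hij : i ≤ j := Finset.mem_range_succ_iff.1 hi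
    have h3 : (j ! * (n + 1) ^ j : ℝ)⁻¹ * (j.choose i * ‖iteratedFDeriv ℝ i f p‖ *
        ‖iteratedFDeriv ℝ (j - i) g p‖) ≤ ((i ! * (a + 1) ^ i : ℝ)⁻¹ * ‖iteratedFDeriv ℝ i f p‖) *
        (((j - i)! * (b + 1) ^ (j - i) : ℝ)⁻¹ * ‖iteratedFDeriv ℝ (j - i) g p‖) := by
      have h4 : (j ! : ℝ) = j.choose i * i ! * (j - i)! := by
        exact_mod_cast (Nat.choose_mul_factorial_mul_factorial hij).symm
      have h5 : ((n : ℝ) + 1) ^ j = (n + 1) ^ i * (n + 1) ^ (j - i) := by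
        rw [← pow_add, Nat.add_sub_cancel' hij]
      have hc : (0 : ℝ) < j.choose i := by exact_mod_cast Nat.choose_pos hij
      have h6 : (j ! * (n + 1) ^ j : ℝ)⁻¹ * j.choose i =
          (i ! * (n + 1) ^ i : ℝ)⁻¹ * ((j - i)! * (n + 1) ^ (j - i) : ℝ)⁻¹ := by
        rw [h4, h5]
        field_simp
      have ha' : (a : ℝ) ≤ n := by exact_mod_cast ha
      have hb' : (b : ℝ) ≤ n := by exact_mod_cast hb
      calc _ = ((j ! * (n + 1) ^ j : ℝ)⁻¹ * j.choose i) * (‖iteratedFDeriv ℝ i f p‖ *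
            ‖iteratedFDeriv ℝ (j - i) g p‖) := by ring
        _ = ((i ! * (n + 1) ^ i : ℝ)⁻¹ * ‖iteratedFDeriv ℝ i f p‖) *
        (((j - i)! * (n + 1) ^ (j - i) : ℝ)⁻¹ * ‖iteratedFDeriv ℝ (j - i) g p‖) := by
            rw [h6]; ring
        _ ≤ _ := by gcongr
    refine (ENNReal.ofReal_le_ofReal h3).trans ?_
    rw [ENNReal.ofReal_mul (by positivity), ENNReal.ofReal_mul (by positivity),
      ENNReal.ofReal_mul (by positivity), ofReal_norm, ofReal_norm]
    exact mul_le_mul' (mul_le_mul_right (le_iSup (fun p => ‖iteratedFDeriv ℝ i f p‖ₑ) p) _)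
      (mul_le_mul_right (le_iSup (fun p => ‖iteratedFDeriv ℝ (j - i) g p‖ₑ) p) _)
  refine (Finset.sum_le_sum h1).trans ?_
  have h2 : ∀ j, ∑ i ∈ Finset.range (j + 1), A i * B (j - i) =
      ∑ x ∈ Finset.HasAntidiagonal.antidiagonal j, A x.1 * B x.2 := fun j =>
    (Finset.Nat.sum_antidiagonal_eq_sum_range_succ (fun i l => A i * B l) j).symm
  simp only [h2]
  rw [jetNorm, jetNorm, Finset.sum_mul_sum, ← Finset.sum_product',
    Finset.sum_sigma']
  rw [← Finset.sum_image (s := (Finset.range (k + 1)).sigma fun j => Finset.HasAntidiagonal.antidiagonal j)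
    (g := fun x => x.2) (f := fun x : ℕ × ℕ => A x.1 * B x.2)]
  · refine Finset.sum_le_sum_of_subset ?_
    intro x hx
    simp only [Finset.mem_image, Finset.mem_sigma, Finset.mem_range, Finset.HasAntidiagonal.mem_antidiagonal,
      Finset.mem_product] at hx ⊢
    obtain ⟨⟨j, y⟩, ⟨h3, h4⟩, rfl⟩ := hx
    simp only at h3 h4
    have h5 : y.1 + y.2 = j := h4
    change y.1 < k + 1 ∧ y.2 < k + 1
    constructor <;> omega
  · rintro ⟨j, y⟩ hx ⟨j', y'⟩ hx' h
    simp only [Finset.coe_sigma, Set.mem_sigma_iff, Finset.mem_coe, Finset.HasAntidiagonal.mem_antidiagonal] at hx hx' h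
    subst h
    obtain rfl : j = j' := hx.2.symm.trans hx'.2
    rfl

theorem jetNorm_one_le : jetNorm k n 1 ≤ 1 := by
  rw [jetNorm, Finset.sum_range_succ']
  have h : ∀ p : ℝ × ℝ, ‖iteratedFDeriv ℝ 0 (1 : ℝ × ℝ → ℝ) p‖ₑ = 1 := by
    intro p
    rw [← ofReal_norm, norm_iteratedFDeriv_zero]
    simp
  have h2 : ∀ (j : ℕ) (p : ℝ × ℝ), iteratedFDeriv ℝ (j + 1) (1 : ℝ × ℝ → ℝ) p = 0 := fun j p => by
    have := iteratedFDeriv_const_of_ne (𝕜 := ℝ) (E := ℝ × ℝ) (n := j + 1) (by omega) (1 : ℝ)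
    exact congrFun this p
  have h3 : ∀ (j : ℕ) (p : ℝ × ℝ), ‖iteratedFDeriv ℝ (j + 1) (1 : ℝ × ℝ → ℝ) p‖ₑ = 0 := fun j p => by
    rw [← ofReal_norm, h2]
    simp
  simp [h, h3]

/-- Weights of larger index are smaller, by a bounded factor for consecutive indices. -/
theorem jetNorm_le_succ : jetNorm k n f ≤ 2 ^ k * jetNorm k (n + 1) f := by
  rw [jetNorm, jetNorm, Finset.mul_sum]
  refine Finset.sum_le_sum fun j hj => ?_
  rw [← mul_assoc]
  refine mul_le_mul_left ?_ _
  have hj' : j ≤ k := Finset.mem_range_succ_iff.1 hj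
  rw [show (2 : ℝ≥0∞) ^ k = ENNReal.ofReal (2 ^ k) by
    rw [ENNReal.ofReal_pow (by norm_num)]; simp, ← ENNReal.ofReal_mul (by positivity)]
  refine ENNReal.ofReal_le_ofReal ?_
  push_cast
  rw [← div_eq_mul_inv, ← one_div, div_le_div_iff₀ (by positivity) (by positivity)]
  have h1 : ((n : ℝ) + 1 + 1) ^ j ≤ 2 ^ k * (n + 1) ^ j := by
    calc ((n : ℝ) + 1 + 1) ^ j ≤ (2 * (n + 1)) ^ j := by
          gcongr
          linarith [(Nat.cast_nonneg n : (0 : ℝ) ≤ n)]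
      _ = 2 ^ j * (n + 1) ^ j := by rw [mul_pow]
      _ ≤ _ := by gcongr; norm_num
  have : (0 : ℝ) < j ! := by positivity
  nlinarith

theorem eq_zero_of_jetNorm_eq_zero (h : jetNorm k n f = 0) : f = 0 := by
  ext p
  have := enorm_apply_le_jetNorm (k := k) (n := n) (f := f) p
  rw [h] at this
  simpa using this

end

section

open scoped ENNReal Nat

/-- The norm of a power series: the sum of the jet norms of its coefficients. -/
def seriesNorm (k : ℕ) (f : PowerSeries (ℝ × ℝ → ℝ)) : ℝ≥0∞ :=
  ∑' n, jetNorm k n (PowerSeries.coeff n f)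

variable {k : ℕ}

theorem jetNorm_coeff_le_seriesNorm (f : PowerSeries (ℝ × ℝ → ℝ)) (n : ℕ) :
    jetNorm k n (PowerSeries.coeff n f) ≤ seriesNorm k f := ENNReal.le_tsum n

theorem seriesNorm_add_le {f g : PowerSeries (ℝ × ℝ → ℝ)}
    (hf : ∀ n, ContDiff ℝ k (PowerSeries.coeff n f))
    (hg : ∀ n, ContDiff ℝ k (PowerSeries.coeff n g)) :
    seriesNorm k (f + g) ≤ seriesNorm k f + seriesNorm k g := by
  rw [seriesNorm, seriesNorm, seriesNorm, ← ENNReal.tsum_add]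
  refine ENNReal.tsum_le_tsum fun n => ?_
  rw [map_add]
  exact jetNorm_add_le (hf n) (hg n)

theorem jetNorm_sum_le {ι : Type} (s : Finset ι) {n : ℕ} {f : ι → ℝ × ℝ → ℝ}
    (hf : ∀ i ∈ s, ContDiff ℝ k (f i)) :
    jetNorm k n (∑ i ∈ s, f i) ≤ ∑ i ∈ s, jetNorm k n (f i) := by
  classical
  induction s using Finset.induction_on with
  | empty => simp [jetNorm_zero]
  | insert a s ha ih =>
    rw [Finset.sum_insert ha, Finset.sum_insert ha]
    refine (jetNorm_add_le (hf a (Finset.mem_insert_self _ _)) ?_).trans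
      (add_le_add le_rfl (ih fun i hi => hf i (Finset.mem_insert_of_mem hi)))
    rw [show (∑ i ∈ s, f i) = fun p => ∑ i ∈ s, f i p by ext p; simp]
    exact ContDiff.sum fun i hi => hf i (Finset.mem_insert_of_mem hi)

theorem contDiff_coeff_mul {f g : PowerSeries (ℝ × ℝ → ℝ)}
    (hf : ∀ n, ContDiff ℝ k (PowerSeries.coeff n f))
    (hg : ∀ n, ContDiff ℝ k (PowerSeries.coeff n g)) (n : ℕ) :
    ContDiff ℝ k (PowerSeries.coeff n (f * g)) := by
  rw [PowerSeries.coeff_mul]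
  rw [show (∑ p ∈ Finset.HasAntidiagonal.antidiagonal n,
    PowerSeries.coeff p.1 f * PowerSeries.coeff p.2 g) =
    fun q => ∑ p ∈ Finset.HasAntidiagonal.antidiagonal n,
      PowerSeries.coeff p.1 f q * PowerSeries.coeff p.2 g q by ext q; simp]
  exact ContDiff.sum fun p _ => (hf _).mul (hg _)

theorem seriesNorm_mul_le {f g : PowerSeries (ℝ × ℝ → ℝ)}
    (hf : ∀ n, ContDiff ℝ k (PowerSeries.coeff n f))
    (hg : ∀ n, ContDiff ℝ k (PowerSeries.coeff n g)) :
    seriesNorm k (f * g) ≤ seriesNorm k f * seriesNorm k g := by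
  have h : ∀ n, jetNorm k n (PowerSeries.coeff n (f * g)) ≤
      ∑ p ∈ Finset.HasAntidiagonal.antidiagonal n,
        jetNorm k p.1 (PowerSeries.coeff p.1 f) * jetNorm k p.2 (PowerSeries.coeff p.2 g) := by
    intro n
    rw [PowerSeries.coeff_mul]
    refine (jetNorm_sum_le _ fun p _ => (hf _).mul (hg _)).trans (Finset.sum_le_sum fun p hp => ?_)
    rw [Finset.HasAntidiagonal.mem_antidiagonal] at hp
    exact jetNorm_mul_le (by omega) (by omega) (hf _) (hg _)
  refine (ENNReal.tsum_le_tsum h).trans (le_of_eq ?_)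
  rw [seriesNorm, seriesNorm, ← ENNReal.tsum_mul_right]
  simp only [← ENNReal.tsum_mul_left]
  rw [← ENNReal.tsum_prod (f := fun a b => jetNorm k a (PowerSeries.coeff a f) *
    jetNorm k b (PowerSeries.coeff b g)),
    ← (Finset.HasAntidiagonal.sigmaAntidiagonalEquivProd (A := ℕ)).tsum_eq, ENNReal.tsum_sigma']
  refine tsum_congr fun n => ?_
  rw [tsum_fintype, ← Finset.sum_coe_sort]
  rfl

/-- Power series in one variable whose coefficients are `C^k` functions of the two parameters, with
finite norm. -/
def paramSeries (k : ℕ) : Subring (PowerSeries (ℝ × ℝ → ℝ)) where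
  carrier := {f | (∀ n, ContDiff ℝ k (PowerSeries.coeff n f)) ∧ seriesNorm k f ≠ ⊤}
  zero_mem' := ⟨fun n => contDiff_const (c := (0 : ℝ)), by simp [seriesNorm, jetNorm_zero]⟩
  one_mem' := by
    have h : ∀ n ≠ 0, jetNorm k n (PowerSeries.coeff n (1 : PowerSeries (ℝ × ℝ → ℝ))) = 0 := by
      intro n hn
      simp [PowerSeries.coeff_one, hn, jetNorm_zero]
    refine ⟨fun n => ?_, ?_⟩
    · rw [PowerSeries.coeff_one]
      split_ifs
      · exact contDiff_const
      · exact contDiff_const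
    · rw [seriesNorm, tsum_eq_single 0 h]
      simpa using (jetNorm_one_le.trans_lt ENNReal.one_lt_top).ne
  add_mem' := fun {f g} hf hg => ⟨fun n => by
    rw [map_add]
    exact (hf.1 n).add (hg.1 n), ne_top_of_le_ne_top (ENNReal.add_ne_top.2 ⟨hf.2, hg.2⟩)
      (seriesNorm_add_le hf.1 hg.1)⟩
  neg_mem' := fun {f} hf => ⟨fun n => by
    rw [map_neg]
    exact (hf.1 n).neg, by
      have : seriesNorm k (-f) = seriesNorm k f := by simp [seriesNorm, jetNorm_neg]
      rw [this]
      exact hf.2⟩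
  mul_mem' := fun {f g} hf hg => ⟨contDiff_coeff_mul hf.1 hg.1,
    ne_top_of_le_ne_top (ENNReal.mul_ne_top hf.2 hg.2) (seriesNorm_mul_le hf.1 hg.1)⟩

/-- The ring norm given by `seriesNorm`. -/
def paramSeriesNorm (k : ℕ) : RingNorm (paramSeries k) where
  toFun f := (seriesNorm k f.1).toReal
  map_zero' := by simp [seriesNorm, jetNorm_zero]
  add_le' f g := by
    rw [← ENNReal.toReal_add f.2.2 g.2.2]
    exact ENNReal.toReal_mono (ENNReal.add_ne_top.2 ⟨f.2.2, g.2.2⟩) (seriesNorm_add_le f.2.1 g.2.1)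
  neg' f := by simp [seriesNorm, jetNorm_neg]
  mul_le' f g := by
    rw [← ENNReal.toReal_mul]
    exact ENNReal.toReal_mono (ENNReal.mul_ne_top f.2.2 g.2.2) (seriesNorm_mul_le f.2.1 g.2.1)
  eq_zero_of_map_eq_zero' f hf := by
    have h : seriesNorm k f.1 = 0 := ((ENNReal.toReal_eq_zero_iff _).1 hf).resolve_right f.2.2
    rw [seriesNorm, ENNReal.tsum_eq_zero] at h
    ext n : 2
    simpa using eq_zero_of_jetNorm_eq_zero (h n)

instance : NormedRing (paramSeries k) := (paramSeriesNorm k).toNormedRing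

instance : NormedCommRing (paramSeries k) where
  mul_comm := mul_comm

/-- The `n`-th coefficient. -/
abbrev cf (f : paramSeries k) (n : ℕ) : ℝ × ℝ → ℝ := PowerSeries.coeff n f.1

theorem norm_paramSeries (f : paramSeries k) : ‖f‖ = (seriesNorm k f.1).toReal := rfl

theorem ofReal_norm_paramSeries (f : paramSeries k) : ENNReal.ofReal ‖f‖ = seriesNorm k f.1 := by
  rw [norm_paramSeries, ENNReal.ofReal_toReal f.2.2]

theorem contDiff_cf (f : paramSeries k) (n : ℕ) : ContDiff ℝ k (cf f n) := f.2.1 n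

instance : NormOneClass (paramSeries k) where
  norm_one := by
    have h : ∀ n ≠ 0, jetNorm k n (PowerSeries.coeff n (1 : PowerSeries (ℝ × ℝ → ℝ))) = 0 := by
      intro n hn
      simp [PowerSeries.coeff_one, hn, jetNorm_zero]
    rw [norm_paramSeries, seriesNorm]
    change (∑' n, jetNorm k n (PowerSeries.coeff n (1 : PowerSeries (ℝ × ℝ → ℝ)))).toReal = 1
    rw [tsum_eq_single 0 h]
    have h1 : jetNorm k 0 (1 : ℝ × ℝ → ℝ) = 1 := by
      refine le_antisymm jetNorm_one_le ?_
      have := enorm_apply_le_jetNorm (k := k) (n := 0) (f := 1) (0 : ℝ × ℝ)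
      simpa using this
    simp [h1]

/-- Membership and norm bound for a power series with given coefficients. -/
theorem exists_paramSeries {c : ℕ → ℝ × ℝ → ℝ} (hc : ∀ n, ContDiff ℝ k (c n)) {C : ℝ} (hC : 0 ≤ C)
    (h : ∑' n, jetNorm k n (c n) ≤ ENNReal.ofReal C) :
    ∃ f : paramSeries k, (∀ n, cf f n = c n) ∧ ‖f‖ ≤ C := by
  refine ⟨⟨PowerSeries.mk c, fun n => by simpa using hc n, ?_⟩, fun n => by simp [cf], ?_⟩
  · simp only [seriesNorm, PowerSeries.coeff_mk]
    exact ne_top_of_le_ne_top ENNReal.ofReal_ne_top h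
  · simp only [norm_paramSeries, seriesNorm, PowerSeries.coeff_mk]
    exact ENNReal.toReal_le_of_le_ofReal hC h

theorem paramSeries_ext {f g : paramSeries k} (h : ∀ n, cf f n = cf g n) : f = g := by
  ext n : 2
  exact h n

instance : CompleteSpace (paramSeries k) := by
  refine NormedAddCommGroup.completeSpace_of_summable_imp_tendsto fun u hu => ?_
  -- the coefficients of the limit are series of `C^k` functions
  have hu' : ∑' i, seriesNorm k (u i).1 ≠ ⊤ := by
    simp only [← ofReal_norm_paramSeries]
    rw [← ENNReal.ofReal_tsum_of_nonneg (fun i => norm_nonneg _) hu]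
    exact ENNReal.ofReal_ne_top
  have hjet : ∀ n, ∑' i, jetNorm k n (cf (u i) n) ≠ ⊤ := fun n =>
    ne_top_of_le_ne_top hu' (ENNReal.tsum_le_tsum fun i => jetNorm_coeff_le_seriesNorm _ n)
  let v : ℕ → ℕ → ℕ → ℝ := fun n j i => j ! * (n + 1) ^ j * (jetNorm k n (cf (u i) n)).toReal
  have hv : ∀ n j, Summable (v n j) := fun n j => (ENNReal.summable_toReal (hjet n)).mul_left _
  have hfin : ∀ n i, jetNorm k n (cf (u i) n) ≠ ⊤ := fun n i =>
    ne_top_of_le_ne_top (u i).2.2 (jetNorm_coeff_le_seriesNorm _ n)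
  have hbound : ∀ n j i (x : ℝ × ℝ), j ≤ k → ‖iteratedFDeriv ℝ j (cf (u i) n) x‖ ≤ v n j i := by
    intro n j i x hj
    have := enorm_iteratedFDeriv_le (k := k) (n := n) (f := cf (u i) n) hj x
    rw [← ofReal_norm, ← ENNReal.ofReal_toReal (hfin n i), ← ENNReal.ofReal_mul (by positivity)] at this
    exact (ENNReal.ofReal_le_ofReal_iff (by positivity)).1 this
  have hcd : ∀ n I, ContDiff ℝ k (fun p => ∑' i, cf (u (i + I)) n p) := fun n I =>
    contDiff_tsum (N := k) (v := fun j i => v n j (i + I)) (fun i => contDiff_cf _ n)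
      (fun j _ => (summable_nat_add_iff I).2 (hv n j))
      (fun j i x hj => hbound n j _ x (by exact_mod_cast hj))
  have htail : ∀ n I, jetNorm k n (fun p => ∑' i, cf (u (i + I)) n p) ≤
      ∑' i, jetNorm k n (cf (u (i + I)) n) := by
    intro n I
    simp only [jetNorm]
    rw [Summable.tsum_finsetSum (fun _ _ => ENNReal.summable)]
    refine Finset.sum_le_sum fun j hj => ?_
    have hjk : j ≤ k := Finset.mem_range_succ_iff.1 hj
    rw [ENNReal.tsum_mul_left]
    refine mul_le_mul_right (iSup_le fun p => ?_) _
    rw [iteratedFDeriv_tsum_apply (N := k) (v := fun j i => v n j (i + I))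
      (fun i => contDiff_cf _ n) (fun j _ => (summable_nat_add_iff I).2 (hv n j))
      (fun j i x hj => hbound n j _ x (by exact_mod_cast hj)) (by exact_mod_cast hjk)]
    have hs : Summable fun i => ‖iteratedFDeriv ℝ j (cf (u (i + I)) n) p‖ :=
      Summable.of_nonneg_of_le (fun _ => norm_nonneg _) (fun i => hbound n j _ p hjk)
        ((summable_nat_add_iff I).2 (hv n j))
    rw [← ofReal_norm]
    refine (ENNReal.ofReal_le_ofReal (norm_tsum_le_tsum_norm hs)).trans ?_
    rw [ENNReal.ofReal_tsum_of_nonneg (fun _ => norm_nonneg _) hs]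
    refine ENNReal.tsum_le_tsum fun i => ?_
    rw [ofReal_norm]
    exact le_iSup (fun p => ‖iteratedFDeriv ℝ j (cf (u (i + I)) n) p‖ₑ) p
  have hnorm : ∀ I, ∑' n, jetNorm k n (fun p => ∑' i, cf (u (i + I)) n p) ≤
      ∑' i, seriesNorm k (u (i + I)).1 := by
    intro I
    refine (ENNReal.tsum_le_tsum fun n => htail n I).trans (le_of_eq ?_)
    rw [ENNReal.tsum_comm]
    rfl
  have hlim := ENNReal.tendsto_sum_nat_add (fun i => seriesNorm k (u i).1) hu'
  have hshift : ∀ I, ∑' i, seriesNorm k (u (i + I)).1 ≠ ⊤ := by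
    intro I
    refine ne_top_of_le_ne_top hu' ?_
    exact ENNReal.tsum_comp_le_tsum_of_injective (add_left_injective I) _
  obtain ⟨a, ha, -⟩ := exists_paramSeries (fun n => hcd n 0) ENNReal.toReal_nonneg
    ((hnorm 0).trans (ENNReal.ofReal_toReal (hshift 0)).symm.le)
  refine ⟨a, ?_⟩
  rw [tendsto_iff_norm_sub_tendsto_zero]
  have hle : ∀ I, ‖∑ i ∈ Finset.range I, u i - a‖ ≤ (∑' i, seriesNorm k (u (i + I)).1).toReal := by
    intro I
    obtain ⟨b, hb, hbn⟩ := exists_paramSeries (fun n => hcd n I) ENNReal.toReal_nonneg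
      ((hnorm I).trans (ENNReal.ofReal_toReal (hshift I)).symm.le)
    have : a - ∑ i ∈ Finset.range I, u i = b := by
      refine paramSeries_ext fun n => ?_
      have h1 : cf (a - ∑ i ∈ Finset.range I, u i) n =
          cf a n - ∑ i ∈ Finset.range I, cf (u i) n := by
        simp [cf, map_sub, map_sum]
      rw [h1, ha, hb]
      ext p
      have hs : Summable fun i => cf (u i) n p := by
        refine Summable.of_norm_bounded (hv n 0) fun i => ?_
        have := hbound n 0 i p (Nat.zero_le _)
        rwa [norm_iteratedFDeriv_zero] at this
      rw [Pi.sub_apply, Finset.sum_apply, sub_eq_iff_eq_add']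
      simpa using (hs.sum_add_tsum_nat_add I).symm
    rw [norm_sub_rev, this]
    exact hbn
  refine squeeze_zero (fun _ => norm_nonneg _) hle ?_
  have := (ENNReal.tendsto_toReal ENNReal.zero_ne_top).comp hlim
  rw [ENNReal.toReal_zero] at this
  exact this

end

section

open scoped ENNReal Nat

variable {k : ℕ}

/-- Functions of the parameters as constant power series. -/
theorem exists_const {f : ℝ × ℝ → ℝ} (hf : ContDiff ℝ k f) {C : ℝ} (hC : 0 ≤ C)
    (h : jetNorm k 0 f ≤ ENNReal.ofReal C) :
    ∃ a : paramSeries k, cf a 0 = f ∧ (∀ n, cf a (n + 1) = 0) ∧ ‖a‖ ≤ C := by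
  obtain ⟨a, h1, h2⟩ := exists_paramSeries (k := k) (c := fun n => if n = 0 then f else 0)
    (fun n => by
      by_cases hn : n = 0
      · simpa only [hn, if_true] using hf
      · simp only [hn, if_false]
        exact contDiff_const (c := (0 : ℝ))) hC (by
      rw [tsum_eq_single 0 (fun n hn => by simp [hn, jetNorm_zero])]
      simpa using h)
  exact ⟨a, by simp [h1], fun n => by simp [h1], h2⟩

/-- The variable of the power series. -/
theorem exists_variable (k : ℕ) : ∃ a : paramSeries k, cf a 1 = 1 ∧ (∀ n ≠ 1, cf a n = 0) ∧
    ‖a‖ ≤ 1 := by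
  obtain ⟨a, h1, h2⟩ := exists_paramSeries (k := k) (c := fun n => if n = 1 then 1 else 0)
    (fun n => by
      by_cases hn : n = 1
      · simp only [hn, if_true]
        exact contDiff_const (c := (1 : ℝ))
      · simp only [hn, if_false]
        exact contDiff_const (c := (0 : ℝ))) zero_le_one (by
      rw [tsum_eq_single 1 (fun n hn => by simp [hn, jetNorm_zero])]
      simpa using jetNorm_one_le)
  exact ⟨a, by simp [h1], fun n hn => by simp [h1, hn], h2⟩

theorem tsum_jetNorm_cf (f : paramSeries k) :
    ∑' n, jetNorm k n (cf f n) = ENNReal.ofReal ‖f‖ := (ofReal_norm_paramSeries f).symm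

/-- Multiplication of the coefficients by a bounded sequence of functions. -/
theorem exists_multiplier {κ : ℕ → ℝ × ℝ → ℝ} (hκ : ∀ n, ContDiff ℝ k (κ n)) {C : ℝ} (hC : 0 ≤ C)
    (h : ∀ n, jetNorm k n (κ n) ≤ ENNReal.ofReal C) :
    ∃ T : paramSeries k →+ paramSeries k, (∀ f n, cf (T f) n = κ n * cf f n) ∧
      ∀ f, ‖T f‖ ≤ C * ‖f‖ := by
  have : ∀ f : paramSeries k, ∃ g : paramSeries k, (∀ n, cf g n = κ n * cf f n) ∧
      ‖g‖ ≤ C * ‖f‖ := fun f => by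
    refine exists_paramSeries (fun n => (hκ n).mul (contDiff_cf f n)) (by positivity) ?_
    rw [ENNReal.ofReal_mul hC, ← tsum_jetNorm_cf, ← ENNReal.tsum_mul_left]
    exact ENNReal.tsum_le_tsum fun n =>
      (jetNorm_mul_le le_rfl le_rfl (hκ n) (contDiff_cf f n)).trans (mul_le_mul_left (h n) _)
  choose T h1 h2 using this
  refine ⟨⟨⟨T, ?_⟩, ?_⟩, h1, h2⟩
  · refine paramSeries_ext fun n => ?_
    simp [h1, cf]
  · intro f g
    refine paramSeries_ext fun n => ?_
    have e : ∀ a b : paramSeries k, cf (a + b) n = cf a n + cf b n := fun a b => by simp [cf]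
    rw [e, h1, h1, h1, e, mul_add]

/-- The left shift of the coefficients. -/
theorem exists_shift (k : ℕ) : ∃ T : paramSeries k →+ paramSeries k,
    (∀ f n, cf (T f) n = cf f (n + 1)) ∧ ∀ f, ‖T f‖ ≤ 2 ^ k * ‖f‖ := by
  have : ∀ f : paramSeries k, ∃ g : paramSeries k, (∀ n, cf g n = cf f (n + 1)) ∧
      ‖g‖ ≤ 2 ^ k * ‖f‖ := fun f => by
    refine exists_paramSeries (fun n => contDiff_cf f (n + 1)) (by positivity) ?_
    rw [ENNReal.ofReal_mul (by positivity), ← tsum_jetNorm_cf, ← ENNReal.tsum_mul_left]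
    rw [show ENNReal.ofReal (2 ^ k) = 2 ^ k by rw [ENNReal.ofReal_pow (by norm_num)]; simp]
    exact (ENNReal.tsum_le_tsum fun n => jetNorm_le_succ).trans
      (ENNReal.tsum_comp_le_tsum_of_injective (add_left_injective 1)
        (fun n => 2 ^ k * jetNorm k n (cf f n)))
  choose T h1 h2 using this
  refine ⟨⟨⟨T, ?_⟩, ?_⟩, h1, h2⟩
  · refine paramSeries_ext fun n => ?_
    simp [h1, cf]
  · intro f g
    refine paramSeries_ext fun n => ?_
    have e : ∀ (a b : paramSeries k) n, cf (a + b) n = cf a n + cf b n := fun a b => by simp [cf]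
    rw [e, h1, h1, h1, e]

/-- Absolute convergence at every parameter. -/
theorem summable_cf (f : paramSeries k) (p : ℝ × ℝ) : Summable (fun n => ‖cf f n p‖) ∧
    ∑' n, ‖cf f n p‖ ≤ ‖f‖ := by
  have h : ∑' n, ENNReal.ofReal ‖cf f n p‖ ≤ ENNReal.ofReal ‖f‖ := by
    rw [← tsum_jetNorm_cf]
    refine ENNReal.tsum_le_tsum fun n => ?_
    rw [ofReal_norm]
    exact enorm_apply_le_jetNorm p
  have hs : Summable (fun n => ‖cf f n p‖) := by
    have := ENNReal.summable_toReal (ne_top_of_le_ne_top ENNReal.ofReal_ne_top h)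
    simpa using this
  refine ⟨hs, ?_⟩
  rw [← ENNReal.ofReal_tsum_of_nonneg (fun _ => norm_nonneg _) hs] at h
  exact (ENNReal.ofReal_le_ofReal_iff (norm_nonneg _)).1 h

theorem summable_eval (f : paramSeries k) (p : ℝ × ℝ) {t : ℝ} (ht : |t| ≤ 1) :
    Summable (fun n => ‖t ^ n * cf f n p‖) := by
  refine Summable.of_nonneg_of_le (fun _ => norm_nonneg _) (fun n => ?_) (summable_cf f p).1
  rw [norm_mul, norm_pow]
  exact mul_le_of_le_one_left (norm_nonneg _) (pow_le_one₀ (norm_nonneg _) ht)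

/-- Evaluation of a power series at a parameter `p` and a point `t` of the closed unit disc. -/
def evalHom (k : ℕ) (p : ℝ × ℝ) {t : ℝ} (ht : |t| ≤ 1) : paramSeries k →+* ℝ where
  toFun f := ∑' n, t ^ n * cf f n p
  map_zero' := by simp [cf]
  map_one' := by
    rw [tsum_eq_single 0]
    · simp [cf]
    · intro n hn
      simp [cf, PowerSeries.coeff_one, hn]
  map_add' f g := by
    rw [← (summable_eval f p ht).of_norm.tsum_add (summable_eval g p ht).of_norm]
    refine tsum_congr fun n => ?_
    simp [cf, mul_add]
  map_mul' f g := by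
    rw [tsum_mul_tsum_eq_tsum_sum_antidiagonal_of_summable_norm (summable_eval f p ht)
      (summable_eval g p ht)]
    refine tsum_congr fun n => ?_
    simp only [cf, Subring.coe_mul, PowerSeries.coeff_mul, Finset.sum_apply, Pi.mul_apply,
      Finset.mul_sum]
    refine Finset.sum_congr rfl fun x hx => ?_
    rw [Finset.HasAntidiagonal.mem_antidiagonal] at hx
    rw [← hx, pow_add]
    ring

theorem evalHom_apply (p : ℝ × ℝ) {t : ℝ} (ht : |t| ≤ 1) (f : paramSeries k) :
    evalHom k p ht f = ∑' n, t ^ n * cf f n p := rfl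

theorem abs_evalHom_le (p : ℝ × ℝ) {t : ℝ} (ht : |t| ≤ 1) (f : paramSeries k) :
    |evalHom k p ht f| ≤ ‖f‖ := by
  rw [evalHom_apply, ← Real.norm_eq_abs]
  refine (norm_tsum_le_tsum_norm (summable_eval f p ht)).trans
    (le_trans ((summable_eval f p ht).tsum_le_tsum (fun n => ?_) (summable_cf f p).1)
      (summable_cf f p).2)
  rw [norm_mul, norm_pow]
  exact mul_le_of_le_one_left (norm_nonneg _) (pow_le_one₀ (norm_nonneg _) ht)

theorem continuous_evalHom (p : ℝ × ℝ) {t : ℝ} (ht : |t| ≤ 1) : Continuous (evalHom k p ht) :=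
  AddMonoidHomClass.continuous_of_bound (evalHom k p ht) 1 fun f => by
    simpa using abs_evalHom_le p ht f

theorem evalHom_const {a : paramSeries k} {f : ℝ × ℝ → ℝ} (h0 : cf a 0 = f)
    (h1 : ∀ n, cf a (n + 1) = 0) (p : ℝ × ℝ) {t : ℝ} (ht : |t| ≤ 1) :
    evalHom k p ht a = f p := by
  rw [evalHom_apply, tsum_eq_single 0]
  · rw [h0]; simp
  · intro n hn
    obtain ⟨m, rfl⟩ := Nat.exists_eq_succ_of_ne_zero hn
    rw [h1]; simp

theorem evalHom_variable {a : paramSeries k} (h1 : cf a 1 = 1) (h0 : ∀ n ≠ 1, cf a n = 0)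
    (p : ℝ × ℝ) {t : ℝ} (ht : |t| ≤ 1) : evalHom k p ht a = t := by
  rw [evalHom_apply, tsum_eq_single 1]
  · rw [h1]; simp
  · intro n hn
    rw [h0 n hn]; simp

/-- Term by term differentiation. The factor `ρ` may vanish, and it need not be possible to divide
`w` by it in the algebra. -/
theorem hasDerivAt_eval {v w : paramSeries k} {p : ℝ × ℝ} {ρ : ℝ}
    (h : ∀ n, cf w n p = ρ * ((n + 1) * cf v (n + 1) p)) {t : ℝ} (ht : |t| < 1) :
    HasDerivAt (fun t => ρ * ∑' n, t ^ n * cf v n p) (∑' n, t ^ n * cf w n p) t := by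
  have hterm : ∀ (n : ℕ) (s : ℝ), HasDerivAt (fun s => ρ * (s ^ n * cf v n p))
      (ρ * (n * s ^ (n - 1) * cf v n p)) s := fun n s =>
    (((hasDerivAt_pow n s).mul_const _).const_mul ρ)
  have hb : ∀ (n : ℕ) (s : ℝ), s ∈ Metric.ball (0 : ℝ) 1 →
      ‖ρ * (n * s ^ (n - 1) * cf v n p)‖ ≤ (fun n => if n = 0 then 0 else ‖cf w (n - 1) p‖) n := by
    intro n s hs
    rcases n with _ | n
    · simp
    · have hs' : |s| ≤ 1 := by simpa using (mem_ball_zero_iff.1 hs).le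
      have : ρ * (((n + 1 : ℕ) : ℝ) * s ^ (n + 1 - 1) * cf v (n + 1) p) = s ^ n * cf w n p := by
        rw [h]; push_cast; ring_nf
      rw [this, norm_mul, norm_pow]
      simpa using mul_le_of_le_one_left (norm_nonneg (cf w n p))
        (pow_le_one₀ (norm_nonneg s) (n := n) hs')
  have hsum : Summable (fun n => if n = 0 then 0 else ‖cf w (n - 1) p‖) := by
    rw [← summable_nat_add_iff 1]
    simpa using (summable_cf w p).1
  have key := hasDerivAt_tsum_of_isPreconnected hsum Metric.isOpen_ball
    (convex_ball (0 : ℝ) 1).isPreconnected (fun n s _ => hterm n s) hb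
    (Metric.mem_ball_self one_pos) (by
      refine (summable_of_ne_finset_zero (s := {0}) fun n hn => ?_)
      simp only [Finset.mem_singleton] at hn
      simp [hn]) (mem_ball_zero_iff.2 (by simpa using ht))
  have e : ∑' n : ℕ, ρ * (n * t ^ (n - 1) * cf v n p) = ∑' n, t ^ n * cf w n p := by
    rw [tsum_eq_zero_add' ]
    · simp only [Nat.cast_zero, zero_mul, mul_zero, zero_add]
      refine tsum_congr fun n => ?_
      rw [h]; push_cast; ring_nf
    · refine (summable_eval w p ht.le).of_norm.congr fun n => ?_
      rw [h]; push_cast; ring_nf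
  rw [e] at key
  have e' : (fun s => ρ * ∑' n, s ^ n * cf v n p) = fun s => ∑' n, ρ * (s ^ n * cf v n p) := by
    ext s
    rw [tsum_mul_left]
  rw [e']
  exact key

/-! ### The resolvent of the rotation -/

/-- The resolvent `1 / (x - i)` on the real line. -/
def resolvent (x : ℝ) : ℂ := ((x : ℂ) - Complex.I)⁻¹

theorem sub_I_ne_zero (x : ℝ) : (x : ℂ) - Complex.I ≠ 0 := by
  intro h
  have := congrArg Complex.im h
  simp at this

theorem hasDerivAt_resolvent_pow (m : ℕ) (x : ℝ) :
    HasDerivAt (fun x => resolvent x ^ (m + 1)) (-(m + 1 : ℕ) * resolvent x ^ (m + 2)) x := by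
  have h1 : HasDerivAt (fun x : ℝ => (x : ℂ) - Complex.I) 1 x :=
    (Complex.ofRealCLM.hasDerivAt (x := x)).sub_const _
  refine ((h1.inv (sub_I_ne_zero x)).pow (m + 1)).congr_deriv ?_
  simp only [resolvent, Nat.add_sub_cancel, Pi.inv_apply, inv_pow]
  field_simp [sub_I_ne_zero x]
  ring

theorem iteratedDeriv_resolvent (j : ℕ) :
    iteratedDeriv j resolvent = fun x => (-1) ^ j * j ! * resolvent x ^ (j + 1) := by
  induction j with
  | zero => ext x; simp
  | succ j ih =>
    rw [iteratedDeriv_succ, ih]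
    ext x
    rw [((hasDerivAt_resolvent_pow j x).const_mul ((-1) ^ j * (j ! : ℂ))).deriv, Nat.factorial_succ]
    push_cast
    ring

theorem norm_resolvent_le (x : ℝ) : ‖resolvent x‖ ≤ 1 := by
  rw [resolvent, norm_inv]
  refine inv_le_one_of_one_le₀ ?_
  have := Complex.abs_im_le_norm ((x : ℂ) - Complex.I)
  simpa using this

theorem contDiff_resolvent : ContDiff ℝ ∞ resolvent :=
  (Complex.ofRealCLM.contDiff.sub contDiff_const).inv sub_I_ne_zero

theorem norm_iteratedFDeriv_resolvent_le (j : ℕ) (x : ℝ) :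
    ‖iteratedFDeriv ℝ j resolvent x‖ ≤ j ! := by
  rw [norm_iteratedFDeriv_eq_norm_iteratedDeriv, iteratedDeriv_resolvent]
  simp only [norm_mul, norm_pow, norm_neg, norm_one, one_pow, one_mul, Complex.norm_natCast]
  exact mul_le_of_le_one_right (by positivity) (pow_le_one₀ (norm_nonneg _) (norm_resolvent_le x))

/-- The multipliers `L (1 / (n x - i))` with `x` a small function of the parameters are bounded,
uniformly in `n`: their derivatives grow like powers of `n`, which the weights absorb. -/
theorem jetNorm_resolvent_le (L : ℂ →L[ℝ] ℝ) (hL : ‖L‖ ≤ 1) {x : ℝ × ℝ → ℝ} (hx : ContDiff ℝ k x)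
    (hb : ∀ j ≤ k, ∀ p, ‖iteratedFDeriv ℝ j x p‖ ≤ 1) (n : ℕ) :
    ContDiff ℝ k (fun p => L (resolvent (n * x p))) ∧
      jetNorm k n (fun p => L (resolvent (n * x p))) ≤ ENNReal.ofReal ((k + 1) * k !) := by
  have hnx : ContDiff ℝ k (fun p => n * x p) := contDiff_const.mul hx
  have hr : ContDiff ℝ k resolvent := contDiff_resolvent.of_le (by exact_mod_cast le_top)
  have hc : ContDiff ℝ k (fun p => resolvent (n * x p)) := hr.comp hnx
  refine ⟨L.contDiff.comp hc, jetNorm_le_of_bound fun j hj p => ?_⟩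
  have hj' : ((j : ℕ) : ℕ∞ω) ≤ k := by exact_mod_cast hj
  have h1 := L.norm_iteratedFDeriv_comp_left (x := p) (n := j) hc.contDiffAt hj'
  have h2 : ‖iteratedFDeriv ℝ j (resolvent ∘ fun p => n * x p) p‖ ≤ j ! * k ! * (n + 1) ^ j := by
    refine norm_iteratedFDeriv_comp_le hr hnx hj' p (fun i hi => ?_) (fun i hi1 hi => ?_)
    · refine (norm_iteratedFDeriv_resolvent_le i _).trans ?_
      exact_mod_cast Nat.factorial_le (hi.trans hj)
    · have h3 : iteratedFDeriv ℝ i (fun p => (n : ℝ) * x p) p = (n : ℝ) • iteratedFDeriv ℝ i x p :=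
        iteratedFDeriv_const_smul_apply (a := (n : ℝ)) (f := x)
          ((hx.of_le (by exact_mod_cast hi.trans hj)).contDiffAt)
      rw [h3, norm_smul, Real.norm_of_nonneg (Nat.cast_nonneg n)]
      have h4 : ((n : ℝ) + 1) ^ 1 ≤ (n + 1) ^ i := pow_le_pow_right₀ (by simp) hi1
      have h5 := hb i (hi.trans hj) p
      have h6 : (0 : ℝ) ≤ n := Nat.cast_nonneg n
      nlinarith
  calc _ ≤ ‖L‖ * ‖iteratedFDeriv ℝ j (resolvent ∘ fun p => n * x p) p‖ := h1
    _ ≤ 1 * (j ! * k ! * (n + 1) ^ j) := by gcongr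
    _ = k ! * (j ! * (n + 1) ^ j) := by ring

end

section

/-! ### Analytic substitution in a Banach algebra, and a contraction -/

section Substitution

variable {E : Type} [NormedCommRing E] [NormOneClass E]

/-- The factor `n` in the Lipschitz constant of the power is absorbed by enlarging the ratio `1/4`
to `1/2`. -/
theorem norm_pow_sub_pow_le {X X' : E} (hX : ‖X‖ ≤ 1 / 4) (hX' : ‖X'‖ ≤ 1 / 4) (n : ℕ) :
    ‖X ^ n - X' ^ n‖ ≤ 4 * (1 / 2) ^ n * ‖X - X'‖ := by
  have key : ∀ n : ℕ, ‖X ^ n - X' ^ n‖ ≤ n * (4 * (1 / 4) ^ n) * ‖X - X'‖ := by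
    intro n
    induction n with
    | zero => simp
    | succ n ih =>
      have e : X ^ (n + 1) - X' ^ (n + 1) = X ^ n * (X - X') + (X ^ n - X' ^ n) * X' := by ring
      have h1 : ‖X ^ n‖ ≤ (1 / 4) ^ n := (norm_pow_le X n).trans (by gcongr)
      calc _ ≤ ‖X ^ n‖ * ‖X - X'‖ + ‖X ^ n - X' ^ n‖ * ‖X'‖ := by
            rw [e]
            exact (norm_add_le _ _).trans (add_le_add (norm_mul_le _ _) (norm_mul_le _ _))
        _ ≤ (1 / 4) ^ n * ‖X - X'‖ + (n * (4 * (1 / 4) ^ n) * ‖X - X'‖) * (1 / 4) := by gcongr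
        _ = _ := by push_cast; ring
  refine (key n).trans (mul_le_mul_of_nonneg_right ?_ (norm_nonneg _))
  have h2 : (n : ℝ) ≤ 2 ^ n := by exact_mod_cast Nat.lt_two_pow_self.le
  calc (n : ℝ) * (4 * (1 / 4) ^ n) ≤ 2 ^ n * (4 * (1 / 4) ^ n) := by gcongr
    _ = 4 * (1 / 2) ^ n := by
      rw [show (1 / 2 : ℝ) = 2 * (1 / 4) by norm_num, mul_pow]; ring

theorem norm_monomial_le {X Y Z : E} (hX : ‖X‖ ≤ 1 / 4) (hY : ‖Y‖ ≤ 1 / 4) (hZ : ‖Z‖ ≤ 1 / 4)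
    (i : ℕ × ℕ × ℕ) : ‖X ^ i.1 * (Y ^ i.2.1 * Z ^ i.2.2)‖ ≤
      (1 / 2) ^ i.1 * ((1 / 2) ^ i.2.1 * (1 / 2) ^ i.2.2) := by
  have h : ∀ {X : E} (_ : ‖X‖ ≤ 1 / 4) (n : ℕ), ‖X ^ n‖ ≤ (1 / 2) ^ n := fun hX n =>
    (norm_pow_le _ n).trans (pow_le_pow_left₀ (norm_nonneg _) (hX.trans (by norm_num)) n)
  refine (norm_mul_le _ _).trans ?_
  have h2 := (norm_mul_le (Y ^ i.2.1) (Z ^ i.2.2)).trans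
    (mul_le_mul (h hY _) (h hZ _) (norm_nonneg _) (by positivity))
  exact mul_le_mul (h hX _) h2 (norm_nonneg _) (by positivity)

theorem norm_monomial_sub_le {X Y Z X' Y' Z' : E} (hX : ‖X‖ ≤ 1 / 4) (hY : ‖Y‖ ≤ 1 / 4)
    (hZ : ‖Z‖ ≤ 1 / 4) (hX' : ‖X'‖ ≤ 1 / 4) (hY' : ‖Y'‖ ≤ 1 / 4) (hZ' : ‖Z'‖ ≤ 1 / 4)
    (i : ℕ × ℕ × ℕ) :
    ‖X ^ i.1 * (Y ^ i.2.1 * Z ^ i.2.2) - X' ^ i.1 * (Y' ^ i.2.1 * Z' ^ i.2.2)‖ ≤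
      (1 / 2) ^ i.1 * ((1 / 2) ^ i.2.1 * (1 / 2) ^ i.2.2) *
        (4 * (‖X - X'‖ + ‖Y - Y'‖ + ‖Z - Z'‖)) := by
  obtain ⟨a, b, c⟩ := i
  have h : ∀ {X : E} (_ : ‖X‖ ≤ 1 / 4) (n : ℕ), ‖X ^ n‖ ≤ (1 / 2) ^ n := fun hX n =>
    (norm_pow_le _ n).trans (pow_le_pow_left₀ (norm_nonneg _) (hX.trans (by norm_num)) n)
  have e : X ^ a * (Y ^ b * Z ^ c) - X' ^ a * (Y' ^ b * Z' ^ c) =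
      (X ^ a - X' ^ a) * (Y ^ b * Z ^ c) + X' ^ a * ((Y ^ b - Y' ^ b) * Z ^ c) +
        X' ^ a * (Y' ^ b * (Z ^ c - Z' ^ c)) := by ring
  have hm : ∀ u v w : E, ‖u * (v * w)‖ ≤ ‖u‖ * (‖v‖ * ‖w‖) := fun u v w =>
    (norm_mul_le _ _).trans (mul_le_mul_of_nonneg_left (norm_mul_le _ _) (norm_nonneg _))
  have h1 := norm_pow_sub_pow_le hX hX' a
  have h2 := norm_pow_sub_pow_le hY hY' b
  have h3 := norm_pow_sub_pow_le hZ hZ' c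
  simp only
  rw [e]
  calc _ ≤ ‖X ^ a - X' ^ a‖ * (‖Y ^ b‖ * ‖Z ^ c‖) + ‖X' ^ a‖ * (‖Y ^ b - Y' ^ b‖ * ‖Z ^ c‖) +
        ‖X' ^ a‖ * (‖Y' ^ b‖ * ‖Z ^ c - Z' ^ c‖) :=
        (norm_add_le _ _).trans (add_le_add ((norm_add_le _ _).trans
          (add_le_add (hm _ _ _) (hm _ _ _))) (hm _ _ _))
    _ ≤ (4 * (1 / 2) ^ a * ‖X - X'‖) * ((1 / 2) ^ b * (1 / 2) ^ c) +
        (1 / 2) ^ a * ((4 * (1 / 2) ^ b * ‖Y - Y'‖) * (1 / 2) ^ c) +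
        (1 / 2) ^ a * ((1 / 2) ^ b * (4 * (1 / 2) ^ c * ‖Z - Z'‖)) := by
        gcongr <;> exact h ‹_› _
    _ = _ := by ring

theorem hasSum_half_pow : HasSum (fun i : ℕ × ℕ × ℕ =>
    (1 / 2 : ℝ) ^ i.1 * ((1 / 2) ^ i.2.1 * (1 / 2) ^ i.2.2)) 8 := by
  have h := hasSum_geometric_two
  have h2 := h.mul h (h.summable.mul_of_nonneg h.summable (fun _ => by positivity)
    fun _ => by positivity)
  have h3 := h.mul h2 (h.summable.mul_of_nonneg h2.summable (fun _ => by positivity)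
    fun _ => by positivity)
  rw [show (8 : ℝ) = 2 * (2 * 2) by norm_num]
  exact h3

variable [CompleteSpace E]

/-- Substitution of small elements of the algebra into a power series in three variables with
bounded coefficients: convergence, bound and Lipschitz constant. -/
theorem substitution {c : ℕ × ℕ × ℕ → E} {M : ℝ} (hc : ∀ i, ‖c i‖ ≤ M) :
    (∀ X Y Z : E, ‖X‖ ≤ 1 / 4 → ‖Y‖ ≤ 1 / 4 → ‖Z‖ ≤ 1 / 4 →
      Summable (fun i => c i * (X ^ i.1 * (Y ^ i.2.1 * Z ^ i.2.2))) ∧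
      ‖∑' i, c i * (X ^ i.1 * (Y ^ i.2.1 * Z ^ i.2.2))‖ ≤ 8 * M) ∧
    ∀ X Y Z X' Y' Z' : E, ‖X‖ ≤ 1 / 4 → ‖Y‖ ≤ 1 / 4 → ‖Z‖ ≤ 1 / 4 →
      ‖X'‖ ≤ 1 / 4 → ‖Y'‖ ≤ 1 / 4 → ‖Z'‖ ≤ 1 / 4 →
      ‖∑' i, c i * (X ^ i.1 * (Y ^ i.2.1 * Z ^ i.2.2)) -
        ∑' i, c i * (X' ^ i.1 * (Y' ^ i.2.1 * Z' ^ i.2.2))‖ ≤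
        32 * M * (‖X - X'‖ + ‖Y - Y'‖ + ‖Z - Z'‖) := by
  have hM : 0 ≤ M := (norm_nonneg _).trans (hc 0)
  have hs : ∀ X Y Z : E, ‖X‖ ≤ 1 / 4 → ‖Y‖ ≤ 1 / 4 → ‖Z‖ ≤ 1 / 4 → ∀ i : ℕ × ℕ × ℕ,
      ‖c i * (X ^ i.1 * (Y ^ i.2.1 * Z ^ i.2.2))‖ ≤
        M * ((1 / 2) ^ i.1 * ((1 / 2) ^ i.2.1 * (1 / 2) ^ i.2.2)) := fun X Y Z hX hY hZ i =>
    (norm_mul_le _ _).trans (mul_le_mul (hc i) (norm_monomial_le hX hY hZ i) (norm_nonneg _) hM)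
  have hsum : ∀ X Y Z : E, ‖X‖ ≤ 1 / 4 → ‖Y‖ ≤ 1 / 4 → ‖Z‖ ≤ 1 / 4 →
      Summable (fun i => c i * (X ^ i.1 * (Y ^ i.2.1 * Z ^ i.2.2))) := fun X Y Z hX hY hZ =>
    Summable.of_norm_bounded (hasSum_half_pow.mul_left M).summable (hs X Y Z hX hY hZ)
  refine ⟨fun X Y Z hX hY hZ => ⟨hsum X Y Z hX hY hZ, ?_⟩, ?_⟩
  · have := tsum_of_norm_bounded (hasSum_half_pow.mul_left M) (hs X Y Z hX hY hZ)
    linarith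
  · intro X Y Z X' Y' Z' hX hY hZ hX' hY' hZ'
    rw [← (hsum X Y Z hX hY hZ).tsum_sub (hsum X' Y' Z' hX' hY' hZ')]
    have := tsum_of_norm_bounded ((hasSum_half_pow.mul_left M).mul_right
      (4 * (‖X - X'‖ + ‖Y - Y'‖ + ‖Z - Z'‖)))
      (f := fun i => c i * (X ^ i.1 * (Y ^ i.2.1 * Z ^ i.2.2)) -
        c i * (X' ^ i.1 * (Y' ^ i.2.1 * Z' ^ i.2.2))) (fun i => by
        rw [← mul_sub, mul_assoc]
        exact (norm_mul_le _ _).trans (mul_le_mul (hc i)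
          (norm_monomial_sub_le hX hY hZ hX' hY' hZ' i) (norm_nonneg _) hM))
    linarith

end Substitution

section UniformlyLipschitz

variable {E V ι : Type} [NormedCommRing E] [NormedAddCommGroup V] {l : Filter ι} {ρ : ℝ}

/-- Along the filter `l`, the maps `φ i` are bounded and Lipschitz on the ball of radius `ρ`,
uniformly in `i`. -/
def UniformLip (l : Filter ι) (ρ : ℝ) (φ : ι → V → E) : Prop :=
  ∃ M, 0 ≤ M ∧ ∀ᶠ i in l, ∀ w ∈ Metric.closedBall (0 : V) ρ, ‖φ i w‖ ≤ M ∧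
    ∀ w' ∈ Metric.closedBall (0 : V) ρ, ‖φ i w - φ i w'‖ ≤ M * ‖w - w'‖

theorem UniformLip.of_bounded {c : ι → E} (hc : ∃ M, ∀ᶠ i in l, ‖c i‖ ≤ M) :
    UniformLip l ρ (fun i (_ : V) => c i) := by
  obtain ⟨M, hM⟩ := hc
  refine ⟨max M 0, le_max_right _ _, hM.mono fun i hi w _ => ⟨hi.trans (le_max_left _ _), ?_⟩⟩
  intro w' _
  simpa using mul_nonneg (le_max_right M 0) (norm_nonneg (w - w'))

theorem UniformLip.add {φ ψ : ι → V → E} (hφ : UniformLip l ρ φ) (hψ : UniformLip l ρ ψ) :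
    UniformLip l ρ (fun i w => φ i w + ψ i w) := by
  obtain ⟨M, hM0, hM⟩ := hφ
  obtain ⟨N, hN0, hN⟩ := hψ
  refine ⟨M + N, add_nonneg hM0 hN0, ?_⟩
  filter_upwards [hM, hN] with i h1 h2 w hw
  refine ⟨(norm_add_le _ _).trans (add_le_add (h1 w hw).1 (h2 w hw).1), fun w' hw' => ?_⟩
  rw [add_sub_add_comm, add_mul]
  exact (norm_add_le _ _).trans (add_le_add ((h1 w hw).2 w' hw') ((h2 w hw).2 w' hw'))

theorem UniformLip.neg {φ : ι → V → E} (hφ : UniformLip l ρ φ) :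
    UniformLip l ρ (fun i w => -φ i w) := by
  obtain ⟨M, hM0, hM⟩ := hφ
  refine ⟨M, hM0, hM.mono fun i h w hw => ⟨by simpa using (h w hw).1, fun w' hw' => ?_⟩⟩
  rw [← neg_sub_neg, neg_neg, neg_neg, norm_sub_rev w w']
  have := (h w' hw').2 w hw
  exact this

theorem UniformLip.sub {φ ψ : ι → V → E} (hφ : UniformLip l ρ φ) (hψ : UniformLip l ρ ψ) :
    UniformLip l ρ (fun i w => φ i w - ψ i w) := by
  simpa only [sub_eq_add_neg] using hφ.add hψ.neg

theorem UniformLip.mul {φ ψ : ι → V → E} (hφ : UniformLip l ρ φ) (hψ : UniformLip l ρ ψ) :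
    UniformLip l ρ (fun i w => φ i w * ψ i w) := by
  obtain ⟨M, hM0, hM⟩ := hφ
  obtain ⟨N, hN0, hN⟩ := hψ
  refine ⟨M * N + 2 * (M * N), by positivity, ?_⟩
  filter_upwards [hM, hN] with i h1 h2 w hw
  have hMN : 0 ≤ M * N := by positivity
  refine ⟨?_, fun w' hw' => ?_⟩
  · refine (norm_mul_le _ _).trans
      ((mul_le_mul (h1 w hw).1 (h2 w hw).1 (norm_nonneg _) hM0).trans ?_)
    linarith
  · rw [show φ i w * ψ i w - φ i w' * ψ i w' =
      φ i w * (ψ i w - ψ i w') + (φ i w - φ i w') * ψ i w' by ring]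
    calc _ ≤ ‖φ i w‖ * ‖ψ i w - ψ i w'‖ + ‖φ i w - φ i w'‖ * ‖ψ i w'‖ :=
          (norm_add_le _ _).trans (add_le_add (norm_mul_le _ _) (norm_mul_le _ _))
      _ ≤ M * (N * ‖w - w'‖) + (M * ‖w - w'‖) * N := by
          gcongr
          · exact (h1 w hw).1
          · exact (h2 w hw).2 w' hw'
          · exact (h1 w hw).2 w' hw'
          · exact (h2 w' hw').1
      _ ≤ _ := by nlinarith [mul_nonneg hMN (norm_nonneg (w - w'))]

theorem UniformLip.map {φ : ι → V → E} (hφ : UniformLip l ρ φ) {T : ι → E →+ E}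
    (hT : ∃ C, ∀ᶠ i in l, ∀ x, ‖T i x‖ ≤ C * ‖x‖) : UniformLip l ρ (fun i w => T i (φ i w)) := by
  obtain ⟨M, hM0, hM⟩ := hφ
  obtain ⟨C, hC⟩ := hT
  have hC' : 0 ≤ max C 0 := le_max_right _ _
  refine ⟨max C 0 * M, by positivity, ?_⟩
  filter_upwards [hM, hC] with i h1 h2 w hw
  have h3 : ∀ x, ‖T i x‖ ≤ max C 0 * ‖x‖ := fun x =>
    (h2 x).trans (mul_le_mul_of_nonneg_right (le_max_left _ _) (norm_nonneg _))
  refine ⟨(h3 _).trans (mul_le_mul_of_nonneg_left (h1 w hw).1 hC'), fun w' hw' => ?_⟩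
  rw [← map_sub, mul_assoc]
  exact (h3 _).trans (mul_le_mul_of_nonneg_left ((h1 w hw).2 w' hw') hC')

/-- A uniformly Lipschitz family times a family of elements that tends to `0`. -/
theorem UniformLip.small {φ : ι → V → E} (hφ : UniformLip l ρ φ) {e : ι → E}
    (he : Tendsto e l (𝓝 0)) {η : ℝ} (hη : 0 < η) :
    ∀ᶠ i in l, ∀ w ∈ Metric.closedBall (0 : V) ρ, ‖e i * φ i w‖ ≤ η ∧
      ∀ w' ∈ Metric.closedBall (0 : V) ρ, ‖e i * φ i w - e i * φ i w'‖ ≤ η * ‖w - w'‖ := by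
  obtain ⟨M, hM0, hM⟩ := hφ
  have h : ∀ᶠ i in l, ‖e i‖ < η / (M + 1) := by
    have := he.norm
    rw [norm_zero] at this
    exact this.eventually (gt_mem_nhds (by positivity))
  filter_upwards [hM, h] with i h1 h2 w hw
  have h3 : ‖e i‖ * M ≤ η := by
    have h4 : ‖e i‖ * (M + 1) ≤ η := ((lt_div_iff₀ (by positivity)).1 h2).le
    nlinarith [norm_nonneg (e i)]
  refine ⟨(norm_mul_le _ _).trans
    ((mul_le_mul_of_nonneg_left (h1 w hw).1 (norm_nonneg _)).trans h3), fun w' hw' => ?_⟩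
  rw [← mul_sub]
  refine (norm_mul_le _ _).trans
    ((mul_le_mul_of_nonneg_left ((h1 w hw).2 w' hw') (norm_nonneg _)).trans ?_)
  rw [← mul_assoc]
  exact mul_le_mul_of_nonneg_right h3 (norm_nonneg _)

/-- A substitution operator: bounded and Lipschitz in its three small arguments, uniformly. -/
def UniformSubst (l : Filter ι) (B : ℝ) (Φ : ι → E → E → E → E) : Prop :=
  0 ≤ B ∧ ∀ᶠ i in l, (∀ X Y Z : E, ‖X‖ ≤ 1 / 4 → ‖Y‖ ≤ 1 / 4 → ‖Z‖ ≤ 1 / 4 → ‖Φ i X Y Z‖ ≤ B) ∧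
    ∀ X Y Z X' Y' Z' : E, ‖X‖ ≤ 1 / 4 → ‖Y‖ ≤ 1 / 4 → ‖Z‖ ≤ 1 / 4 →
      ‖X'‖ ≤ 1 / 4 → ‖Y'‖ ≤ 1 / 4 → ‖Z'‖ ≤ 1 / 4 →
      ‖Φ i X Y Z - Φ i X' Y' Z'‖ ≤ B * (‖X - X'‖ + ‖Y - Y'‖ + ‖Z - Z'‖)

/-- Along the scaling `(e x, e y, e z)` a substitution operator is bounded by `B`, and its Lipschitz
constant tends to zero with `e`. -/
theorem UniformSubst.small_lip {B : ℝ} {Φ : ι → E → E → E → E} (hΦ : UniformSubst l B Φ)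
    {e : ι → E} (he : Tendsto e l (𝓝 0)) {x y z : ι → V → E} (hx : UniformLip l ρ x)
    (hy : UniformLip l ρ y) (hz : UniformLip l ρ z) {η : ℝ} (hη : 0 < η) :
    ∀ᶠ i in l, ∀ w ∈ Metric.closedBall (0 : V) ρ,
      ‖e i * x i w‖ ≤ 1 / 4 ∧ ‖e i * y i w‖ ≤ 1 / 4 ∧ ‖e i * z i w‖ ≤ 1 / 4 ∧
      ‖Φ i (e i * x i w) (e i * y i w) (e i * z i w)‖ ≤ B ∧
      ∀ w' ∈ Metric.closedBall (0 : V) ρ,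
        ‖Φ i (e i * x i w) (e i * y i w) (e i * z i w) -
          Φ i (e i * x i w') (e i * y i w') (e i * z i w')‖ ≤ η * ‖w - w'‖ := by
  obtain ⟨hB, hΦ⟩ := hΦ
  set η' := min (1 / 4) (η / (3 * (B + 1))) with hη'
  have hpos : 0 < η' := lt_min (by norm_num) (by positivity)
  have h4 : η' ≤ 1 / 4 := min_le_left _ _
  have h5 : η' * (3 * (B + 1)) ≤ η := by
    rw [← le_div_iff₀ (by positivity)]; exact min_le_right _ _
  filter_upwards [hΦ, hx.small he hpos, hy.small he hpos, hz.small he hpos] with i h1 hx hy hz w hw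
  have hx1 := (hx w hw).1.trans h4
  have hy1 := (hy w hw).1.trans h4
  have hz1 := (hz w hw).1.trans h4
  refine ⟨hx1, hy1, hz1, h1.1 _ _ _ hx1 hy1 hz1, fun w' hw' => ?_⟩
  refine (h1.2 _ _ _ _ _ _ hx1 hy1 hz1 ((hx w' hw').1.trans h4) ((hy w' hw').1.trans h4)
    ((hz w' hw').1.trans h4)).trans ?_
  have a1 := (hx w hw).2 w' hw'
  have a2 := (hy w hw).2 w' hw'
  have a3 := (hz w hw).2 w' hw'
  calc _ ≤ B * (η' * ‖w - w'‖ + η' * ‖w - w'‖ + η' * ‖w - w'‖) := by gcongr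
    _ = (B * (3 * η')) * ‖w - w'‖ := by ring
    _ ≤ η * ‖w - w'‖ := by
      gcongr
      nlinarith

/-- Substitution of uniformly Lipschitz functions, scaled by a small factor. -/
theorem UniformSubst.uniformLip {B : ℝ} {Φ : ι → E → E → E → E} (hΦ : UniformSubst l B Φ)
    {e : ι → E} (he : Tendsto e l (𝓝 0)) {x y z : ι → V → E} (hx : UniformLip l ρ x)
    (hy : UniformLip l ρ y) (hz : UniformLip l ρ z) :
    UniformLip l ρ (fun i w => Φ i (e i * x i w) (e i * y i w) (e i * z i w)) := by
  refine ⟨max B 1, zero_le_one.trans (le_max_right _ _), ?_⟩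
  filter_upwards [hΦ.small_lip he hx hy hz one_pos] with i h w hw
  refine ⟨(h w hw).2.2.2.1.trans (le_max_left _ _), fun w' hw' => ((h w hw).2.2.2.2 w' hw').trans ?_⟩
  exact mul_le_mul_of_nonneg_right (le_max_right _ _) (norm_nonneg _)

/-- A map of the form (bounded, with small Lipschitz constant) + (small) × (Lipschitz) has a fixed
point. -/
theorem exists_fixedPoint [CompleteSpace E] {B : ℝ} {Φ : ι → E × E → E}
    {ψ₁ ψ₂ : ι → E × E → E} {e : ι → E} (he : Tendsto e l (𝓝 0))
    (hΦ : ∀ᶠ i in l, ∀ w ∈ Metric.closedBall (0 : E × E) (B + 1), ‖Φ i w‖ ≤ B ∧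
      ∀ w' ∈ Metric.closedBall (0 : E × E) (B + 1), ‖Φ i w - Φ i w'‖ ≤ 1 / 4 * ‖w - w'‖)
    (h₁ : UniformLip l (B + 1) ψ₁) (h₂ : UniformLip l (B + 1) ψ₂) (hB : 0 ≤ B) :
    ∀ᶠ i in l, ∃ w ∈ Metric.closedBall (0 : E × E) (B + 1),
      w.1 = Φ i w + e i * ψ₁ i w ∧ w.2 = e i * ψ₂ i w := by
  filter_upwards [hΦ, h₁.small he (η := 1 / 4) (by norm_num), h₂.small he (η := 1 / 4)
    (by norm_num)] with i hΦ h₁ h₂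
  set s := Metric.closedBall (0 : E × E) (B + 1)
  set T : E × E → E × E := fun w => (Φ i w + e i * ψ₁ i w, e i * ψ₂ i w) with hT
  have hmaps : MapsTo T s s := by
    intro w hw
    have a1 := (hΦ w hw).1
    have a2 := (h₁ w hw).1
    have a3 := (h₂ w hw).1
    rw [mem_closedBall_zero_iff, Prod.norm_def]
    refine max_le ((norm_add_le _ _).trans (by linarith)) (by simp only [hT]; linarith)
  have hc : ContractingWith (1 / 2) (hmaps.restrict T s s) := by
    refine ⟨by rw [← NNReal.coe_lt_coe]; norm_num, LipschitzWith.of_dist_le_mul ?_⟩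
    rintro ⟨w, hw⟩ ⟨w', hw'⟩
    rw [Subtype.dist_eq, Subtype.dist_eq, dist_eq_norm, dist_eq_norm]
    have a1 := (hΦ w hw).2 w' hw'
    have a2 := (h₁ w hw).2 w' hw'
    have a3 := (h₂ w hw).2 w' hw'
    have hn := norm_nonneg (w - w')
    simp only [MapsTo.val_restrict_apply, hT]
    rw [Prod.norm_def]
    push_cast
    refine max_le ?_ ?_
    · simp only [Prod.fst_sub]
      rw [add_sub_add_comm]
      exact (norm_add_le _ _).trans (by linarith)
    · simp only [Prod.snd_sub]
      linarith
  obtain ⟨w, hw, hfix, -⟩ := hc.exists_fixedPoint' (Metric.isClosed_closedBall.isComplete) hmaps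
    (x := 0) (Metric.mem_closedBall_self (by linarith)) (edist_ne_top _ _)
  have h3 : T w = w := hfix
  exact ⟨w, hw, congrArg Prod.fst h3.symm, congrArg Prod.snd h3.symm⟩

end UniformlyLipschitz

end

section

/-! ### The invariance equations as a fixed point problem -/

/-- The invariance equations of the slow manifold, as a fixed point problem. In terms of
`r = e² A`, `μ₂ = e² B`, `y = e t`, the manifold is `x = -y² + r v₁`, `z = y + r v₂`, the slow
velocity is `λ y + e² γ`, and `w = (λ r t ∂ₜ - A) v` with the rotation `A (v₁, v₂) = (-v₂, v₁)`;
`P` and `Q` are the components of the inverse of this operator. -/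
theorem exists_slow_fixedPoint {E ι : Type} [NormedCommRing E] [CompleteSpace E] {l : Filter ι}
    {e A B t la li α hf : ι → E} {P Q S : ι → E →+ E} {Ff Gg Hh : ι → E → E → E → E} {CF CG CH : ℝ}
    (he : Tendsto e l (𝓝 0)) (hA : ∃ M, ∀ᶠ i in l, ‖A i‖ ≤ M) (hB : ∃ M, ∀ᶠ i in l, ‖B i‖ ≤ M)
    (ht : ∃ M, ∀ᶠ i in l, ‖t i‖ ≤ M) (hla : ∃ M, ∀ᶠ i in l, ‖la i‖ ≤ M)
    (hli : ∃ M, ∀ᶠ i in l, ‖li i‖ ≤ M) (hα : ∃ M, ∀ᶠ i in l, ‖α i‖ ≤ M)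
    (hhf : ∃ M, ∀ᶠ i in l, ‖hf i‖ ≤ M)
    (hP : ∃ C, ∀ᶠ i in l, ∀ x, ‖P i x‖ ≤ C * ‖x‖) (hQ : ∃ C, ∀ᶠ i in l, ∀ x, ‖Q i x‖ ≤ C * ‖x‖)
    (hS : ∃ C, ∀ᶠ i in l, ∀ x, ‖S i x‖ ≤ C * ‖x‖)
    (hF : UniformSubst l CF Ff) (hG : UniformSubst l CG Gg) (hH : UniformSubst l CH Hh) :
    ∀ᶠ i in l, ∃ w₁ w₂ v₁ v₂ X Y Z γ : E, ‖X‖ ≤ 1 / 4 ∧ ‖Y‖ ≤ 1 / 4 ∧ ‖Z‖ ≤ 1 / 4 ∧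
      v₁ = P i w₁ - Q i w₂ ∧ v₂ = Q i w₁ + P i w₂ ∧
      X = -(e i * t i) ^ 2 + e i ^ 2 * A i * v₁ ∧ Y = e i * t i ∧
      Z = e i * t i + e i ^ 2 * A i * v₂ ∧ γ = hf i * B i + A i * (α i * v₂ + Gg i X Y Z) ∧
      w₁ = 2 * (e i * t i) * (la i * (e i * t i) + e i ^ 2 * γ) - e i * γ * li i * S i (w₁ - v₂)
        - e i ^ 2 * B i * Z + Ff i X Y Z ∧
      w₂ = -(la i * (e i * t i) + e i ^ 2 * γ) - e i * γ * li i * S i (w₂ + v₁)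
        + 2 * (e i * t i) * v₂ + e i ^ 2 * A i * v₂ ^ 2 + Z * Hh i X Y Z := by
  have hCF := hF.1
  -- all the ingredients are uniformly Lipschitz functions of `w`
  have bdd : ∀ {c : ι → E}, (∃ M, ∀ᶠ i in l, ‖c i‖ ≤ M) →
      UniformLip l (CF + 1) (fun i (_ : E × E) => c i) := fun h => UniformLip.of_bounded h
  have hw1 : UniformLip l (CF + 1) (fun _ (w : E × E) => w.1) := by
    refine ⟨max (CF + 1) 1, by positivity, Eventually.of_forall fun i w hw => ⟨?_, fun w' _ => ?_⟩⟩
    · exact ((norm_fst_le w).trans (mem_closedBall_zero_iff.1 hw)).trans (le_max_left _ _)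
    · exact (norm_fst_le (w - w')).trans
        (le_mul_of_one_le_left (norm_nonneg _) (le_max_right _ _))
  have hw2 : UniformLip l (CF + 1) (fun _ (w : E × E) => w.2) := by
    refine ⟨max (CF + 1) 1, by positivity, Eventually.of_forall fun i w hw => ⟨?_, fun w' _ => ?_⟩⟩
    · exact ((norm_snd_le w).trans (mem_closedBall_zero_iff.1 hw)).trans (le_max_left _ _)
    · exact (norm_snd_le (w - w')).trans
        (le_mul_of_one_le_left (norm_nonneg _) (le_max_right _ _))
  have hE : UniformLip l (CF + 1) (fun i (_ : E × E) => e i) := by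
    refine bdd ⟨1, ?_⟩
    have := he.norm
    rw [norm_zero] at this
    exact (this.eventually (gt_mem_nhds one_pos)).mono fun i hi => hi.le
  have hv1 := (hw1.map hP).sub (hw2.map hQ)
  have hv2 := (hw1.map hQ).add (hw2.map hP)
  -- the coordinates of the manifold, divided by the scale `e`
  have hx := (hE.mul ((bdd ht).mul (bdd ht))).neg.add (hE.mul ((bdd hA).mul hv1))
  have hy := bdd ht
  have hz := (bdd ht).add (hE.mul ((bdd hA).mul hv2))
  have hγ := ((bdd hhf).mul (bdd hB)).add
    ((bdd hA).mul (((bdd hα).mul hv2).add (hG.uniformLip he hx hy hz)))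
  have hg := ((bdd hla).mul (bdd ht)).add (hE.mul hγ)
  have hψ₁ := (((bdd ht).mul (hE.mul hg)).add ((bdd ht).mul (hE.mul hg))).sub
    ((hγ.mul ((bdd hli).mul ((hw1.sub hv2).map hS))).add (hE.mul (hE.mul ((bdd hB).mul hz))))
  have hψ₂ := (((((bdd ht).mul hv2).add ((bdd ht).mul hv2)).add
    (hE.mul ((bdd hA).mul (hv2.mul hv2)))).add (hz.mul (hH.uniformLip he hx hy hz))).sub
    (hg.add (hγ.mul ((bdd hli).mul ((hw2.add hv1).map hS))))
  have hΦ := hF.small_lip he hx hy hz (η := 1 / 4) (by norm_num)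
  have hfix := exists_fixedPoint he (hΦ.mono fun i hi w hw =>
    ⟨(hi w hw).2.2.2.1, (hi w hw).2.2.2.2⟩) hψ₁ hψ₂ hCF
  filter_upwards [hfix, hΦ] with i ⟨w, hw, h1, h2⟩ h3
  obtain ⟨hX, hY, hZ, -⟩ := h3 w hw
  refine ⟨w.1, w.2, _, _, _, _, _, _, hX, hY, hZ, rfl, rfl, by ring, rfl, by ring, rfl, ?_, ?_⟩
  · conv_lhs => rw [h1]
    ring
  · conv_lhs => rw [h2]
    ring

end

section

/-! ### Substitution operators on parameter dependent series -/

open scoped Nat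

/-- `f (r, μ, x, y, z)` is, for small `r ≠ 0`, a power series in `(x, y, z)` with radius of
convergence `1` whose coefficients are smooth functions of `(r, μ)` with uniformly bounded
derivatives. -/
def HasUniformSeries (ρ : ℝ) (f : ℝ × ℝ × ℝ × ℝ × ℝ → ℝ) : Prop :=
  ∃ c : ℕ × ℕ × ℕ → ℝ × ℝ → ℝ, (∀ i, ContDiff ℝ ∞ (c i)) ∧
    (∀ j : ℕ, ∃ C, ∀ i, ∀ p ∈ Metric.closedBall (0 : ℝ × ℝ) 1,
      ‖iteratedFDeriv ℝ j (c i) p‖ ≤ C) ∧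
    ∀ r μ : ℝ, r ≠ 0 → |r| < ρ → |μ| < 1 → ∀ x y z : ℝ, |x| < 1 → |y| < 1 → |z| < 1 →
      HasSum (fun i => c i (r, μ) * (x ^ i.1 * (y ^ i.2.1 * z ^ i.2.2))) (f (r, μ, x, y, z))

/-- Cut-off of the parameters, with bounded derivatives. -/
theorem exists_cutoff_bound (k : ℕ) {θ : ℝ → ℝ} (hθ : ContDiff ℝ ∞ θ) (hs : HasCompactSupport θ) :
    ∃ B, 1 ≤ B ∧ ∀ j ≤ k, ∀ p : ℝ × ℝ, ‖iteratedFDeriv ℝ j (fun p : ℝ × ℝ => θ p.1) p‖ ≤ B ∧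
      ‖iteratedFDeriv ℝ j (fun p : ℝ × ℝ => θ p.2) p‖ ≤ B := by
  have h : ∀ j : ℕ, ∃ C, ∀ x, ‖iteratedFDeriv ℝ j θ x‖ ≤ C := fun j =>
    (hs.iteratedFDeriv j).exists_bound_of_continuous (hθ.continuous_iteratedFDeriv
      (by exact_mod_cast le_top))
  choose C hC using h
  have hC0 : ∀ j, 0 ≤ C j := fun j => (norm_nonneg _).trans (hC j 0)
  refine ⟨1 + ∑ j ∈ Finset.range (k + 1), C j, by
    have := Finset.sum_nonneg (s := Finset.range (k + 1)) fun j _ => hC0 j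
    linarith, fun j hj p => ?_⟩
  have hle : C j ≤ 1 + ∑ j ∈ Finset.range (k + 1), C j := by
    have := Finset.single_le_sum (s := Finset.range (k + 1)) (fun j _ => hC0 j)
      (Finset.mem_range.2 (Nat.lt_succ_of_le hj))
    linarith
  have key : ∀ L : ℝ × ℝ →L[ℝ] ℝ, ‖L‖ ≤ 1 → ‖iteratedFDeriv ℝ j (θ ∘ L) p‖ ≤ C j := by
    intro L hL
    rw [L.iteratedFDeriv_comp_right hθ p (by exact_mod_cast le_top)]
    refine (ContinuousMultilinearMap.norm_compContinuousLinearMap_le _ _).trans ?_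
    rw [Finset.prod_const]
    exact (mul_le_of_le_one_right (norm_nonneg _) (pow_le_one₀ (norm_nonneg _) hL)).trans (hC _ _)
  exact ⟨(key (ContinuousLinearMap.fst ℝ ℝ ℝ) (ContinuousLinearMap.norm_fst_le ..)).trans hle,
    (key (ContinuousLinearMap.snd ℝ ℝ ℝ) (ContinuousLinearMap.norm_snd_le ..)).trans hle⟩

/-- Functions of the parameters with bounded derivatives, as constant power series. -/
theorem exists_const_of_bound {k : ℕ} {f : ℝ × ℝ → ℝ} (hf : ContDiff ℝ k f) {C : ℝ} (hC : 0 ≤ C)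
    (h : ∀ j ≤ k, ∀ p, ‖iteratedFDeriv ℝ j f p‖ ≤ C) :
    ∃ a : paramSeries k, cf a 0 = f ∧ (∀ n, cf a (n + 1) = 0) ∧ ‖a‖ ≤ (k + 1) * C :=
  exists_const hf (by positivity) (jetNorm_le_of_bound fun j hj p => (h j hj p).trans (by
    have : (1 : ℝ) ≤ j ! := by exact_mod_cast Nat.one_le_iff_ne_zero.2 (Nat.factorial_ne_zero j)
    simpa using le_mul_of_one_le_right hC this))

theorem exists_real_const (k : ℕ) (x : ℝ) : ∃ a : paramSeries k, cf a 0 = (fun _ => x) ∧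
    (∀ n, cf a (n + 1) = 0) ∧ ‖a‖ ≤ (k + 1) * |x| := by
  refine exists_const_of_bound contDiff_const (abs_nonneg x) fun j _ p => ?_
  rcases j with _ | j
  · simp
  · simp [iteratedFDeriv_const_of_ne (𝕜 := ℝ) (Nat.succ_ne_zero j)]

/-- The substitution operator of `f`, at the scale `ε` of the parameters. -/
theorem exists_uniformSubst {θ : ℝ → ℝ} (hθ : ContDiff ℝ ∞ θ) (hs : HasCompactSupport θ)
    (hθ1 : ∀ x, |x| ≤ 1 → θ x = x) (hθ2 : ∀ x, |θ x| ≤ 2) (k : ℕ) {ρ : ℝ}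
    (hρ : 0 < ρ) {f : ℝ × ℝ × ℝ × ℝ × ℝ → ℝ}
    (hf : HasUniformSeries ρ f) :
    ∃ (C : ℝ) (Φ : ℝ → paramSeries k → paramSeries k → paramSeries k → paramSeries k),
      UniformSubst (𝓝[>] 0) C Φ ∧ ∀ᶠ ε in 𝓝[>] (0 : ℝ), ∀ X Y Z : paramSeries k,
        ‖X‖ ≤ 1 / 4 → ‖Y‖ ≤ 1 / 4 → ‖Z‖ ≤ 1 / 4 → ∀ (p : ℝ × ℝ) (t : ℝ) (ht : |t| ≤ 1),
          |p.1| ≤ 1 → |p.2| ≤ 1 → p.1 ≠ 0 → evalHom k p ht (Φ ε X Y Z) =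
            f (ε ^ 2 * p.1, ε ^ 2 * p.2, evalHom k p ht X, evalHom k p ht Y, evalHom k p ht Z) := by
  obtain ⟨c, hc, hb, hsum⟩ := hf
  choose C hC using hb
  have hC0 : ∀ j, 0 ≤ C j := fun j => (norm_nonneg _).trans (hC j 0 0 (by simp))
  obtain ⟨B, hB1, hB⟩ := exists_cutoff_bound k hθ hs
  set C' := ∑ j ∈ Finset.range (k + 1), C j with hC'
  have hC'0 : 0 ≤ C' := Finset.sum_nonneg fun j _ => hC0 j
  set N : ℝ := (k + 1) * (k ! * C' * (2 * B) ^ k) with hN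
  -- the parameters, scaled and cut off: for `|p.1|, |p.2| ≤ 1` this is `ε² p`
  set g : ℝ → ℝ × ℝ → ℝ × ℝ := fun ε p => (ε ^ 2 * θ p.1, ε ^ 2 * θ p.2) with hg
  have hgc : ∀ ε, ContDiff ℝ ∞ (g ε) := fun ε =>
    (contDiff_const.mul (hθ.comp contDiff_fst)).prodMk (contDiff_const.mul (hθ.comp contDiff_snd))
  have hgb : ∀ ε : ℝ, 0 < ε → ε < 1 / 2 → ∀ j ≤ k, ∀ p, ‖iteratedFDeriv ℝ j (g ε) p‖ ≤ 2 * B := by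
    intro ε h1 h2 j hj p
    have hj' : ((j : ℕ) : ℕ∞ω) ≤ ∞ := by exact_mod_cast le_top
    have h1' : ContDiff ℝ ∞ (fun p : ℝ × ℝ => θ p.1) := hθ.comp contDiff_fst
    have h2' : ContDiff ℝ ∞ (fun p : ℝ × ℝ => θ p.2) := hθ.comp contDiff_snd
    set L₁ : ℝ →L[ℝ] ℝ × ℝ := ε ^ 2 • ContinuousLinearMap.inl ℝ ℝ ℝ
    set L₂ : ℝ →L[ℝ] ℝ × ℝ := ε ^ 2 • ContinuousLinearMap.inr ℝ ℝ ℝ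
    have hε : ‖ε ^ 2‖ ≤ 1 := by
      rw [Real.norm_of_nonneg (by positivity)]; nlinarith
    have n1 : ‖L₁‖ ≤ 1 := by
      rw [norm_smul]
      exact mul_le_one₀ hε (norm_nonneg _) (ContinuousLinearMap.norm_inl_le_one ℝ ℝ ℝ)
    have n2 : ‖L₂‖ ≤ 1 := by
      rw [norm_smul]
      exact mul_le_one₀ hε (norm_nonneg _) (ContinuousLinearMap.norm_inr_le_one ℝ ℝ ℝ)
    have e : g ε = (L₁ ∘ fun p : ℝ × ℝ => θ p.1) + (L₂ ∘ fun p : ℝ × ℝ => θ p.2) := by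
      ext q <;> simp [hg, L₁, L₂]
    have e1 := L₁.norm_iteratedFDeriv_comp_left (x := p) (n := j) h1'.contDiffAt hj'
    have e2 := L₂.norm_iteratedFDeriv_comp_left (x := p) (n := j) h2'.contDiffAt hj'
    rw [e, iteratedFDeriv_add_apply ((L₁.contDiff.comp h1').of_le hj').contDiffAt
      ((L₂.contDiff.comp h2').of_le hj').contDiffAt]
    refine (norm_add_le _ _).trans ?_
    have b1 := (hB j hj p).1
    have b2 := (hB j hj p).2
    have c1 : ‖L₁‖ * ‖iteratedFDeriv ℝ j (fun p : ℝ × ℝ => θ p.1) p‖ ≤ 1 * B := by gcongr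
    have c2 : ‖L₂‖ * ‖iteratedFDeriv ℝ j (fun p : ℝ × ℝ => θ p.2) p‖ ≤ 1 * B := by gcongr
    linarith
  -- the coefficients `c i` of `f`, at the scaled parameters, as constant series with a common bound
  have hel : ∀ (ε : ℝ) (i : ℕ × ℕ × ℕ), ∃ a : paramSeries k, 0 < ε → ε < 1 / 2 →
      cf a 0 = (fun p => c i (g ε p)) ∧ (∀ n, cf a (n + 1) = 0) ∧ ‖a‖ ≤ N := by
    intro ε i
    by_cases hε : 0 < ε ∧ ε < 1 / 2
    swap
    · exact ⟨0, fun h1 h2 => absurd ⟨h1, h2⟩ hε⟩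
    obtain ⟨h1, h2⟩ := hε
    have hk : ((k : ℕ) : ℕ∞ω) ≤ ∞ := by exact_mod_cast le_top
    obtain ⟨a, ha⟩ := exists_const_of_bound (k := k) (f := fun p => c i (g ε p))
      (C := k ! * C' * (2 * B) ^ k) (((hc i).comp (hgc ε)).of_le hk) (by positivity) (by
      intro j hj p
      have hj' : ((j : ℕ) : ℕ∞ω) ≤ ∞ := by exact_mod_cast le_top
      have hmem : g ε p ∈ Metric.closedBall (0 : ℝ × ℝ) 1 := by
        have : ∀ x, ‖ε ^ 2 * θ x‖ ≤ 1 := fun x => by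
          rw [norm_mul, Real.norm_of_nonneg (by positivity), Real.norm_eq_abs]
          nlinarith [hθ2 x, abs_nonneg (θ x)]
        rw [mem_closedBall_zero_iff, Prod.norm_def]
        exact max_le (this _) (this _)
      have := norm_iteratedFDeriv_comp_le (hc i) (hgc ε) hj' p (C := C') (D := 2 * B)
        (fun m hm => (hC m i _ hmem).trans (Finset.single_le_sum (f := C) (fun j _ => hC0 j)
          (Finset.mem_range.2 (Nat.lt_succ_of_le (hm.trans hj)))))
        (fun m hm1 hm => (hgb ε h1 h2 m (hm.trans hj) p).trans
          (le_self_pow₀ (by linarith) (by omega)))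
      refine this.trans ?_
      have f1 : (j ! : ℝ) ≤ k ! := by exact_mod_cast Nat.factorial_le hj
      have f2 : (2 * B) ^ j ≤ (2 * B) ^ k := pow_le_pow_right₀ (by linarith) hj
      gcongr)
    exact ⟨a, fun _ _ => ha⟩
  choose a ha using hel
  have hev : ∀ᶠ ε in 𝓝[>] (0 : ℝ), 0 < ε ∧ ε < 1 / 2 ∧ ε < ρ := by
    filter_upwards [self_mem_nhdsWithin, mem_nhdsWithin_of_mem_nhds (Iio_mem_nhds
      (show (0 : ℝ) < 1 / 2 by norm_num)), mem_nhdsWithin_of_mem_nhds (Iio_mem_nhds hρ)]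
      with ε h1 h2 h3 using ⟨h1, h2, h3⟩
  have hN0 : 0 ≤ N := by positivity
  refine ⟨32 * N, fun ε X Y Z => ∑' i, a ε i * (X ^ i.1 * (Y ^ i.2.1 * Z ^ i.2.2)),
    ⟨by positivity, ?_⟩, ?_⟩
  · filter_upwards [hev] with ε ⟨h1, h2, _⟩
    have := substitution (c := a ε) (fun i => (ha ε i h1 h2).2.2)
    exact ⟨fun X Y Z hX hY hZ => ((this.1 X Y Z hX hY hZ).2).trans (by linarith), this.2⟩
  · filter_upwards [hev] with ε ⟨h1, h2, h3⟩ X Y Z hX hY hZ p t ht hp1 hp2 hp0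
    have hsub := ((substitution (c := a ε) (fun i => (ha ε i h1 h2).2.2)).1 X Y Z hX hY hZ).1
    have h4 := hsub.hasSum.map (evalHom k p ht) (continuous_evalHom p ht)
    have hlt : ∀ X : paramSeries k, ‖X‖ ≤ 1 / 4 → |evalHom k p ht X| < 1 := fun X hX =>
      (abs_evalHom_le p ht X).trans_lt (hX.trans_lt (by norm_num))
    have hε2 : ε ^ 2 < ρ ∧ ε ^ 2 < 1 := by constructor <;> nlinarith
    have h5 := hsum (ε ^ 2 * p.1) (ε ^ 2 * p.2) (mul_ne_zero (by positivity) hp0) (by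
      rw [abs_mul, abs_of_pos (by positivity)]; nlinarith [abs_nonneg p.1]) (by
      rw [abs_mul, abs_of_pos (by positivity)]; nlinarith [abs_nonneg p.2]) _ _ _
      (hlt X hX) (hlt Y hY) (hlt Z hZ)
    refine h4.unique (h5.congr_fun fun i => ?_)
    simp only [Function.comp, map_mul, map_pow]
    rw [evalHom_const (ha ε i h1 h2).1 (ha ε i h1 h2).2.1 p ht]
    simp only [hg]
    rw [hθ1 _ hp1, hθ1 _ hp2]

end

section

/-! ### The slow manifold as a power series -/


variable {k : ℕ}

theorem cf_add (a b : paramSeries k) (n : ℕ) : cf (a + b) n = cf a n + cf b n := by simp [cf]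

theorem cf_sub (a b : paramSeries k) (n : ℕ) : cf (a - b) n = cf a n - cf b n := by simp [cf]

/-- A series without constant term is the variable times its shift. -/
theorem evalHom_eq_mul_shift {f g : paramSeries k} (hg : ∀ n, cf g n = cf f (n + 1)) {p : ℝ × ℝ}
    (h0 : cf f 0 p = 0) {t : ℝ} (ht : |t| ≤ 1) : evalHom k p ht f = t * evalHom k p ht g := by
  rw [evalHom_apply, evalHom_apply, (summable_eval f p ht).of_norm.tsum_eq_zero_add, h0,
    ← tsum_mul_left]
  simp only [mul_zero, zero_add]
  refine tsum_congr fun n => ?_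
  rw [hg, pow_succ]; ring

theorem resolvent_re (x : ℝ) : (resolvent x).re = x / (x ^ 2 + 1) := by
  simp [resolvent, Complex.inv_re, Complex.normSq_apply, pow_two]

theorem resolvent_im (x : ℝ) : (resolvent x).im = 1 / (x ^ 2 + 1) := by
  simp [resolvent, Complex.inv_im, Complex.normSq_apply, pow_two]

/-- The components of the inverse of `λ r t ∂ₜ - A`, `A (v₁, v₂) = (-v₂, v₁)`, with
`r = ε² θ (p.1)`. -/
theorem exists_resolvent_multipliers {θ : ℝ → ℝ} (hθ : ContDiff ℝ ∞ θ) (hs : HasCompactSupport θ)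
    (k : ℕ) (lam : ℝ) : ∃ (C : ℝ) (P Q : ℝ → paramSeries k →+ paramSeries k),
      ∀ᶠ ε in 𝓝[>] (0 : ℝ), (∀ f, ‖P ε f‖ ≤ C * ‖f‖) ∧ (∀ f, ‖Q ε f‖ ≤ C * ‖f‖) ∧
        ∀ f n p, cf (P ε f) n p =
            (n * (lam * (ε ^ 2 * θ p.1))) / ((n * (lam * (ε ^ 2 * θ p.1))) ^ 2 + 1) * cf f n p ∧
          cf (Q ε f) n p = 1 / ((n * (lam * (ε ^ 2 * θ p.1))) ^ 2 + 1) * cf f n p := by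
  obtain ⟨B, hB1, hB⟩ := exists_cutoff_bound k hθ hs
  have hlim : Tendsto (fun ε : ℝ => |lam| * ε ^ 2 * B) (𝓝[>] 0) (𝓝 0) := by
    have : Continuous fun ε : ℝ => |lam| * ε ^ 2 * B := by fun_prop
    simpa using (this.tendsto 0).mono_left nhdsWithin_le_nhds
  have hev : ∀ᶠ ε in 𝓝[>] (0 : ℝ), |lam| * ε ^ 2 * B < 1 := hlim.eventually (gt_mem_nhds one_pos)
  have key : ∀ ε : ℝ, ∃ P Q : paramSeries k →+ paramSeries k, |lam| * ε ^ 2 * B < 1 →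
      (∀ f, ‖P f‖ ≤ (k + 1) * k.factorial * ‖f‖) ∧ (∀ f, ‖Q f‖ ≤ (k + 1) * k.factorial * ‖f‖) ∧
        ∀ f n p, cf (P f) n p =
            (n * (lam * (ε ^ 2 * θ p.1))) / ((n * (lam * (ε ^ 2 * θ p.1))) ^ 2 + 1) * cf f n p ∧
          cf (Q f) n p = 1 / ((n * (lam * (ε ^ 2 * θ p.1))) ^ 2 + 1) * cf f n p := by
    intro ε
    by_cases hε : |lam| * ε ^ 2 * B < 1
    swap
    · exact ⟨0, 0, fun h => absurd h hε⟩
    have hk : ((k : ℕ) : ℕ∞ω) ≤ ∞ := by exact_mod_cast le_top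
    have hθ' : ContDiff ℝ ∞ (fun p : ℝ × ℝ => θ p.1) := hθ.comp contDiff_fst
    have hx : ContDiff ℝ k (fun p : ℝ × ℝ => lam * (ε ^ 2 * θ p.1)) :=
      (contDiff_const.mul (contDiff_const.mul hθ')).of_le hk
    have hxb : ∀ j ≤ k, ∀ p,
        ‖iteratedFDeriv ℝ j (fun p : ℝ × ℝ => lam * (ε ^ 2 * θ p.1)) p‖ ≤ 1 := by
      intro j hj p
      have hj' : ((j : ℕ) : ℕ∞ω) ≤ ∞ := by exact_mod_cast le_top
      have e : (fun p : ℝ × ℝ => lam * (ε ^ 2 * θ p.1)) =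
          (lam * ε ^ 2) • (fun p : ℝ × ℝ => θ p.1) := by ext p; simp [mul_assoc]
      rw [e, iteratedFDeriv_const_smul_apply (hθ'.of_le hj').contDiffAt, norm_smul, norm_mul,
        Real.norm_eq_abs, Real.norm_of_nonneg (sq_nonneg ε)]
      refine (mul_le_mul_of_nonneg_left (hB j hj p).1 (by positivity)).trans hε.le
    have hre := jetNorm_resolvent_le Complex.reCLM Complex.reCLM_norm.le hx hxb
    have him := jetNorm_resolvent_le Complex.imCLM Complex.imCLM_norm.le hx hxb
    obtain ⟨P, hP1, hP2⟩ := exists_multiplier (fun n => (hre n).1) (by positivity)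
      (fun n => (hre n).2)
    obtain ⟨Q, hQ1, hQ2⟩ := exists_multiplier (fun n => (him n).1) (by positivity)
      (fun n => (him n).2)
    refine ⟨P, Q, fun _ => ⟨hP2, hQ2, fun f n p => ⟨?_, ?_⟩⟩⟩
    · rw [hP1]; simp only [Pi.mul_apply, Complex.reCLM_apply, resolvent_re]
    · rw [hQ1]; simp only [Pi.mul_apply, Complex.imCLM_apply, resolvent_im]
  choose P Q h using key
  exact ⟨_, P, Q, hev.mono fun ε hε => h ε hε⟩

/-- The slow manifold as a power series in `t = y / ε`, with coefficients that are `C^k` functions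
of `p = (r, μ₂) / ε²`. -/
theorem exists_slow_series (k : ℕ) {ρF ρG ρH a₁ a₂ : ℝ} (hρF : 0 < ρF) (hρG : 0 < ρG)
    (hρH : 0 < ρH) {fF fG fH : ℝ × ℝ × ℝ × ℝ × ℝ → ℝ}
    (hF : HasUniformSeries ρF fF) (hG : HasUniformSeries ρG fG) (hH : HasUniformSeries ρH fH)
    (hlam : a₁ + a₂ ≠ 0) {s : ℝ} (hs0 : 0 < s) :
    ∃ ε, 0 < ε ∧ ε < s ∧ ∃ v₁ v₂ : paramSeries k, ∀ p : ℝ × ℝ, |p.1| ≤ 1 → |p.2| ≤ 1 → p.1 ≠ 0 →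
      ∀ t : ℝ, |t| < 1 → ∀ r μ y V₁ V₂ x z g : ℝ, r = ε ^ 2 * p.1 → μ = ε ^ 2 * p.2 → y = ε * t →
        V₁ = ∑' n, t ^ n * cf v₁ n p → V₂ = ∑' n, t ^ n * cf v₂ n p → x = -y ^ 2 + r * V₁ →
        z = y + r * V₂ → g = μ / 2 + a₁ * y + a₂ * z + r * fG (r, μ, x, y, z) →
        |x| ≤ 1 / 4 ∧ |y| ≤ 1 / 4 ∧ |z| ≤ 1 / 4 ∧ ∃ d₁ d₂,
          HasDerivAt (fun t => r * ∑' n, t ^ n * cf v₁ n p) d₁ t ∧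
          HasDerivAt (fun t => r * ∑' n, t ^ n * cf v₂ n p) d₂ t ∧
          g * (-2 * y + d₁ / ε) = -V₂ - μ * z + fF (r, μ, x, y, z) ∧
          g * (1 + d₂ / ε) = V₁ + 2 * y * V₂ + r * V₂ ^ 2 + z * fH (r, μ, x, y, z) := by
  obtain ⟨θ, hθ, hs, hθ1, hθ2⟩ := exists_cutoff_id
  set lam := a₁ + a₂ with hlamdef
  obtain ⟨CF, Ff, hFf, evF⟩ := exists_uniformSubst hθ hs hθ1 hθ2 k hρF hF
  obtain ⟨CG, Gg, hGg, evG⟩ := exists_uniformSubst hθ hs hθ1 hθ2 k hρG hG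
  obtain ⟨CH, Hh, hHh, evH⟩ := exists_uniformSubst hθ hs hθ1 hθ2 k hρH hH
  obtain ⟨CP, P, Q, hPQ⟩ := exists_resolvent_multipliers hθ hs k lam
  obtain ⟨S, hS1, hS2⟩ := exists_shift k
  obtain ⟨B, hB1, hB⟩ := exists_cutoff_bound k hθ hs
  have hk : ((k : ℕ) : ℕ∞ω) ≤ ∞ := by exact_mod_cast le_top
  choose e he0 he1 he2 using fun ε : ℝ => exists_real_const k ε
  obtain ⟨A, hA0, hA1, hA2⟩ := exists_const_of_bound (k := k) (f := fun p : ℝ × ℝ => θ p.1)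
    ((hθ.comp contDiff_fst).of_le hk) (by linarith) (fun j hj p => (hB j hj p).1)
  obtain ⟨Bb, hBb0, hBb1, hBb2⟩ := exists_const_of_bound (k := k) (f := fun p : ℝ × ℝ => θ p.2)
    ((hθ.comp contDiff_snd).of_le hk) (by linarith) (fun j hj p => (hB j hj p).2)
  obtain ⟨tt, htt1, htt2, htt3⟩ := exists_variable k
  obtain ⟨la, hla0, hla1, -⟩ := exists_real_const k lam
  obtain ⟨li, hli0, hli1, -⟩ := exists_real_const k lam⁻¹
  obtain ⟨al, hal0, hal1, -⟩ := exists_real_const k a₂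
  obtain ⟨hf, hhf0, hhf1, -⟩ := exists_real_const k (1 / 2)
  have hbdd : ∀ a : paramSeries k, ∃ M, ∀ᶠ _ε in 𝓝[>] (0 : ℝ), ‖a‖ ≤ M := fun a =>
    ⟨‖a‖, Eventually.of_forall fun _ => le_rfl⟩
  have het : Tendsto e (𝓝[>] 0) (𝓝 0) := by
    refine squeeze_zero_norm he2 ?_
    have : Continuous fun ε : ℝ => ((k : ℝ) + 1) * |ε| := by fun_prop
    simpa using (this.tendsto 0).mono_left nhdsWithin_le_nhds
  have hfix := exists_slow_fixedPoint het (hbdd A) (hbdd Bb) (hbdd tt) (hbdd la) (hbdd li)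
    (hbdd al) (hbdd hf) ⟨CP, hPQ.mono fun ε h => h.1⟩ ⟨CP, hPQ.mono fun ε h => h.2.1⟩
    (S := fun _ => S) ⟨2 ^ k, Eventually.of_forall fun _ => hS2⟩ hFf hGg hHh
  obtain ⟨ε, hε0, hεs, ⟨w₁, w₂, v₁, v₂, X, Y, Z, γ, hX, hY, hZ, ev1, ev2, eX, eY, eZ, eγ, ew1, ew2⟩,
      hPQ, evF, evG, evH⟩ := ((eventually_mem_nhdsWithin (a := (0 : ℝ)) (s := Ioi 0)).and
    ((show ∀ᶠ ε in 𝓝[>] (0 : ℝ), ε < s from mem_nhdsWithin_of_mem_nhds (Iio_mem_nhds hs0)).and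
    (hfix.and (hPQ.and (evF.and (evG.and evH)))))).exists
  have hε0 : 0 < ε := hε0
  refine ⟨ε, hε0, hεs, v₁, v₂, ?_⟩
  intro p hp1 hp2 hp0 t ht r μ y V₁ V₂ x z g er eμ ey eV1 eV2 ex ez eg
  have ht' := ht.le
  set φ := evalHom k p ht' with hφ
  have φe : φ (e ε) = ε := evalHom_const (he0 ε) (he1 ε) p ht'
  have φA : φ A = p.1 := (evalHom_const hA0 hA1 p ht').trans (hθ1 _ hp1)
  have φB : φ Bb = p.2 := (evalHom_const hBb0 hBb1 p ht').trans (hθ1 _ hp2)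
  have φt : φ tt = t := evalHom_variable htt1 htt2 p ht'
  have φla : φ la = lam := evalHom_const hla0 hla1 p ht'
  have φli : φ li = lam⁻¹ := evalHom_const hli0 hli1 p ht'
  have φal : φ al = a₂ := evalHom_const hal0 hal1 p ht'
  have φhf : φ hf = 1 / 2 := evalHom_const hhf0 hhf1 p ht'
  have φ1 : φ v₁ = V₁ := eV1.symm
  have φ2 : φ v₂ = V₂ := eV2.symm
  have φX : φ X = x := by
    rw [eX]; simp only [map_add, map_neg, map_mul, map_pow, φe, φA, φ1, φt]
    rw [ex, ey, er]
  have φY : φ Y = y := by rw [eY, map_mul, φe, φt, ey]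
  have φZ : φ Z = z := by
    rw [eZ]; simp only [map_add, map_mul, map_pow, φe, φA, φ2, φt]
    rw [ez, ey, er]
  have hle : ∀ a : paramSeries k, ‖a‖ ≤ 1 / 4 → |φ a| ≤ 1 / 4 := fun a ha =>
    (abs_evalHom_le p ht' a).trans ha
  have φF : φ (Ff ε X Y Z) = fF (r, μ, x, y, z) := by
    rw [hφ, evF X Y Z hX hY hZ p t ht' hp1 hp2 hp0, ← hφ, φX, φY, φZ, er, eμ]
  have φG : φ (Gg ε X Y Z) = fG (r, μ, x, y, z) := by
    rw [hφ, evG X Y Z hX hY hZ p t ht' hp1 hp2 hp0, ← hφ, φX, φY, φZ, er, eμ]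
  have φH : φ (Hh ε X Y Z) = fH (r, μ, x, y, z) := by
    rw [hφ, evH X Y Z hX hY hZ p t ht' hp1 hp2 hp0, ← hφ, φX, φY, φZ, er, eμ]
  -- coefficients of `w` in terms of those of `v`
  have c1 : ∀ n, cf (w₁ - v₂) n p = n * (lam * r) * cf v₁ n p := by
    intro n
    have h1 := hPQ.2.2 w₁ n p
    have h2 := hPQ.2.2 w₂ n p
    rw [ev1, ev2, cf_sub, cf_sub, cf_add, Pi.sub_apply, Pi.sub_apply, Pi.add_apply, h1.1, h1.2,
      h2.1, h2.2, hθ1 _ hp1, ← er]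
    have hne : (n * (lam * r)) ^ 2 + 1 ≠ 0 := by positivity
    field_simp
    ring
  have c2 : ∀ n, cf (w₂ + v₁) n p = n * (lam * r) * cf v₂ n p := by
    intro n
    have h1 := hPQ.2.2 w₁ n p
    have h2 := hPQ.2.2 w₂ n p
    rw [ev1, ev2, cf_add, cf_sub, cf_add, Pi.add_apply, Pi.sub_apply, Pi.add_apply, h1.1, h1.2,
      h2.1, h2.2, hθ1 _ hp1, ← er]
    have hne : (n * (lam * r)) ^ 2 + 1 ≠ 0 := by positivity
    field_simp
    ring
  -- the `t`-derivatives
  have D : ∀ {v w : paramSeries k}, (∀ n, cf w n p = n * (lam * r) * cf v n p) →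
      HasDerivAt (fun t => r * ∑' n, t ^ n * cf v n p) (lam⁻¹ * φ (S w)) t ∧
        φ w = t * φ (S w) := by
    intro v w h
    refine ⟨?_, evalHom_eq_mul_shift (hS1 w) (by simp [h]) ht'⟩
    have h1 := (hasDerivAt_eval (v := v) (w := S w) (p := p) (ρ := lam * r) (fun n => by
      rw [hS1, h]; push_cast; ring) ht).const_mul lam⁻¹
    rw [show φ (S w) = ∑' n, t ^ n * cf (S w) n p from rfl]
    refine h1.congr_of_eventuallyEq (Eventually.of_forall fun s => ?_)
    field_simp
  obtain ⟨D1, E1⟩ := D c1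
  obtain ⟨D2, E2⟩ := D c2
  have φγ : g = lam * y + ε ^ 2 * φ γ := by
    rw [eγ]
    simp only [map_add, map_mul, φhf, φB, φA, φal, φ2, φG]
    rw [eg, ez]
    generalize fG _ = u
    rw [er, eμ, hlamdef]
    ring
  rw [map_sub, φ2] at E1
  rw [map_add, φ1] at E2
  generalize S (w₁ - v₂) = s₁ at ew1 D1 E1
  generalize S (w₂ + v₁) = s₂ at ew2 D2 E2
  have F1 := congrArg φ ew1
  have F2 := congrArg φ ew2
  simp only [map_add, map_sub, map_neg, map_mul, map_pow, map_ofNat, φe, φt, φla, φli, φA, φB, φF,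
    φH, φZ, φ2] at F1 F2
  have hg : g = ε * (lam * t + ε * φ γ) := by rw [φγ, ey]; ring
  refine ⟨φX ▸ hle X hX, φY ▸ hle Y hY, φZ ▸ hle Z hZ, _, _, D1, D2, ?_, ?_⟩
  · have h1 : g * (lam⁻¹ * φ s₁ / ε) = (lam * t + ε * φ γ) * (lam⁻¹ * φ s₁) := by
      rw [hg]; field_simp
    have h2 : lam * t * (lam⁻¹ * φ s₁) = t * φ s₁ := by field_simp
    rw [mul_add, h1, add_mul, h2, ← E1, F1, φγ, ey, eμ]
    ring
  · have h1 : g * (lam⁻¹ * φ s₂ / ε) = (lam * t + ε * φ γ) * (lam⁻¹ * φ s₂) := by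
      rw [hg]; field_simp
    have h2 : lam * t * (lam⁻¹ * φ s₂) = t * φ s₂ := by field_simp
    rw [mul_add, h1, add_mul, h2, ← E2, F2, φγ, ey, er]
    ring

end

section

/-! ### Summable sequences of functions as smooth maps into `ℓ¹` -/

section Sequences

theorem hasSum_norm_lp_one {W : Type} [NormedAddCommGroup W]
    (β : lp (fun _ : ℕ => W) 1) : HasSum (fun n => ‖β n‖) ‖β‖ := by
  have := lp.hasSum_norm (p := 1) (by simp) β
  simpa using this

variable {W : Type} [NormedAddCommGroup W] [NormedSpace ℝ W]

/-- The inclusion of the `n`-th coordinate in `ℓ¹`. -/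
def singleCLM (W : Type) [NormedAddCommGroup W] [NormedSpace ℝ W] (n : ℕ) :
    W →L[ℝ] lp (fun _ : ℕ => W) 1 :=
  (lp.lsingle (𝕜 := ℝ) (E := fun _ : ℕ => W) 1 n).mkContinuous 1 fun x => by
    rw [one_mul]
    exact (lp.norm_single (E := fun _ : ℕ => W) (p := 1) one_pos n x).le

theorem singleCLM_apply (n : ℕ) (x : W) (j : ℕ) :
    (singleCLM W n x : ℕ → W) j = if j = n then x else 0 := by
  change (lp.single (E := fun _ : ℕ => W) 1 n x : ∀ _, _) j = _
  by_cases h : j = n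
  · subst h; simp
  · simp [h]

/-- The coordinates of `ℓ¹`. -/
def coordCLM (W : Type) [NormedAddCommGroup W] [NormedSpace ℝ W] (n : ℕ) :
    lp (fun _ : ℕ => W) 1 →L[ℝ] W :=
  LinearMap.mkContinuous
    { toFun := fun β => β n
      map_add' := fun _ _ => rfl
      map_smul' := fun _ _ => rfl } 1 fun β => by
    rw [one_mul]
    exact (hasSum_norm_lp_one β).summable.le_tsum n (fun _ _ => norm_nonneg _) |>.trans
      (hasSum_norm_lp_one β).tsum_eq.le

theorem coordCLM_apply (n : ℕ) (β : lp (fun _ : ℕ => W) 1) : coordCLM W n β = β n := rfl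

/-- A sequence of functions whose derivatives are summable is a smooth function with values in
`ℓ¹`. -/
theorem exists_contDiff_lp [CompleteSpace W] {X : Type} [NormedAddCommGroup X] [NormedSpace ℝ X]
    {k : ℕ} {c : ℕ → X → W} (hc : ∀ n, ContDiff ℝ k (c n)) {u : ℕ → ℕ → ℝ}
    (hu : ∀ j ≤ k, Summable (u j))
    (hb : ∀ j ≤ k, ∀ n p, ‖iteratedFDeriv ℝ j (c n) p‖ ≤ u j n) :
    ∃ b : X → lp (fun _ : ℕ => W) 1, ContDiff ℝ k b ∧ ∀ p n, b p n = c n p := by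
  have hn : ∀ n, ‖singleCLM W n‖ ≤ 1 := fun n => LinearMap.mkContinuous_norm_le _ zero_le_one _
  have hsumm : ∀ p, Summable fun n => singleCLM W n (c n p) := fun p => by
    refine Summable.of_norm_bounded (hu 0 (Nat.zero_le _)) fun n => ?_
    refine ((singleCLM W n).le_opNorm _).trans ?_
    have := hb 0 (Nat.zero_le _) n p
    rw [norm_iteratedFDeriv_zero] at this
    nlinarith [hn n, norm_nonneg (c n p)]
  refine ⟨fun p => ∑' n, singleCLM W n (c n p), ?_, fun p n => ?_⟩
  · have := contDiff_tsum (𝕜 := ℝ) (N := (k : ℕ∞)) (f := fun n p => singleCLM W n (c n p)) (v := u)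
      (fun n => (singleCLM W n).contDiff.comp (by exact_mod_cast hc n))
      (fun j hj => hu j (by exact_mod_cast hj)) (fun j n p hj => by
        have hj' : j ≤ k := by exact_mod_cast hj
        have h1 := (singleCLM W n).norm_iteratedFDeriv_comp_left (x := p) (n := j)
          (hc n).contDiffAt (by exact_mod_cast hj')
        refine h1.trans ?_
        have := hb j hj' n p
        nlinarith [hn n, norm_nonneg (iteratedFDeriv ℝ j (c n) p)])
    exact_mod_cast this
  · rw [← coordCLM_apply, (coordCLM W n).map_tsum (hsumm p)]
    rw [tsum_eq_single n]
    · rw [coordCLM_apply, singleCLM_apply, if_pos rfl]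
    · intro j hj
      rw [coordCLM_apply, singleCLM_apply, if_neg hj.symm]

theorem exists_shift_lp (W : Type) [NormedAddCommGroup W] [NormedSpace ℝ W] :
    ∃ S : lp (fun _ : ℕ => W) 1 →L[ℝ] lp (fun _ : ℕ => W) 1, ‖S‖ ≤ 1 ∧
      ∀ β n, (S β : ℕ → W) n = β (n + 1) := by
  have hs : ∀ β : lp (fun _ : ℕ => W) 1, Summable fun n => ‖β (n + 1)‖ := fun β =>
    (summable_nat_add_iff 1).2 (hasSum_norm_lp_one β).summable
  have hmem : ∀ β : lp (fun _ : ℕ => W) 1, Memℓp (fun n => β (n + 1)) 1 := fun β => by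
    refine memℓp_gen ?_
    simpa using hs β
  let S : lp (fun _ : ℕ => W) 1 →ₗ[ℝ] lp (fun _ : ℕ => W) 1 :=
    { toFun := fun β => ⟨fun n => β (n + 1), hmem β⟩
      map_add' := fun _ _ => rfl
      map_smul' := fun _ _ => rfl }
  refine ⟨S.mkContinuous 1 fun β => ?_, LinearMap.mkContinuous_norm_le _ zero_le_one _,
    fun _ _ => rfl⟩
  rw [one_mul, ← (hasSum_norm_lp_one (S β)).tsum_eq, ← (hasSum_norm_lp_one β).tsum_eq,
    (hasSum_norm_lp_one β).summable.tsum_eq_zero_add]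
  exact le_add_of_nonneg_left (norm_nonneg _)

/-- The sum `∑ τⁿ βₙ` is a smooth function of `|τ| < 1` and `β ∈ ℓ¹`: it is a coordinate of
`(1 - τ S)⁻¹ β`, with `S` the shift. -/
theorem exists_smooth_sum (W : Type) [NormedAddCommGroup W] [NormedSpace ℝ W] [CompleteSpace W] :
    ∃ E : ℝ × lp (fun _ : ℕ => W) 1 → W, (∀ q, |q.1| < 1 → ContDiffAt ℝ ∞ E q) ∧
      ∀ τ : ℝ, |τ| < 1 → ∀ β, HasSum (fun n => τ ^ n • β n) (E (τ, β)) := by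
  obtain ⟨S, hS, hS'⟩ := exists_shift_lp W
  have hpow' : ∀ n β j, coordCLM W j ((S ^ n) β) = β (j + n) := by
    intro n
    induction n with
    | zero => intro β j; simp [coordCLM_apply]
    | succ n ih =>
      intro β j
      rw [pow_succ', mul_apply_eq_comp, coordCLM_apply, hS', ← coordCLM_apply, ih,
        show j + 1 + n = j + (n + 1) by omega]
  have hpow : ∀ n β, ((S ^ n) β : ℕ → W) 0 = β n := fun n β => by
    have := hpow' n β 0
    rwa [zero_add] at this
  have hn : ∀ τ : ℝ, |τ| < 1 → ‖τ • S‖ < 1 := fun τ h => by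
    rw [norm_smul, Real.norm_eq_abs]
    exact (mul_le_of_le_one_right (abs_nonneg _) hS).trans_lt h
  refine ⟨fun q => coordCLM W 0 (Ring.inverse (1 - q.1 • S) q.2), fun q hq => ?_, fun τ hτ β => ?_⟩
  · have h1 : ContDiffAt ℝ ∞ (fun q : ℝ × lp (fun _ : ℕ => W) 1 => Ring.inverse (1 - q.1 • S)) q := by
      have h2 := contDiffAt_ringInverse (𝕜 := ℝ) (n := ∞) (Units.oneSub (q.1 • S) (hn _ hq))
      exact ContDiffAt.comp (g := Ring.inverse) q h2
        (contDiff_const.sub (contDiff_fst.smul contDiff_const)).contDiffAt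
    exact (coordCLM W 0).contDiff.contDiffAt.comp q (h1.clm_apply contDiffAt_snd)
  · have h1 := (summable_geometric_of_norm_lt_one (hn τ hτ)).hasSum
    rw [show (∑' n, (τ • S) ^ n) = Ring.inverse (1 - τ • S) by
      rw [NormedRing.inverse_one_sub _ (hn τ hτ)]; rfl] at h1
    have h2 := h1.mapL (((coordCLM W 0).comp
      (ContinuousLinearMap.apply ℝ (lp (fun _ : ℕ => W) 1) β)))
    refine h2.congr_fun fun n => ?_
    simp only [ContinuousLinearMap.comp_apply, ContinuousLinearMap.apply_apply, smul_pow, map_smul,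
      coordCLM_apply, hpow]

end Sequences

end

section

/-! ### The chart system in terms of smooth functions -/

variable {F G H : ℝ → ℝ → ℝ → ℝ → ℝ → ℝ}

/-- Smooth functions `f`, `g`, `h` of `(r, μ₂, x₂, y₂, z₂)` such that the chart system is
`x' = y - (r μ₂ + 1) z + r f`, `y' = r (μ₂ / 2 + a₁ y + a₂ z + r g)`, `z' = x + z² + r z h`. -/
structure ChartData (F G H : ℝ → ℝ → ℝ → ℝ → ℝ → ℝ) where
  /-- the radius of validity, in terms of the original variables -/
  ρ : ℝ
  ρ_pos : 0 < ρ
  ρ_le : ρ ≤ 1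
  f : ℝ × ℝ × ℝ × ℝ × ℝ → ℝ
  g : ℝ × ℝ × ℝ × ℝ × ℝ → ℝ
  h : ℝ × ℝ × ℝ × ℝ × ℝ → ℝ
  smooth_f : ContDiff ℝ ∞ f
  smooth_g : ContDiff ℝ ∞ g
  smooth_h : ContDiff ℝ ∞ h
  series_f : HasUniformSeries ρ f
  series_g : HasUniformSeries ρ g
  series_h : HasUniformSeries ρ h
  field_eq : ∀ r μ x y z : ℝ, |r ^ 2 * x| < ρ → |r * y| < ρ → |r * z| < ρ → |r ^ 2| < ρ →
    |r * μ| < ρ → chartField F G H r (r * μ) (x, y, z) =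
      (y - (r * μ + 1) * z + r * f (r, μ, x, y, z),
        r * (μ / 2 + a₁ G * y + a₂ G * z + r * g (r, μ, x, y, z)),
        x + z ^ 2 + r * (z * h (r, μ, x, y, z)))
  rate_eq : ∀ r μ x y z : ℝ, |r ^ 2 * x| < ρ → |r * y| < ρ → |r * z| < ρ → |r ^ 2| < ρ →
    |r * μ| < ρ → slowRate G r μ (x, y, z) = μ / 2 + a₁ G * y + a₂ G * z + r * g (r, μ, x, y, z)

theorem hasDerivAt_zero_of_le_sq {u : ℝ → ℝ} {C : ℝ} (h : ∀ᶠ t in 𝓝 0, |u t| ≤ C * t ^ 2) :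
    HasDerivAt u 0 0 := by
  have h0 : u 0 = 0 := by simpa using h.self_of_nhds
  have hO : u =O[𝓝 0] fun t : ℝ => t ^ 2 := Asymptotics.IsBigO.of_bound C (h.mono fun t ht => by
    simpa using ht)
  rw [hasDerivAt_iff_isLittleO]
  simp only [h0, sub_zero, smul_zero]
  exact hO.trans_isLittleO (by simpa using Asymptotics.isLittleO_pow_pow (𝕜 := ℝ) one_lt_two)

/-- Restriction of an estimate near the origin to a line. -/
theorem eventually_line {p : ℝ × ℝ × ℝ × ℝ × ℝ → Prop} (h : ∀ᶠ q in 𝓝 0, p q)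
    (a : ℝ × ℝ × ℝ × ℝ × ℝ) : ∀ᶠ t : ℝ in 𝓝 0, p (t • a) := by
  have hc : Continuous fun t : ℝ => t • a := by fun_prop
  have := hc.tendsto 0
  rw [zero_smul] at this
  exact this.eventually h

theorem AnalyticInSpace.sub_linear (hG : AnalyticInSpace G) (a b : ℝ) :
    AnalyticInSpace (fun x y z ε μ => G x y z ε μ - (a * y + b * z)) := by
  obtain ⟨ρ, hρ, Φ, h1, h2, h3⟩ := hG
  refine ⟨ρ, hρ, fun q => Φ q - (a * q.1.2.1 + b * q.1.2.2), ?_, fun c hc => ?_, ?_⟩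
  · exact h1.sub (by fun_prop)
  · exact (h2 c hc).sub (by fun_prop)
  · intro x y z ε μ hx hy hz hε hμ
    simp only
    rw [h3 x y z ε μ hx hy hz hε hμ]
    push_cast
    rfl

/-- A function that is analytic in space is differentiable in the real variables. -/
theorem AnalyticInSpace.differentiableAt (hG : AnalyticInSpace G) :
    DifferentiableAt ℝ (fun q : ℝ × ℝ × ℝ × ℝ × ℝ => G q.1 q.2.1 q.2.2.1 q.2.2.2.1 q.2.2.2.2)
      0 := by
  obtain ⟨ρ, hρ, Φ, h1, -, h3⟩ := hG
  have hΦ : DifferentiableAt ℝ Φ 0 :=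
    (h1.contDiffAt (Metric.ball_mem_nhds 0 hρ)).differentiableAt (by simp)
  let L : ℝ × ℝ × ℝ × ℝ × ℝ → (ℂ × ℂ × ℂ) × (ℝ × ℝ) := fun q =>
    (((q.1 : ℂ), (q.2.1 : ℂ), (q.2.2.1 : ℂ)), (q.2.2.2.1, q.2.2.2.2))
  have hL : Differentiable ℝ L := by
    have : Differentiable ℝ (fun x : ℝ => (x : ℂ)) := Complex.ofRealCLM.differentiable
    fun_prop
  have hL0 : L 0 = 0 := by simp [L]
  have h4 : DifferentiableAt ℝ (fun q => (Φ (L q)).re) 0 := by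
    have h5 : DifferentiableAt ℝ (Φ ∘ L) 0 :=
      DifferentiableAt.comp 0 (by rw [hL0]; exact hΦ) (hL 0)
    exact Complex.reCLM.differentiableAt.comp 0 h5
  refine h4.congr_of_eventuallyEq ?_
  filter_upwards [Metric.ball_mem_nhds (0 : ℝ × ℝ × ℝ × ℝ × ℝ) hρ] with q hq
  simp only [mem_ball_zero_iff, Prod.norm_def, max_lt_iff, Real.norm_eq_abs] at hq
  simp only [L]
  rw [h3 _ _ _ _ _ hq.1 hq.2.1 hq.2.2.1 hq.2.2.2.1 hq.2.2.2.2, Complex.ofReal_re]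

/-- The order conditions are what makes `F`, `G - a₁ y - a₂ z` and `H` divisible by `r²` in the
chart. -/
theorem exists_chartData (hF : AnalyticInSpace F) (hG : AnalyticInSpace G) (hH : AnalyticInSpace H)
    (oF : OrderF F) (oG : OrderG G) (oH : OrderH H) : Nonempty (ChartData F G H) := by
  obtain ⟨CF, hCF⟩ := oF.bound
  obtain ⟨CG, hCG⟩ := oG.bound
  obtain ⟨CH, hCH⟩ := oH.bound
  -- the values and the derivatives at the origin that follow from the order conditions
  have F0 : F 0 0 0 0 0 = 0 := by simpa using hCF.self_of_nhds
  have G0 : G 0 0 0 0 0 = 0 := by simpa using hCG.self_of_nhds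
  have H0 : H 0 0 0 0 0 = 0 := by simpa using hCH.self_of_nhds
  have Fy := hasDerivAt_zero_of_le_sq (u := fun y => F 0 y 0 0 0) (C := CF)
    ((eventually_line hCF (0, 1, 0, 0, 0)).mono fun t ht => by simpa using ht)
  have Fz := hasDerivAt_zero_of_le_sq (u := fun z => F 0 0 z 0 0) (C := CF)
    ((eventually_line hCF (0, 0, 1, 0, 0)).mono fun t ht => by simpa using ht)
  have Fμ := hasDerivAt_zero_of_le_sq (u := fun μ => F 0 0 0 0 μ) (C := 0)
    ((eventually_line hCF (0, 0, 0, 0, 1)).mono fun t ht => by simpa using ht)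
  have Hy := hasDerivAt_zero_of_le_sq (u := fun y => H 0 y 0 0 0) (C := 0)
    ((eventually_line hCH (0, 1, 0, 0, 0)).mono fun t ht => by simpa using ht)
  have Hz := hasDerivAt_zero_of_le_sq (u := fun z => H 0 0 z 0 0) (C := CH)
    ((eventually_line hCH (0, 0, 1, 0, 0)).mono fun t ht => by simpa using ht)
  have Hμ := hasDerivAt_zero_of_le_sq (u := fun μ => H 0 0 0 0 μ) (C := 0)
    ((eventually_line hCH (0, 0, 0, 0, 1)).mono fun t ht => by simpa using ht)
  have Gμ := hasDerivAt_zero_of_le_sq (u := fun μ => G 0 0 0 0 μ) (C := 0)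
    ((eventually_line hCG (0, 0, 0, 0, 1)).mono fun t ht => by simpa using ht)
  have Gd := hG.differentiableAt
  have Gy : HasDerivAt (fun y => G 0 y 0 0 0) (a₁ G) 0 := by
    have h : DifferentiableAt ℝ (fun y : ℝ => ((0, y, 0, 0, 0) : ℝ × ℝ × ℝ × ℝ × ℝ)) 0 := by
      fun_prop
    exact (DifferentiableAt.comp (0 : ℝ) (g := fun q : ℝ × ℝ × ℝ × ℝ × ℝ =>
      G q.1 q.2.1 q.2.2.1 q.2.2.2.1 q.2.2.2.2) Gd h).hasDerivAt
  have Gz : HasDerivAt (fun z => G 0 0 z 0 0) (a₂ G) 0 := by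
    have h : DifferentiableAt ℝ (fun y : ℝ => ((0, 0, y, 0, 0) : ℝ × ℝ × ℝ × ℝ × ℝ)) 0 := by
      fun_prop
    exact (DifferentiableAt.comp (0 : ℝ) (g := fun q : ℝ × ℝ × ℝ × ℝ × ℝ =>
      G q.1 q.2.1 q.2.2.1 q.2.2.2.1 q.2.2.2.2) Gd h).hasDerivAt
  obtain ⟨ρ₁, p1, q1, f, sf, ef, uf⟩ := exists_rescaled hF F0 Fy Fz Fμ
  obtain ⟨ρ₂, p2, q2, g, sg, eg, ug⟩ := exists_rescaled (hG.sub_linear (a₁ G) (a₂ G)) (by simp [G0])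
    (by simpa using Gy.fun_sub ((hasDerivAt_id (0 : ℝ)).const_mul (a₁ G)))
    (by simpa using Gz.fun_sub ((hasDerivAt_id (0 : ℝ)).const_mul (a₂ G))) (by simpa using Gμ)
  obtain ⟨ρ₃, p3, q3, h, sh, eh, uh⟩ := exists_rescaled hH H0 Hy Hz Hμ
  have mono : ∀ {ρ ρ' : ℝ} {f : ℝ × ℝ × ℝ × ℝ × ℝ → ℝ}, ρ' ≤ ρ → HasUniformSeries ρ f →
      HasUniformSeries ρ' f := by
    rintro ρ ρ' f hle ⟨c, h1, h2, h3⟩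
    exact ⟨c, h1, h2, fun r μ hr hr' => h3 r μ hr (hr'.trans_le hle)⟩
  set ρ := min ρ₁ (min ρ₂ ρ₃)
  have l1 : ρ ≤ ρ₁ := min_le_left _ _
  have l2 : ρ ≤ ρ₂ := (min_le_right _ _).trans (min_le_left _ _)
  have l3 : ρ ≤ ρ₃ := (min_le_right _ _).trans (min_le_right _ _)
  have key : ∀ r μ x y z : ℝ, |r ^ 2 * x| < ρ → |r * y| < ρ → |r * z| < ρ → |r ^ 2| < ρ →
      |r * μ| < ρ → G (r ^ 2 * x) (r * y) (r * z) (r ^ 2) (r * μ) =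
        r * (a₁ G * y + a₂ G * z + r * g (r, μ, x, y, z)) := fun r μ x y z h1 h2 h3 h4 h5 => by
    have := eg r μ x y z (h1.trans_le l2) (h2.trans_le l2) (h3.trans_le l2) (h4.trans_le l2)
      (h5.trans_le l2)
    linear_combination this
  refine ⟨⟨ρ, lt_min p1 (lt_min p2 p3), l1.trans q1, f, g, h, sf, sg, sh, mono l1 uf, mono l2 ug,
    mono l3 uh, ?_, ?_⟩⟩
  · intro r μ x y z h1 h2 h3 h4 h5
    simp only [chartField]
    rw [ef r μ x y z (h1.trans_le l1) (h2.trans_le l1) (h3.trans_le l1) (h4.trans_le l1)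
      (h5.trans_le l1), eh r μ x y z (h1.trans_le l3) (h2.trans_le l3) (h3.trans_le l3)
      (h4.trans_le l3) (h5.trans_le l3), key r μ x y z h1 h2 h3 h4 h5]
    -- for `r = 0` both sides vanish, since the quotient is then read as zero
    have e : ∀ u : ℝ, r ^ 2 * u / r = r * u := fun u => by
      rcases eq_or_ne r 0 with rfl | hr
      · simp
      · field_simp
    rw [e, e]
    simp only [Prod.mk.injEq, true_and]
    constructor <;> ring
  · intro r μ x y z h1 h2 h3 h4 h5
    simp only [slowRate]
    rcases eq_or_ne r 0 with rfl | hr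
    · simp; ring
    · rw [if_neg hr, key r μ x y z h1 h2 h3 h4 h5]
      field_simp
      ring

end

section

/-! ### The slow manifold -/

/-- The derivatives of the coefficients grow at most polynomially with the index. -/
theorem norm_iteratedFDeriv_cf_le {k : ℕ} (v : paramSeries k) {j : ℕ} (hj : j ≤ k) (n : ℕ)
    (p : ℝ × ℝ) : ‖iteratedFDeriv ℝ j (cf v n) p‖ ≤ j.factorial * (n + 1) ^ j * ‖v‖ := by
  have h := (enorm_iteratedFDeriv_le (n := n) (f := cf v n) hj p).trans
    (mul_le_mul_right (jetNorm_coeff_le_seriesNorm v.1 n) _)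
  rw [← ofReal_norm_paramSeries, ← ENNReal.ofReal_mul (by positivity), ← ofReal_norm] at h
  exact (ENNReal.ofReal_le_ofReal_iff (by positivity)).1 h

/-- The coefficients of a pair of series, at half the radius, form a smooth map into `ℓ¹`. -/
theorem exists_lp_of_paramSeries {k : ℕ} (v₁ v₂ : paramSeries k) :
    ∃ b : ℝ × ℝ → lp (fun _ : ℕ => ℝ × ℝ) 1, ContDiff ℝ k b ∧
      ∀ p n, b p n = ((1 / 2) ^ n * cf v₁ n p, (1 / 2) ^ n * cf v₂ n p) := by
  refine exists_contDiff_lp (u := fun j n => (1 / 2 : ℝ) ^ n *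
    (j.factorial * (n + 1) ^ j * (‖v₁‖ + ‖v₂‖))) (fun n => ?_) (fun j hj => ?_) (fun j hj n p => ?_)
  · exact (contDiff_const.mul (contDiff_cf v₁ n)).prodMk (contDiff_const.mul (contDiff_cf v₂ n))
  · have h := (summable_nat_add_iff 1).2 (summable_pow_mul_geometric_of_norm_lt_one j
      (r := (1 / 2 : ℝ)) (by norm_num))
    refine (h.mul_left (2 * (j.factorial * (‖v₁‖ + ‖v₂‖)))).congr fun n => ?_
    push_cast
    ring
  · have hj' : ((j : ℕ) : ℕ∞ω) ≤ k := by exact_mod_cast hj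
    set L₁ : ℝ →L[ℝ] ℝ × ℝ := (1 / 2 : ℝ) ^ n • ContinuousLinearMap.inl ℝ ℝ ℝ
    set L₂ : ℝ →L[ℝ] ℝ × ℝ := (1 / 2 : ℝ) ^ n • ContinuousLinearMap.inr ℝ ℝ ℝ
    have hε : ‖(1 / 2 : ℝ) ^ n‖ = (1 / 2) ^ n := Real.norm_of_nonneg (by positivity)
    have n1 : ‖L₁‖ ≤ (1 / 2) ^ n := by
      rw [norm_smul, hε]
      exact mul_le_of_le_one_right (by positivity) (ContinuousLinearMap.norm_inl_le_one ℝ ℝ ℝ)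
    have n2 : ‖L₂‖ ≤ (1 / 2) ^ n := by
      rw [norm_smul, hε]
      exact mul_le_of_le_one_right (by positivity) (ContinuousLinearMap.norm_inr_le_one ℝ ℝ ℝ)
    have e : (fun p => ((1 / 2) ^ n * cf v₁ n p, (1 / 2) ^ n * cf v₂ n p)) =
        (L₁ ∘ cf v₁ n) + (L₂ ∘ cf v₂ n) := by ext q <;> simp [L₁, L₂]
    have h1 := contDiff_cf v₁ n
    have h2 := contDiff_cf v₂ n
    have e1 := L₁.norm_iteratedFDeriv_comp_left (x := p) (n := j) h1.contDiffAt hj'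
    have e2 := L₂.norm_iteratedFDeriv_comp_left (x := p) (n := j) h2.contDiffAt hj'
    rw [e, iteratedFDeriv_add_apply ((L₁.contDiff.comp h1).of_le hj').contDiffAt
      ((L₂.contDiff.comp h2).of_le hj').contDiffAt]
    refine (norm_add_le _ _).trans ?_
    have c1 := e1.trans (mul_le_mul n1 (norm_iteratedFDeriv_cf_le v₁ hj n p) (norm_nonneg _)
      (by positivity))
    have c2 := e2.trans (mul_le_mul n2 (norm_iteratedFDeriv_cf_le v₂ hj n p) (norm_nonneg _)
      (by positivity))
    refine (add_le_add c1 c2).trans (le_of_eq ?_)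
    ring

variable {F G H : ℝ → ℝ → ℝ → ℝ → ℝ → ℝ}

/-- The slow manifolds. Near the origin they are `m = (-y², y) + r v` with a function `v` of
`(r, μ₂, y)` that has a few more derivatives than demanded, and they are invariant for small `r` of
either sign. -/
theorem exists_slowManifold (N : ChartData F G H) (hlam : lam G ≠ 0) (k : ℕ) :
    ∃ ν > 0, ∃ R > 0, ∃ m : ℝ → ℝ → ℝ → ℝ × ℝ, IsSlowManifold F G H k ν R R m ∧
      ∃ σ > 0, σ < ν ∧ σ < R ∧ ∃ v : ℝ × ℝ × ℝ → ℝ × ℝ, ContDiff ℝ (k + 4 : ℕ) v ∧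
        ∀ r μ y : ℝ, |r| < σ → |μ| < σ → |y| < σ → m y r μ = (-y ^ 2, y) + r • v (r, μ, y) ∧
          ∀ x z g : ℝ, ∀ D : ℝ × ℝ, D = fderiv ℝ v (r, μ, y) (0, 0, 1) →
          x = -y ^ 2 + r * (v (r, μ, y)).1 → z = y + r * (v (r, μ, y)).2 →
          g = μ / 2 + a₁ G * y + a₂ G * z + r * N.g (r, μ, x, y, z) →
            y - (r * μ + 1) * z + r * N.f (r, μ, x, y, z) = r * (g * (-2 * y + r * D.1)) ∧
            x + z ^ 2 + r * (z * N.h (r, μ, x, y, z)) = r * (g * (1 + r * D.2)) := by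
  obtain ⟨ε, hε, hεs, v₁, v₂, hv⟩ := exists_slow_series (k + 4) N.ρ_pos N.ρ_pos N.ρ_pos N.series_f
    N.series_g N.series_h hlam N.ρ_pos
  have hρ := N.ρ_pos
  have hρ1 := N.ρ_le
  obtain ⟨b, hb, hbn⟩ := exists_lp_of_paramSeries v₁ v₂
  obtain ⟨E, hE1, hE2⟩ := exists_smooth_sum (ℝ × ℝ)
  set R := ε ^ 2 with hR
  have hRpos : 0 < R := by positivity
  have hRρ : R < N.ρ := by nlinarith
  set ν := ε / 2 with hν
  have hνpos : 0 < ν := by positivity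
  set pr : ℝ → ℝ → ℝ × ℝ := fun r μ => (r / R, μ / R) with hpr
  set V₁ : ℝ → ℝ → ℝ → ℝ := fun y r μ => ∑' n, (y / ε) ^ n * cf v₁ n (pr r μ) with hV₁
  set V₂ : ℝ → ℝ → ℝ → ℝ := fun y r μ => ∑' n, (y / ε) ^ n * cf v₂ n (pr r μ) with hV₂
  set m : ℝ → ℝ → ℝ → ℝ × ℝ := fun y r μ => (-y ^ 2 + r * V₁ y r μ, y + r * V₂ y r μ) with hm
  have hprle : ∀ r, |r| ≤ R → |r / R| ≤ 1 := fun r h => by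
    rw [abs_div, abs_of_pos hRpos]; exact div_le_one_of_le₀ h hRpos.le
  -- the series at half the radius
  have hsum : ∀ y r μ, |y| ≤ ν →
      HasSum (fun n => (y / ν) ^ n • b (pr r μ) n) (V₁ y r μ, V₂ y r μ) := by
    intro y r μ hy
    have ht : |y / ε| ≤ 1 := by
      rw [abs_div, abs_of_pos hε]
      exact div_le_one_of_le₀ (hy.trans (by linarith)) hε.le
    have s1 := (summable_eval v₁ (pr r μ) ht).of_norm.hasSum
    have s2 := (summable_eval v₂ (pr r μ) ht).of_norm.hasSum
    refine (s1.prodMk s2).congr_fun fun n => ?_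
    have : y / ε = (y / ν) * (1 / 2) := by rw [hν]; field_simp
    rw [hbn, this, mul_pow]
    ext <;> simp only [Prod.smul_mk, smul_eq_mul] <;> ring
  -- the invariance equations
  have inv : ∀ y r μ, |y| < ε → |r| ≤ R → |μ| ≤ R → r ≠ 0 → ∀ x z g, x = -y ^ 2 + r * V₁ y r μ →
      z = y + r * V₂ y r μ → g = μ / 2 + a₁ G * y + a₂ G * z + r * N.g (r, μ, x, y, z) →
      |x| ≤ 1 / 4 ∧ |y| ≤ 1 / 4 ∧ |z| ≤ 1 / 4 ∧ ∃ d₁ d₂,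
        HasDerivAt (fun y => r * V₁ y r μ) d₁ y ∧ HasDerivAt (fun y => r * V₂ y r μ) d₂ y ∧
        y - (r * μ + 1) * z + r * N.f (r, μ, x, y, z) = r * (g * (-2 * y + d₁)) ∧
        x + z ^ 2 + r * (z * N.h (r, μ, x, y, z)) = r * (g * (1 + d₂)) := by
    intro y r μ hy hr hμ hr0 x z g hx hz hg
    have ht : |y / ε| < 1 := by
      rw [abs_div, abs_of_pos hε, div_lt_one hε]; exact hy
    obtain ⟨bx, bY, bz, d₁, d₂, h1, h2, h3, h4⟩ := hv (pr r μ) (hprle r hr) (hprle μ hμ)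
      (div_ne_zero hr0 hRpos.ne') (y / ε) ht r μ y (V₁ y r μ) (V₂ y r μ) x z g
      (by simp only [hpr]; field_simp) (by simp only [hpr]; field_simp) (by field_simp)
      rfl rfl hx hz hg
    have hd := (hasDerivAt_id y).div_const ε
    refine ⟨bx, bY, bz, d₁ / ε, d₂ / ε, ?_, ?_, ?_, ?_⟩
    · have := HasDerivAt.comp y h1 hd
      rw [mul_one_div] at this
      exact this
    · have := HasDerivAt.comp y h2 hd
      rw [mul_one_div] at this
      exact this
    · rw [h3, hz]; ring
    · rw [h4, hx, hz]; ring
  have hslow : IsSlowManifold F G H k ν R R m := by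
    refine ⟨⟨fun q => q.1 • b (pr q.1 q.2) + (singleCLM _ 1 (0, ν) + singleCLM _ 2 (-ν ^ 2, 0)),
      ?_, ?_⟩, ?_, ?_⟩
    · have hp : ContDiff ℝ (k + 4 : ℕ) (fun q : ℝ × ℝ => pr q.1 q.2) := by
        simp only [hpr]; fun_prop
      exact (((contDiff_fst.smul (hb.comp hp)).add contDiff_const).of_le
        (by exact_mod_cast Nat.le_add_right k 4)).contDiffOn
    · intro y hy r _ μ _
      have hs1 : ∀ (i : ℕ) (w : ℝ × ℝ), HasSum (fun n => (y / ν) ^ n •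
          (singleCLM (ℝ × ℝ) i w : ℕ → ℝ × ℝ) n) ((y / ν) ^ i • w) := fun i w => by
        have := hasSum_ite_eq i ((y / ν) ^ i • w)
        refine this.congr_fun fun n => ?_
        rw [singleCLM_apply]
        split_ifs with h
        · rw [h]
        · simp
      have h := ((hsum y r μ (abs_le.2 hy)).const_smul r).add
        ((hs1 1 (0, ν)).add (hs1 2 (-ν ^ 2, 0)))
      have e : r • (V₁ y r μ, V₂ y r μ) + ((y / ν) ^ 1 • ((0 : ℝ), ν) +
          (y / ν) ^ 2 • (-ν ^ 2, (0 : ℝ))) = m y r μ := by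
        simp only [hm, Prod.smul_mk, smul_eq_mul, Prod.mk_add_mk, Prod.mk.injEq]
        constructor <;> field_simp <;> ring
      rw [e] at h
      refine h.congr_fun fun n => ?_
      simp only [lp.coeFn_add, lp.coeFn_smul, Pi.add_apply, Pi.smul_apply, smul_add]
      rw [smul_comm]
    · intro y _ μ _
      simp [hm]
    · intro y hy r hr μ hμ
      have hr' : |r| ≤ R := by rw [abs_of_nonneg hr.1]; exact hr.2
      have hμ' : |μ| ≤ R := abs_le.2 hμ
      have hy' : |y| < ν := abs_lt.2 hy
      have cond : ∀ x z : ℝ, |x| ≤ 1 / 4 → |y| ≤ 1 / 4 → |z| ≤ 1 / 4 →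
          |r ^ 2 * x| < N.ρ ∧ |r * y| < N.ρ ∧ |r * z| < N.ρ ∧ |r ^ 2| < N.ρ ∧ |r * μ| < N.ρ := by
        intro x z hx hy hz
        have h0 := abs_nonneg r
        have h1 : |r| < N.ρ := hr'.trans_lt hRρ
        have h2 : |r| ^ 2 < N.ρ := by nlinarith
        simp only [abs_mul, abs_pow]
        refine ⟨?_, ?_, ?_, h2, ?_⟩
        · nlinarith [abs_nonneg x, sq_nonneg |r|]
        · nlinarith [abs_nonneg y]
        · nlinarith [abs_nonneg z]
        · nlinarith [abs_nonneg μ]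
      rcases eq_or_ne r 0 with hr0 | hr0
      · subst hr0
        have hεq : ε < 1 := by linarith
        have c : graphPt m 0 μ y = (-y ^ 2, y, y) := by simp [graphPt, hm]
        rw [c, N.field_eq 0 μ (-y ^ 2) y y (by simpa using hρ) (by simpa using hρ)
          (by simpa using hρ) (by simpa using hρ) (by simpa using hρ)]
        simp
      · obtain ⟨bx, bY, bz, d₁, d₂, h1, h2, h3, h4⟩ := inv y r μ (by linarith) hr' hμ' hr0 _ _ _
          rfl rfl rfl
        obtain ⟨c1, c2, c3, c4, c5⟩ := cond _ _ bx bY bz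
        have hd : HasDerivAt (graphPt m r μ) (-2 * y + d₁, 1, 1 + d₂) y := by
          have e1 : HasDerivAt (fun y => -y ^ 2 + r * V₁ y r μ) (-2 * y + d₁) y := by
            refine (((hasDerivAt_pow 2 y).neg).add h1).congr_deriv ?_
            push_cast; ring
          have e2 : HasDerivAt (fun y => y + r * V₂ y r μ) (1 + d₂) y := (hasDerivAt_id y).add h2
          exact e1.prodMk ((hasDerivAt_id y).prodMk e2)
        rw [hd.deriv]
        have c : graphPt m r μ y = (-y ^ 2 + r * V₁ y r μ, y, y + r * V₂ y r μ) := by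
          simp [graphPt, hm]
        rw [c, N.field_eq r μ _ y _ c1 c2 c3 c4 c5, h3, h4]
        simp only [Prod.smul_mk, smul_eq_mul, Prod.mk.injEq]
        refine ⟨?_, ?_, ?_⟩ <;> ring
  -- the smooth representative
  set σ₀ := min ν R with hσ₀
  have hσ₀pos : 0 < σ₀ := lt_min hνpos hRpos
  have hsm : ContDiffOn ℝ ((k + 4 : ℕ) : ℕ∞)
      (fun q : ℝ × ℝ × ℝ => E (q.2.2 / ν, b (pr q.1 q.2.1))) (Metric.ball 0 σ₀) := by
    intro q hq
    simp only [mem_ball_zero_iff, Prod.norm_def, max_lt_iff, Real.norm_eq_abs] at hq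
    have h1 : |q.2.2 / ν| < 1 := by
      rw [abs_div, abs_of_pos hνpos, div_lt_one hνpos]
      exact hq.2.2.trans_le (min_le_left _ _)
    have hp : ContDiff ℝ (k + 4 : ℕ) (fun q : ℝ × ℝ × ℝ => pr q.1 q.2.1) := by
      simp only [hpr]; fun_prop
    have h2 : ContDiff ℝ (k + 4 : ℕ) (fun q : ℝ × ℝ × ℝ => (q.2.2 / ν, b (pr q.1 q.2.1))) :=
      ContDiff.prodMk (by fun_prop) (hb.comp hp)
    refine ContDiffAt.contDiffWithinAt ?_
    exact ContDiffAt.comp (g := E) q ((hE1 (q.2.2 / ν, b (pr q.1 q.2.1)) h1).of_le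
      (by exact_mod_cast le_top)) h2.contDiffAt
  obtain ⟨v, hvs, hveq⟩ := exists_contDiff_extension hσ₀pos hsm
  have hvs' : ContDiff ℝ (k + 4 : ℕ) v := by exact_mod_cast hvs
  have hvV : ∀ r μ y, |r| < σ₀ / 3 → |μ| < σ₀ / 3 → |y| < σ₀ / 3 →
      v (r, μ, y) = (V₁ y r μ, V₂ y r μ) := by
    intro r μ y hr hμ hy
    rw [hveq _ (by
      simp only [mem_ball_zero_iff, Prod.norm_def, max_lt_iff, Real.norm_eq_abs]
      exact ⟨hr, hμ, hy⟩)]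
    have hy' : |y| < ν := by linarith [min_le_left ν R]
    have h1 : |y / ν| < 1 := by
      rw [abs_div, abs_of_pos hνpos, div_lt_one hνpos]; exact hy'
    exact (hE2 _ h1 _).unique (hsum y r μ hy'.le)
  refine ⟨ν, hνpos, R, hRpos, m, hslow, σ₀ / 3, by positivity, by linarith [min_le_left ν R],
    by linarith [min_le_right ν R], v, hvs', ?_⟩
  intro r μ y hr hμ hy
  refine ⟨?_, ?_⟩
  · rw [hvV r μ y hr hμ hy]
    simp [hm]
  · intro x z g D hD hx hz hg
    rcases eq_or_ne r 0 with hr0 | hr0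
    · subst hr0
      constructor
      · rw [hz]; ring
      · rw [hx, hz]; ring
    · rw [hvV r μ y hr hμ hy] at hx hz
      obtain ⟨-, -, -, d₁, d₂, h1, h2, h3, h4⟩ := inv y r μ (by linarith [min_le_left ν R])
        (by linarith [min_le_right ν R]) (by linarith [min_le_right ν R]) hr0 x z g hx hz hg
      -- compare the two derivatives
      have hd : HasDerivAt (fun y => v (r, μ, y)) D y := by
        have e1 : HasDerivAt (fun y : ℝ => (r, μ, y)) (0, 0, 1) y :=
          (hasDerivAt_const y r).prodMk ((hasDerivAt_const y μ).prodMk (hasDerivAt_id y))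
        rw [hD]
        exact ((hvs'.differentiable (by simp)).differentiableAt.hasFDerivAt).comp_hasDerivAt y e1
      have hd₁ : HasDerivAt (fun y => (v (r, μ, y)).1) D.1 y := by
        have := ((ContinuousLinearMap.fst ℝ ℝ ℝ).hasFDerivAt (x := v (r, μ, y))).comp_hasDerivAt y hd
        exact this
      have hd₂ : HasDerivAt (fun y => (v (r, μ, y)).2) D.2 y := by
        have := ((ContinuousLinearMap.snd ℝ ℝ ℝ).hasFDerivAt (x := v (r, μ, y))).comp_hasDerivAt y hd
        exact this
      have hloc : ∀ᶠ y' in 𝓝 y, v (r, μ, y') = (V₁ y' r μ, V₂ y' r μ) := by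
        have : ∀ᶠ y' in 𝓝 y, |y'| < σ₀ / 3 := continuous_abs.continuousAt.eventually (gt_mem_nhds hy)
        exact this.mono fun y' hy' => hvV r μ y' hr hμ hy'
      have k1 : d₁ = r * D.1 := by
        refine h1.unique ((hd₁.const_mul r).congr_of_eventuallyEq (hloc.mono fun y' h => ?_))
        simp only [h]
      have k2 : d₂ = r * D.2 := by
        refine h2.unique ((hd₂.const_mul r).congr_of_eventuallyEq (hloc.mono fun y' h => ?_))
        simp only [h]
      rw [← k1, ← k2]
      exact ⟨h3, h4⟩

end

section

/-! ### Smooth dependence of solutions on parameters -/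

section Volterra

theorem intervalIntegrable_IccExtend {X : Type} [NormedAddCommGroup X] {T : ℝ}
    (hT : 0 ≤ T) (g : C(Icc 0 T, X)) (a b : ℝ) :
    IntervalIntegrable (IccExtend hT g) volume a b :=
  (g.continuous.Icc_extend' (h := hT)).intervalIntegrable a b

variable {X : Type} [NormedAddCommGroup X] [NormedSpace ℝ X] [CompleteSpace X] {T : ℝ} (hT : 0 ≤ T)

/-- The primitive that vanishes at the left endpoint. -/
def volterra : C(Icc 0 T, X) →L[ℝ] C(Icc 0 T, X) :=
  LinearMap.mkContinuous
    { toFun := fun g => ⟨fun t => ∫ s in (0 : ℝ)..t, IccExtend hT g s,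
        (intervalIntegral.continuous_primitive (intervalIntegrable_IccExtend hT g) 0).comp
          continuous_subtype_val⟩
      map_add' := fun g₁ g₂ => by
        ext t
        simp only [ContinuousMap.coe_mk, ContinuousMap.add_apply]
        rw [← intervalIntegral.integral_add (intervalIntegrable_IccExtend hT g₁ _ _)
          (intervalIntegrable_IccExtend hT g₂ _ _)]
        rfl
      map_smul' := fun c g => by
        ext t
        simp only [ContinuousMap.coe_mk, ContinuousMap.smul_apply, RingHom.id_apply]
        rw [← intervalIntegral.integral_smul]
        rfl } T
    (fun g => by
      rw [ContinuousMap.norm_le _ (by positivity)]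
      intro t
      have := intervalIntegral.norm_integral_le_of_norm_le_const (a := 0) (b := t)
        (f := IccExtend hT g) (C := ‖g‖) (fun s _ => g.norm_coe_le_norm _)
      refine this.trans ?_
      rw [sub_zero, abs_of_nonneg t.2.1, mul_comm]
      exact mul_le_mul_of_nonneg_right t.2.2 (norm_nonneg _))

theorem volterra_apply (g : C(Icc 0 T, X)) (t : Icc 0 T) :
    volterra hT g t = ∫ s in (0 : ℝ)..t, IccExtend hT g s := rfl

theorem hasFDerivAt_volterra_comp {Y : Type} [NormedAddCommGroup Y] [NormedSpace ℝ Y]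
    {u : Y → C(Icc 0 T, X)} {L : Y →L[ℝ] C(Icc 0 T, X)} {y : Y} (h : HasFDerivAt u L y) :
    HasFDerivAt (fun y => volterra hT (u y)) ((volterra hT).comp L) y := by
  have h1 := ContinuousLinearMap.hasFDerivAt (volterra (X := X) hT) (x := u y)
  exact HasFDerivAt.comp y h1 h

/-- Iterated integration produces factorials, so that a power of the operator is a contraction. -/
theorem norm_volterra_pow_le (A : C(Icc 0 T, X →L[ℝ] X)) (m : ℕ) (δ : C(Icc 0 T, X))
    (t : Icc 0 T) :
    ‖(((volterra hT).comp (pointwiseApply (Icc 0 T) X X A)) ^ m) δ t‖ ≤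
      ‖δ‖ * ((‖A‖ * t) ^ m / m.factorial) := by
  have hA : 0 ≤ ‖A‖ := norm_nonneg A
  induction m generalizing t with
  | zero => simpa using δ.norm_coe_le_norm t
  | succ m ih =>
    set B := (volterra hT).comp (pointwiseApply (Icc 0 T) X X A)
    rw [pow_succ', mul_apply_eq_comp, ContinuousLinearMap.comp_apply, volterra_apply]
    have hb : ∀ s ∈ Ioc (0 : ℝ) t, ‖IccExtend hT (pointwiseApply (Icc 0 T) X X A ((B ^ m) δ)) s‖ ≤
        ‖A‖ * (‖δ‖ * (‖A‖ ^ m * s ^ m / m.factorial)) := by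
      intro s hs
      have hs' : s ∈ Icc 0 T := ⟨hs.1.le, hs.2.trans t.2.2⟩
      rw [IccExtend_of_mem _ _ hs', pointwiseApply_apply]
      refine ((A _).le_opNorm _).trans (mul_le_mul (A.norm_coe_le_norm _) ?_ (norm_nonneg _) hA)
      have := ih ⟨s, hs'⟩
      rwa [mul_pow] at this
    have h1 := intervalIntegral.norm_integral_le_of_norm_le t.2.1
      (g := fun s => ‖A‖ * (‖δ‖ * (‖A‖ ^ m * s ^ m / m.factorial)))
      (μ := volume) (Eventually.of_forall hb) (Continuous.intervalIntegrable (by fun_prop) _ _)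
    refine h1.trans (le_of_eq ?_)
    have h2 : ∀ s : ℝ, ‖A‖ * (‖δ‖ * (‖A‖ ^ m * s ^ m / m.factorial)) =
        (‖δ‖ * ‖A‖ ^ (m + 1) / m.factorial) * s ^ m := fun s => by ring
    simp only [h2]
    rw [intervalIntegral.integral_const_mul, integral_pow, Nat.factorial_succ]
    push_cast
    have h3 : (m.factorial : ℝ) ≠ 0 := by positivity
    have h4 : ((m : ℝ) + 1) ≠ 0 := by positivity
    field_simp
    ring

/-- Linear Volterra equations of the second kind are uniquely solvable. -/
theorem isUnit_one_sub_volterra (A : C(Icc 0 T, X →L[ℝ] X)) :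
    IsUnit (1 - (volterra hT).comp (pointwiseApply (Icc 0 T) X X A)) := by
  set B := (volterra hT).comp (pointwiseApply (Icc 0 T) X X A) with hB
  have hlim := FloorSemiring.tendsto_pow_div_factorial_atTop (‖A‖ * T)
  obtain ⟨m, hm⟩ := (hlim.eventually (gt_mem_nhds (show (0 : ℝ) < 1 / 2 by norm_num))).exists
  have hn : ‖B ^ m‖ ≤ 1 / 2 := by
    refine ContinuousLinearMap.opNorm_le_bound _ (by norm_num) fun δ => ?_
    rw [ContinuousMap.norm_le _ (by positivity)]
    intro t
    refine (norm_volterra_pow_le hT A m δ t).trans ?_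
    rw [mul_comm]
    refine mul_le_mul_of_nonneg_right (le_trans ?_ hm.le) (norm_nonneg _)
    have hA : 0 ≤ ‖A‖ := norm_nonneg A
    have h0 : 0 ≤ ‖A‖ * (t : ℝ) := mul_nonneg hA t.2.1
    have h1 : ‖A‖ * (t : ℝ) ≤ ‖A‖ * T := mul_le_mul_of_nonneg_left t.2.2 hA
    gcongr
  -- `1 - B ^ m` is invertible and a multiple of `1 - B`
  have hu : IsUnit (1 - B ^ m) := (Units.oneSub (B ^ m) (hn.trans_lt (by norm_num))).isUnit
  have hc : Commute (1 - B) (∑ i ∈ Finset.range m, B ^ i) :=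
    Commute.sum_right _ _ _ fun i _ => ((Commute.one_left _).sub_left (Commute.self_pow B i))
  rw [← mul_neg_geom_sum] at hu
  exact (hc.isUnit_mul_iff.1 hu).1

theorem isInvertible_of_isUnit {E : Type} [NormedAddCommGroup E] [NormedSpace ℝ E]
    {A : E →L[ℝ] E} (h : IsUnit A) : A.IsInvertible := by
  obtain ⟨u, rfl⟩ := h
  exact ⟨ContinuousLinearEquiv.unitsEquiv ℝ E u, rfl⟩

end Volterra

section Dependence

variable {P X : Type} [NormedAddCommGroup P] [NormedSpace ℝ P] [NormedAddCommGroup X]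
  [NormedSpace ℝ X] {T : ℝ}

/-- The superposition operator `(π, w) ↦ f (·, π, w (·))`. -/
def superpose (T : ℝ) (f : C(ℝ × P × X, X)) (q : P × C(Icc 0 T, X)) : C(Icc 0 T, X) :=
  f.comp ((⟨Subtype.val, continuous_subtype_val⟩ : C(Icc 0 T, ℝ)).prodMk
    ((ContinuousMap.const (Icc 0 T) q.1).prodMk q.2))

@[simp] theorem superpose_apply (f : C(ℝ × P × X, X)) (q : P × C(Icc 0 T, X)) (t : Icc 0 T) :
    superpose T f q t = f (t, q.1, q.2 t) := rfl

/-- The linear part of `(π, w) ↦ (t ↦ (t, π, w t))`. -/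
def graphCLM (P X : Type) [NormedAddCommGroup P] [NormedSpace ℝ P] [NormedAddCommGroup X]
    [NormedSpace ℝ X] (T : ℝ) : P × C(Icc 0 T, X) →L[ℝ] C(Icc 0 T, ℝ × P × X) :=
  LinearMap.mkContinuous
    { toFun := fun q => (ContinuousMap.const (Icc 0 T) (0 : ℝ)).prodMk
        ((ContinuousMap.const (Icc 0 T) q.1).prodMk q.2)
      map_add' := fun _ _ => by ext t <;> simp
      map_smul' := fun _ _ => by ext t <;> simp } 1 (fun q => by
        rw [one_mul, ContinuousMap.norm_le _ (norm_nonneg _)]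
        intro t
        change ‖((0 : ℝ), q.1, q.2 t)‖ ≤ ‖q‖
        simp only [Prod.norm_def, norm_zero]
        exact max_le (by positivity) (max_le_max le_rfl (q.2.norm_coe_le_norm t)))

theorem graphCLM_apply (q : P × C(Icc 0 T, X)) (t : Icc 0 T) :
    graphCLM P X T q t = (0, q.1, q.2 t) := rfl

theorem superpose_eq (f : C(ℝ × P × X, X)) : superpose T f =
    (fun u : C(Icc 0 T, ℝ × P × X) => f.comp u) ∘
    (fun q => (⟨fun t => ((t : ℝ), (0 : P), (0 : X)), by fun_prop⟩ : C(Icc 0 T, ℝ × P × X)) +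
      graphCLM P X T q) := by
  ext q t
  simp [graphCLM_apply]

theorem contDiff_superpose {n : ℕ} (f : C(ℝ × P × X, X)) (hf : ContDiff ℝ n f) :
    ContDiff ℝ n (superpose T f) := by
  rw [superpose_eq]
  exact (contDiff_postcomp f hf).comp (contDiff_const.add (graphCLM P X T).contDiff)

theorem hasFDerivAt_superpose (f : C(ℝ × P × X, X)) (hf : ContDiff ℝ 1 f)
    (q : P × C(Icc 0 T, X)) : ∃ L : P × C(Icc 0 T, X) →L[ℝ] C(Icc 0 T, X),
      HasFDerivAt (superpose T f) L q ∧
      ∀ p t, L p t = fderiv ℝ f (t, q.1, q.2 t) (0, p.1, p.2 t) := by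
  have h1 : Continuous (fderiv ℝ f) := hf.continuous_fderiv (by simp)
  set u : C(Icc 0 T, ℝ × P × X) :=
    (⟨fun t => ((t : ℝ), (0 : P), (0 : X)), by fun_prop⟩ : C(Icc 0 T, ℝ × P × X)) +
      graphCLM P X T q with hu
  have h2 := hasFDerivAt_postcomp f ⟨fderiv ℝ f, h1⟩
    (fun x => (hf.differentiable (by simp) x).hasFDerivAt) u
  refine ⟨(pointwiseApply (Icc 0 T) (ℝ × P × X) X
    ((⟨fderiv ℝ f, h1⟩ : C(ℝ × P × X, ℝ × P × X →L[ℝ] X)).comp u)).comp (graphCLM P X T), ?_, ?_⟩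
  · rw [superpose_eq]
    exact HasFDerivAt.comp q h2 ((graphCLM P X T).hasFDerivAt.const_add _)
  · intro p t
    simp [graphCLM_apply, hu]

variable [CompleteSpace P] [CompleteSpace X] (hT : 0 ≤ T)

/-- Near a parameter with a solution on `[0, T]` that starts at `0` there is a smooth family of such
solutions. -/
theorem exists_smooth_solutions {n : ℕ} (hn : n ≠ 0) (f : C(ℝ × P × X, X)) (hf : ContDiff ℝ n f)
    {π₀ : P} {w₀ : C(Icc 0 T, X)} (h₀ : w₀ = volterra hT (superpose T f (π₀, w₀))) :
    ∃ W : P → C(Icc 0 T, X), ContDiffAt ℝ n W π₀ ∧ W π₀ = w₀ ∧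
      ∀ᶠ π in 𝓝 π₀, W π = volterra hT (superpose T f (π, W π)) := by
  set Φ : P × C(Icc 0 T, X) → C(Icc 0 T, X) := fun q => q.2 - volterra hT (superpose T f q) with hΦ
  have hΦs : ContDiff ℝ n Φ :=
    contDiff_snd.sub ((volterra hT).contDiff.comp (contDiff_superpose f hf))
  have hn' : ((n : ℕ) : ℕ∞ω) ≠ 0 := by exact_mod_cast hn
  have hf1 : ContDiff ℝ 1 f := hf.of_le (by exact_mod_cast Nat.one_le_iff_ne_zero.2 hn)
  obtain ⟨L, hL, hL'⟩ := hasFDerivAt_superpose (T := T) f hf1 (π₀, w₀)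
  have hd : HasFDerivAt Φ (ContinuousLinearMap.snd ℝ P _ - (volterra hT).comp L) (π₀, w₀) :=
    HasFDerivAt.sub hasFDerivAt_snd (hasFDerivAt_volterra_comp hT hL)
  let A : C(Icc 0 T, X →L[ℝ] X) :=
    ⟨fun t => (fderiv ℝ f (t, π₀, w₀ t)).comp
      ((ContinuousLinearMap.inr ℝ ℝ (P × X)).comp (ContinuousLinearMap.inr ℝ P X)), by
      have h1 : Continuous (fderiv ℝ f) := hf1.continuous_fderiv (by simp)
      exact ((h1.comp (by fun_prop : Continuous fun t : Icc 0 T => ((t : ℝ), π₀, w₀ t)))).clm_comp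
        continuous_const⟩
  have hinv : (fderiv ℝ Φ (π₀, w₀) ∘L .inr ℝ P _).IsInvertible := by
    rw [hd.fderiv]
    have e : (ContinuousLinearMap.snd ℝ P _ - (volterra hT).comp L) ∘L
        ContinuousLinearMap.inr ℝ P C(Icc 0 T, X) =
        1 - (volterra hT).comp (pointwiseApply (Icc 0 T) X X A) := by
      ext1 δ
      have : L (0, δ) = pointwiseApply (Icc 0 T) X X A δ := by
        ext t
        rw [hL']
        rfl
      simp [this]
    rw [e]
    exact isInvertible_of_isUnit (isUnit_one_sub_volterra hT A)
  have hcd : ContDiffAt ℝ n Φ (π₀, w₀) := hΦs.contDiffAt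
  have hΦ0 : Φ (π₀, w₀) = 0 := by
    simp only [hΦ]; rw [← h₀, sub_self]
  refine ⟨hcd.implicitFunction hn' hinv, hcd.contDiffAt_implicitFunction hn' hinv,
    hcd.implicitFunction_apply_self hn' hinv, ?_⟩
  filter_upwards [hcd.eventually_apply_implicitFunction hn' hinv] with π hπ
  rw [hΦ0] at hπ
  exact sub_eq_zero.1 hπ

/-- The variational equation. -/
theorem variational_equation {f : C(ℝ × P × X, X)} (hf : ContDiff ℝ 1 f) {π₀ : P}
    {W : P → C(Icc 0 T, X)} (hW : DifferentiableAt ℝ W π₀)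
    (h : ∀ᶠ π in 𝓝 π₀, W π = volterra hT (superpose T f (π, W π))) (p : P) (t : Icc 0 T) :
    fderiv ℝ W π₀ p t = ∫ s in (0 : ℝ)..t,
      fderiv ℝ f (s, π₀, IccExtend hT (W π₀) s) (0, p, IccExtend hT (fderiv ℝ W π₀ p) s) := by
  obtain ⟨L, hL, hL'⟩ := hasFDerivAt_superpose (T := T) f hf (π₀, W π₀)
  have h1 : HasFDerivAt (fun π => (π, W π))
      ((ContinuousLinearMap.id ℝ P).prod (fderiv ℝ W π₀)) π₀ :=
    (hasFDerivAt_id π₀).prodMk hW.hasFDerivAt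
  have h2 : HasFDerivAt (fun π => volterra hT (superpose T f (π, W π)))
      ((volterra hT).comp (L.comp ((ContinuousLinearMap.id ℝ P).prod (fderiv ℝ W π₀)))) π₀ :=
    hasFDerivAt_volterra_comp hT (HasFDerivAt.comp (g := superpose T f) π₀ hL h1)
  have h3 := hW.hasFDerivAt.unique (h2.congr_of_eventuallyEq h)
  have h4 : fderiv ℝ W π₀ p = volterra hT (L (p, fderiv ℝ W π₀ p)) := by
    conv_lhs => rw [h3]
    rfl
  conv_lhs => rw [h4]
  rw [volterra_apply]
  refine intervalIntegral.integral_congr fun s hs => ?_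
  rw [uIcc_of_le t.2.1] at hs
  have hs' : s ∈ Icc 0 T := ⟨hs.1, hs.2.trans t.2.2⟩
  simp only [IccExtend_of_mem _ _ hs']
  rw [hL']

/-- Solutions of the integral equation solve the differential equation. -/
theorem hasDerivWithinAt_of_volterra {f : C(ℝ × P × X, X)} {π : P} {w : C(Icc 0 T, X)}
    (h : w = volterra hT (superpose T f (π, w))) {t : ℝ} (ht : t ∈ Icc 0 T) :
    HasDerivWithinAt (IccExtend hT w) (f (t, π, IccExtend hT w t)) (Icc 0 T) t := by
  set g := superpose T f (π, w) with hg
  have hc : Continuous (IccExtend hT g) := g.continuous.Icc_extend'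
  have h1 := (hc.integral_hasStrictDerivAt 0 t).hasDerivAt.hasDerivWithinAt (s := Icc 0 T)
  have e : IccExtend hT g t = f (t, π, IccExtend hT w t) := by
    rw [IccExtend_of_mem _ _ ht, IccExtend_of_mem _ _ ht]; rfl
  rw [← e]
  have h2 : ∀ s ∈ Icc 0 T, IccExtend hT w s = ∫ x in (0 : ℝ)..s, IccExtend hT g x := by
    intro s hs
    rw [IccExtend_of_mem _ _ hs]
    conv_lhs => rw [h]
    rw [volterra_apply]
  exact h1.congr h2 (h2 t ht)

/-- Solutions of the differential equation that start at `0` solve the integral equation. -/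
theorem volterra_of_hasDerivWithinAt {f : C(ℝ × P × X, X)} {π : P} {w : C(Icc 0 T, X)}
    (h0 : IccExtend hT w 0 = 0) (h : ∀ t ∈ Icc 0 T,
      HasDerivWithinAt (IccExtend hT w) (f (t, π, IccExtend hT w t)) (Icc 0 T) t) :
    w = volterra hT (superpose T f (π, w)) := by
  ext t
  rw [volterra_apply]
  have hc : ContinuousOn (IccExtend hT w) (Icc 0 (t : ℝ)) :=
    (w.continuous.Icc_extend' (h := hT)).continuousOn
  have h1 := intervalIntegral.integral_eq_sub_of_hasDerivAt_of_le t.2.1 hc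
    (f' := IccExtend hT (superpose T f (π, w))) (fun s hs => by
      have hs' : s ∈ Icc 0 T := ⟨hs.1.le, hs.2.le.trans t.2.2⟩
      have := (h s hs').hasDerivAt (Icc_mem_nhds hs.1 (hs.2.trans_le t.2.2))
      rw [IccExtend_of_mem _ _ hs', superpose_apply]
      rw [IccExtend_of_mem _ _ hs'] at this
      exact this) (intervalIntegrable_IccExtend hT _ _ _)
  rw [h1, h0, sub_zero, IccExtend_of_mem _ _ t.2]

/-- Uniqueness of solutions. -/
theorem volterra_unique [FiniteDimensional ℝ X] {f : C(ℝ × P × X, X)} (hf : ContDiff ℝ 1 f) {π : P}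
    {w w' : C(Icc 0 T, X)} (h : w = volterra hT (superpose T f (π, w)))
    (h' : w' = volterra hT (superpose T f (π, w'))) : w = w' := by
  set B := max ‖w‖ ‖w'‖
  have hcomp : IsCompact (Icc 0 T ×ˢ Metric.closedBall (0 : X) B) :=
    isCompact_Icc.prod (isCompact_closedBall 0 B)
  have hl : LocallyLipschitz (fun q : ℝ × X => f (q.1, π, q.2)) := by
    have : ContDiff ℝ 1 (fun q : ℝ × X => f (q.1, π, q.2)) := hf.comp (by fun_prop)
    exact this.locallyLipschitz
  obtain ⟨K, hK⟩ := hl.locallyLipschitzOn.exists_lipschitzOnWith_of_compact hcomp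
  have hmem : ∀ u : C(Icc 0 T, X), ‖u‖ ≤ B → ∀ t, IccExtend hT u t ∈ Metric.closedBall (0 : X) B :=
    fun u hu t => mem_closedBall_zero_iff.2 ((u.norm_coe_le_norm _).trans hu)
  have hder : ∀ u : C(Icc 0 T, X), u = volterra hT (superpose T f (π, u)) → ∀ t ∈ Ico 0 T,
      HasDerivWithinAt (IccExtend hT u) (f (t, π, IccExtend hT u t)) (Ici t) t := fun u hu t ht =>
    (hasDerivWithinAt_of_volterra hT hu ⟨ht.1, ht.2.le⟩).mono_of_mem_nhdsWithin
      (Icc_mem_nhdsGE_of_mem ht)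
  have h0 : ∀ u : C(Icc 0 T, X), u = volterra hT (superpose T f (π, u)) → IccExtend hT u 0 = 0 := by
    intro u hu
    rw [IccExtend_of_mem _ _ (left_mem_Icc.2 hT), hu, volterra_apply]
    simp
  have := ODE_solution_unique_of_mem_Icc_right (K := K) (a := 0) (b := T)
    (v := fun t x => f (t, π, x)) (s := fun _ => Metric.closedBall (0 : X) B)
    (f := IccExtend hT w) (g := IccExtend hT w')
    (fun t ht x hx y hy => by
      have := hK (x := (t, x)) ⟨⟨ht.1, ht.2.le⟩, hx⟩ (y := (t, y)) ⟨⟨ht.1, ht.2.le⟩, hy⟩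
      simpa [Prod.edist_eq] using this)
    (w.continuous.Icc_extend' (h := hT)).continuousOn (hder w h)
    (fun t _ => hmem w (le_max_left _ _) t)
    (w'.continuous.Icc_extend' (h := hT)).continuousOn (hder w' h')
    (fun t _ => hmem w' (le_max_right _ _) t) ((h0 w h).trans (h0 w' h').symm)
  ext t
  have h3 := this t.2
  rwa [IccExtend_of_mem _ _ t.2, IccExtend_of_mem _ _ t.2] at h3

end Dependence

end

section

/-! ### The periodic orbits of the limit system -/

/-- An injective endomorphism of a finite dimensional space is invertible. -/
theorem isInvertible_of_injective {E : Type} [NormedAddCommGroup E] [NormedSpace ℝ E]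
    [FiniteDimensional ℝ E] {L : E →L[ℝ] E} (h : ∀ x, L x = 0 → x = 0) : L.IsInvertible :=
  ⟨(LinearEquiv.ofInjectiveEndo (L : E →ₗ[ℝ] E)
    ((injective_iff_map_eq_zero _).2 h)).toContinuousLinearEquiv, by ext x; rfl⟩

/-- Up to the sign, the conserved quantity `e^{2 u₁} (u₁ + u₂² - 1/2)` of `u' = (-u₂, u₁ + u₂²)`
at the point `u = s (a, b)`. -/
def firstIntegral (a b s : ℝ) : ℝ := Real.exp (2 * (s * a)) * (1 / 2 - s * a - s ^ 2 * b ^ 2)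

section Angular

variable {a b s h : ℝ}

theorem sq_mul_angular (hab : a ^ 2 + b ^ 2 = 1) : s ^ 2 * (1 + s * a * b ^ 2) =
    (s * a) ^ 2 + s ^ 2 * b ^ 2 + (s * a) * (s ^ 2 * b ^ 2) := by
  linear_combination -(s ^ 2) * hab

/-- Inside the parabola `u₁ + u₂² = 1/2` the angular velocity is positive. -/
theorem angular_bound (hab : a ^ 2 + b ^ 2 = 1) (hp : 0 < 1 / 2 - s * a - s ^ 2 * b ^ 2) :
    min (s ^ 2 / 2) (1 / 4) ≤ s ^ 2 * (1 + s * a * b ^ 2) := by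
  rw [sq_mul_angular hab]
  have hs : s ^ 2 = (s * a) ^ 2 + s ^ 2 * b ^ 2 := by linear_combination -(s ^ 2) * hab
  have hw : 0 ≤ s ^ 2 * b ^ 2 := by positivity
  generalize s ^ 2 * b ^ 2 = w at *
  generalize s * a = u at *
  rw [hs]
  rcases le_or_gt (-1 / 2) u with hu | hu
  · refine (min_le_left _ _).trans ?_
    nlinarith [sq_nonneg u]
  · refine (min_le_right _ _).trans ?_
    rcases le_or_gt 0 (1 + u) with hu1 | hu1
    · nlinarith
    · nlinarith

theorem angular_pos (hab : a ^ 2 + b ^ 2 = 1) (hs : 0 ≤ s)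
    (hp : 0 < 1 / 2 - s * a - s ^ 2 * b ^ 2) : 0 < 1 + s * a * b ^ 2 := by
  rcases hs.eq_or_lt with rfl | hs
  · simp
  · have h1 := angular_bound hab hp
    have h2 : 0 < min (s ^ 2 / 2) (1 / 4) := lt_min (by positivity) (by norm_num)
    exact (mul_pos_iff_of_pos_left (by positivity)).1 (h2.trans_le h1)

/-- The part of the plane enclosed by the orbit through `(-h, 0)` lies in the disc of radius `h + 1`,
and the angular velocity is bounded below there. -/
theorem orbit_bound (hab : a ^ 2 + b ^ 2 = 1) (hs : 0 < s) (hh : 0 ≤ h)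
    (hJ : Real.exp (-(2 * h)) * (1 / 2 + h) ≤ firstIntegral a b s) :
    s ≤ h + 1 ∧ 1 / (4 * (h + 1) ^ 2) ≤ 1 + s * a * b ^ 2 := by
  have hc : 0 < Real.exp (-(2 * h)) * (1 / 2 + h) := by positivity
  have hp : 0 < 1 / 2 - s * a - s ^ 2 * b ^ 2 := by
    by_contra hcon
    have : firstIntegral a b s ≤ 0 := mul_nonpos_of_nonneg_of_nonpos (Real.exp_nonneg _)
      (not_lt.1 hcon)
    linarith
  have hw : 0 ≤ s ^ 2 * b ^ 2 := by positivity
  have hu : -h ≤ s * a := by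
    by_contra hcon
    set d := -h - s * a with hd
    have hd0 : 0 < d := by rw [hd]; linarith [not_le.1 hcon]
    have e1 : Real.exp (2 * (s * a)) = Real.exp (-(2 * h)) / Real.exp (2 * d) := by
      rw [← Real.exp_sub]; congr 1; rw [hd]; ring
    -- to the left of `u₁ = -h` the exponential factor makes the first integral too small
    have e2 : 2 * d + 1 < Real.exp (2 * d) := Real.add_one_lt_exp (by positivity)
    have e3 : firstIntegral a b s ≤ Real.exp (2 * (s * a)) * (1 / 2 + h + d) := by
      refine mul_le_mul_of_nonneg_left ?_ (Real.exp_nonneg _)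
      rw [hd]; linarith
    rw [e1, div_mul_eq_mul_div] at e3
    have e4 : Real.exp (-(2 * h)) * (1 / 2 + h + d) <
        Real.exp (-(2 * h)) * (1 / 2 + h) * Real.exp (2 * d) := by
      rw [mul_assoc]
      refine mul_lt_mul_of_pos_left ?_ (Real.exp_pos _)
      nlinarith [mul_nonneg hh hd0.le]
    have e5 := (div_lt_iff₀ (Real.exp_pos (2 * d))).2 e4
    linarith
  have hs2 : s ^ 2 = (s * a) ^ 2 + s ^ 2 * b ^ 2 := by linear_combination -(s ^ 2) * hab
  have hsq : s ^ 2 ≤ (h + 1) ^ 2 := by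
    have h1 : (s * a + h) * (s * a - h - 1) ≤ 0 :=
      mul_nonpos_of_nonneg_of_nonpos (by linarith) (by linarith)
    nlinarith
  have hsh : s ≤ h + 1 := by
    have := abs_le_of_sq_le_sq hsq (by linarith)
    exact (le_abs_self s).trans this
  refine ⟨hsh, ?_⟩
  have h1 := angular_bound hab hp
  have h2 : s ^ 2 * (1 / (4 * (h + 1) ^ 2)) ≤ min (s ^ 2 / 2) (1 / 4) := by
    have hpos : 0 < (h + 1) ^ 2 := by positivity
    rw [mul_one_div]
    refine le_min ?_ ?_
    · rw [div_le_div_iff₀ (by positivity) (by norm_num)]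
      have h3 : 1 ≤ (h + 1) ^ 2 := by nlinarith
      have := mul_le_mul_of_nonneg_left h3 (sq_nonneg s)
      linarith [sq_nonneg s]
    · rw [div_le_div_iff₀ (by positivity) (by norm_num)]
      nlinarith
  exact le_of_mul_le_mul_left (h2.trans h1) (by positivity)

theorem hasDerivAt_firstIntegral (hab : a ^ 2 + b ^ 2 = 1) (s : ℝ) :
    HasDerivAt (firstIntegral a b) (-(2 * s * Real.exp (2 * (s * a)) * (1 + s * a * b ^ 2))) s := by
  have h1 : HasDerivAt (fun s : ℝ => s * a) a s := by simpa using (hasDerivAt_id s).mul_const a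
  have h2 := ((h1.const_mul 2).exp).mul ((h1.const_sub (1 / 2)).sub ((hasDerivAt_pow 2 s).mul_const
    (b ^ 2)))
  refine h2.congr_deriv ?_
  simp only [Pi.sub_apply]
  push_cast
  linear_combination (-(2 * s * Real.exp (2 * (s * a)))) * hab

/-- An orbit of the limit system meets each ray from the origin only once: the conserved quantity
decreases along the ray as long as it is positive. -/
theorem firstIntegral_injective (hab : a ^ 2 + b ^ 2 = 1) {s₁ s₂ c : ℝ} (hc : 0 < c) (h1 : 0 < s₁)
    (h2 : 0 < s₂) (e1 : firstIntegral a b s₁ = c) (e2 : firstIntegral a b s₂ = c) : s₁ = s₂ := by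
  by_contra hne
  wlog hlt : s₁ < s₂ generalizing s₁ s₂
  · exact this h2 h1 e2 e1 (Ne.symm hne) (lt_of_le_of_ne (not_lt.1 hlt) (Ne.symm hne))
  have hp : ∀ s, 0 ≤ s → s ≤ s₂ → 0 < 1 / 2 - s * a - s ^ 2 * b ^ 2 := by
    intro s hs hs2
    have hp2 : 0 < 1 / 2 - s₂ * a - s₂ ^ 2 * b ^ 2 :=
      (mul_pos_iff_of_pos_left (Real.exp_pos _)).1 (e2 ▸ hc)
    have h3 : s₂ * (1 / 2 - s * a - s ^ 2 * b ^ 2) = s * (1 / 2 - s₂ * a - s₂ ^ 2 * b ^ 2) +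
        (s₂ - s) * (1 / 2) + s * s₂ * (s₂ - s) * b ^ 2 := by ring
    have h4 : 0 ≤ (s₂ - s) * (1 / 2) := by linarith
    have h5 : 0 ≤ s * s₂ * (s₂ - s) * b ^ 2 := by
      have : 0 ≤ s₂ - s := by linarith
      positivity
    rcases hs2.eq_or_lt with rfl | hs2
    · exact hp2
    · have h6 : 0 ≤ s * (1 / 2 - s₂ * a - s₂ ^ 2 * b ^ 2) := by positivity
      have h7 : 0 < s₂ * (1 / 2 - s * a - s ^ 2 * b ^ 2) := by rw [h3]; linarith
      exact (mul_pos_iff_of_pos_left h2).1 h7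
  have hanti : StrictAntiOn (firstIntegral a b) (Icc 0 s₂) := by
    refine strictAntiOn_of_hasDerivWithinAt_neg (convex_Icc _ _)
      (fun s _ => (hasDerivAt_firstIntegral hab s).continuousAt.continuousWithinAt)
      (fun s _ => (hasDerivAt_firstIntegral hab s).hasDerivWithinAt) fun s hs => ?_
    rw [interior_Icc] at hs
    have := angular_pos hab hs.1.le (hp s hs.1.le hs.2.le)
    have h3 := hs.1
    have : 0 < 2 * s * Real.exp (2 * (s * a)) * (1 + s * a * b ^ 2) := by positivity
    linarith
  have := hanti ⟨h1.le, hlt.le⟩ ⟨h2.le, le_rfl⟩ hlt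
  linarith

end Angular

/-- The orbits of `u' = (-u₂, u₁ + u₂²)` around the origin, in polar coordinates
`u = s (-cos ψ, -sin ψ)`, are closed. -/
theorem exists_reference {h : ℝ} (hh : 0 < h) : ∃ s : ℝ → ℝ, s 0 = h ∧ s (2 * Real.pi) = h ∧
    ∀ ψ, 0 < s ψ ∧ s ψ ≤ h + 1 ∧
      1 / (4 * (h + 1) ^ 2) ≤ 1 + s ψ * -Real.cos ψ * (-Real.sin ψ) ^ 2 ∧
      HasDerivAt s (s ψ ^ 2 * (-Real.sin ψ) ^ 3 /
        (1 + s ψ * -Real.cos ψ * (-Real.sin ψ) ^ 2)) ψ := by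
  set c := Real.exp (-(2 * h)) * (1 / 2 + h) with hc
  have hcpos : 0 < c := by positivity
  have hcs : ∀ ψ : ℝ, (-Real.cos ψ) ^ 2 + (-Real.sin ψ) ^ 2 = 1 := fun ψ => by
    rw [neg_sq, neg_sq, add_comm]; exact Real.sin_sq_add_cos_sq ψ
  have hchalf : c < 1 / 2 := by
    have e2 : 2 * h + 1 < Real.exp (2 * h) := Real.add_one_lt_exp (by positivity)
    rw [hc, Real.exp_neg, inv_mul_lt_iff₀ (Real.exp_pos _)]
    linarith
  have hex : ∀ ψ : ℝ, ∃ s, 0 < s ∧ firstIntegral (-Real.cos ψ) (-Real.sin ψ) s = c := by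
    intro ψ
    have hcont : ContinuousOn (firstIntegral (-Real.cos ψ) (-Real.sin ψ)) (Icc 0 (h + 2)) :=
      fun s _ => (hasDerivAt_firstIntegral (hcs ψ) s).continuousAt.continuousWithinAt
    have h0 : firstIntegral (-Real.cos ψ) (-Real.sin ψ) 0 = 1 / 2 := by simp [firstIntegral]
    have h1 : firstIntegral (-Real.cos ψ) (-Real.sin ψ) (h + 2) ≤ c := by
      by_contra hcon
      have := (orbit_bound (hcs ψ) (by linarith) hh.le (not_le.1 hcon).le).1
      linarith
    obtain ⟨s, hs, hs'⟩ := intermediate_value_Icc' (by linarith) hcont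
      ⟨h1, by rw [h0]; exact hchalf.le⟩
    refine ⟨s, lt_of_le_of_ne hs.1 ?_, hs'⟩
    rintro rfl
    linarith
  choose s hs hsJ using hex
  have huniq : ∀ ψ t, 0 < t → firstIntegral (-Real.cos ψ) (-Real.sin ψ) t = c → t = s ψ :=
    fun ψ t ht htJ => firstIntegral_injective (hcs ψ) hcpos ht (hs ψ) htJ (hsJ ψ)
  refine ⟨s, (huniq 0 h hh ?_).symm, (huniq (2 * Real.pi) h hh ?_).symm, fun ψ => ?_⟩
  · simp [firstIntegral, hc]
  · simp [firstIntegral, hc]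
  have hb := orbit_bound (hcs ψ) (hs ψ) hh.le (hsJ ψ).ge
  refine ⟨hs ψ, hb.1, hb.2, ?_⟩
  have hQ : 0 < 1 + s ψ * -Real.cos ψ * (-Real.sin ψ) ^ 2 :=
    lt_of_lt_of_le (by positivity) hb.2
  -- differentiability by the implicit function theorem
  set J : ℝ × ℝ → ℝ := fun q => firstIntegral (-Real.cos q.1) (-Real.sin q.1) q.2 with hJ
  have hJs : ContDiff ℝ 1 J := by
    simp only [hJ, firstIntegral]
    have := Real.contDiff_cos (n := 1)
    have := Real.contDiff_sin (n := 1)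
    fun_prop
  have hcd : ContDiffAt ℝ 1 J (ψ, s ψ) := hJs.contDiffAt
  have hpart : fderiv ℝ J (ψ, s ψ) (0, 1) = -(2 * s ψ * Real.exp (2 * (s ψ * -Real.cos ψ)) *
      (1 + s ψ * -Real.cos ψ * (-Real.sin ψ) ^ 2)) := by
    have h1 : HasDerivAt (fun t : ℝ => (ψ, t)) (0, 1) (s ψ) :=
      (hasDerivAt_const _ _).prodMk (hasDerivAt_id _)
    have h2 := (hcd.differentiableAt (by simp)).hasFDerivAt.comp_hasDerivAt (s ψ) h1
    exact h2.unique (hasDerivAt_firstIntegral (hcs ψ) (s ψ))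
  have hneg : fderiv ℝ J (ψ, s ψ) (0, 1) ≠ 0 := by
    rw [hpart]
    have := hs ψ
    have : 0 < 2 * s ψ * Real.exp (2 * (s ψ * -Real.cos ψ)) *
      (1 + s ψ * -Real.cos ψ * (-Real.sin ψ) ^ 2) := by positivity
    linarith
  have hinv : (fderiv ℝ J (ψ, s ψ) ∘L .inr ℝ ℝ ℝ).IsInvertible := by
    refine isInvertible_of_injective fun x hx => ?_
    have : (0, x) = x • ((0 : ℝ), (1 : ℝ)) := by simp
    rw [ContinuousLinearMap.comp_apply, ContinuousLinearMap.inr_apply, this, map_smul,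
      smul_eq_mul] at hx
    exact (mul_eq_zero.1 hx).resolve_right hneg
  set σ := hcd.implicitFunction one_ne_zero hinv with hσ
  have hσ0 : σ ψ = s ψ := hcd.implicitFunction_apply_self one_ne_zero hinv
  have hσd : ContDiffAt ℝ 1 σ ψ := hcd.contDiffAt_implicitFunction one_ne_zero hinv
  have hσJ : ∀ᶠ t in 𝓝 ψ, J (t, σ t) = c := by
    filter_upwards [hcd.eventually_apply_implicitFunction one_ne_zero hinv] with t ht
    rw [ht]; exact hsJ ψ
  have hσs : σ =ᶠ[𝓝 ψ] s := by
    have hpos : ∀ᶠ t in 𝓝 ψ, 0 < σ t :=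
      hσd.continuousAt.eventually (lt_mem_nhds (by rw [hσ0]; exact hs ψ))
    filter_upwards [hσJ, hpos] with t h1 h2 using huniq t _ h2 h1
  have hd : HasDerivAt σ (deriv σ ψ) ψ := (hσd.differentiableAt (by simp)).hasDerivAt
  set d := deriv σ ψ
  -- differentiate the first integral along the curve
  have hc1 : HasDerivAt (fun t => σ t * -Real.cos t) (d * -Real.cos ψ + σ ψ * Real.sin ψ) ψ := by
    refine (hd.mul (Real.hasDerivAt_cos ψ).neg).congr_deriv ?_
    simp
  have hc2 : HasDerivAt (fun t => σ t ^ 2 * (-Real.sin t) ^ 2)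
      (2 * σ ψ * d * (-Real.sin ψ) ^ 2 + σ ψ ^ 2 * (2 * -Real.sin ψ * -Real.cos ψ)) ψ := by
    refine ((hd.pow 2).mul ((Real.hasDerivAt_sin ψ).neg.pow 2)).congr_deriv ?_
    simp
  have hJd : HasDerivAt (fun t => J (t, σ t)) _ ψ :=
    ((hc1.const_mul 2).exp).mul ((hc1.const_sub (1 / 2)).sub hc2)
  have hzero := hJd.unique ((hasDerivAt_const ψ c).congr_of_eventuallyEq hσJ)
  have hE := (Real.exp_pos (2 * (σ ψ * -Real.cos ψ))).ne'
  have hmain : d * (1 + s ψ * -Real.cos ψ * (-Real.sin ψ) ^ 2) = s ψ ^ 2 * (-Real.sin ψ) ^ 3 := by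
    have hsne := (hs ψ).ne'
    rw [hσ0] at hzero hE
    simp only at hzero
    have h0 : Real.exp (2 * (s ψ * -Real.cos ψ)) * (2 * s ψ) *
        (d * (1 + s ψ * -Real.cos ψ * (-Real.sin ψ) ^ 2) - s ψ ^ 2 * (-Real.sin ψ) ^ 3) = 0 := by
      linear_combination -hzero - Real.exp (2 * (s ψ * -Real.cos ψ)) * (2 * s ψ * d) * (hcs ψ)
    have h1 := (mul_eq_zero.1 h0).resolve_left (mul_ne_zero hE (mul_ne_zero two_ne_zero hsne))
    linarith
  have : s ψ ^ 2 * (-Real.sin ψ) ^ 3 / (1 + s ψ * -Real.cos ψ * (-Real.sin ψ) ^ 2) = d := by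
    rw [← hmain, mul_div_assoc, div_self hQ.ne', mul_one]
  rw [this]
  exact hd.congr_of_eventuallyEq hσs.symm

end

section

/-! ### The chart system in straightened coordinates -/

/-- The chart system near a slow manifold `(x, z) = m(y, r, μ₂)`, in the coordinates `u = ũ` and `y`:
`u' = U`, `y' = r g`, where `U` and `g` are functions of `(r, μ₂, y, u₁, u₂)` defined everywhere, and
`m = (-y², y) + r v` near the origin. The slow manifold is `u = 0`. -/
structure StraightChart (F G H : ℝ → ℝ → ℝ → ℝ → ℝ → ℝ) (k : ℕ) (m : ℝ → ℝ → ℝ → ℝ × ℝ) where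
  σ : ℝ
  σ_pos : 0 < σ
  v : ℝ × ℝ × ℝ → ℝ × ℝ
  U : ℝ × ℝ × ℝ × ℝ × ℝ → ℝ × ℝ
  g : ℝ × ℝ × ℝ × ℝ × ℝ → ℝ
  smooth_v : ContDiff ℝ (k + 4 : ℕ) v
  smooth_U : ContDiff ℝ (k + 3 : ℕ) U
  smooth_g : ContDiff ℝ (k + 3 : ℕ) g
  m_eq : ∀ r μ y : ℝ, |r| < σ → |μ| < σ → |y| < σ → m y r μ = (-y ^ 2, y) + r • v (r, μ, y)
  U_zero : ∀ r μ y, U (r, μ, y, 0, 0) = 0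
  U_lim : ∀ μ y a b, U (0, μ, y, a, b) = (-b, a + 2 * y * b + b ^ 2)
  g_lim : ∀ μ y a b, g (0, μ, y, a, b) = μ / 2 + lam G * y + a₂ G * b
  /-- On bounded sets the coordinate change conjugates the two systems, for small `(r, μ₂, y)`. -/
  transfer : ∀ B : ℝ, ∃ τ > 0, τ ≤ σ ∧ ∀ r μ y a b : ℝ, |r| < τ → |μ| < τ → |y| < τ → |a| ≤ B →
    |b| ≤ B → ∀ D : ℝ × ℝ, D = fderiv ℝ v (r, μ, y) (0, 0, 1) →
      chartField F G H r (r * μ) (-y ^ 2 + r * (v (r, μ, y)).1 + a, y, y + r * (v (r, μ, y)).2 + b) =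
        (r * g (r, μ, y, a, b) * (-2 * y + r * D.1) + (U (r, μ, y, a, b)).1, r * g (r, μ, y, a, b),
          r * g (r, μ, y, a, b) * (1 + r * D.2) + (U (r, μ, y, a, b)).2) ∧
      slowRate G r μ (-y ^ 2 + r * (v (r, μ, y)).1 + a, y, y + r * (v (r, μ, y)).2 + b) =
        g (r, μ, y, a, b) ∧
      (r ≠ 0 → ContDiffAt ℝ ∞ (fun q : ℝ × ℝ × ℝ × ℝ => chartField F G H r q.1 q.2)
        (r * μ, -y ^ 2 + r * (v (r, μ, y)).1 + a, y, y + r * (v (r, μ, y)).2 + b))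

variable {F G H : ℝ → ℝ → ℝ → ℝ → ℝ → ℝ}

/-- For `r ≠ 0` the right hand side is smooth in all variables and in `μ = r μ₂`. -/
theorem ChartData.contDiffAt_chartField (N : ChartData F G H) {r μ x y z : ℝ} (hr : r ≠ 0)
    (h1 : |r ^ 2 * x| < N.ρ) (h2 : |r * y| < N.ρ) (h3 : |r * z| < N.ρ) (h4 : |r ^ 2| < N.ρ)
    (h5 : |r * μ| < N.ρ) :
    ContDiffAt ℝ ∞ (fun q : ℝ × ℝ × ℝ × ℝ => chartField F G H r q.1 q.2) (r * μ, x, y, z) := by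
  have hf := N.smooth_f
  have hg := N.smooth_g
  have hh := N.smooth_h
  have hs : ContDiff ℝ ∞ fun q : ℝ × ℝ × ℝ × ℝ =>
      (q.2.2.1 - (q.1 + 1) * q.2.2.2 + r * N.f (r, q.1 / r, q.2.1, q.2.2.1, q.2.2.2),
        r * (q.1 / r / 2 + a₁ G * q.2.2.1 + a₂ G * q.2.2.2 +
          r * N.g (r, q.1 / r, q.2.1, q.2.2.1, q.2.2.2)),
        q.2.1 + q.2.2.2 ^ 2 + r * (q.2.2.2 * N.h (r, q.1 / r, q.2.1, q.2.2.1, q.2.2.2))) := by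
    fun_prop
  refine hs.contDiffAt.congr_of_eventuallyEq ?_
  have hlt : ∀ φ : ℝ × ℝ × ℝ × ℝ → ℝ, Continuous φ → |φ (r * μ, x, y, z)| < N.ρ →
      ∀ᶠ q in 𝓝 (r * μ, x, y, z), |φ q| < N.ρ := fun φ hφ h =>
    hφ.abs.continuousAt.eventually (gt_mem_nhds h)
  filter_upwards [hlt (fun q => r ^ 2 * q.2.1) (by fun_prop) h1, hlt (fun q => r * q.2.2.1)
    (by fun_prop) h2, hlt (fun q => r * q.2.2.2) (by fun_prop) h3, hlt (fun q => q.1)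
    (by fun_prop) h5] with q k1 k2 k3 k5
  have e : r * (q.1 / r) = q.1 := mul_div_cancel₀ _ hr
  have := N.field_eq r (q.1 / r) q.2.1 q.2.2.1 q.2.2.2 k1 k2 k3 h4 (by rwa [e])
  rw [e] at this
  exact this

/-- Invariance of the slow manifold is what makes `U` vanish for `u = 0`. -/
theorem exists_straightChart (N : ChartData F G H) {k : ℕ} {m : ℝ → ℝ → ℝ → ℝ × ℝ} {σ : ℝ}
    (hσ : 0 < σ) {v : ℝ × ℝ × ℝ → ℝ × ℝ} (hv : ContDiff ℝ (k + 4 : ℕ) v)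
    (hm : ∀ r μ y : ℝ, |r| < σ → |μ| < σ → |y| < σ → m y r μ = (-y ^ 2, y) + r • v (r, μ, y) ∧
      ∀ x z g : ℝ, ∀ D : ℝ × ℝ, D = fderiv ℝ v (r, μ, y) (0, 0, 1) →
        x = -y ^ 2 + r * (v (r, μ, y)).1 → z = y + r * (v (r, μ, y)).2 →
        g = μ / 2 + a₁ G * y + a₂ G * z + r * N.g (r, μ, x, y, z) →
          y - (r * μ + 1) * z + r * N.f (r, μ, x, y, z) = r * (g * (-2 * y + r * D.1)) ∧
          x + z ^ 2 + r * (z * N.h (r, μ, x, y, z)) = r * (g * (1 + r * D.2))) :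
    ∃ S : StraightChart F G H k m, S.σ = σ := by
  set D : ℝ × ℝ × ℝ → ℝ × ℝ := fun p => fderiv ℝ v p (0, 0, 1) with hD
  have hv3 : ContDiff ℝ (k + 3 : ℕ) v := hv.of_le (by norm_cast; omega)
  have hDs : ContDiff ℝ (k + 3 : ℕ) D :=
    (hv.fderiv_right (m := (k + 3 : ℕ)) (by norm_cast)).clm_apply contDiff_const
  set x : ℝ × ℝ × ℝ × ℝ × ℝ → ℝ := fun q =>
    -q.2.2.1 ^ 2 + q.1 * (v (q.1, q.2.1, q.2.2.1)).1 + q.2.2.2.1 with hx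
  set z : ℝ × ℝ × ℝ × ℝ × ℝ → ℝ := fun q =>
    q.2.2.1 + q.1 * (v (q.1, q.2.1, q.2.2.1)).2 + q.2.2.2.2 with hz
  set P : ℝ × ℝ × ℝ × ℝ × ℝ → ℝ × ℝ × ℝ × ℝ × ℝ := fun q =>
    (q.1, q.2.1, x q, q.2.2.1, z q) with hP
  set g : ℝ × ℝ × ℝ × ℝ × ℝ → ℝ := fun q =>
    q.2.1 / 2 + a₁ G * q.2.2.1 + a₂ G * z q + q.1 * N.g (P q) with hg
  -- the components of `u'`: the field of the chart minus the motion of the slow manifold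
  set X₁ : ℝ × ℝ × ℝ × ℝ × ℝ → ℝ := fun q => q.2.2.1 - (q.1 * q.2.1 + 1) * z q + q.1 * N.f (P q) -
    q.1 * (g q * (-2 * q.2.2.1 + q.1 * (D (q.1, q.2.1, q.2.2.1)).1)) with hX₁
  set X₂ : ℝ × ℝ × ℝ × ℝ × ℝ → ℝ := fun q => x q + z q ^ 2 + q.1 * (z q * N.h (P q)) -
    q.1 * (g q * (1 + q.1 * (D (q.1, q.2.1, q.2.2.1)).2)) with hX₂
  set b : ℝ × ℝ × ℝ × ℝ × ℝ → ℝ × ℝ × ℝ × ℝ × ℝ := fun q => (q.1, q.2.1, q.2.2.1, 0, 0) with hb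
  have hxs : ContDiff ℝ (k + 3 : ℕ) x := by fun_prop
  have hzs : ContDiff ℝ (k + 3 : ℕ) z := by fun_prop
  have hPs : ContDiff ℝ (k + 3 : ℕ) P := by fun_prop
  have hNf : ContDiff ℝ (k + 3 : ℕ) N.f := contDiff_infty.1 N.smooth_f _
  have hNg : ContDiff ℝ (k + 3 : ℕ) N.g := contDiff_infty.1 N.smooth_g _
  have hNh : ContDiff ℝ (k + 3 : ℕ) N.h := contDiff_infty.1 N.smooth_h _
  have hgs : ContDiff ℝ (k + 3 : ℕ) g := by
    have : ContDiff ℝ (k + 3 : ℕ) fun q : ℝ × ℝ × ℝ × ℝ × ℝ => q.2.1 / 2 + a₁ G * q.2.2.1 := by fun_prop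
    exact (this.add (contDiff_const.mul hzs)).add (contDiff_fst.mul (hNg.comp hPs))
  have hX₁s : ContDiff ℝ (k + 3 : ℕ) X₁ := by fun_prop
  have hX₂s : ContDiff ℝ (k + 3 : ℕ) X₂ := by fun_prop
  have hbs : ContDiff ℝ (k + 3 : ℕ) b := by fun_prop
  have hX0 : ∀ r μ y : ℝ, |r| < σ → |μ| < σ → |y| < σ →
      X₁ (r, μ, y, 0, 0) = 0 ∧ X₂ (r, μ, y, 0, 0) = 0 := by
    intro r μ y hr hμ hy
    obtain ⟨h1, h2⟩ := (hm r μ y hr hμ hy).2 (x (r, μ, y, 0, 0)) (z (r, μ, y, 0, 0))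
      (g (r, μ, y, 0, 0)) (D (r, μ, y)) rfl (by simp [hx]) (by simp [hz]) rfl
    exact ⟨sub_eq_zero.2 h1, sub_eq_zero.2 h2⟩
  -- the subtracted terms vanish near the origin; subtracting them makes `U` vanish on `u = 0`
  -- everywhere
  refine ⟨⟨σ, hσ, v, fun q => (X₁ q - X₁ (b q), X₂ q - X₂ (b q)), g, hv,
    (hX₁s.sub (hX₁s.comp hbs)).prodMk (hX₂s.sub (hX₂s.comp hbs)), hgs,
    fun r μ y hr hμ hy => (hm r μ y hr hμ hy).1, fun r μ y => ?_, fun μ y a c => ?_,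
    fun μ y a c => ?_, fun B => ?_⟩, rfl⟩
  · simp [hb]
  · simp only [hX₁, hX₂, hb, hx, hz, Prod.mk.injEq]
    constructor <;> ring
  · simp only [hg, hz, lam]; ring
  · -- the estimates hold for `(r, μ, y) = 0` and all bounded `u`
    have key : ∀ᶠ p : ℝ × ℝ × ℝ in 𝓝 0, ∀ u ∈ Icc (-B) B ×ˢ Icc (-B) B,
        |p.1 ^ 2 * x (p.1, p.2.1, p.2.2, u)| < N.ρ ∧ |p.1 * p.2.2| < N.ρ ∧
        |p.1 * z (p.1, p.2.1, p.2.2, u)| < N.ρ ∧ |p.1 ^ 2| < N.ρ ∧ |p.1 * p.2.1| < N.ρ := by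
      refine (isCompact_Icc.prod isCompact_Icc).eventually_forall_of_forall_eventually fun u _ => ?_
      have hρ := N.ρ_pos
      have hcx := hxs.continuous
      have hcz := hzs.continuous
      have hlt : ∀ φ : (ℝ × ℝ × ℝ) × ℝ × ℝ → ℝ, Continuous φ → φ (0, u) = 0 →
          ∀ᶠ w in 𝓝 ((0 : ℝ × ℝ × ℝ), u), |φ w| < N.ρ := fun φ hφ h0 =>
        hφ.abs.continuousAt.eventually (gt_mem_nhds (by simpa [h0] using hρ))
      refine (hlt (fun w => w.1.1 ^ 2 * x (w.1.1, w.1.2.1, w.1.2.2, w.2)) (by fun_prop)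
        (by simp)).and ((hlt (fun w => w.1.1 * w.1.2.2) (by fun_prop) (by simp)).and
        ((hlt (fun w => w.1.1 * z (w.1.1, w.1.2.1, w.1.2.2, w.2)) (by fun_prop) (by simp)).and
        ((hlt (fun w => w.1.1 ^ 2) (by fun_prop) (by simp)).and
        (hlt (fun w => w.1.1 * w.1.2.1) (by fun_prop) (by simp)))))
    obtain ⟨τ, hτ, hball⟩ := Metric.eventually_nhds_iff.1 key
    refine ⟨min τ σ, lt_min hτ hσ, min_le_right _ _, fun r μ y a c hr hμ hy ha hc D' hD' => ?_⟩
    obtain ⟨h1, h2, h3, h4, h5⟩ := hball (y := (r, μ, y)) (by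
      rw [dist_zero_right, Prod.norm_def, Prod.norm_def]
      exact max_lt (hr.trans_le (min_le_left _ _)) (max_lt (hμ.trans_le (min_le_left _ _))
        (hy.trans_le (min_le_left _ _)))) (a, c) ⟨abs_le.1 ha, abs_le.1 hc⟩
    obtain ⟨e1, e2⟩ := hX0 r μ y (hr.trans_le (min_le_right _ _)) (hμ.trans_le (min_le_right _ _))
      (hy.trans_le (min_le_right _ _))
    have f1 := N.field_eq r μ _ y _ h1 h2 h3 h4 h5
    have f2 := N.rate_eq r μ _ y _ h1 h2 h3 h4 h5
    refine ⟨f1.trans ?_, f2, fun hr0 => N.contDiffAt_chartField hr0 h1 h2 h3 h4 h5⟩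
    have hb' : b (r, μ, y, a, c) = (r, μ, y, 0, 0) := rfl
    simp only [hb', e1, e2, hD', sub_zero, Prod.mk.injEq]
    refine ⟨?_, rfl, ?_⟩
    · simp only [hX₁, hD]; ring
    · simp only [hX₂, hD]; ring

end

section

/-! ### Zero branches over a compact interval -/

/-- If `D` vanishes for `(y, r, μ) = 0` and the implicit function theorem applies there for every
`h` in the interval `[0, h₁]`, the zeros of `D` near that interval form a graph over `(h, r)`. -/
theorem exists_zeroBranch {k n : ℕ} (hkn : k ≤ n) (hn : n ≠ 0) {h₁ : ℝ}
    {D : ℝ × ℝ × ℝ × ℝ → ℝ × ℝ} (hD : ∀ h ∈ Icc 0 h₁, ContDiffAt ℝ n D (h, 0, 0, 0))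
    (hD0 : ∀ h ∈ Icc 0 h₁, D (h, 0, 0, 0) = 0)
    (hinj : ∀ h ∈ Icc 0 h₁, ∀ y μ : ℝ, fderiv ℝ D (h, 0, 0, 0) (0, y, 0, μ) = 0 → y = 0 ∧ μ = 0) :
    ∀ᶠ η in 𝓝[>] (0 : ℝ), ∀ᶠ r₀ in 𝓝[>] (0 : ℝ), ∃ Y M : ℝ → ℝ → ℝ, IsZeroBranch k h₁ η r₀ D Y M := by
  set L : (ℝ × ℝ) × (ℝ × ℝ) →L[ℝ] ℝ × ℝ × ℝ × ℝ :=
    ((ContinuousLinearMap.fst ℝ ℝ ℝ).comp (ContinuousLinearMap.fst ℝ (ℝ × ℝ) (ℝ × ℝ))).prod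
    (((ContinuousLinearMap.fst ℝ ℝ ℝ).comp (ContinuousLinearMap.snd ℝ (ℝ × ℝ) (ℝ × ℝ))).prod
    (((ContinuousLinearMap.snd ℝ ℝ ℝ).comp (ContinuousLinearMap.fst ℝ (ℝ × ℝ) (ℝ × ℝ))).prod
    ((ContinuousLinearMap.snd ℝ ℝ ℝ).comp (ContinuousLinearMap.snd ℝ (ℝ × ℝ) (ℝ × ℝ))))) with hL
  have hLa : ∀ h r y μ : ℝ, L ((h, r), (y, μ)) = (h, y, r, μ) := fun _ _ _ _ => rfl
  have hn' : (n : ℕ∞ω) ≠ 0 := by exact_mod_cast hn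
  have himp : ∀ h ∈ Icc 0 h₁, ∃ Z : ℝ × ℝ → ℝ × ℝ, ContDiffAt ℝ n Z (h, 0) ∧ Z (h, 0) = 0 ∧
      (∀ᶠ q in 𝓝 (h, (0 : ℝ)), D (q.1, (Z q).1, q.2, (Z q).2) = 0) ∧
      ∀ᶠ w in 𝓝 ((h, (0 : ℝ)), (0 : ℝ × ℝ)), D (L w) = 0 → Z w.1 = w.2 := by
    intro h hh
    have hcd : ContDiffAt ℝ n (fun w => D (L w)) ((h, 0), 0) :=
      ContDiffAt.comp _ (by exact hD h hh) L.contDiff.contDiffAt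
    have hfd : fderiv ℝ (fun w => D (L w)) ((h, 0), 0) = (fderiv ℝ D (h, 0, 0, 0)).comp L := by
      have h1 : HasFDerivAt D (fderiv ℝ D (h, 0, 0, 0)) (L ((h, 0), 0)) :=
        ((hD h hh).differentiableAt hn').hasFDerivAt
      exact (h1.comp _ L.hasFDerivAt).fderiv
    have hinv : (fderiv ℝ (fun w => D (L w)) ((h, 0), 0) ∘L .inr ℝ (ℝ × ℝ) (ℝ × ℝ)).IsInvertible := by
      refine isInvertible_of_injective fun w hw => ?_
      rw [hfd] at hw
      obtain ⟨h1, h2⟩ := hinj h hh w.1 w.2 hw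
      exact Prod.ext h1 h2
    have h0 : D (L ((h, 0), 0)) = 0 := hD0 h hh
    refine ⟨hcd.implicitFunction hn' hinv, hcd.contDiffAt_implicitFunction hn' hinv,
      hcd.implicitFunction_apply_self hn' hinv, ?_, ?_⟩
    · filter_upwards [hcd.eventually_apply_implicitFunction hn' hinv] with q hq
      rw [h0] at hq
      exact hq
    · filter_upwards [hcd.eventually_apply_eq_iff_implicitFunction hn' hinv] with w hw h1
      exact hw.1 (by rw [h1, h0])
  -- uniqueness, uniformly in `h`
  have huniq : ∀ᶠ p : ℝ × (ℝ × ℝ) × (ℝ × ℝ) in 𝓝 0, ∀ h ∈ Icc 0 h₁,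
      D (h, p.2.1.1, p.1, p.2.1.2) = 0 → D (h, p.2.2.1, p.1, p.2.2.2) = 0 → p.2.1 = p.2.2 := by
    refine isCompact_Icc.eventually_forall_of_forall_eventually fun h hh => ?_
    obtain ⟨Z, -, -, -, hZ⟩ := himp h hh
    have t1 : Tendsto (fun q : (ℝ × (ℝ × ℝ) × (ℝ × ℝ)) × ℝ => ((q.2, q.1.1), q.1.2.1))
        (𝓝 (0, h)) (𝓝 ((h, 0), 0)) := by
      have : Continuous (fun q : (ℝ × (ℝ × ℝ) × (ℝ × ℝ)) × ℝ => ((q.2, q.1.1), q.1.2.1)) := by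
        fun_prop
      exact this.tendsto _
    have t2 : Tendsto (fun q : (ℝ × (ℝ × ℝ) × (ℝ × ℝ)) × ℝ => ((q.2, q.1.1), q.1.2.2))
        (𝓝 (0, h)) (𝓝 ((h, 0), 0)) := by
      have : Continuous (fun q : (ℝ × (ℝ × ℝ) × (ℝ × ℝ)) × ℝ => ((q.2, q.1.1), q.1.2.2)) := by
        fun_prop
      exact this.tendsto _
    filter_upwards [t1.eventually hZ, t2.eventually hZ] with q q1 q2 h1 h2
    exact (q1 h1).symm.trans (q2 h2)
  -- existence, uniformly in `h`
  have hex : ∀ η > 0, ∀ᶠ r in 𝓝 (0 : ℝ), ∀ h ∈ Icc 0 h₁, ∃ Z : ℝ × ℝ → ℝ × ℝ,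
      ContDiffAt ℝ k Z (h, r) ∧ ∀ᶠ q in 𝓝 (h, r), |(Z q).1| < η ∧ |(Z q).2| < η ∧
        D (q.1, (Z q).1, q.2, (Z q).2) = 0 := by
    intro η hη
    refine isCompact_Icc.eventually_forall_of_forall_eventually fun h hh => ?_
    obtain ⟨Z, hZs, hZ0, hZ, -⟩ := himp h hh
    have hc1 : ContinuousAt (fun q => |(Z q).1|) (h, 0) :=
      (continuous_fst.continuousAt.comp hZs.continuousAt).abs
    have hc2 : ContinuousAt (fun q => |(Z q).2|) (h, 0) :=
      (continuous_snd.continuousAt.comp hZs.continuousAt).abs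
    have hall := ((hZs.of_le (show (k : ℕ∞ω) ≤ n by exact_mod_cast hkn)).eventually (by simp)).and
      ((hc1.eventually (gt_mem_nhds (by simpa [hZ0] using hη))).and
      ((hc2.eventually (gt_mem_nhds (by simpa [hZ0] using hη))).and hZ)).eventually_nhds
    have hswap : Tendsto (fun q : ℝ × ℝ => (q.2, q.1)) (𝓝 (0, h)) (𝓝 (h, 0)) :=
      continuous_swap.tendsto _
    filter_upwards [hswap.eventually hall] with q hq
    exact ⟨Z, hq.1, hq.2⟩
  obtain ⟨η₀, hη₀, hball⟩ := Metric.eventually_nhds_iff.1 huniq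
  filter_upwards [Ioo_mem_nhdsGT hη₀] with η hη
  obtain ⟨r₁, hr₁, hballr⟩ := Metric.eventually_nhds_iff.1 (hex η hη.1)
  filter_upwards [Ioo_mem_nhdsGT (lt_min hr₁ hη₀)] with r₀ hr₀
  have huniq' : ∀ h ∈ Icc 0 h₁, ∀ r ∈ Icc 0 r₀, ∀ z z' : ℝ × ℝ, |z.1| ≤ η → |z.2| ≤ η →
      |z'.1| ≤ η → |z'.2| ≤ η → D (h, z.1, r, z.2) = 0 → D (h, z'.1, r, z'.2) = 0 → z = z' := by
    intro h hh r hr z z' h1 h2 h3 h4 e1 e2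
    refine hball (y := (r, z, z')) ?_ h hh e1 e2
    have hr' : |r| < η₀ := by
      rw [abs_of_nonneg hr.1]; exact hr.2.trans_lt (hr₀.2.trans_le (min_le_right _ _))
    simp only [dist_zero_right, Prod.norm_def, Real.norm_eq_abs]
    have := hη.2
    exact max_lt hr' (max_lt (max_lt (h1.trans_lt this) (h2.trans_lt this))
      (max_lt (h3.trans_lt this) (h4.trans_lt this)))
  have hex' : ∀ h ∈ Icc 0 h₁, ∀ r ∈ Icc 0 r₀, ∃ Z : ℝ × ℝ → ℝ × ℝ,
      ContDiffAt ℝ k Z (h, r) ∧ ∀ᶠ q in 𝓝 (h, r), |(Z q).1| < η ∧ |(Z q).2| < η ∧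
        D (q.1, (Z q).1, q.2, (Z q).2) = 0 := by
    intro h hh r hr
    refine hballr (y := r) ?_ h hh
    rw [dist_zero_right, Real.norm_eq_abs, abs_of_nonneg hr.1]
    exact hr.2.trans_lt (hr₀.2.trans_le (min_le_left _ _))
  have hpt : ∀ q : ℝ × ℝ, ∃ z : ℝ × ℝ, q ∈ Icc 0 h₁ ×ˢ Icc 0 r₀ →
      |z.1| < η ∧ |z.2| < η ∧ D (q.1, z.1, q.2, z.2) = 0 := by
    intro q
    by_cases hq : q ∈ Icc 0 h₁ ×ˢ Icc 0 r₀
    · obtain ⟨Z, -, hZ⟩ := hex' q.1 hq.1 q.2 hq.2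
      exact ⟨Z q, fun _ => hZ.self_of_nhds⟩
    · exact ⟨0, fun h => absurd h hq⟩
  choose z hz using hpt
  have hzs : ContDiffOn ℝ k z (Icc 0 h₁ ×ˢ Icc 0 r₀) := by
    intro q hq
    obtain ⟨Z, hZs, hZ⟩ := hex' q.1 hq.1 q.2 hq.2
    have heq : ∀ᶠ p in 𝓝[Icc 0 h₁ ×ˢ Icc 0 r₀] q, z p = Z p := by
      filter_upwards [self_mem_nhdsWithin, mem_nhdsWithin_of_mem_nhds hZ] with p hp hpZ
      obtain ⟨h1, h2, h3⟩ := hz p hp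
      exact huniq' p.1 hp.1 p.2 hp.2 _ _ h1.le h2.le hpZ.1.le hpZ.2.1.le h3 hpZ.2.2
    exact hZs.contDiffWithinAt.congr_of_eventuallyEq heq (heq.self_of_nhdsWithin hq)
  have h0r : (0 : ℝ) ∈ Icc 0 r₀ := ⟨le_rfl, hr₀.1.le⟩
  have hz0 : ∀ h ∈ Icc 0 h₁, z (h, 0) = 0 := fun h hh => by
    obtain ⟨h1, h2, h3⟩ := hz (h, 0) ⟨hh, h0r⟩
    refine huniq' h hh 0 h0r _ 0 h1.le h2.le ?_ ?_ h3 (hD0 h hh) <;> simp [hη.1.le]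
  refine ⟨fun h r => (z (h, r)).1, fun h r => (z (h, r)).2, ?_, ?_, ?_, ?_, ?_, ?_, ?_⟩
  · exact contDiff_fst.comp_contDiffOn hzs
  · exact contDiff_snd.comp_contDiffOn hzs
  · intro h hh; simp [hz0 h hh]
  · intro h hh; simp [hz0 h hh]
  · intro h hh r hr
    obtain ⟨h1, h2, -⟩ := hz (h, r) ⟨hh, hr⟩
    exact ⟨hh, abs_le.1 h1.le, hr, abs_le.1 h2.le⟩
  · intro h hh r hr
    exact (hz (h, r) ⟨hh, hr⟩).2.2
  · intro h y r μ hbox h0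
    obtain ⟨h1, h2, h3⟩ := hz (h, r) ⟨hbox.1, hbox.2.2.1⟩
    have := huniq' h hbox.1 r hbox.2.2.1 (y, μ) _ (abs_le.2 hbox.2.1) (abs_le.2 hbox.2.2.2) h1.le
      h2.le h0 h3
    exact ⟨congrArg Prod.fst this, congrArg Prod.snd this⟩

end

section

/-! ### Polar coordinates -/

/-- A smooth function that equals `x⁻¹` for `x ≥ c`. -/
def recip (c x : ℝ) : ℝ := Real.smoothTransition ((x - c / 2) / (c / 2)) * x⁻¹

theorem recip_eq {c x : ℝ} (hc : 0 < c) (hx : c ≤ x) : recip c x = x⁻¹ := by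
  rw [recip, Real.smoothTransition.one_of_one_le, one_mul]
  rw [le_div_iff₀ (by positivity)]; linarith

theorem contDiff_recip {c : ℝ} (hc : 0 < c) {n : ℕ∞} : ContDiff ℝ n (recip c) := by
  refine contDiff_iff_contDiffAt.2 fun x => ?_
  rcases lt_or_ge x (c / 2) with hx | hx
  · have : recip c =ᶠ[𝓝 x] fun _ => 0 := by
      filter_upwards [gt_mem_nhds hx] with y hy
      rw [recip, Real.smoothTransition.zero_of_nonpos, zero_mul]
      exact div_nonpos_of_nonpos_of_nonneg (by linarith) (by positivity)
    exact contDiffAt_const.congr_of_eventuallyEq this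
  · have h1 : ContDiff ℝ n fun x : ℝ => (x - c / 2) / (c / 2) :=
      (contDiff_id.sub contDiff_const).div_const _
    exact (Real.smoothTransition.contDiff.comp h1).contDiffAt.mul
      (contDiffAt_inv ℝ (by linarith [half_pos hc]))

namespace StraightChart

variable {F G H : ℝ → ℝ → ℝ → ℝ → ℝ → ℝ} {k : ℕ} {m : ℝ → ℝ → ℝ → ℝ × ℝ}

/-- The field `U` vanishes on the slow manifold, hence is divisible by the radius `s` in polar
coordinates. The quotient extends to `s = 0`, where it is the linearization: this is the blow-up of
the slow manifold, at the cost of one derivative. -/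
theorem exists_radial (S : StraightChart F G H k m) :
    ∃ V : ℝ × (ℝ × ℝ × ℝ × ℝ × ℝ) → ℝ × ℝ, ContDiff ℝ (k + 2 : ℕ) V ∧
      (∀ s r μ y a b, S.U (r, μ, y, s * a, s * b) = s • V (s, (r, μ, y, a, b))) ∧
      (∀ s μ y a b, V (s, (0, μ, y, a, b)) = (-b, a + 2 * y * b + s * b ^ 2)) ∧
      ∀ r μ y a b, V (0, (r, μ, y, a, b)) = fderiv ℝ S.U (r, μ, y, 0, 0) (0, 0, 0, a, b) := by
  set j : ℝ × (ℝ × ℝ × ℝ × ℝ × ℝ) → ℝ × ℝ × ℝ × ℝ × ℝ := fun q =>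
    (q.2.1, q.2.2.1, q.2.2.2.1, q.1 * q.2.2.2.2.1, q.1 * q.2.2.2.2.2) with hj
  have hjs : ContDiff ℝ (k + 3 : ℕ) j := by fun_prop
  have hs : ContDiff ℝ ((k + 2 : ℕ) + 1) (fun q => S.U (j q)) := S.smooth_U.comp hjs
  -- division of `U(r, μ₂, y, s a, s b)` by `s`
  obtain ⟨V, h1, h2⟩ := exists_eq_smul_of_eq_zero (g := fun q => S.U (j q))
    (fun e => by simp [hj, S.U_zero])
  obtain ⟨h3, h4⟩ := h2 (hs.of_le (by norm_cast; omega))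
  have hVs := h1 _ hs
  refine ⟨V, hVs, fun s r μ y a b => h3 s (r, μ, y, a, b), fun s μ y a b => ?_,
    fun r μ y a b => ?_⟩
  · -- both sides are continuous in `s`, and agree for `s ≠ 0`
    have e1 : Continuous fun s => V (s, (0, μ, y, a, b)) := hVs.continuous.comp (by fun_prop)
    have e2 : Continuous fun s : ℝ => ((-b, a + 2 * y * b + s * b ^ 2) : ℝ × ℝ) := by fun_prop
    refine congrFun (Continuous.ext_on (dense_compl_singleton (0 : ℝ)) e1 e2 fun s hs => ?_) s
    have h5 := h3 s (0, μ, y, a, b)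
    simp only [hj, S.U_lim] at h5
    have hs' : s ≠ 0 := hs
    have h6 : s • V (s, (0, μ, y, a, b)) = s • ((-b, a + 2 * y * b + s * b ^ 2) : ℝ × ℝ) := by
      rw [← h5]; ext <;> simp only [Prod.smul_mk, smul_eq_mul] <;> ring
    exact smul_right_injective _ hs' h6
  · rw [h4]
    have hd : HasDerivAt (fun s : ℝ => j (s, (r, μ, y, a, b))) (0, 0, 0, a, b) 0 := by
      refine (hasDerivAt_const _ _).prodMk ((hasDerivAt_const _ _).prodMk
        ((hasDerivAt_const _ _).prodMk ?_))
      exact (hasDerivAt_mul_const a).prodMk (hasDerivAt_mul_const b)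
    have hU : HasFDerivAt S.U (fderiv ℝ S.U (r, μ, y, 0, 0)) (j (0, (r, μ, y, a, b))) := by
      have := (S.smooth_U.differentiable (by simp)) (r, μ, y, 0, 0)
      simpa [hj] using this.hasFDerivAt
    have e1 := hU.comp_hasDerivAt (0 : ℝ) hd
    have hi : HasDerivAt (fun s : ℝ => (s, ((r, μ, y, a, b) : ℝ × ℝ × ℝ × ℝ × ℝ))) (1, 0) 0 :=
      (hasDerivAt_id _).prodMk (hasDerivAt_const _ _)
    have e2 := ((hs.differentiable (by simp)) (0, (r, μ, y, a, b))).hasFDerivAt.comp_hasDerivAt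
      (0 : ℝ) hi
    exact e2.unique e1

/-- `U(s a, s b) = s V(s, a, b)`. -/
def V (S : StraightChart F G H k m) : ℝ × (ℝ × ℝ × ℝ × ℝ × ℝ) → ℝ × ℝ := S.exists_radial.choose

variable (S : StraightChart F G H k m)

theorem smooth_V : ContDiff ℝ (k + 2 : ℕ) S.V := S.exists_radial.choose_spec.1

theorem U_eq (s r μ y a b : ℝ) : S.U (r, μ, y, s * a, s * b) = s • S.V (s, (r, μ, y, a, b)) :=
  S.exists_radial.choose_spec.2.1 s r μ y a b

theorem V_lim (s μ y a b : ℝ) : S.V (s, (0, μ, y, a, b)) = (-b, a + 2 * y * b + s * b ^ 2) :=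
  S.exists_radial.choose_spec.2.2.1 s μ y a b

theorem V_zero (r μ y a b : ℝ) :
    S.V (0, (r, μ, y, a, b)) = fderiv ℝ S.U (r, μ, y, 0, 0) (0, 0, 0, a, b) :=
  S.exists_radial.choose_spec.2.2.2 r μ y a b

/-- The radius `s = h eˡ`, as a function of the angle, the parameters `(h, y₀, r, μ₂)` and the state
`(l, q, t)`. -/
def rad (p : ℝ × (ℝ × ℝ × ℝ × ℝ) × (ℝ × ℝ × ℝ)) : ℝ := p.2.1.1 * Real.exp p.2.2.1

/-- The slow variable `y = y₀ + r q`. -/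
def slow (p : ℝ × (ℝ × ℝ × ℝ × ℝ) × (ℝ × ℝ × ℝ)) : ℝ := p.2.1.2.1 + p.2.1.2.2.1 * p.2.2.2.1

/-- The velocity `u' / s`. -/
def vel (p : ℝ × (ℝ × ℝ × ℝ × ℝ) × (ℝ × ℝ × ℝ)) : ℝ × ℝ :=
  S.V (rad p, (p.2.1.2.2.1, p.2.1.2.2.2, slow p, -Real.cos p.1, -Real.sin p.1))

/-- The angular velocity. -/
def ang (p : ℝ × (ℝ × ℝ × ℝ × ℝ) × (ℝ × ℝ × ℝ)) : ℝ :=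
  Real.sin p.1 * (S.vel p).1 - Real.cos p.1 * (S.vel p).2

/-- The slow velocity `y' / r`. -/
def rate (p : ℝ × (ℝ × ℝ × ℝ × ℝ) × (ℝ × ℝ × ℝ)) : ℝ :=
  S.g (p.2.1.2.2.1, p.2.1.2.2.2, slow p, rad p * -Real.cos p.1, rad p * -Real.sin p.1)

/-- The system in the polar coordinates `u = h eˡ (-cos ψ, -sin ψ)`, `y = y₀ + r q`, with the angle
`ψ` as independent variable and the time `t` as a dependent one. It is modified where the angular
velocity is less than `c`. -/
def polar (c : ℝ) (p : ℝ × (ℝ × ℝ × ℝ × ℝ) × (ℝ × ℝ × ℝ)) : ℝ × ℝ × ℝ :=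
  ((-Real.cos p.1 * (S.vel p).1 - Real.sin p.1 * (S.vel p).2) * recip c (S.ang p),
    S.rate p * recip c (S.ang p), recip c (S.ang p))

theorem contDiff_rad {n : ℕ} : ContDiff ℝ n rad :=
  contDiff_snd.fst.fst.mul (Real.contDiff_exp.comp contDiff_snd.snd.fst)

theorem contDiff_slow {n : ℕ} : ContDiff ℝ n slow := by unfold slow; fun_prop

theorem contDiff_vel : ContDiff ℝ (k + 2 : ℕ) S.vel := by
  have h1 : ContDiff ℝ (k + 2 : ℕ) fun p : ℝ × (ℝ × ℝ × ℝ × ℝ) × (ℝ × ℝ × ℝ) => -Real.cos p.1 :=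
    (Real.contDiff_cos.comp contDiff_fst).neg
  have h2 : ContDiff ℝ (k + 2 : ℕ) fun p : ℝ × (ℝ × ℝ × ℝ × ℝ) × (ℝ × ℝ × ℝ) => -Real.sin p.1 :=
    (Real.contDiff_sin.comp contDiff_fst).neg
  refine S.smooth_V.comp (contDiff_rad.prodMk (ContDiff.prodMk ?_ (ContDiff.prodMk ?_
    (contDiff_slow.prodMk (h1.prodMk h2))))) <;> fun_prop

theorem contDiff_ang : ContDiff ℝ (k + 2 : ℕ) S.ang := by
  have h1 : ContDiff ℝ (k + 2 : ℕ) fun p : ℝ × (ℝ × ℝ × ℝ × ℝ) × (ℝ × ℝ × ℝ) => Real.cos p.1 :=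
    Real.contDiff_cos.comp contDiff_fst
  have h2 : ContDiff ℝ (k + 2 : ℕ) fun p : ℝ × (ℝ × ℝ × ℝ × ℝ) × (ℝ × ℝ × ℝ) => Real.sin p.1 :=
    Real.contDiff_sin.comp contDiff_fst
  exact (h2.mul S.contDiff_vel.fst).sub (h1.mul S.contDiff_vel.snd)

theorem contDiff_rate : ContDiff ℝ (k + 2 : ℕ) S.rate := by
  have h1 : ContDiff ℝ (k + 2 : ℕ) fun p : ℝ × (ℝ × ℝ × ℝ × ℝ) × (ℝ × ℝ × ℝ) => -Real.cos p.1 :=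
    (Real.contDiff_cos.comp contDiff_fst).neg
  have h2 : ContDiff ℝ (k + 2 : ℕ) fun p : ℝ × (ℝ × ℝ × ℝ × ℝ) × (ℝ × ℝ × ℝ) => -Real.sin p.1 :=
    (Real.contDiff_sin.comp contDiff_fst).neg
  refine (S.smooth_g.of_le (by norm_cast; omega)).comp (ContDiff.prodMk ?_ (ContDiff.prodMk ?_
    (contDiff_slow.prodMk ((contDiff_rad.mul h1).prodMk (contDiff_rad.mul h2))))) <;> fun_prop

theorem contDiff_polar {c : ℝ} (hc : 0 < c) : ContDiff ℝ (k + 2 : ℕ) (S.polar c) := by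
  have h1 : ContDiff ℝ (k + 2 : ℕ) fun p : ℝ × (ℝ × ℝ × ℝ × ℝ) × (ℝ × ℝ × ℝ) => -Real.cos p.1 :=
    (Real.contDiff_cos.comp contDiff_fst).neg
  have h2 : ContDiff ℝ (k + 2 : ℕ) fun p : ℝ × (ℝ × ℝ × ℝ × ℝ) × (ℝ × ℝ × ℝ) => Real.sin p.1 :=
    Real.contDiff_sin.comp contDiff_fst
  have h3 : ContDiff ℝ (k + 2 : ℕ) fun p => recip c (S.ang p) :=
    (contDiff_recip (n := (k + 2 : ℕ)) hc).comp S.contDiff_ang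
  exact (((h1.mul S.contDiff_vel.fst).sub (h2.mul S.contDiff_vel.snd)).mul h3).prodMk
    ((S.contDiff_rate.mul h3).prodMk h3)

theorem two_pi_nonneg : (0 : ℝ) ≤ 2 * Real.pi := Real.two_pi_pos.le

/-- `w` is the solution of the polar system on `[0, 2π]` with the parameters `π`; it starts
at `(0, 0, 0)`. -/
def IsPolar {c : ℝ} (hc : 0 < c) (π : ℝ × ℝ × ℝ × ℝ) (w : C(Icc 0 (2 * Real.pi), ℝ × ℝ × ℝ)) :
    Prop :=
  w = volterra two_pi_nonneg (superpose (2 * Real.pi)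
    ⟨S.polar c, (S.contDiff_polar hc).continuous⟩ (π, w))

open Classical in
/-- The solution of the polar system on `[0, 2π]`, if it exists. -/
def sol {c : ℝ} (hc : 0 < c) (π : ℝ × ℝ × ℝ × ℝ) : C(Icc 0 (2 * Real.pi), ℝ × ℝ × ℝ) :=
  if h : ∃ w, S.IsPolar hc π w then h.choose else 0

variable {S} {c : ℝ} {hc : 0 < c} {π : ℝ × ℝ × ℝ × ℝ}
  {w : C(Icc 0 (2 * Real.pi), ℝ × ℝ × ℝ)}

theorem IsPolar.sol_eq (h : S.IsPolar hc π w) : S.sol hc π = w := by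
  have hex : ∃ w, S.IsPolar hc π w := ⟨w, h⟩
  rw [sol, dif_pos hex]
  exact volterra_unique two_pi_nonneg ((S.contDiff_polar hc).of_le (by norm_cast; omega))
    hex.choose_spec h

/-- The solution depends smoothly on the parameters, in the space of continuous functions. -/
theorem IsPolar.contDiffAt (h : S.IsPolar hc π w) : ContDiffAt ℝ (k + 2 : ℕ) (S.sol hc) π ∧
    ∀ᶠ π' in 𝓝 π, S.IsPolar hc π' (S.sol hc π') := by
  obtain ⟨W, hW, -, hev⟩ := exists_smooth_solutions two_pi_nonneg (Nat.succ_ne_zero _)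
    (⟨S.polar c, (S.contDiff_polar hc).continuous⟩ : C(_, _)) (S.contDiff_polar hc) h
  have heq : ∀ᶠ π' in 𝓝 π, S.sol hc π' = W π' := hev.mono fun π' h' => IsPolar.sol_eq h'
  refine ⟨hW.congr_of_eventuallyEq heq, ?_⟩
  filter_upwards [hev, heq] with π' h1 h2
  rw [h2]; exact h1

/-- Conditions that are strict along a solution persist under small changes of the parameters. -/
theorem IsPolar.eventually_lt (h : S.IsPolar hc π w)
    {φ : ℝ × (ℝ × ℝ × ℝ × ℝ) × (ℝ × ℝ × ℝ) → ℝ} (hφ : Continuous φ) {ε : ℝ}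
    (hlt : ∀ ψ : Icc 0 (2 * Real.pi), φ (ψ, π, w ψ) < ε) :
    ∀ᶠ π' in 𝓝 π, ∀ ψ : Icc 0 (2 * Real.pi), φ (ψ, π', S.sol hc π' ψ) < ε := by
  have hcont : ContinuousAt (S.sol hc) π := h.contDiffAt.1.continuousAt
  have key : ∀ᶠ π' in 𝓝 π, ∀ ψ ∈ (univ : Set (Icc 0 (2 * Real.pi))),
      φ (ψ, π', S.sol hc π' ψ) < ε := by
    refine isCompact_univ.eventually_forall_of_forall_eventually fun ψ _ => ?_
    have h1 : ContinuousAt (fun q : (ℝ × ℝ × ℝ × ℝ) × Icc 0 (2 * Real.pi) =>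
        φ (q.2, q.1, S.sol hc q.1 q.2)) (π, ψ) := by
      refine hφ.continuousAt.comp (ContinuousAt.prodMk (by fun_prop) (ContinuousAt.prodMk
        continuousAt_fst ?_))
      have h2 : ContinuousAt (fun q : (ℝ × ℝ × ℝ × ℝ) × Icc 0 (2 * Real.pi) =>
          (S.sol hc q.1, q.2)) (π, ψ) :=
        (ContinuousAt.comp (f := Prod.fst) (x := (π, ψ)) hcont continuousAt_fst).prodMk
          continuousAt_snd
      exact (ContinuousEval.continuous_eval (F := C(Icc 0 (2 * Real.pi), ℝ × ℝ × ℝ))).continuousAt.comp h2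
    refine h1.eventually (gt_mem_nhds ?_)
    simp only [h.sol_eq]
    exact hlt ψ
  exact key.mono fun π' h' ψ => h' ψ (mem_univ _)

theorem IsPolar.start (h : S.IsPolar hc π w) : IccExtend two_pi_nonneg w 0 = 0 := by
  rw [IccExtend_of_mem _ _ ⟨le_rfl, two_pi_nonneg⟩, h, volterra_apply]
  simp

/-- Recognition of the solution. -/
theorem isPolar_of_hasDerivAt {l q t : ℝ → ℝ} (h0 : l 0 = 0 ∧ q 0 = 0 ∧ t 0 = 0)
    (h : ∀ ψ ∈ Icc 0 (2 * Real.pi),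
      HasDerivAt (fun ψ => (l ψ, q ψ, t ψ)) (S.polar c (ψ, π, (l ψ, q ψ, t ψ))) ψ) :
    ∃ w : C(Icc 0 (2 * Real.pi), ℝ × ℝ × ℝ), S.IsPolar hc π w ∧
      ∀ ψ : Icc 0 (2 * Real.pi), w ψ = (l ψ, q ψ, t ψ) := by
  refine ⟨⟨fun ψ => (l ψ, q ψ, t ψ), continuous_iff_continuousAt.2 fun ψ => ?_⟩, ?_, fun ψ => rfl⟩
  · exact (h ψ ψ.2).continuousAt.comp continuousAt_subtype_val
  · refine volterra_of_hasDerivWithinAt two_pi_nonneg ?_ fun ψ hψ => ?_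
    · rw [IccExtend_of_mem _ _ ⟨le_rfl, two_pi_nonneg⟩]
      simp [h0]
    · rw [IccExtend_of_mem _ _ hψ]
      refine (h ψ hψ).hasDerivWithinAt.congr_of_mem (fun x hx => ?_) hψ
      rw [IccExtend_of_mem _ _ hx]; rfl

end StraightChart

end

section

/-! ### The limit of the polar system -/

namespace StraightChart

variable {F G H : ℝ → ℝ → ℝ → ℝ → ℝ → ℝ} {k : ℕ} {m : ℝ → ℝ → ℝ → ℝ × ℝ}
  (S : StraightChart F G H k m)

theorem vel_lim (ψ h y μ : ℝ) (w : ℝ × ℝ × ℝ) : S.vel (ψ, (h, y, 0, μ), w) =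
    (Real.sin ψ, -Real.cos ψ - 2 * y * Real.sin ψ + h * Real.exp w.1 * Real.sin ψ ^ 2) := by
  simp only [vel, rad, slow, V_lim, zero_mul, add_zero, neg_neg, Prod.mk.injEq, true_and]
  ring

theorem ang_lim (ψ h y μ : ℝ) (w : ℝ × ℝ × ℝ) : S.ang (ψ, (h, y, 0, μ), w) =
    1 + 2 * y * (Real.sin ψ * Real.cos ψ) -
      h * Real.exp w.1 * (Real.cos ψ * Real.sin ψ ^ 2) := by
  simp only [ang, vel_lim]
  linear_combination Real.sin_sq_add_cos_sq ψ

theorem polar_lim (c ψ h y μ : ℝ) (w : ℝ × ℝ × ℝ) : S.polar c (ψ, (h, y, 0, μ), w) =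
    ((2 * y * Real.sin ψ ^ 2 - h * Real.exp w.1 * Real.sin ψ ^ 3) *
        recip c (S.ang (ψ, (h, y, 0, μ), w)),
      (μ / 2 + lam G * y - a₂ G * (h * Real.exp w.1 * Real.sin ψ)) *
        recip c (S.ang (ψ, (h, y, 0, μ), w)), recip c (S.ang (ψ, (h, y, 0, μ), w))) := by
  simp only [polar, vel_lim, rate, rad, slow, S.g_lim, zero_mul, add_zero, Prod.mk.injEq, and_true]
  constructor <;> ring

/-- The closed orbits of the limit system, as solutions of the polar system for `r = y = 0`: the
slow variable changes by `μ₂ T / 2` during one turn. -/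
theorem exists_isPolar {c : ℝ} (hc : 0 < c) {h : ℝ} (hh : 0 ≤ h)
    (hch : 2 * c ≤ 1 / (4 * (h + 1) ^ 2)) : ∃ T > 0, ∀ μ, ∃ w, S.IsPolar hc (h, 0, 0, μ) w ∧
      (IccExtend two_pi_nonneg w (2 * Real.pi)).1 = 0 ∧
      (IccExtend two_pi_nonneg w (2 * Real.pi)).2.1 = μ * T / 2 ∧
      ∀ ψ : Icc 0 (2 * Real.pi), 2 * c ≤ S.ang (ψ, (h, 0, 0, μ), w ψ) ∧
        |rad (ψ, (h, 0, 0, μ), w ψ)| ≤ h + 1 := by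
  -- the logarithm of the radius; for `h = 0` it is constant
  obtain ⟨l, hl0, hl1, hl⟩ : ∃ l : ℝ → ℝ, l 0 = 0 ∧ l (2 * Real.pi) = 0 ∧ ∀ ψ,
      h * Real.exp (l ψ) ≤ h + 1 ∧
      2 * c ≤ 1 - h * Real.exp (l ψ) * (Real.cos ψ * Real.sin ψ ^ 2) ∧
      HasDerivAt l (-(h * Real.exp (l ψ) * Real.sin ψ ^ 3) /
        (1 - h * Real.exp (l ψ) * (Real.cos ψ * Real.sin ψ ^ 2))) ψ := by
    rcases hh.eq_or_lt with rfl | hpos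
    · refine ⟨fun _ => 0, rfl, rfl, fun ψ => ⟨by simp, ?_, ?_⟩⟩
      · norm_num at hch ⊢; linarith
      · simpa using hasDerivAt_const ψ (0 : ℝ)
    · obtain ⟨s, hs0, hs1, hs⟩ := exists_reference hpos
      have he : ∀ ψ, h * Real.exp (Real.log (s ψ / h)) = s ψ := fun ψ => by
        rw [Real.exp_log (div_pos (hs ψ).1 hpos)]; field_simp
      refine ⟨fun ψ => Real.log (s ψ / h), by simp [hs0, hpos.ne'], by simp [hs1, hpos.ne'],
        fun ψ => ?_⟩
      obtain ⟨h1, h2, h3, h4⟩ := hs ψ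
      have e : 1 - s ψ * (Real.cos ψ * Real.sin ψ ^ 2) =
        1 + s ψ * -Real.cos ψ * (-Real.sin ψ) ^ 2 := by ring
      simp only [he, e]
      refine ⟨h2, hch.trans h3, ?_⟩
      have hQ : 0 < 1 + s ψ * -Real.cos ψ * (-Real.sin ψ) ^ 2 := lt_of_lt_of_le (by positivity) h3
      refine ((h4.div_const h).log (div_pos h1 hpos).ne').congr_deriv ?_
      field_simp
  set Q : ℝ → ℝ := fun ψ => 1 - h * Real.exp (l ψ) * (Real.cos ψ * Real.sin ψ ^ 2) with hQ
  have hQpos : ∀ ψ, 0 < Q ψ := fun ψ => lt_of_lt_of_le (by positivity) (hl ψ).2.1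
  have hlc : Continuous l := continuous_iff_continuousAt.2 fun ψ => (hl ψ).2.2.continuousAt
  have hQc : Continuous fun ψ => (Q ψ)⁻¹ := by
    refine Continuous.inv₀ ?_ fun ψ => (hQpos ψ).ne'
    have := Real.continuous_exp.comp hlc
    simp only [hQ]; fun_prop
  set t : ℝ → ℝ := fun ψ => ∫ x in (0 : ℝ)..ψ, (Q x)⁻¹ with ht
  have htd : ∀ ψ, HasDerivAt t (Q ψ)⁻¹ ψ := fun ψ => (hQc.integral_hasStrictDerivAt 0 ψ).hasDerivAt
  have hT : 0 < t (2 * Real.pi) :=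
    intervalIntegral.intervalIntegral_pos_of_pos (hQc.intervalIntegrable _ _)
      (fun ψ => inv_pos.2 (hQpos ψ)) Real.two_pi_pos
  refine ⟨t (2 * Real.pi), hT, fun μ => ?_⟩
  have hang : ∀ ψ q t, S.ang (ψ, (h, 0, 0, μ), (l ψ, q, t)) = Q ψ := fun ψ q t => by
    rw [ang_lim]; simp only [hQ]; ring
  -- the slow equation is integrable since `u₂ = -u₁'` along the orbits
  set q : ℝ → ℝ := fun ψ => a₂ G * (h * Real.exp (l ψ) * Real.cos ψ - h) + μ * t ψ / 2 with hq
  obtain ⟨w, hw, hws⟩ := S.isPolar_of_hasDerivAt (hc := hc) (π := (h, 0, 0, μ)) (l := l) (q := q)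
      (t := t) (by simp [hq, hl0, ht]) fun ψ _ => by
    have hrec : recip c (Q ψ) = (Q ψ)⁻¹ := recip_eq hc (by linarith [(hl ψ).2.1])
    have hlψ : HasDerivAt l _ ψ := (hl ψ).2.2
    have hqd : HasDerivAt q ((μ / 2 - a₂ G * (h * Real.exp (l ψ) * Real.sin ψ)) * (Q ψ)⁻¹) ψ := by
      refine (((((hlψ.exp.const_mul h).mul (Real.hasDerivAt_cos ψ)).sub_const h).const_mul
        (a₂ G)).add (((htd ψ).const_mul μ).div_const 2)).congr_deriv ?_
      have hne := (hQpos ψ).ne'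
      change a₂ G * (h * (Real.exp (l ψ) * (-(h * Real.exp (l ψ) * Real.sin ψ ^ 3) / Q ψ)) *
        Real.cos ψ + h * Real.exp (l ψ) * -Real.sin ψ) + μ * (Q ψ)⁻¹ / 2 = _
      field_simp
      simp only [hQ]
      ring
    refine HasDerivAt.congr_deriv (hlψ.prodMk (hqd.prodMk (htd ψ))) ?_
    rw [polar_lim, hang, hrec]
    simp only [hQ, div_eq_mul_inv, mul_zero, zero_mul, zero_sub, add_zero]
  have h2π : (2 * Real.pi) ∈ Icc 0 (2 * Real.pi) := ⟨two_pi_nonneg, le_rfl⟩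
  refine ⟨w, hw, ?_, ?_, fun ψ => ?_⟩
  · rw [IccExtend_of_mem _ _ h2π, hws]; exact hl1
  · rw [IccExtend_of_mem _ _ h2π, hws]; simp [hq, hl1]
  · rw [hws]
    refine ⟨(hl ψ).2.1.trans_eq (hang ψ _ _).symm, ?_⟩
    simp only [rad]
    rw [abs_of_nonneg (by positivity)]
    exact (hl ψ).1

end StraightChart

end

section

/-! ### The Melnikov function -/

namespace StraightChart

variable {F G H : ℝ → ℝ → ℝ → ℝ → ℝ → ℝ} {k : ℕ} {m : ℝ → ℝ → ℝ → ℝ × ℝ}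
  (S : StraightChart F G H k m)

/-- The angle `2π`. -/
def turn : Icc (0 : ℝ) (2 * Real.pi) := ⟨2 * Real.pi, two_pi_nonneg, le_rfl⟩

/-- The Melnikov function: after one turn `h` has become `h eˡ`, and `y` has changed by `r q`. -/
def melnikov {c : ℝ} (hc : 0 < c) (π : ℝ × ℝ × ℝ × ℝ) : ℝ × ℝ :=
  (1 - Real.exp (S.sol hc π turn).1, (S.sol hc π turn).2.1)

/-- In the variational equation along the limit orbits, the equation for the logarithm `l` of the
radius is decoupled from the others, and it is driven only by the perturbation of `y`, with a source
term of constant sign. -/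
theorem hasFDerivAt_polar_fst {c : ℝ} (hc : 0 < c) {ψ h : ℝ} {w : ℝ × ℝ × ℝ}
    (hw : c < S.ang (ψ, (h, 0, 0, 0), w)) : ∃ α : ℝ, ∀ y μ : ℝ, ∀ δ : ℝ × ℝ × ℝ,
      (fderiv ℝ (S.polar c) (ψ, (h, 0, 0, 0), w) (0, (0, y, 0, μ), δ)).1 =
        α * δ.1 + y * (2 * Real.sin ψ ^ 2 / S.ang (ψ, (h, 0, 0, 0), w) ^ 2) := by
  set Q := S.ang (ψ, (h, 0, 0, 0), w) with hQ
  have hQ' : Q = 1 - h * Real.exp w.1 * (Real.cos ψ * Real.sin ψ ^ 2) := by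
    rw [hQ, ang_lim]; ring
  have hQ0 : Q ≠ 0 := (hc.trans hw).ne'
  refine ⟨(-(h * Real.exp w.1 * Real.sin ψ ^ 3) * Q + -(h * Real.exp w.1 * Real.sin ψ ^ 3) *
    (h * Real.exp w.1 * (Real.cos ψ * Real.sin ψ ^ 2))) / Q ^ 2, fun y μ δ => ?_⟩
  -- differentiate the explicit limit along the line in the direction `(y, μ, δ)`, on which `r = 0`
  set φ : ℝ → ℝ × (ℝ × ℝ × ℝ × ℝ) × (ℝ × ℝ × ℝ) := fun τ => (ψ, (h, τ * y, 0, τ * μ), w + τ • δ)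
    with hφ
  have hφ0 : φ 0 = (ψ, (h, 0, 0, 0), w) := by simp [hφ]
  have hφd : HasDerivAt φ (0, (0, y, 0, μ), δ) 0 := by
    refine (hasDerivAt_const _ _).prodMk (((hasDerivAt_const _ _).prodMk
      ((hasDerivAt_mul_const y).prodMk ((hasDerivAt_const _ _).prodMk
        (hasDerivAt_mul_const μ)))).prodMk ?_)
    simpa using ((hasDerivAt_id (0 : ℝ)).smul_const δ).const_add w
  have hd : HasFDerivAt (S.polar c) (fderiv ℝ (S.polar c) (ψ, (h, 0, 0, 0), w)) (φ 0) := by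
    rw [hφ0]
    exact ((S.contDiff_polar hc).differentiable (by simp) _).hasFDerivAt
  have h1 : HasDerivAt (fun τ : ℝ => (S.polar c (φ τ)).1) _ 0 := (hd.comp_hasDerivAt 0 hφd).fst
  have hE : HasDerivAt (fun τ : ℝ => h * Real.exp (w + τ • δ).1) (h * Real.exp w.1 * δ.1) 0 := by
    have : HasDerivAt (fun τ : ℝ => (w + τ • δ).1) δ.1 0 := by
      simpa using ((hasDerivAt_id (0 : ℝ)).mul_const δ.1).const_add w.1
    exact (this.exp.const_mul h).congr_deriv (by simp; ring)
  have hN : HasDerivAt (fun τ : ℝ => 2 * (τ * y) * Real.sin ψ ^ 2 -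
      h * Real.exp (w + τ • δ).1 * Real.sin ψ ^ 3)
      (2 * y * Real.sin ψ ^ 2 - h * Real.exp w.1 * δ.1 * Real.sin ψ ^ 3) 0 :=
    ((((hasDerivAt_mul_const y).const_mul 2).mul_const _).sub (hE.mul_const _))
  have hA : HasDerivAt (fun τ : ℝ => 1 + 2 * (τ * y) * (Real.sin ψ * Real.cos ψ) -
      h * Real.exp (w + τ • δ).1 * (Real.cos ψ * Real.sin ψ ^ 2))
      (2 * y * (Real.sin ψ * Real.cos ψ) -
        h * Real.exp w.1 * δ.1 * (Real.cos ψ * Real.sin ψ ^ 2)) 0 :=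
    (((((hasDerivAt_mul_const y).const_mul 2).mul_const _).const_add 1).sub (hE.mul_const _))
  have h2 : (fun τ : ℝ => (S.polar c (φ τ)).1) =ᶠ[𝓝 0] fun τ : ℝ => (2 * (τ * y) * Real.sin ψ ^ 2 -
      h * Real.exp (w + τ • δ).1 * Real.sin ψ ^ 3) /
      (1 + 2 * (τ * y) * (Real.sin ψ * Real.cos ψ) -
      h * Real.exp (w + τ • δ).1 * (Real.cos ψ * Real.sin ψ ^ 2)) := by
    have hc1 : ContinuousAt (fun τ => S.ang (φ τ)) 0 :=
      S.contDiff_ang.continuous.continuousAt.comp hφd.continuousAt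
    filter_upwards [hc1.eventually (lt_mem_nhds (show c < S.ang (φ 0) by rw [hφ0]; exact hw))]
      with τ hτ
    simp only [hφ] at hτ ⊢
    rw [polar_lim, recip_eq hc hτ.le, ang_lim]
    exact (div_eq_mul_inv _ _).symm
  have hA0 : (1 + 2 * ((0 : ℝ) * y) * (Real.sin ψ * Real.cos ψ) -
      h * Real.exp (w + (0 : ℝ) • δ).1 * (Real.cos ψ * Real.sin ψ ^ 2)) = Q := by
    rw [hQ']; simp
  have h3 := h1.unique ((hN.fun_div hA (by rw [hA0]; exact hQ0)).congr_of_eventuallyEq h2)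
  change (fderiv ℝ (S.polar c) (ψ, (h, 0, 0, 0), w) (0, (0, y, 0, μ), δ)).1 = _ at h3
  rw [h3, hA0]
  simp only [zero_smul, add_zero, zero_mul, mul_zero, zero_sub]
  field_simp
  rw [hQ']
  ring

variable {S}

/-- The Melnikov function is smooth wherever the polar system has a solution, also for `h = 0` and
`r = 0`. -/
theorem IsPolar.contDiffAt_melnikov {c : ℝ} {hc : 0 < c} {π : ℝ × ℝ × ℝ × ℝ}
    {w : C(Icc 0 (2 * Real.pi), ℝ × ℝ × ℝ)} (h : S.IsPolar hc π w) :
    ContDiffAt ℝ (k + 2 : ℕ) (S.melnikov hc) π := by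
  have h1 : ContDiffAt ℝ (k + 2 : ℕ) (fun π => S.sol hc π turn) π := by
    have := (ContinuousMap.evalCLM ℝ turn (M := ℝ × ℝ × ℝ)).contDiff
      (n := (k + 2 : ℕ)).contDiffAt (x := S.sol hc π)
    exact this.comp π h.contDiffAt.1
  exact (contDiffAt_const.sub h1.fst.exp).prodMk h1.snd.fst

/-- The derivative of the Melnikov function with respect to `(y, μ₂)` is invertible along the closed
orbits of the limit system: the variational equation for `l` has a source term of constant sign. -/
theorem melnikov_limit (S : StraightChart F G H k m) {c : ℝ} (hc : 0 < c) {h : ℝ} (hh : 0 ≤ h)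
    (hch : 2 * c ≤ 1 / (4 * (h + 1) ^ 2)) :
    (∃ w, S.IsPolar hc (h, 0, 0, 0) w ∧ ∀ ψ : Icc 0 (2 * Real.pi),
      2 * c ≤ S.ang (ψ, (h, 0, 0, 0), w ψ) ∧ |rad (ψ, (h, 0, 0, 0), w ψ)| ≤ h + 1) ∧
    S.melnikov hc (h, 0, 0, 0) = 0 ∧
    ∀ y μ : ℝ, fderiv ℝ (S.melnikov hc) (h, 0, 0, 0) (0, y, 0, μ) = 0 → y = 0 ∧ μ = 0 := by
  obtain ⟨T, hT, href⟩ := S.exists_isPolar hc hh hch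
  have hturn : ∀ w : C(Icc 0 (2 * Real.pi), ℝ × ℝ × ℝ),
      IccExtend two_pi_nonneg w (2 * Real.pi) = w turn := fun w =>
    IccExtend_of_mem _ _ turn.2
  simp only [hturn] at href
  have hM : ∀ μ, S.melnikov hc (h, 0, 0, μ) = (0, μ * T / 2) := fun μ => by
    obtain ⟨w, hw, h1, h2, -⟩ := href μ
    simp only [melnikov, hw.sol_eq, h1, h2, Real.exp_zero, sub_self]
  obtain ⟨w, hw, hw1, -, hwb⟩ := href 0
  refine ⟨⟨w, hw, hwb⟩, by rw [hM]; simp, fun y μ h0 => ?_⟩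
  have hDd : HasFDerivAt (S.melnikov hc) (fderiv ℝ (S.melnikov hc) (h, 0, 0, 0)) (h, 0, 0, 0) :=
    (hw.contDiffAt_melnikov.differentiableAt (by simp)).hasFDerivAt
  have hWd : DifferentiableAt ℝ (S.sol hc) (h, 0, 0, 0) :=
    hw.contDiffAt.1.differentiableAt (by simp)
  set A : C(Icc 0 (2 * Real.pi), ℝ × ℝ × ℝ) := fderiv ℝ (S.sol hc) (h, 0, 0, 0) (0, y, 0, μ)
    with hA
  -- the first component of the Melnikov function is `1 - e^l`
  have hlast : (A turn).1 = 0 := by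
    have h1 : HasFDerivAt (fun π => S.sol hc π turn)
        ((ContinuousMap.evalCLM ℝ turn).comp (fderiv ℝ (S.sol hc) (h, 0, 0, 0))) (h, 0, 0, 0) := by
      have := (ContinuousMap.evalCLM ℝ turn (M := ℝ × ℝ × ℝ)).hasFDerivAt
        (x := S.sol hc (h, 0, 0, 0))
      exact this.comp _ hWd.hasFDerivAt
    have h2 := ((h1.fst.exp).const_sub 1)
    have h3 := congrArg (fun L : (ℝ × ℝ × ℝ × ℝ) →L[ℝ] ℝ => L (0, y, 0, μ)) (h2.unique hDd.fst)
    have h4 : (fderiv ℝ (S.melnikov hc) (h, 0, 0, 0) (0, y, 0, μ)).1 = 0 := by rw [h0]; rfl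
    have h5 : -(Real.exp (S.sol hc (h, 0, 0, 0) turn).1 * (A turn).1) = 0 := h3.trans h4
    exact (mul_eq_zero.1 (neg_eq_zero.1 h5)).resolve_left (Real.exp_pos _).ne'
  have hy : y = 0 := by
    set ww := IccExtend two_pi_nonneg w with hww
    set Φ : ℝ → (ℝ × ℝ × ℝ × ℝ) → (ℝ × ℝ × ℝ) → ℝ × ℝ × ℝ := fun s p δ =>
      fderiv ℝ (S.polar c) (s, (h, 0, 0, 0), ww s) (0, p, δ) with hΦ
    have hwwc : Continuous ww := w.continuous.Icc_extend'
    have hAc : Continuous (IccExtend two_pi_nonneg A) := A.continuous.Icc_extend'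
    have hfc : Continuous fun s => fderiv ℝ (S.polar c) (s, (h, 0, 0, 0), ww s) :=
      ((S.contDiff_polar hc).continuous_fderiv (by simp)).comp (by fun_prop)
    have hform : ∀ s ∈ Icc 0 (2 * Real.pi), ∃ α : ℝ, ∀ y μ : ℝ, ∀ δ : ℝ × ℝ × ℝ,
        (Φ s (0, y, 0, μ) δ).1 = α * δ.1 + y * (2 * Real.sin s ^ 2 /
          S.ang (s, (h, 0, 0, 0), ww s) ^ 2) ∧ 0 < S.ang (s, (h, 0, 0, 0), ww s) := by
      intro s hs
      have h1 : 2 * c ≤ S.ang (s, (h, 0, 0, 0), ww s) := by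
        rw [hww, IccExtend_of_mem _ _ hs]; exact (hwb ⟨s, hs⟩).1
      obtain ⟨α, hα⟩ := S.hasFDerivAt_polar_fst hc (show c < S.ang (s, (h, 0, 0, 0), ww s) by linarith)
      exact ⟨α, fun y μ δ => ⟨hα y μ δ, by linarith⟩⟩
    set α : ℝ → ℝ := fun s => (Φ s 0 (1, 0, 0)).1 with hα
    set β : ℝ → ℝ := fun s => (Φ s (0, 1, 0, 0) 0).1 with hβ
    have hαc : Continuous α := (hfc.clm_apply continuous_const).fst
    have hβc : Continuous β := (hfc.clm_apply continuous_const).fst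
    have hβv : ∀ s ∈ Icc 0 (2 * Real.pi), β s = 2 * Real.sin s ^ 2 /
        S.ang (s, (h, 0, 0, 0), ww s) ^ 2 ∧ 0 < S.ang (s, (h, 0, 0, 0), ww s) := by
      intro s hs
      obtain ⟨a, ha⟩ := hform s hs
      refine ⟨?_, (ha 0 0 0).2⟩
      have := (ha 1 0 0).1
      simpa using this
    have hlin : ∀ s ∈ Icc 0 (2 * Real.pi), ∀ δ, (Φ s (0, y, 0, μ) δ).1 = α s * δ.1 + y * β s := by
      intro s hs δ
      obtain ⟨a, ha⟩ := hform s hs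
      have e1 : α s = a := by
        have := (ha 0 0 (1, 0, 0)).1
        rw [mul_one, zero_mul, add_zero] at this
        exact this
      rw [(ha y μ δ).1, e1, (hβv s hs).1]
    set φ : ℝ → ℝ × ℝ × ℝ := fun s => Φ s (0, y, 0, μ) (IccExtend two_pi_nonneg A s) with hφ
    have hφc : Continuous φ := hfc.clm_apply (by fun_prop)
    set δ : ℝ → ℝ × ℝ × ℝ := fun t => ∫ s in (0 : ℝ)..t, φ s with hδ
    have hδd : ∀ t, HasDerivAt δ (φ t) t := fun t => (hφc.integral_hasStrictDerivAt 0 t).hasDerivAt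
    have hδA : ∀ t : Icc 0 (2 * Real.pi), A t = δ t := by
      intro t
      have := variational_equation two_pi_nonneg
        (f := ⟨S.polar c, (S.contDiff_polar hc).continuous⟩)
        ((S.contDiff_polar hc).of_le (by norm_cast; omega)) hWd hw.contDiffAt.2 (0, y, 0, μ) t
      rw [hw.sol_eq] at this
      exact this
    -- variation of constants: `y ∫ β E = 0` with `β ≥ 0`
    set E : ℝ → ℝ := fun t => Real.exp (-∫ s in (0 : ℝ)..t, α s) with hE
    have hEd : ∀ t, HasDerivAt E (E t * -α t) t := fun t =>
      ((hαc.integral_hasStrictDerivAt 0 t).hasDerivAt.neg).exp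
    have hEc : Continuous E := continuous_iff_continuousAt.2 fun t => (hEd t).continuousAt
    have hprod : ∀ t ∈ uIcc 0 (2 * Real.pi),
        HasDerivAt (fun t => (δ t).1 * E t) (y * (β t * E t)) t := by
      intro t ht
      rw [uIcc_of_le two_pi_nonneg] at ht
      have hfst : HasDerivAt (fun t => (δ t).1) (φ t).1 t := (hδd t).fst
      refine (hfst.mul (hEd t)).congr_deriv ?_
      have : (φ t).1 = α t * (δ t).1 + y * β t := by
        simp only [hφ]
        rw [hlin t ht, IccExtend_of_mem _ _ ht, hδA]
      rw [this]; ring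
    have hint := intervalIntegral.integral_eq_sub_of_hasDerivAt hprod
      ((continuous_const.mul (hβc.mul hEc)).intervalIntegrable _ _)
    rw [intervalIntegral.integral_const_mul] at hint
    have e1 : (δ (2 * Real.pi)).1 = 0 := by
      have := hδA turn
      rw [← hlast, this]; rfl
    have e2 : δ 0 = 0 := by simp [hδ]
    rw [e1, e2] at hint
    have hpos : 0 < ∫ s in (0 : ℝ)..2 * Real.pi, β s * E s := by
      refine intervalIntegral.integral_pos Real.two_pi_pos (hβc.mul hEc).continuousOn
        (fun s hs => ?_) ⟨Real.pi / 2, ⟨by positivity, by linarith [Real.pi_pos]⟩, ?_⟩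
      · rw [(hβv s ⟨hs.1.le, hs.2⟩).1]
        have : 0 < E s := Real.exp_pos _
        positivity
      · obtain ⟨e3, e4⟩ := hβv (Real.pi / 2) ⟨by positivity, by linarith [Real.pi_pos]⟩
        have : 0 < E (Real.pi / 2) := Real.exp_pos _
        rw [e3, Real.sin_pi_div_two]
        positivity
    simp only [Prod.fst_zero, zero_mul, sub_zero] at hint
    exact (mul_eq_zero.1 hint).resolve_right hpos.ne'
  refine ⟨hy, ?_⟩
  -- for `r = y = 0` the Melnikov function is `(0, μ₂ T / 2)`
  have hline : HasDerivAt (fun τ : ℝ => ((h, 0, 0, τ) : ℝ × ℝ × ℝ × ℝ)) (0, 0, 0, 1) 0 :=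
    (hasDerivAt_const _ _).prodMk ((hasDerivAt_const _ _).prodMk ((hasDerivAt_const _ _).prodMk
      (hasDerivAt_id _)))
  have h1 := hDd.comp_hasDerivAt (0 : ℝ) hline
  have h2 : HasDerivAt (S.melnikov hc ∘ fun τ : ℝ => (h, 0, 0, τ)) (0, T / 2) 0 := by
    have : (S.melnikov hc ∘ fun τ : ℝ => (h, 0, 0, τ)) = fun τ => (0, τ * T / 2) := funext hM
    rw [this]
    exact (hasDerivAt_const _ _).prodMk ((hasDerivAt_mul_const T).div_const 2)
  have h3 := h1.unique h2
  have e : ((0 : ℝ), y, (0 : ℝ), μ) = μ • (0, 0, 0, 1) := by simp [hy]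
  rw [e, map_smul, h3] at h0
  have h4 : μ * (T / 2) = 0 := congrArg Prod.snd h0
  exact (mul_eq_zero.1 h4).resolve_right (by positivity)

end StraightChart

end

section

/-! ### Orbits of the chart system from solutions of the polar system -/

namespace StraightChart

variable {F G H : ℝ → ℝ → ℝ → ℝ → ℝ → ℝ} {k : ℕ} {m : ℝ → ℝ → ℝ → ℝ × ℝ}
  (S : StraightChart F G H k m)

/-- The point of the chart with the straightened coordinates `u` and `y`. -/
def emb (r μ y : ℝ) (u : ℝ × ℝ) : ℝ × ℝ × ℝ :=
  (-y ^ 2 + r * (S.v (r, μ, y)).1 + u.1, y, y + r * (S.v (r, μ, y)).2 + u.2)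

/-- The point of the chart with given polar coordinates. -/
def point (p : ℝ × (ℝ × ℝ × ℝ × ℝ) × (ℝ × ℝ × ℝ)) : ℝ × ℝ × ℝ :=
  S.emb p.2.1.2.2.1 p.2.1.2.2.2 (slow p) (rad p * -Real.cos p.1, rad p * -Real.sin p.1)

/-- The coordinate change conjugates the two systems for `|u₁|, |u₂| ≤ B` and `|r|, |μ₂|, |y| < τ`. -/
def IsConjugate (B τ : ℝ) : Prop := τ ≤ S.σ ∧ ∀ r μ y a b : ℝ, |r| < τ → |μ| < τ → |y| < τ → |a| ≤ B →
  |b| ≤ B → ∀ D : ℝ × ℝ, D = fderiv ℝ S.v (r, μ, y) (0, 0, 1) →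
    chartField F G H r (r * μ) (S.emb r μ y (a, b)) =
      (r * S.g (r, μ, y, a, b) * (-2 * y + r * D.1) + (S.U (r, μ, y, a, b)).1,
        r * S.g (r, μ, y, a, b),
        r * S.g (r, μ, y, a, b) * (1 + r * D.2) + (S.U (r, μ, y, a, b)).2) ∧
    slowRate G r μ (S.emb r μ y (a, b)) = S.g (r, μ, y, a, b) ∧
    (r ≠ 0 → ContDiffAt ℝ ∞ (fun q : ℝ × ℝ × ℝ × ℝ => chartField F G H r q.1 q.2)
      (r * μ, S.emb r μ y (a, b)))

theorem exists_isConjugate (B : ℝ) : ∃ τ > 0, S.IsConjugate B τ := S.transfer B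

variable {S}

theorem IsConjugate.mono {B τ τ' : ℝ} (h : S.IsConjugate B τ) (hτ : τ' ≤ τ) : S.IsConjugate B τ' :=
  ⟨hτ.trans h.1, fun r μ y a b h1 h2 h3 => h.2 r μ y a b (h1.trans_le hτ) (h2.trans_le hτ)
    (h3.trans_le hτ)⟩

theorem straight_emb {r μ y : ℝ} (hr : |r| < S.σ) (hμ : |μ| < S.σ) (hy : |y| < S.σ) (u : ℝ × ℝ) :
    straight m r μ (S.emb r μ y u) = u := by
  simp only [straight, emb, S.m_eq r μ y hr hμ hy]
  ext <;> simp

theorem graphPt_eq {r μ y : ℝ} (hr : |r| < S.σ) (hμ : |μ| < S.σ) (hy : |y| < S.σ) :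
    graphPt m r μ y = S.emb r μ y 0 := by
  simp only [graphPt, emb, S.m_eq r μ y hr hμ hy]
  ext <;> simp

/-- A solution of the polar system along which the polar system represents the chart system. -/
structure IsAdmissible (S : StraightChart F G H k m) {c : ℝ} (hc : 0 < c) (B τ : ℝ)
    (π : ℝ × ℝ × ℝ × ℝ) (w : C(Icc 0 (2 * Real.pi), ℝ × ℝ × ℝ)) : Prop where
  conj : S.IsConjugate B τ
  polar : S.IsPolar hc π w
  r_lt : |π.2.2.1| < τ
  μ_lt : |π.2.2.2| < τ
  ang_ge : ∀ ψ : Icc 0 (2 * Real.pi), c ≤ S.ang (ψ, π, w ψ)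
  rad_le : ∀ ψ : Icc 0 (2 * Real.pi), |rad (ψ, π, w ψ)| ≤ B
  slow_lt : ∀ ψ : Icc 0 (2 * Real.pi), |slow (ψ, π, w ψ)| < τ

variable {c : ℝ} {hc : 0 < c} {B τ : ℝ} {π : ℝ × ℝ × ℝ × ℝ}
  {w : C(Icc 0 (2 * Real.pi), ℝ × ℝ × ℝ)}

/-- Back in the chart, a solution of the polar system moves along the vector field, with the angle
as time up to the angular velocity. -/
theorem hasDerivAt_point {w : ℝ → ℝ × ℝ × ℝ} {ψ : ℝ} (hτ : S.IsConjugate B τ)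
    (hw : HasDerivAt w (S.polar c (ψ, π, w ψ)) ψ) (hc : 0 < c)
    (hr : |π.2.2.1| < τ) (hμ : |π.2.2.2| < τ) (hang : c ≤ S.ang (ψ, π, w ψ))
    (hrad : |rad (ψ, π, w ψ)| ≤ B) (hslow : |slow (ψ, π, w ψ)| < τ) :
    HasDerivAt (fun ψ => S.point (ψ, π, w ψ)) ((S.ang (ψ, π, w ψ))⁻¹ •
      chartField F G H π.2.2.1 (π.2.2.1 * π.2.2.2) (S.point (ψ, π, w ψ))) ψ ∧
    slowRate G π.2.2.1 π.2.2.2 (S.point (ψ, π, w ψ)) = S.rate (ψ, π, w ψ) := by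
  obtain ⟨h, y₀, r, μ⟩ := π
  simp only at hr hμ
  set p : ℝ × (ℝ × ℝ × ℝ × ℝ) × (ℝ × ℝ × ℝ) := (ψ, (h, y₀, r, μ), w ψ) with hp
  set A := S.ang p with hA
  have hA0 : A ≠ 0 := (hc.trans_le hang).ne'
  set s := rad p with hs
  set y := slow p with hy
  have hcos : |s * -Real.cos ψ| ≤ B := by
    rw [abs_mul, abs_neg]
    exact (mul_le_of_le_one_right (abs_nonneg _) (Real.abs_cos_le_one ψ)).trans hrad
  have hsin : |s * -Real.sin ψ| ≤ B := by
    rw [abs_mul, abs_neg]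
    exact (mul_le_of_le_one_right (abs_nonneg _) (Real.abs_sin_le_one ψ)).trans hrad
  obtain ⟨e1, e2, -⟩ := hτ.2 r μ y _ _ hr hμ hslow hcos hsin _ rfl
  refine ⟨?_, e2⟩
  have hw' : HasDerivAt w ((-Real.cos ψ * (S.vel p).1 - Real.sin ψ * (S.vel p).2) * A⁻¹,
      S.rate p * A⁻¹, A⁻¹) ψ := by
    refine hw.congr_deriv ?_
    simp only [polar, ← hA, recip_eq hc hang]
    rfl
  have hl : HasDerivAt (fun ψ => (w ψ).1) _ ψ := hw'.fst
  have hq : HasDerivAt (fun ψ => (w ψ).2.1) (S.rate p * A⁻¹) ψ := by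
    have : HasDerivAt (fun ψ => (w ψ).2) _ ψ := hw'.snd
    exact this.fst
  have hyd : HasDerivAt (fun ψ => slow (ψ, (h, y₀, r, μ), w ψ)) (r * (S.rate p * A⁻¹)) ψ :=
    (hq.const_mul r).const_add y₀
  have hsd : HasDerivAt (fun ψ => rad (ψ, (h, y₀, r, μ), w ψ))
      (s * ((-Real.cos ψ * (S.vel p).1 - Real.sin ψ * (S.vel p).2) * A⁻¹)) ψ :=
    (hl.exp.const_mul h).congr_deriv (by simp only [hs, rad, hp]; ring)
  have hvd : HasDerivAt (fun ψ => S.v (r, μ, slow (ψ, (h, y₀, r, μ), w ψ)))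
      ((r * (S.rate p * A⁻¹)) • fderiv ℝ S.v (r, μ, y) (0, 0, 1)) ψ := by
    have h1 : HasDerivAt (fun ψ => (r, μ, slow (ψ, (h, y₀, r, μ), w ψ)))
        (0, 0, r * (S.rate p * A⁻¹)) ψ :=
      (hasDerivAt_const _ _).prodMk ((hasDerivAt_const _ _).prodMk hyd)
    have h2 : HasFDerivAt S.v (fderiv ℝ S.v (r, μ, y)) (r, μ, slow (ψ, (h, y₀, r, μ), w ψ)) :=
      ((S.smooth_v.differentiable (by simp)) _).hasFDerivAt
    refine (h2.comp_hasDerivAt ψ h1).congr_deriv ?_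
    rw [← map_smul]; simp
  have hv1 : HasDerivAt (fun ψ => (S.v (r, μ, slow (ψ, (h, y₀, r, μ), w ψ))).1) _ ψ := hvd.fst
  have hv2 : HasDerivAt (fun ψ => (S.v (r, μ, slow (ψ, (h, y₀, r, μ), w ψ))).2) _ ψ := hvd.snd
  have hU := S.U_eq s r μ y (-Real.cos ψ) (-Real.sin ψ)
  have hg : S.g (r, μ, y, s * -Real.cos ψ, s * -Real.sin ψ) = S.rate p := rfl
  have hV : S.V (s, (r, μ, y, -Real.cos ψ, -Real.sin ψ)) = S.vel p := rfl
  have hAe : A = Real.sin ψ * (S.vel p).1 - Real.cos ψ * (S.vel p).2 := rfl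
  have hcs := Real.sin_sq_add_cos_sq ψ
  have hd := (((hyd.fun_pow 2).fun_neg.fun_add (hv1.const_mul r)).fun_add
    (hsd.fun_mul (Real.hasDerivAt_cos ψ).fun_neg)).prodMk (hyd.prodMk ((hyd.fun_add
      (hv2.const_mul r)).fun_add (hsd.fun_mul (Real.hasDerivAt_sin ψ).fun_neg)))
  refine HasDerivAt.congr_deriv (f := fun ψ => S.point (ψ, (h, y₀, r, μ), w ψ)) hd ?_
  -- compare the components: radial and angular velocity recombine to `u' = s V = U`
  have hpt : S.point p = S.emb r μ y (s * -Real.cos ψ, s * -Real.sin ψ) := rfl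
  have ey : slow (ψ, (h, y₀, r, μ), w ψ) = y := rfl
  have es : rad (ψ, (h, y₀, r, μ), w ψ) = s := rfl
  simp only [hpt, e1, hU, hV, hg, ey, es, Prod.smul_mk, Prod.smul_fst, Prod.smul_snd, smul_eq_mul,
    Prod.mk.injEq, Nat.cast_ofNat]
  refine ⟨?_, by ring, ?_⟩
  · field_simp
    rw [hAe]
    linear_combination s * (S.vel p).1 * hcs
  · field_simp
    rw [hAe]
    linear_combination s * (S.vel p).2 * hcs

/-- The orbit of the chart system that belongs to a solution of the polar system, as a function `φ` of
the time: at the angle `ψ`, the time is the third component of the solution. -/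
theorem IsAdmissible.exists_orbit (h : S.IsAdmissible hc B τ π w) :
    ∃ (φ : ℝ → ℝ × ℝ × ℝ) (q t : ℝ → ℝ), Continuous t ∧ StrictMono t ∧ t 0 = 0 ∧ q 0 = 0 ∧
      (∀ ψ : Icc 0 (2 * Real.pi), t ψ = (w ψ).2.2 ∧ q (t ψ) = (w ψ).2.1 ∧
        φ (t ψ) = S.point (ψ, π, w ψ) ∧
        HasDerivAt φ (chartField F G H π.2.2.1 (π.2.2.1 * π.2.2.2) (φ (t ψ))) (t ψ) ∧
        HasDerivAt q (slowRate G π.2.2.1 π.2.2.2 (φ (t ψ))) (t ψ)) ∧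
      ContinuousOn (fun x => slowRate G π.2.2.1 π.2.2.2 (φ x)) (Icc 0 (t (2 * Real.pi))) := by
  set g : C(Icc 0 (2 * Real.pi), ℝ × ℝ × ℝ) := superpose (2 * Real.pi)
    ⟨S.polar c, (S.contDiff_polar hc).continuous⟩ (π, w) with hg
  have hgc : Continuous (IccExtend two_pi_nonneg g) := g.continuous.Icc_extend'
  -- a continuation of `w` to the line, so that derivatives exist at the ends of the interval as
  -- well
  set W : ℝ → ℝ × ℝ × ℝ := fun ψ => ∫ s in (0 : ℝ)..ψ, IccExtend two_pi_nonneg g s with hW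
  have hWs : ∀ ψ, HasStrictDerivAt W (IccExtend two_pi_nonneg g ψ) ψ := fun ψ =>
    hgc.integral_hasStrictDerivAt 0 ψ
  have hWw : ∀ ψ : Icc 0 (2 * Real.pi), W ψ = w ψ := fun ψ => by
    have := congrArg (fun u : C(Icc 0 (2 * Real.pi), ℝ × ℝ × ℝ) => u ψ) h.polar
    exact this.symm
  have hWd : ∀ ψ : Icc 0 (2 * Real.pi), HasDerivAt W (S.polar c (ψ, π, W ψ)) ψ := fun ψ => by
    refine (hWs ψ).hasDerivAt.congr_deriv ?_
    rw [IccExtend_val, hWw]; rfl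
  have hW0 : W 0 = 0 := by simp [hW]
  set t : ℝ → ℝ := fun ψ => (W ψ).2.2 with ht
  have hts : ∀ ψ, HasStrictDerivAt t (IccExtend two_pi_nonneg g ψ).2.2 ψ := fun ψ => by
    have h1 : HasStrictDerivAt (fun ψ => (W ψ).2) _ ψ := (hWs ψ).snd
    exact h1.snd
  have hgpos : ∀ ψ, 0 < (IccExtend two_pi_nonneg g ψ).2.2 := fun ψ => by
    have h1 := h.ang_ge (projIcc 0 (2 * Real.pi) two_pi_nonneg ψ)
    have : (IccExtend two_pi_nonneg g ψ).2.2 =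
      recip c (S.ang (projIcc 0 (2 * Real.pi) two_pi_nonneg ψ, π, w (projIcc _ _ _ ψ))) := rfl
    rw [this, recip_eq hc h1]
    exact inv_pos.2 (hc.trans_le h1)
  have htmono : StrictMono t := strictMono_of_hasDerivAt_pos (fun ψ => (hts ψ).hasDerivAt) hgpos
  have htc : Continuous t := continuous_iff_continuousAt.2 fun ψ => (hts ψ).hasDerivAt.continuousAt
  -- the angle as a function of the time
  set Ψ : ℝ → ℝ := Function.invFun t with hΨ
  have hΨt : ∀ ψ, Ψ (t ψ) = ψ := Function.leftInverse_invFun htmono.injective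
  have hΨd : ∀ ψ, HasDerivAt Ψ ((IccExtend two_pi_nonneg g ψ).2.2)⁻¹ (t ψ) := fun ψ =>
    ((hts ψ).to_local_left_inverse (hgpos ψ).ne' (Eventually.of_forall hΨt)).hasDerivAt
  have hΨa : ∀ ψ : Icc 0 (2 * Real.pi), HasDerivAt Ψ (S.ang (ψ, π, W ψ)) (t ψ) := fun ψ => by
    refine (hΨd ψ).congr_deriv ?_
    have : (IccExtend two_pi_nonneg g (ψ : ℝ)).2.2 = recip c (S.ang (ψ, π, w ψ)) := by
      rw [IccExtend_val]; rfl
    rw [this, recip_eq hc (h.ang_ge ψ), inv_inv, hWw]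
  have hpt : ∀ ψ : Icc 0 (2 * Real.pi), HasDerivAt (fun ψ => S.point (ψ, π, W ψ))
      ((S.ang (ψ, π, W ψ))⁻¹ • chartField F G H π.2.2.1 (π.2.2.1 * π.2.2.2)
        (S.point (ψ, π, W ψ))) ψ ∧
      slowRate G π.2.2.1 π.2.2.2 (S.point (ψ, π, W ψ)) = S.rate (ψ, π, W ψ) := fun ψ =>
    hasDerivAt_point h.conj (hWd ψ) hc h.r_lt h.μ_lt (by rw [hWw]; exact h.ang_ge ψ)
      (by rw [hWw]; exact h.rad_le ψ) (by rw [hWw]; exact h.slow_lt ψ)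
  have hA0 : ∀ ψ : Icc 0 (2 * Real.pi), S.ang (ψ, π, W ψ) ≠ 0 := fun ψ => by
    rw [hWw]; exact (hc.trans_le (h.ang_ge ψ)).ne'
  refine ⟨fun x => S.point (Ψ x, π, W (Ψ x)), fun x => (W (Ψ x)).2.1, t, htc, htmono,
    by simp [ht, hW0], ?_, fun ψ => ⟨?_, ?_, ?_, ?_, ?_⟩, ?_⟩
  · have : Ψ 0 = 0 := by
      have := hΨt 0
      simpa [ht, hW0] using this
    simp [this, hW0]
  · simp only [ht, hWw]
  · simp only [hΨt, hWw]
  · simp only [hΨt, hWw]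
  · have h1 := (hpt ψ).1
    have h2 : HasDerivAt (fun ψ => S.point (ψ, π, W ψ)) ((S.ang (ψ, π, W ψ))⁻¹ •
        chartField F G H π.2.2.1 (π.2.2.1 * π.2.2.2) (S.point (ψ, π, W ψ))) (Ψ (t ψ)) := by
      rw [hΨt]; exact h1
    refine (h2.scomp (t ψ) (hΨa ψ)).congr_deriv ?_
    rw [smul_smul, mul_inv_cancel₀ (hA0 ψ), one_smul]
    simp only [hΨt]
  · have h1 : HasDerivAt (fun ψ => (W ψ).2.1) (S.rate (ψ, π, W ψ) * (S.ang (ψ, π, W ψ))⁻¹) ψ := by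
      have h3 : HasDerivAt (fun ψ => (W ψ).2) _ (ψ : ℝ) := (hWd ψ).snd
      have h4 : HasDerivAt (fun ψ => (W ψ).2.1) _ (ψ : ℝ) := h3.fst
      refine h4.congr_deriv ?_
      simp only [StraightChart.polar]
      rw [recip_eq hc (by rw [hWw]; exact h.ang_ge ψ)]
    have h2 : HasDerivAt (fun ψ => (W ψ).2.1) (S.rate (ψ, π, W ψ) * (S.ang (ψ, π, W ψ))⁻¹)
      (Ψ (t ψ)) := by rw [hΨt]; exact h1
    refine (h2.comp (t ψ) (hΨa ψ)).congr_deriv ?_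
    rw [inv_mul_cancel_right₀ (hA0 ψ)]
    simp only [hΨt]
    exact (hpt ψ).2.symm
  · intro x hx
    have hsub : ∀ x ∈ Icc 0 (t (2 * Real.pi)), ∃ ψ : Icc 0 (2 * Real.pi), t ψ = x := by
      intro x hx
      have h0 : t 0 = 0 := by simp [ht, hW0]
      obtain ⟨ψ, hψ, hψx⟩ := intermediate_value_Icc two_pi_nonneg htc.continuousOn
        (show x ∈ Icc (t 0) (t (2 * Real.pi)) by rw [h0]; exact hx)
      exact ⟨⟨ψ, hψ⟩, hψx⟩
    have heq : ∀ x ∈ Icc 0 (t (2 * Real.pi)), slowRate G π.2.2.1 π.2.2.2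
        (S.point (Ψ x, π, W (Ψ x))) = S.rate (Ψ x, π, W (Ψ x)) := by
      intro x hx
      obtain ⟨ψ, rfl⟩ := hsub x hx
      rw [hΨt]; exact (hpt ψ).2
    refine ContinuousWithinAt.congr ?_ heq (heq x hx)
    obtain ⟨ψ, rfl⟩ := hsub x hx
    have hWc : Continuous W := continuous_iff_continuousAt.2 fun ψ => (hWs ψ).hasDerivAt.continuousAt
    have h5 : Continuous fun ψ => S.rate (ψ, π, W ψ) :=
      S.contDiff_rate.continuous.comp (by fun_prop)
    exact (h5.continuousAt.comp (hΨa ψ).continuousAt).continuousWithinAt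

theorem eq_pi_of_sin_eq_zero {ψ : ℝ} (h0 : 0 < ψ) (h1 : ψ < 2 * Real.pi) (hs : Real.sin ψ = 0) :
    ψ = Real.pi := by
  have : Real.sin (ψ - Real.pi) = 0 := by rw [Real.sin_sub_pi, hs, neg_zero]
  have := (Real.sin_eq_zero_iff_of_lt_of_lt (by linarith) (by linarith)).1 this
  linarith

/-- The first return takes place at the angle `2π`: the only other angle with `u₂ = 0` is `π`, where
`u₁ > 0`. -/
theorem IsAdmissible.exists_isReturn (h : S.IsAdmissible hc B τ π w) {ν : ℝ} (hν : τ ≤ ν)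
    (hpos : 0 < π.1) : ∃ (T : ℝ) (φ : ℝ → ℝ × ℝ × ℝ),
      IsReturn F G H ν m π.1 π.2.1 π.2.2.1 π.2.2.2 T φ ∧
      (1 - Real.exp (w turn).1, (w turn).2.1) =
        (π.1⁻¹ * ((straight m π.2.2.1 π.2.2.2 (φ T)).1 + π.1),
          ∫ t in (0 : ℝ)..T, slowRate G π.2.2.1 π.2.2.2 (φ t)) := by
  obtain ⟨φ, q, t, htc, htmono, ht0, hq0, hψ, hrc⟩ := h.exists_orbit
  have hsub : ∀ x ∈ Icc 0 (t (2 * Real.pi)), ∃ ψ : Icc 0 (2 * Real.pi), t ψ = x := by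
    intro x hx
    obtain ⟨ψ, hψ, hψx⟩ := intermediate_value_Icc two_pi_nonneg htc.continuousOn
      (show x ∈ Icc (t 0) (t (2 * Real.pi)) by rw [ht0]; exact hx)
    exact ⟨⟨ψ, hψ⟩, hψx⟩
  have hT : 0 < t (2 * Real.pi) := by rw [← ht0]; exact htmono Real.two_pi_pos
  have hu : ∀ ψ : Icc 0 (2 * Real.pi), straight m π.2.2.1 π.2.2.2 (φ (t ψ)) =
      (rad (ψ, π, w ψ) * -Real.cos ψ, rad (ψ, π, w ψ) * -Real.sin ψ) := fun ψ => by
    rw [(hψ ψ).2.2.1]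
    exact straight_emb (h.r_lt.trans_le h.conj.1) (h.μ_lt.trans_le h.conj.1)
      ((h.slow_lt ψ).trans_le h.conj.1) _
  have hy : ∀ ψ : Icc 0 (2 * Real.pi), (φ (t ψ)).2.1 = slow (ψ, π, w ψ) := fun ψ => by
    rw [(hψ ψ).2.2.1]; rfl
  have hrad : ∀ ψ : Icc 0 (2 * Real.pi), 0 < rad (ψ, π, w ψ) := fun ψ =>
    mul_pos hpos (Real.exp_pos _)
  have h0mem : (0 : ℝ) ∈ Icc 0 (2 * Real.pi) := ⟨le_rfl, two_pi_nonneg⟩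
  have hw0 : w ⟨0, h0mem⟩ = 0 := by
    have := h.polar.start
    rwa [IccExtend_of_mem _ _ h0mem] at this
  have hu0 := hu ⟨0, h0mem⟩
  have hy0 := hy ⟨0, h0mem⟩
  have hu1 := hu turn
  simp only [ht0, hw0] at hu0 hy0
  refine ⟨t (2 * Real.pi), φ, ⟨hT, ?_, ?_, ?_, ?_, ?_, ?_, ?_⟩, ?_⟩
  · intro x hx
    obtain ⟨ψ, rfl⟩ := hsub x hx
    exact (hψ ψ).2.2.2.1.hasDerivWithinAt
  · intro x hx
    obtain ⟨ψ, rfl⟩ := hsub x hx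
    rw [hy]
    exact abs_le.1 ((h.slow_lt ψ).le.trans hν)
  · rw [hy0]; simp [slow]
  · rw [hu0]; simp [rad]
  · change (straight m π.2.2.1 π.2.2.2 (φ (t turn))).2 = 0
    rw [hu1]; simp [turn]
  · change (straight m π.2.2.1 π.2.2.2 (φ (t turn))).1 < 0
    rw [hu1]; simpa [turn] using hrad turn
  · intro x hx hcon
    obtain ⟨ψ, rfl⟩ := hsub x ⟨hx.1.le, hx.2.le⟩
    rw [hu ψ] at hcon
    have hs : Real.sin (ψ : ℝ) = 0 := by
      have := (mul_eq_zero.1 hcon.1).resolve_left (hrad ψ).ne'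
      linarith
    -- no earlier return: `sin ψ = 0` forces `ψ = π`, and `u₁ > 0` there
    have hψπ := eq_pi_of_sin_eq_zero (htmono.lt_iff_lt.1 (ht0.trans_lt hx.1))
      (htmono.lt_iff_lt.1 hx.2) hs
    have h2 : rad (ψ, π, w ψ) * -Real.cos ψ < 0 := hcon.2
    rw [show Real.cos (ψ : ℝ) = -1 by rw [hψπ, Real.cos_pi]] at h2
    linarith [hrad ψ]
  · refine Prod.ext ?_ ?_
    · change _ = π.1⁻¹ * ((straight m π.2.2.1 π.2.2.2 (φ (t turn))).1 + π.1)
      rw [hu1]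
      simp only [turn, Real.cos_two_pi, rad]
      field_simp
      ring
    · have hint := intervalIntegral.integral_eq_sub_of_hasDerivAt (f := q)
        (f' := fun x => slowRate G π.2.2.1 π.2.2.2 (φ x)) (a := 0) (b := t (2 * Real.pi))
        (fun x hx => by
          rw [uIcc_of_le hT.le] at hx
          obtain ⟨ψ, rfl⟩ := hsub x hx
          exact (hψ ψ).2.2.2.2) (by
          refine ContinuousOn.intervalIntegrable ?_
          rwa [uIcc_of_le hT.le])
      simp only
      rw [hint, hq0, sub_zero]
      exact (hψ turn).2.1.symm

end StraightChart

end

section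

/-! ### Existence of the Melnikov function and of its zero branch -/

namespace StraightChart

variable {F G H : ℝ → ℝ → ℝ → ℝ → ℝ → ℝ} {k : ℕ} {m : ℝ → ℝ → ℝ → ℝ × ℝ}

/-- Admissibility is an open condition along the closed orbits of the limit system. -/
theorem eventually_isAdmissible (S : StraightChart F G H k m) {c : ℝ} (hc : 0 < c) {h h₁ τ : ℝ}
    (hh : 0 ≤ h) (hh₁ : h ≤ h₁) (hch : 2 * c ≤ 1 / (4 * (h + 1) ^ 2)) (hτ : 0 < τ)
    (hconj : S.IsConjugate (h₁ + 2) τ) :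
    ∀ᶠ π in 𝓝 (h, (0 : ℝ), (0 : ℝ), (0 : ℝ)), S.IsAdmissible hc (h₁ + 2) τ π (S.sol hc π) := by
  obtain ⟨⟨w, hw, hwb⟩, -, -⟩ := S.melnikov_limit hc hh hch
  have e1 := hw.eventually_lt (φ := fun p => -S.ang p) (S.contDiff_ang.continuous.neg) (ε := -c)
    (fun ψ => by linarith [(hwb ψ).1])
  have e2 := hw.eventually_lt (φ := fun p => |rad p|) (contDiff_rad (n := 0)).continuous.abs
    (ε := h₁ + 2) (fun ψ => by linarith [(hwb ψ).2])
  have e3 := hw.eventually_lt (φ := fun p => |slow p|) (contDiff_slow (n := 0)).continuous.abs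
    (ε := τ) (fun ψ => by simpa [slow] using hτ)
  have e4 : ∀ᶠ π : ℝ × ℝ × ℝ × ℝ in 𝓝 (h, (0 : ℝ), (0 : ℝ), (0 : ℝ)), |π.2.2.1| < τ :=
    (show Continuous fun π : ℝ × ℝ × ℝ × ℝ => |π.2.2.1| by fun_prop).continuousAt.eventually
      (gt_mem_nhds (by simpa using hτ))
  have e5 : ∀ᶠ π : ℝ × ℝ × ℝ × ℝ in 𝓝 (h, (0 : ℝ), (0 : ℝ), (0 : ℝ)), |π.2.2.2| < τ :=
    (show Continuous fun π : ℝ × ℝ × ℝ × ℝ => |π.2.2.2| by fun_prop).continuousAt.eventually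
      (gt_mem_nhds (by simpa using hτ))
  filter_upwards [e1, e2, e3, e4, e5, hw.contDiffAt.2] with π h1 h2 h3 h4 h5 h6
  exact ⟨hconj, h6, h4, h5, fun ψ => by linarith [h1 ψ], fun ψ => (h2 ψ).le, h3⟩

/-- By compactness, the solutions of the polar system exist and the implicit function theorem
applies uniformly for `0 ≤ h ≤ h₁`. -/
theorem exists_isMelnikov (S : StraightChart F G H k m) {ν h₁ : ℝ} (hν : 0 < ν) (hh₁ : 0 < h₁) :
    ∃ (c : ℝ) (hc : 0 < c) (B τ : ℝ), c < 1 ∧ ∀ᶠ η in 𝓝[>] (0 : ℝ), ∀ᶠ r₀ in 𝓝[>] (0 : ℝ),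
      ∃ Y M : ℝ → ℝ → ℝ, IsMelnikov F G H k ν m h₁ η r₀ (S.melnikov hc) ∧
        IsZeroBranch k h₁ η r₀ (S.melnikov hc) Y M ∧
        ∀ π ∈ box h₁ η r₀, S.IsAdmissible hc B τ π (S.sol hc π) := by
  -- half of the lower bound for the angular velocity of the limit orbits with `h ≤ h₁`
  have hc : 0 < 1 / (8 * (h₁ + 1) ^ 2) := by positivity
  have hch : ∀ h ∈ Icc 0 h₁, 2 * (1 / (8 * (h₁ + 1) ^ 2)) ≤ 1 / (4 * (h + 1) ^ 2) := fun h hh => by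
    have h0 := hh.1
    have h1 : (h + 1) ^ 2 ≤ (h₁ + 1) ^ 2 := by
      have := hh.2
      gcongr
    have : 2 * (1 / (8 * (h₁ + 1) ^ 2)) = 1 / (4 * (h₁ + 1) ^ 2) := by field_simp; norm_num
    rw [this]
    gcongr
  obtain ⟨τ₀, hτ₀, hconj₀⟩ := S.exists_isConjugate (h₁ + 2)
  have hτ : 0 < min τ₀ ν := lt_min hτ₀ hν
  have hconj := hconj₀.mono (min_le_left τ₀ ν)
  refine ⟨_, hc, h₁ + 2, min τ₀ ν, ?_, ?_⟩
  · rw [div_lt_one (by positivity)]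
    nlinarith
  set D := S.melnikov hc with hD
  have hlim := fun h (hh : h ∈ Icc 0 h₁) => S.melnikov_limit hc hh.1 (hch h hh)
  have hadm : ∀ᶠ p : ℝ × ℝ × ℝ in 𝓝 0, ∀ h ∈ Icc 0 h₁,
      S.IsAdmissible hc (h₁ + 2) (min τ₀ ν) (h, p) (S.sol hc (h, p)) := by
    refine isCompact_Icc.eventually_forall_of_forall_eventually fun h hh => ?_
    have hsw : Tendsto (fun z : (ℝ × ℝ × ℝ) × ℝ => (z.2, z.1)) (𝓝 (0, h)) (𝓝 (h, 0)) :=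
      continuous_swap.tendsto _
    exact hsw.eventually (S.eventually_isAdmissible hc hh.1 hh.2 (hch h hh) hτ hconj)
  obtain ⟨ε, hε, hball⟩ := Metric.eventually_nhds_iff.1 hadm
  have hbranch := exists_zeroBranch (k := k) (n := k + 2) (by omega) (by omega) (h₁ := h₁) (D := D)
    (fun h hh => by
      obtain ⟨⟨w, hw, -⟩, -⟩ := hlim h hh
      exact hw.contDiffAt_melnikov) (fun h hh => (hlim h hh).2.1) (fun h hh => (hlim h hh).2.2)
  filter_upwards [hbranch, Ioo_mem_nhdsGT hε] with η hη1 hη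
  filter_upwards [hη1, Ioo_mem_nhdsGT hε] with r₀ hr1 hr
  obtain ⟨Y, M, hYM⟩ := hr1
  have hbox : ∀ π ∈ box h₁ η r₀, S.IsAdmissible hc (h₁ + 2) (min τ₀ ν) π (S.sol hc π) := by
    rintro ⟨h, y, r, μ⟩ ⟨h1, h2, h3, h4⟩
    refine hball (y := (y, r, μ)) ?_ h h1
    simp only [dist_zero_right, Prod.norm_def, Real.norm_eq_abs]
    refine max_lt ((abs_le.2 h2).trans_lt hη.2) (max_lt ?_ ((abs_le.2 h4).trans_lt hη.2))
    rw [abs_of_nonneg h3.1]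
    exact h3.2.trans_lt hr.2
  refine ⟨Y, M, ⟨fun π hπ => ?_, fun h y r μ hπ hpos => ?_⟩, hYM, hbox⟩
  · exact ((hbox π hπ).polar.contDiffAt_melnikov.of_le (by norm_cast; omega)).contDiffWithinAt
  · obtain ⟨T, φ, h1, h2⟩ := (hbox _ hπ).exists_isReturn (min_le_right _ _) hpos
    exact ⟨T, φ, h1, h2⟩

end StraightChart

end

section

/-! ### Eigenvalues of endomorphisms of three-space -/

/-- The coefficients, up to the sign, of the characteristic polynomial of an endomorphism of
`ℝ × ℝ × ℝ`. -/
def charCoeff (J : ℝ × ℝ × ℝ →L[ℝ] ℝ × ℝ × ℝ) : ℝ × ℝ × ℝ :=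
  let a := J (1, 0, 0)
  let b := J (0, 1, 0)
  let c := J (0, 0, 1)
  (a.1 + b.2.1 + c.2.2,
    a.1 * b.2.1 - b.1 * a.2.1 + (a.1 * c.2.2 - c.1 * a.2.2) + (b.2.1 * c.2.2 - c.2.1 * b.2.2),
    a.1 * (b.2.1 * c.2.2 - c.2.1 * b.2.2) - b.1 * (a.2.1 * c.2.2 - c.2.1 * a.2.2) +
      c.1 * (a.2.1 * b.2.2 - b.2.1 * a.2.2))

open Polynomial in
theorem charpoly_eq_charCoeff (J : ℝ × ℝ × ℝ →L[ℝ] ℝ × ℝ × ℝ) :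
    (J : ℝ × ℝ × ℝ →ₗ[ℝ] ℝ × ℝ × ℝ).charpoly =
      X ^ 3 - C (charCoeff J).1 * X ^ 2 + C (charCoeff J).2.1 * X - C (charCoeff J).2.2 := by
  obtain ⟨e, he0, he1, he2, hes⟩ : ∃ e : (ℝ × ℝ × ℝ) ≃ₗ[ℝ] (Fin 3 → ℝ), (∀ p, e p 0 = p.1) ∧
      (∀ p, e p 1 = p.2.1) ∧ (∀ p, e p 2 = p.2.2) ∧ ∀ x, e.symm x = (x 0, x 1, x 2) :=
    ⟨{ toFun := fun p => ![p.1, p.2.1, p.2.2]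
       invFun := fun x => (x 0, x 1, x 2)
       map_add' := fun p q => by ext i; fin_cases i <;> rfl
       map_smul' := fun t p => by ext i; fin_cases i <;> rfl
       left_inv := fun p => rfl
       right_inv := fun x => by ext i; fin_cases i <;> rfl },
      fun _ => rfl, fun _ => rfl, fun _ => rfl, fun _ => rfl⟩
  have hb : ∀ i, Module.Basis.ofEquivFun e i = e.symm (Pi.single i 1) := fun i => by
    rw [Module.Basis.coe_ofEquivFun]
  rw [← LinearMap.charpoly_toMatrix _ (Module.Basis.ofEquivFun e), Matrix.charpoly,
    Matrix.det_fin_three]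
  simp only [Matrix.charmatrix_apply, LinearMap.toMatrix_apply, Module.Basis.ofEquivFun_repr_apply,
    hb, hes, ContinuousLinearMap.coe_coe, he0, he1, he2, charCoeff]
  simp [Matrix.diagonal]
  ring

theorem mem_eigenvalues_iff (J : ℝ × ℝ × ℝ →L[ℝ] ℝ × ℝ × ℝ) (z : ℂ) : z ∈ eigenvalues J ↔
    z ^ 3 - (charCoeff J).1 * z ^ 2 + (charCoeff J).2.1 * z - (charCoeff J).2.2 = 0 := by
  have hm : ((J : ℝ × ℝ × ℝ →ₗ[ℝ] ℝ × ℝ × ℝ).charpoly.map (algebraMap ℝ ℂ)) ≠ 0 :=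
    ((LinearMap.charpoly_monic _).map _).ne_zero
  rw [eigenvalues, Polynomial.mem_roots hm, Polynomial.IsRoot, charpoly_eq_charCoeff]
  simp

open Polynomial in
/-- The characteristic polynomial is `(X² + θ²) (X - κ)`. -/
theorem eigenvalues_eq {J : ℝ × ℝ × ℝ →L[ℝ] ℝ × ℝ × ℝ} {κ θ : ℝ}
    (h : charCoeff J = (κ, θ ^ 2, κ * θ ^ 2)) :
    eigenvalues J = {θ * Complex.I, -(θ * Complex.I), (κ : ℂ)} := by
  have e : ((J : ℝ × ℝ × ℝ →ₗ[ℝ] ℝ × ℝ × ℝ).charpoly.map (algebraMap ℝ ℂ)) =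
      (({θ * Complex.I, -(θ * Complex.I), (κ : ℂ)} : Multiset ℂ).map fun a => X - C a).prod := by
    rw [charpoly_eq_charCoeff, h]
    have hI : (C Complex.I : ℂ[X]) ^ 2 = -1 := by rw [← C_pow, Complex.I_sq]; simp
    simp only [Polynomial.map_sub, Polynomial.map_add, Polynomial.map_mul, Polynomial.map_pow,
      map_X, map_C, Complex.coe_algebraMap, Multiset.insert_eq_cons, Multiset.map_cons,
      Multiset.map_singleton, Multiset.prod_cons, Multiset.prod_singleton, C_mul, C_neg,
      C_pow]
    linear_combination (C (θ : ℂ) ^ 2 * (X - C (κ : ℂ))) * hI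
  rw [eigenvalues, e, Polynomial.roots_multiset_prod_X_sub_C]

/-- The characteristic polynomial is `(X - κ) (X² - (b₁₁ + b₂₂) X + (b₁₁ b₂₂ - b₁₂ b₂₁))` if the
endomorphism is block triangular with respect to the line through `(α, 1, β)`. -/
theorem charCoeff_of_flag {J : ℝ × ℝ × ℝ →L[ℝ] ℝ × ℝ × ℝ} {α β κ c₁ c₂ b₁₁ b₁₂ b₂₁ b₂₂ : ℝ}
    (h0 : J (α, 1, β) = κ • (α, 1, β)) (h1 : J (1, 0, 0) = c₁ • (α, 1, β) + (b₁₁, 0, b₂₁))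
    (h2 : J (0, 0, 1) = c₂ • (α, 1, β) + (b₁₂, 0, b₂₂)) :
    charCoeff J = (κ + (b₁₁ + b₂₂), κ * (b₁₁ + b₂₂) + (b₁₁ * b₂₂ - b₁₂ * b₂₁),
      κ * (b₁₁ * b₂₂ - b₁₂ * b₂₁)) := by
  have h3 : J (0, 1, 0) = J (α, 1, β) - α • J (1, 0, 0) - β • J (0, 0, 1) := by
    rw [← map_smul, ← map_smul, ← map_sub, ← map_sub]; simp
  simp only [charCoeff, h3, h0, h1, h2, Prod.fst_sub, Prod.fst_add, Prod.snd_sub, Prod.snd_add,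
    Prod.smul_fst, Prod.smul_snd, smul_eq_mul, Prod.mk.injEq]
  refine ⟨?_, ?_, ?_⟩ <;> ring

theorem contDiff_charCoeff {n : ℕ∞} : ContDiff ℝ n charCoeff := by
  have h : ∀ v : ℝ × ℝ × ℝ, ContDiff ℝ n fun J : ℝ × ℝ × ℝ →L[ℝ] ℝ × ℝ × ℝ => J v := fun v =>
    contDiff_id.clm_apply contDiff_const
  have ha := h (1, 0, 0)
  have hb := h (0, 1, 0)
  have hc := h (0, 0, 1)
  unfold charCoeff
  fun_prop

/-- An endomorphism without the eigenvalue `0` is invertible. -/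
theorem isInvertible_of_charCoeff {J : ℝ × ℝ × ℝ →L[ℝ] ℝ × ℝ × ℝ} (h : (charCoeff J).2.2 ≠ 0) :
    J.IsInvertible := by
  refine isInvertible_of_injective fun x hx => ?_
  by_contra hne
  have he : Module.End.HasEigenvalue (J : ℝ × ℝ × ℝ →ₗ[ℝ] ℝ × ℝ × ℝ) 0 :=
    Module.End.hasEigenvalue_of_hasEigenvector (x := x)
      ⟨Module.End.mem_eigenspace_iff.2 (by simpa using hx), hne⟩
  have := (Module.End.hasEigenvalue_iff_isRoot_charpoly _ _).1 he
  rw [charpoly_eq_charCoeff] at this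
  simp at this
  exact h this

variable {F G H : ℝ → ℝ → ℝ → ℝ → ℝ → ℝ}

/-- For `r = μ = 0` the field is `(y - z, 0, x + z²)`. -/
theorem eigenvalues_limit (hG0 : G 0 0 0 0 0 = 0) :
    eigenvalues (fderiv ℝ (chartField F G H 0 0) 0) = {Complex.I, -Complex.I, 0} := by
  have hf : chartField F G H 0 0 = fun p => (p.2.1 - p.2.2, 0, p.1 + p.2.2 ^ 2) := by
    ext p <;> simp [chartField, hG0]
  set J := fderiv ℝ (chartField F G H 0 0) 0 with hJ
  have hd : DifferentiableAt ℝ (chartField F G H 0 0) 0 := by rw [hf]; fun_prop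
  have hJv : ∀ v : ℝ × ℝ × ℝ, J v = (v.2.1 - v.2.2, 0, v.1) := by
    intro v
    have h1 := hd.hasFDerivAt.comp_hasDerivAt_of_eq (0 : ℝ) ((hasDerivAt_id (0 : ℝ)).smul_const v)
      (by simp)
    have h2 : HasDerivAt (chartField F G H 0 0 ∘ fun t : ℝ => t • v)
        (v.2.1 - v.2.2, 0, v.1) 0 := by
      rw [hf]
      have h3 := (((hasDerivAt_mul_const v.2.1).fun_sub (hasDerivAt_mul_const v.2.2)).prodMk
        ((hasDerivAt_const (0 : ℝ) (0 : ℝ)).prodMk ((hasDerivAt_mul_const (x := 0) v.1).fun_add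
          ((hasDerivAt_mul_const (x := 0) v.2.2).fun_pow 2))))
      refine HasDerivAt.congr_deriv (f := _) h3 ?_
      simp
    simpa using h1.unique h2
  have := eigenvalues_eq (J := J) (κ := 0) (θ := 1) (by
    rw [charCoeff_of_flag (J := J) (α := 0) (β := 1) (κ := 0) (c₁ := 0) (c₂ := 0) (b₁₁ := 0)
      (b₁₂ := -1) (b₂₁ := 1) (b₂₂ := 0)] <;> simp [hJv])
  rw [this]; simp

end

section

/-! ### Linearization at the equilibria on the slow manifold -/

namespace StraightChart

variable {F G H : ℝ → ℝ → ℝ → ℝ → ℝ → ℝ} {k : ℕ} {m : ℝ → ℝ → ℝ → ℝ × ℝ}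
  (S : StraightChart F G H k m)

/-- The linearization `∂U/∂u`, applied to `(a, b)`, at the point of the slow manifold with
`(r, μ₂, y) = p`. -/
def lin (p : ℝ × ℝ × ℝ) (a b : ℝ) : ℝ × ℝ := S.V (0, (p.1, p.2.1, p.2.2, a, b))

/-- The trace of `∂U/∂u`. -/
def trB (p : ℝ × ℝ × ℝ) : ℝ := (S.lin p 1 0).1 + (S.lin p 0 1).2

/-- The determinant of `∂U/∂u`. -/
def detB (p : ℝ × ℝ × ℝ) : ℝ := (S.lin p 1 0).1 * (S.lin p 0 1).2 - (S.lin p 0 1).1 * (S.lin p 1 0).2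

/-- The slow velocity `y' / r` on the slow manifold; its zeros are the equilibria. -/
def drift (p : ℝ × ℝ × ℝ) : ℝ := S.g (p.1, p.2.1, p.2.2, 0, 0)

/-- The derivative of the slow velocity along the slow manifold. -/
def driftY (p : ℝ × ℝ × ℝ) : ℝ := fderiv ℝ S.g (p.1, p.2.1, p.2.2, 0, 0) (0, 0, 1, 0, 0)

/-- The function `V` is defined for all `(a, b)`, and is linear in them where the radius vanishes.
-/
theorem lin_eq (p : ℝ × ℝ × ℝ) (a b : ℝ) : S.lin p a b = a • S.lin p 1 0 + b • S.lin p 0 1 := by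
  simp only [lin, V_zero, ← map_smul, ← map_add]
  congr 1
  simp

theorem contDiff_lin (a b : ℝ) : ContDiff ℝ (k + 2 : ℕ) fun p => S.lin p a b :=
  S.smooth_V.comp (by fun_prop)

theorem contDiff_trB : ContDiff ℝ (k + 2 : ℕ) S.trB :=
  (S.contDiff_lin 1 0).fst.add (S.contDiff_lin 0 1).snd

theorem contDiff_detB : ContDiff ℝ (k + 2 : ℕ) S.detB :=
  ((S.contDiff_lin 1 0).fst.mul (S.contDiff_lin 0 1).snd).sub
    ((S.contDiff_lin 0 1).fst.mul (S.contDiff_lin 1 0).snd)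

theorem contDiff_drift : ContDiff ℝ (k + 2 : ℕ) S.drift :=
  (S.smooth_g.of_le (by norm_cast; omega)).comp (by fun_prop)

theorem contDiff_driftY : ContDiff ℝ (k + 2 : ℕ) S.driftY :=
  ((S.smooth_g.fderiv_right (m := (k + 2 : ℕ)) (by norm_cast)).comp (by fun_prop)).clm_apply
    contDiff_const

theorem lin_lim (μ y a b : ℝ) : S.lin (0, μ, y) a b = (-b, a + 2 * y * b) := by
  simp [lin, V_lim]

theorem trB_lim (μ y : ℝ) : S.trB (0, μ, y) = 2 * y := by simp [trB, lin_lim]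

theorem detB_lim (μ y : ℝ) : S.detB (0, μ, y) = 1 := by simp [detB, lin_lim]

theorem drift_lim (μ y : ℝ) : S.drift (0, μ, y) = μ / 2 + lam G * y := by simp [drift, S.g_lim]

theorem hasDerivAt_drift (r μ y : ℝ) :
    HasDerivAt (fun y => S.drift (r, μ, y)) (S.driftY (r, μ, y)) y := by
  have h1 : HasDerivAt (fun y : ℝ => (r, μ, y, (0 : ℝ), (0 : ℝ))) (0, 0, 1, 0, 0) y :=
    (hasDerivAt_const _ _).prodMk ((hasDerivAt_const _ _).prodMk ((hasDerivAt_id _).prodMk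
      (hasDerivAt_const _ _)))
  exact ((S.smooth_g.differentiable (by simp)) _).hasFDerivAt.comp_hasDerivAt y h1

theorem driftY_lim (μ y : ℝ) : S.driftY (0, μ, y) = lam G := by
  refine (S.hasDerivAt_drift 0 μ y).unique ?_
  simp only [drift_lim]
  simpa [mul_comm] using (hasDerivAt_mul_const (x := y) (lam G)).const_add (μ / 2)

variable {S} {B τ r μ y : ℝ}

theorem field_equilibrium (hτ : S.IsConjugate B τ) (hB : 0 ≤ B) (hr : |r| < τ) (hμ : |μ| < τ)
    (hy : |y| < τ) (h0 : S.drift (r, μ, y) = 0) :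
    chartField F G H r (r * μ) (S.emb r μ y 0) = 0 := by
  have h := (hτ.2 r μ y 0 0 hr hμ hy (by simpa using hB) (by simpa using hB) _ rfl).1
  have h1 : S.g (r, μ, y, 0, 0) = 0 := h0
  rw [h1, S.U_zero] at h
  refine Eq.trans h ?_
  simp

/-- The linearization is block triangular, with the blocks `r ∂g/∂y` and `∂U/∂u`. -/
theorem charCoeff_equilibrium (hτ : S.IsConjugate B τ) (hB : 0 < B) (hr : |r| < τ) (hμ : |μ| < τ)
    (hy : |y| < τ) (h0 : S.drift (r, μ, y) = 0)
    (hd : DifferentiableAt ℝ (chartField F G H r (r * μ)) (S.emb r μ y 0)) :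
    charCoeff (fderiv ℝ (chartField F G H r (r * μ)) (S.emb r μ y 0)) =
      (r * S.driftY (r, μ, y) + S.trB (r, μ, y),
        r * S.driftY (r, μ, y) * S.trB (r, μ, y) + S.detB (r, μ, y),
        r * S.driftY (r, μ, y) * S.detB (r, μ, y)) := by
  set J := fderiv ℝ (chartField F G H r (r * μ)) (S.emb r μ y 0) with hJ
  set D := fderiv ℝ S.v (r, μ, y) (0, 0, 1) with hD
  have hvs := S.smooth_v
  -- differentiate the conjugacy along the line through the equilibrium in the direction `d = (dy,
  -- da, db)`
  have key : ∀ d : ℝ × ℝ × ℝ, J (d.1 * (-2 * y + r * D.1) + d.2.1, d.1, d.1 * (1 + r * D.2) + d.2.2) =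
      (r * fderiv ℝ S.g (r, μ, y, 0, 0) (0, 0, d)) • (-2 * y + r * D.1, 1, 1 + r * D.2) +
        ((fderiv ℝ S.U (r, μ, y, 0, 0) (0, 0, d)).1, 0,
          (fderiv ℝ S.U (r, μ, y, 0, 0) (0, 0, d)).2) := by
    rintro ⟨dy, da, db⟩
    have hyt : HasDerivAt (fun t : ℝ => y + t * dy) dy 0 := (hasDerivAt_mul_const dy).const_add y
    have hline : HasDerivAt (fun t : ℝ => (r, μ, y + t * dy, t * da, t * db)) (0, 0, dy, da, db) 0 :=
      (hasDerivAt_const _ _).prodMk ((hasDerivAt_const _ _).prodMk (hyt.prodMk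
        ((hasDerivAt_mul_const da).prodMk (hasDerivAt_mul_const db))))
    have hl3 : HasDerivAt (fun t : ℝ => (r, μ, y + t * dy)) (0, 0, dy) 0 :=
      (hasDerivAt_const _ _).prodMk ((hasDerivAt_const _ _).prodMk hyt)
    have hv : HasDerivAt (fun t : ℝ => S.v (r, μ, y + t * dy)) (dy • D) 0 := by
      refine (((hvs.differentiable (by simp)) _).hasFDerivAt.comp_hasDerivAt_of_eq (0 : ℝ) hl3
        (y := (r, μ, y)) (by simp)).congr_deriv ?_
      rw [hD, ← map_smul]; simp
    have hv1 : HasDerivAt (fun t : ℝ => (S.v (r, μ, y + t * dy)).1) (dy * D.1) 0 := hv.fst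
    have hv2 : HasDerivAt (fun t : ℝ => (S.v (r, μ, y + t * dy)).2) (dy * D.2) 0 := hv.snd
    have hDt : DifferentiableAt ℝ (fun t : ℝ => fderiv ℝ S.v (r, μ, y + t * dy) (0, 0, 1)) 0 := by
      have h1 : ContDiff ℝ 1 (fderiv ℝ S.v) := hvs.fderiv_right (by norm_cast; omega)
      have h2 : ContDiff ℝ 1 fun t : ℝ => fderiv ℝ S.v (r, μ, y + t * dy) (0, 0, 1) :=
        (h1.comp (by fun_prop)).clm_apply contDiff_const
      exact (h2.differentiable (by simp)) _
    have hg : HasDerivAt (fun t : ℝ => S.g (r, μ, y + t * dy, t * da, t * db))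
        (fderiv ℝ S.g (r, μ, y, 0, 0) (0, 0, dy, da, db)) 0 :=
      ((S.smooth_g.differentiable (by simp)) _).hasFDerivAt.comp_hasDerivAt_of_eq (0 : ℝ) hline
        (by simp)
    have hU : HasDerivAt (fun t : ℝ => S.U (r, μ, y + t * dy, t * da, t * db))
        (fderiv ℝ S.U (r, μ, y, 0, 0) (0, 0, dy, da, db)) 0 :=
      ((S.smooth_U.differentiable (by simp)) _).hasFDerivAt.comp_hasDerivAt_of_eq (0 : ℝ) hline
        (by simp)
    have hU1 : HasDerivAt (fun t : ℝ => (S.U (r, μ, y + t * dy, t * da, t * db)).1) _ 0 := hU.fst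
    have hU2 : HasDerivAt (fun t : ℝ => (S.U (r, μ, y + t * dy, t * da, t * db)).2) _ 0 := hU.snd
    have hemb : HasDerivAt (fun t : ℝ => S.emb r μ (y + t * dy) (t * da, t * db))
        (dy * (-2 * y + r * D.1) + da, dy, dy * (1 + r * D.2) + db) 0 := by
      have h1 := ((((hyt.fun_pow 2).fun_neg.fun_add (hv1.const_mul r)).fun_add
        (hasDerivAt_mul_const da))).prodMk (hyt.prodMk ((hyt.fun_add
        (hv2.const_mul r)).fun_add (hasDerivAt_mul_const db)))
      refine HasDerivAt.congr_deriv (f := fun t : ℝ => S.emb r μ (y + t * dy) (t * da, t * db)) h1 ?_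
      simp only [zero_mul, add_zero, Nat.cast_ofNat, Prod.mk.injEq]
      refine ⟨by ring, trivial, by ring⟩
    have hL : HasDerivAt (fun t : ℝ => chartField F G H r (r * μ)
        (S.emb r μ (y + t * dy) (t * da, t * db)))
        (J (dy * (-2 * y + r * D.1) + da, dy, dy * (1 + r * D.2) + db)) 0 :=
      hd.hasFDerivAt.comp_hasDerivAt_of_eq (0 : ℝ) hemb (by simp [← Prod.zero_eq_mk])
    have hDt1 : DifferentiableAt ℝ (fun t : ℝ => (fderiv ℝ S.v (r, μ, y + t * dy) (0, 0, 1)).1) 0 :=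
      hDt.fst
    have hDt2 : DifferentiableAt ℝ (fun t : ℝ => (fderiv ℝ S.v (r, μ, y + t * dy) (0, 0, 1)).2) 0 :=
      hDt.snd
    have hR := (((hg.const_mul r).fun_mul ((hyt.const_mul (-2)).fun_add
      (hDt1.hasDerivAt.const_mul r))).fun_add hU1).prodMk ((hg.const_mul r).prodMk
      (((hg.const_mul r).fun_mul ((hDt2.hasDerivAt.const_mul r).const_add 1)).fun_add hU2))
    have c1 : ∀ᶠ t in 𝓝 (0 : ℝ), |y + t * dy| < τ :=
      hyt.continuousAt.abs.eventually (gt_mem_nhds (by simpa using hy))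
    have c2 : ∀ᶠ t in 𝓝 (0 : ℝ), |t * da| < B :=
      (hasDerivAt_mul_const da).continuousAt.abs.eventually (gt_mem_nhds (by simpa using hB))
    have c3 : ∀ᶠ t in 𝓝 (0 : ℝ), |t * db| < B :=
      (hasDerivAt_mul_const db).continuousAt.abs.eventually (gt_mem_nhds (by simpa using hB))
    have h1 := hL.unique (hR.congr_of_eventuallyEq (by
      filter_upwards [c1, c2, c3] with t t1 t2 t3
      exact (hτ.2 r μ _ _ _ hr hμ t1 t2.le t3.le _ rfl).1))
    rw [h1]
    have hg0 : S.g (r, μ, y, 0, 0) = 0 := h0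
    simp only [zero_mul, add_zero, hg0, mul_zero, Prod.smul_mk, smul_eq_mul, Prod.mk_add_mk,
      mul_one, ← hD]
  -- `U` vanishes on the slow manifold, hence so does its derivative along it
  have hUy : fderiv ℝ S.U (r, μ, y, 0, 0) (0, 0, 1, 0, 0) = 0 := by
    have h1 : HasDerivAt (fun y : ℝ => (r, μ, y, (0 : ℝ), (0 : ℝ))) (0, 0, 1, 0, 0) y :=
      (hasDerivAt_const _ _).prodMk ((hasDerivAt_const _ _).prodMk ((hasDerivAt_id _).prodMk
        (hasDerivAt_const _ _)))
    have h2 := ((S.smooth_U.differentiable (by simp)) _).hasFDerivAt.comp_hasDerivAt y h1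
    refine h2.unique ?_
    have : (S.U ∘ fun y : ℝ => (r, μ, y, (0 : ℝ), (0 : ℝ))) = fun _ => 0 :=
      funext fun y => S.U_zero r μ y
    rw [this]
    exact hasDerivAt_const _ _
  have k0 := key (1, 0, 0)
  have k1 := key (0, 1, 0)
  have k2 := key (0, 0, 1)
  simp only [one_mul, zero_mul, add_zero, zero_add, hUy, Prod.fst_zero, Prod.snd_zero] at k0 k1 k2
  rw [← S.V_zero] at k1 k2
  have z0 : ((0 : ℝ), (0 : ℝ), (0 : ℝ)) = 0 := rfl
  rw [z0, add_zero] at k0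
  exact charCoeff_of_flag k0 k1 k2

end StraightChart

end

section

/-! ### The blown-up equilibrium -/

namespace StraightChart

variable {F G H : ℝ → ℝ → ℝ → ℝ → ℝ → ℝ} {k : ℕ} {m : ℝ → ℝ → ℝ → ℝ × ℝ}
  (S : StraightChart F G H k m)

/-- The angular velocity of the linear flow of `∂U/∂u`. -/
def linAng (p : ℝ × ℝ × ℝ) (ψ : ℝ) : ℝ :=
  Real.sin ψ * (S.lin p (-Real.cos ψ) (-Real.sin ψ)).1 -
    Real.cos ψ * (S.lin p (-Real.cos ψ) (-Real.sin ψ)).2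

/-- At an equilibrium where the trace of `∂U/∂u` vanishes, the polar system for `h = 0` has a closed
orbit with `y` constant; the period is that of the linear oscillation. -/
theorem exists_isPolar_equilibrium {c : ℝ} (hc : 0 < c) {r μ y θ : ℝ} (h0 : S.drift (r, μ, y) = 0)
    (htr : S.trB (r, μ, y) = 0) (hA : ∀ ψ, c ≤ S.linAng (r, μ, y) ψ)
    (hA1 : ∀ ψ, |(S.linAng (r, μ, y) ψ)⁻¹ - 1| ≤ 1 / 4) (hdet : S.detB (r, μ, y) = θ ^ 2)
    (hθ : 3 / 4 < θ) (hθ' : θ < 5 / 4) :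
    ∃ w, S.IsPolar hc (0, y, r, μ) w ∧ w turn = (0, 0, 2 * Real.pi / θ) ∧ ∀ ψ, (w ψ).2.1 = 0 := by
  set p := (S.lin (r, μ, y) 1 0).1 with hp
  set s := (S.lin (r, μ, y) 1 0).2 with hs
  set q := (S.lin (r, μ, y) 0 1).1 with hq
  have hp' : (S.lin (r, μ, y) 0 1).2 = -p := by
    have : p + (S.lin (r, μ, y) 0 1).2 = 0 := htr
    linarith
  have hdet' : -p ^ 2 - q * s = θ ^ 2 := by
    rw [← hdet, detB, hp', ← hp, ← hs, ← hq]; ring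
  have hlin : ∀ ψ, S.lin (r, μ, y) (-Real.cos ψ) (-Real.sin ψ) =
      (-(p * Real.cos ψ) - q * Real.sin ψ, -(s * Real.cos ψ) + p * Real.sin ψ) := fun ψ => by
    rw [lin_eq]
    refine Prod.ext ?_ ?_
    · simp only [Prod.fst_add, Prod.smul_fst, smul_eq_mul, ← hp, ← hq]; ring
    · simp only [Prod.snd_add, Prod.smul_snd, smul_eq_mul, ← hs, hp']; ring
  set A : ℝ → ℝ := S.linAng (r, μ, y) with hAdef
  have hAe : ∀ ψ, A ψ = -2 * p * (Real.sin ψ * Real.cos ψ) - q * Real.sin ψ ^ 2 +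
      s * Real.cos ψ ^ 2 := fun ψ => by
    simp only [hAdef, linAng, hlin]; ring
  have hApos : ∀ ψ, 0 < A ψ := fun ψ => hc.trans_le (hA ψ)
  have hAd : ∀ ψ, HasDerivAt A (-2 * (p * Real.cos ψ ^ 2 + (q + s) * (Real.sin ψ * Real.cos ψ) -
      p * Real.sin ψ ^ 2)) ψ := fun ψ => by
    have h1 := Real.hasDerivAt_sin ψ
    have h2 := Real.hasDerivAt_cos ψ
    have h3 := (((h1.fun_mul h2).const_mul (-2 * p)).fun_sub ((h1.fun_pow 2).const_mul q)).fun_add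
      ((h2.fun_pow 2).const_mul s)
    rw [show A = fun ψ => _ from funext hAe]
    refine h3.congr_deriv ?_
    push_cast; ring
  have hAc : Continuous A := continuous_iff_continuousAt.2 fun ψ => (hAd ψ).continuousAt
  have hAic : Continuous fun ψ => (A ψ)⁻¹ := hAc.inv₀ fun ψ => (hApos ψ).ne'
  -- without trace, the linear flow has the invariant `s² A`, so that `l = -log(A) / 2` up to a
  -- constant
  set t : ℝ → ℝ := fun ψ => ∫ x in (0 : ℝ)..ψ, (A x)⁻¹ with ht
  have htd : ∀ ψ, HasDerivAt t (A ψ)⁻¹ ψ := fun ψ => (hAic.integral_hasStrictDerivAt 0 ψ).hasDerivAt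
  set l : ℝ → ℝ := fun ψ => (Real.log (A 0) - Real.log (A ψ)) / 2 with hl
  have hld : ∀ ψ, HasDerivAt l ((p * Real.cos ψ ^ 2 + (q + s) * (Real.sin ψ * Real.cos ψ) -
      p * Real.sin ψ ^ 2) * (A ψ)⁻¹) ψ := fun ψ => by
    refine ((((hAd ψ).log (hApos ψ).ne').const_sub _).div_const 2).congr_deriv ?_
    field_simp
  have hA2π : A (2 * Real.pi) = A 0 := by simp [hAe]
  have hl0 : l 0 = 0 := by simp [hl]
  have hl1 : l (2 * Real.pi) = 0 := by simp [hl, hA2π]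
  obtain ⟨w, hw, hws⟩ := S.isPolar_of_hasDerivAt (hc := hc) (π := (0, y, r, μ)) (l := l)
      (q := fun _ => 0) (t := t) ⟨hl0, rfl, by simp [ht]⟩ fun ψ _ => by
    refine ((hld ψ).prodMk ((hasDerivAt_const _ (0 : ℝ)).prodMk (htd ψ))).congr_deriv ?_
    have hvel : S.vel (ψ, (0, y, r, μ), (l ψ, 0, t ψ)) =
        S.lin (r, μ, y) (-Real.cos ψ) (-Real.sin ψ) := by simp [vel, rad, slow, lin]
    have hang : S.ang (ψ, (0, y, r, μ), (l ψ, 0, t ψ)) = A ψ := by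
      simp only [ang, hvel]; rfl
    have hrate : S.rate (ψ, (0, y, r, μ), (l ψ, 0, t ψ)) = 0 := by
      simp only [rate, slow, rad, zero_mul, mul_zero, add_zero]; exact h0
    simp only [StraightChart.polar, hang, hrate, hvel, hlin, recip_eq hc (hA ψ), zero_mul]
    congr 1
    ring
  refine ⟨w, hw, ?_, fun ψ => by rw [hws]⟩
  have hturn : w turn = (0, 0, t (2 * Real.pi)) := by rw [hws]; simp [turn, hl1]
  rw [hturn]
  -- a left eigenvector of the linear system gives a conserved quantity
  have hθ0 : 0 < θ := by linarith
  set X : ℝ → ℂ := fun ψ => ((s * (Real.exp (l ψ) * -Real.cos ψ) : ℝ) +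
      (θ * Complex.I - p) * ((Real.exp (l ψ) * -Real.sin ψ : ℝ) : ℂ)) *
      Complex.exp (-(θ * Complex.I) * t ψ) with hX
  have hXd : ∀ ψ, HasDerivAt X 0 ψ := fun ψ => by
    set L := Real.exp (l ψ) with hL
    have hcs := Real.sin_sq_add_cos_sq ψ
    have hne := (hApos ψ).ne'
    have d1 : HasDerivAt (fun ψ => Real.exp (l ψ) * -Real.cos ψ)
        (L * (-(p * Real.cos ψ) - q * Real.sin ψ) * (A ψ)⁻¹) ψ := by
      refine ((hld ψ).exp.fun_mul (Real.hasDerivAt_cos ψ).fun_neg).congr_deriv ?_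
      rw [← hL]
      field_simp
      rw [hAe]
      linear_combination L * (-p * Real.cos ψ - q * Real.sin ψ) * hcs
    have d2 : HasDerivAt (fun ψ => Real.exp (l ψ) * -Real.sin ψ)
        (L * (-(s * Real.cos ψ) + p * Real.sin ψ) * (A ψ)⁻¹) ψ := by
      refine ((hld ψ).exp.fun_mul (Real.hasDerivAt_sin ψ).fun_neg).congr_deriv ?_
      rw [← hL]
      field_simp
      rw [hAe]
      linear_combination L * (-s * Real.cos ψ + p * Real.sin ψ) * hcs
    have d3 : HasDerivAt (fun ψ => Complex.exp (-(θ * Complex.I) * t ψ)) _ ψ :=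
      ((htd ψ).ofReal_comp.const_mul (-(θ * Complex.I))).cexp
    refine (((d1.const_mul s).ofReal_comp.fun_add (d2.ofReal_comp.const_mul
      (θ * Complex.I - p))).fun_mul d3).congr_deriv ?_
    have hdetC : (-(p : ℂ) ^ 2 - q * s) = (θ : ℂ) ^ 2 := by
      rw [← Complex.ofReal_pow θ, ← hdet']; push_cast; ring
    simp only [← hL]
    push_cast
    linear_combination (Complex.exp (-(θ * Complex.I) * t ψ) * L * (A ψ : ℂ)⁻¹ * Complex.sin ψ) *
      hdetC + (Complex.exp (-(θ * Complex.I) * t ψ) * L * (A ψ : ℂ)⁻¹ * Complex.sin ψ * θ ^ 2) *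
      Complex.I_sq
  have hXc := is_const_of_deriv_eq_zero (fun ψ => (hXd ψ).differentiableAt)
    (fun ψ => (hXd ψ).deriv) (2 * Real.pi) 0
  have hs0 : s ≠ 0 := by
    have := hApos 0
    rw [hAe] at this
    simp at this
    exact this.ne'
  have ht0 : t 0 = 0 := by simp [ht]
  have hexp : Complex.exp (-(θ * Complex.I) * t (2 * Real.pi)) = 1 := by
    have hsC : (s : ℂ) ≠ 0 := by exact_mod_cast hs0
    simp only [hX, hl0, hl1, ht0] at hXc
    simpa [hsC] using hXc
  obtain ⟨n, hn⟩ := Complex.exp_eq_one_iff.1 hexp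
  have hn' : θ * t (2 * Real.pi) = -n * (2 * Real.pi) := by
    have h1 : (Complex.I : ℂ) * ((θ * t (2 * Real.pi) : ℝ) + (n * (2 * Real.pi) : ℝ)) = 0 := by
      push_cast; linear_combination -hn
    have h2 := (mul_eq_zero.1 h1).resolve_left Complex.I_ne_zero
    have h3 : θ * t (2 * Real.pi) + n * (2 * Real.pi) = 0 := by exact_mod_cast h2
    linarith
  -- the period is a multiple of `2π / θ`; it is so close to `2π` that the multiple is the first one
  have hT : |t (2 * Real.pi) - 2 * Real.pi| ≤ Real.pi / 2 := by
    have h1 : t (2 * Real.pi) - 2 * Real.pi = ∫ x in (0 : ℝ)..2 * Real.pi, ((A x)⁻¹ - 1) := by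
      rw [intervalIntegral.integral_sub (hAic.intervalIntegrable _ _) (by simp)]
      simp [ht]
    rw [h1, ← Real.norm_eq_abs]
    refine (intervalIntegral.norm_integral_le_of_norm_le_const (C := 1 / 4) fun x _ => hA1 x).trans ?_
    rw [sub_zero, abs_of_pos Real.two_pi_pos]
    linarith
  have hn1 : n = -1 := by
    have hpi := Real.pi_pos
    obtain ⟨h1, h2⟩ := abs_le.1 hT
    have h3 : 0 < -(n : ℝ) * (2 * Real.pi) := by rw [← hn']; nlinarith
    have h4 : -(n : ℝ) * (2 * Real.pi) < 2 * (2 * Real.pi) := by rw [← hn']; nlinarith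
    have h5 : 0 < -(n : ℝ) := by nlinarith
    have h6 : -(n : ℝ) < 2 := lt_of_mul_lt_mul_right h4 Real.two_pi_pos.le
    have h7 : 0 < -n := by exact_mod_cast h5
    have h8 : -n < 2 := by exact_mod_cast h6
    omega
  rw [hn1] at hn'
  have : t (2 * Real.pi) = 2 * Real.pi / θ := by
    rw [eq_div_iff hθ0.ne']
    push_cast at hn'
    linarith
  rw [this]

end StraightChart

end

section

/-! ### The curve of Hopf points -/

/-- The derivative in a direction, computed along a line. -/
theorem fderiv_eq_of_line {E F : Type} [NormedAddCommGroup E] [NormedSpace ℝ E]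
    [NormedAddCommGroup F] [NormedSpace ℝ F] {f : E → F} {x v : E} {f' : F}
    (hf : DifferentiableAt ℝ f x) (h : HasDerivAt (fun t : ℝ => f (x + t • v)) f' 0) :
    fderiv ℝ f x v = f' := by
  have h1 : HasDerivAt (fun t : ℝ => x + t • v) v 0 := by
    simpa using ((hasDerivAt_id (0 : ℝ)).smul_const v).const_add x
  exact (hf.hasFDerivAt.comp_hasDerivAt_of_eq (0 : ℝ) h1 (by simp)).unique h

/-- A differentiable function deviates from its value at `0` by at most a multiple of `|r|`. -/
theorem exists_lipschitz_bound {f : ℝ → ℝ} (hf : DifferentiableAt ℝ f 0) :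
    ∃ C : ℝ, ∀ᶠ r in 𝓝 0, |f r - f 0| ≤ C * |r| := by
  obtain ⟨C, hC⟩ := hf.isBigO_sub.bound
  exact ⟨C, hC.mono fun r hr => by simpa using hr⟩

namespace StraightChart

variable {F G H : ℝ → ℝ → ℝ → ℝ → ℝ → ℝ} {k : ℕ} {m : ℝ → ℝ → ℝ → ℝ × ℝ}
  (S : StraightChart F G H k m)

/-- The Jacobian determinant of the slow velocity and the trace of `∂U/∂u` with respect to
`(y, μ₂)`. -/
def hopfJac (p : ℝ × ℝ × ℝ) : ℝ := fderiv ℝ S.trB p (0, 1, 0) * S.driftY p -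
  fderiv ℝ S.trB p (0, 0, 1) * fderiv ℝ S.drift p (0, 1, 0)

theorem continuous_hopfJac : Continuous S.hopfJac := by
  have h1 : Continuous (fderiv ℝ S.trB) := S.contDiff_trB.continuous_fderiv (by simp)
  have h2 : Continuous (fderiv ℝ S.drift) := S.contDiff_drift.continuous_fderiv (by simp)
  have h3 := S.contDiff_driftY.continuous
  unfold hopfJac
  fun_prop

/-- In the limit the two functions are `μ₂ / 2 + λ y` and `2 y`. -/
theorem hopfJac_zero : S.hopfJac 0 = -1 := by
  have ht := (S.contDiff_trB.differentiable (by simp)) 0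
  have hd := (S.contDiff_drift.differentiable (by simp)) 0
  have e1 : fderiv ℝ S.trB 0 (0, 1, 0) = 0 := fderiv_eq_of_line ht (by
    simpa [trB_lim] using hasDerivAt_const (0 : ℝ) (0 : ℝ))
  have e2 : fderiv ℝ S.trB 0 (0, 0, 1) = 2 := fderiv_eq_of_line ht (by
    simpa [trB_lim] using (hasDerivAt_id (0 : ℝ)).const_mul 2)
  have e3 : fderiv ℝ S.drift 0 (0, 1, 0) = 1 / 2 := fderiv_eq_of_line hd (by
    simpa [drift_lim] using (hasDerivAt_id (0 : ℝ)).div_const 2)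
  rw [hopfJac, e1, e2, e3]; norm_num

theorem continuous_linAng : Continuous fun q : (ℝ × ℝ × ℝ) × ℝ => S.linAng q.1 q.2 := by
  have h1 : Continuous fun q : (ℝ × ℝ × ℝ) × ℝ => S.lin q.1 (-Real.cos q.2) (-Real.sin q.2) :=
    S.smooth_V.continuous.comp (by fun_prop)
  unfold linAng
  fun_prop

/-- In the limit the linear flow is the rotation with angular velocity `1`. -/
theorem eventually_linAng {c : ℝ} (hc1 : c < 1) {p : ℝ → ℝ × ℝ × ℝ} (hpc : ContinuousAt p 0)
    (hp0 : p 0 = 0) :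
    ∀ᶠ r in 𝓝 (0 : ℝ), ∀ ψ, c ≤ S.linAng (p r) ψ ∧ |(S.linAng (p r) ψ)⁻¹ - 1| ≤ 1 / 4 := by
  have hper : ∀ p, Function.Periodic (S.linAng p) (2 * Real.pi) := fun p ψ => by
    simp [linAng]
  suffices ∀ᶠ r in 𝓝 (0 : ℝ), ∀ ψ ∈ Icc 0 (2 * Real.pi),
      c < S.linAng (p r) ψ ∧ |(S.linAng (p r) ψ)⁻¹ - 1| < 1 / 4 by
    filter_upwards [this] with r h2 ψ
    obtain ⟨ψ', hψ', e⟩ := (hper (p r)).exists_mem_Ico₀ Real.two_pi_pos ψ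
    obtain ⟨a1, a2⟩ := h2 ψ' ⟨hψ'.1, hψ'.2.le⟩
    rw [e]
    exact ⟨a1.le, a2.le⟩
  refine isCompact_Icc.eventually_forall_of_forall_eventually fun ψ _ => ?_
  have h0 : ∀ f : ℝ × ℝ × ℝ → ℝ → ℝ, (Continuous fun q : (ℝ × ℝ × ℝ) × ℝ => f q.1 q.2) →
      Tendsto (fun q : ℝ × ℝ => f (p q.1) q.2) (𝓝 (0, ψ)) (𝓝 (f (p 0) ψ)) := fun f hf => by
    have h2 : Tendsto (fun q : ℝ × ℝ => (p q.1, q.2)) (𝓝 (0, ψ)) (𝓝 (p 0, ψ)) :=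
      (hpc.tendsto.comp (continuous_fst.tendsto ((0 : ℝ), ψ))).prodMk_nhds
        (continuous_snd.tendsto ((0 : ℝ), ψ))
    exact (hf.tendsto (p 0, ψ)).comp h2
  have h1 := h0 S.linAng S.continuous_linAng
  have h3 : S.linAng (p 0) ψ = 1 := by
    rw [hp0]
    have : S.lin 0 (-Real.cos ψ) (-Real.sin ψ) = (Real.sin ψ, -Real.cos ψ) := by
      refine (S.lin_lim 0 0 (-Real.cos ψ) (-Real.sin ψ)).trans ?_
      simp
    rw [linAng, this]
    simp only
    linear_combination Real.sin_sq_add_cos_sq ψ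
  rw [h3] at h1
  refine (h1.eventually (lt_mem_nhds hc1)).and
    (((h1.inv₀ one_ne_zero).sub_const 1).abs.eventually (gt_mem_nhds ?_))
  norm_num

/-- Equilibria on the slow manifold where the trace of `∂U/∂u` vanishes form a curve over `r`. -/
theorem exists_hopf_curve (hlam : lam G ≠ 0) {c : ℝ} (hc1 : c < 1) :
    ∃ (Z : ℝ → ℝ × ℝ) (C : ℝ), ContinuousAt Z 0 ∧ Z 0 = 0 ∧ ∀ᶠ r in 𝓝 (0 : ℝ), ∀ p : ℝ × ℝ × ℝ,
      p = (r, (Z r).2, (Z r).1) → S.drift p = 0 ∧ S.trB p = 0 ∧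
        (∀ ψ, c ≤ S.linAng p ψ ∧ |(S.linAng p ψ)⁻¹ - 1| ≤ 1 / 4) ∧
        9 / 16 < S.detB p ∧ S.detB p < 25 / 16 ∧ |√(S.detB p) - 1| ≤ C * |r| ∧
        |S.driftY p - lam G| ≤ C * |r| ∧ S.hopfJac p ≠ 0 ∧ S.driftY p ≠ 0 := by
  -- implicit function theorem for the slow velocity and the trace, as functions of `(y, μ₂)`
  set Ξ : ℝ × (ℝ × ℝ) → ℝ × ℝ := fun q =>
    (S.drift (q.1, q.2.2, q.2.1), S.trB (q.1, q.2.2, q.2.1)) with hX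
  have hXs : ContDiff ℝ (k + 2 : ℕ) Ξ :=
    (S.contDiff_drift.comp (by fun_prop)).prodMk (S.contDiff_trB.comp (by fun_prop))
  have hcd : ContDiffAt ℝ (k + 2 : ℕ) Ξ ((0 : ℝ), (0 : ℝ × ℝ)) := hXs.contDiffAt
  have hn : ((k + 2 : ℕ) : ℕ∞ω) ≠ 0 := by simp
  have hpart : ∀ w : ℝ × ℝ, fderiv ℝ Ξ (0, 0) (0, w) = (w.2 / 2 + lam G * w.1, 2 * w.1) := by
    intro w
    refine fderiv_eq_of_line (hXs.differentiable hn _) ?_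
    simp only [hX, Prod.smul_mk, Prod.mk_add_mk, add_zero, zero_add, Prod.smul_fst,
      Prod.smul_snd, smul_eq_mul, mul_zero, drift_lim, trB_lim]
    refine (((hasDerivAt_mul_const w.2).div_const 2).fun_add
      ((hasDerivAt_mul_const w.1).const_mul _)).prodMk ((hasDerivAt_mul_const w.1).const_mul 2)
  have hinv : (fderiv ℝ Ξ ((0 : ℝ), (0 : ℝ × ℝ)) ∘L .inr ℝ ℝ (ℝ × ℝ)).IsInvertible := by
    refine isInvertible_of_injective fun w hw => ?_
    have h1 : (w.2 / 2 + lam G * w.1, 2 * w.1) = (0 : ℝ × ℝ) := by rw [← hpart]; exact hw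
    have h2 : 2 * w.1 = 0 := congrArg Prod.snd h1
    have h3 : w.2 / 2 + lam G * w.1 = 0 := congrArg Prod.fst h1
    have h4 : w.1 = 0 := by linarith
    rw [h4, mul_zero, add_zero] at h3
    exact Prod.ext h4 (show w.2 = 0 by linarith)
  set Z := hcd.implicitFunction hn hinv with hZ
  have hZ0 : Z 0 = 0 := hcd.implicitFunction_apply_self hn hinv
  have hZs : ContDiffAt ℝ (k + 2 : ℕ) Z 0 := hcd.contDiffAt_implicitFunction hn hinv
  set p : ℝ → ℝ × ℝ × ℝ := fun r => (r, (Z r).2, (Z r).1) with hp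
  have hp0 : p 0 = 0 := by simp [hp, hZ0]
  have hps : ContDiffAt ℝ (k + 2 : ℕ) p 0 := contDiffAt_id.prodMk (hZs.snd.prodMk hZs.fst)
  have hpd : DifferentiableAt ℝ p 0 := hps.differentiableAt hn
  have hdet0 : S.detB (p 0) = 1 := by rw [hp0]; exact S.detB_lim 0 0
  have hdr0 : S.driftY (p 0) = lam G := by rw [hp0]; exact S.driftY_lim 0 0
  have hdd : DifferentiableAt ℝ (fun r => S.detB (p r)) 0 :=
    ((S.contDiff_detB.differentiable hn) _).comp 0 hpd
  have hdrd : DifferentiableAt ℝ (fun r => S.driftY (p r)) 0 :=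
    ((S.contDiff_driftY.differentiable hn) _).comp 0 hpd
  obtain ⟨C₁, hC₁⟩ := exists_lipschitz_bound (hdd.sqrt (by rw [hdet0]; exact one_ne_zero))
  obtain ⟨C₂, hC₂⟩ := exists_lipschitz_bound hdrd
  simp only [hdet0, Real.sqrt_one, hdr0] at hC₁ hC₂
  have hjc : ContinuousAt (fun r => S.hopfJac (p r)) 0 :=
    S.continuous_hopfJac.continuousAt.comp hpd.continuousAt
  have hang := S.eventually_linAng hc1 hpd.continuousAt hp0
  refine ⟨Z, max C₁ C₂, hZs.continuousAt, hZ0, ?_⟩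
  filter_upwards [hcd.eventually_apply_implicitFunction hn hinv, hang, hC₁, hC₂,
    hdd.continuousAt.eventually (lt_mem_nhds (show 9 / 16 < S.detB (p 0) by rw [hdet0]; norm_num)),
    hdd.continuousAt.eventually (gt_mem_nhds (show S.detB (p 0) < 25 / 16 by rw [hdet0]; norm_num)),
    hjc.eventually_ne (show S.hopfJac (p 0) ≠ 0 by rw [hp0, hopfJac_zero]; norm_num),
    hdrd.continuousAt.eventually_ne (show S.driftY (p 0) ≠ 0 by rw [hdr0]; exact hlam)]
    with r h1 h2 h3 h4 h5 h6 h7 h8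
  rintro _ rfl
  have h9 : Ξ (r, Z r) = 0 := by
    rw [h1]
    have e1 := S.drift_lim 0 0
    have e2 := S.trB_lim 0 0
    simp only [hX, Prod.fst_zero, Prod.snd_zero, e1, e2]
    simp
  refine ⟨congrArg Prod.fst h9, congrArg Prod.snd h9, fun ψ => ?_, h5, h6,
    h3.trans (by gcongr; exact le_max_left _ _), h4.trans (by gcongr; exact le_max_right _ _), h7, h8⟩
  exact h2 ψ

end StraightChart

end

section

/-! ### Crossing of the imaginary axis -/

/-- An equilibrium with the eigenvalues `± iθ, κ`, where `θ, κ ≠ 0`, continues to a smooth branch of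
equilibria that contains all equilibria nearby, and the eigenvalue `iθ` continues smoothly. -/
theorem exists_smooth_eigenvalue {X : ℝ → ℝ × ℝ × ℝ → ℝ × ℝ × ℝ} {μ₀ κ θ : ℝ} {p₀ : ℝ × ℝ × ℝ}
    (hX : ContDiffAt ℝ ∞ (fun q : ℝ × ℝ × ℝ × ℝ => X q.1 q.2) (μ₀, p₀)) (h0 : X μ₀ p₀ = 0)
    (hJ : charCoeff (fderiv ℝ (X μ₀) p₀) = (κ, θ ^ 2, κ * θ ^ 2)) (hκ : κ ≠ 0) (hθ : θ ≠ 0) :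
    ∃ (p : ℝ → ℝ × ℝ × ℝ) (ev : ℝ → ℂ), ContDiffAt ℝ ∞ p μ₀ ∧ ContDiffAt ℝ ∞ ev μ₀ ∧ p μ₀ = p₀ ∧
      ev μ₀ = θ * Complex.I ∧
      (∀ᶠ μ in 𝓝 μ₀, X μ (p μ) = 0 ∧ ev μ ∈ eigenvalues (fderiv ℝ (X μ) (p μ))) ∧
      ∀ᶠ q : ℝ × ℝ × ℝ × ℝ in 𝓝 (μ₀, p₀), X q.1 q.2 = 0 → p q.1 = q.2 := by
  set f : ℝ × (ℝ × ℝ × ℝ) → ℝ × ℝ × ℝ := fun q => X q.1 q.2 with hf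
  have hn : (∞ : ℕ∞ω) ≠ 0 := by simp
  have hpart : fderiv ℝ f (μ₀, p₀) ∘L .inr ℝ ℝ (ℝ × ℝ × ℝ) = fderiv ℝ (X μ₀) p₀ := by
    have h1 := (hX.differentiableAt hn).hasFDerivAt
    have h2 : HasFDerivAt (fun q => (μ₀, q)) (ContinuousLinearMap.inr ℝ ℝ (ℝ × ℝ × ℝ)) p₀ :=
      hasFDerivAt_prodMk_right μ₀ p₀
    exact (h1.comp p₀ h2).fderiv.symm
  have hinv : (fderiv ℝ f (μ₀, p₀) ∘L .inr ℝ ℝ (ℝ × ℝ × ℝ)).IsInvertible := by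
    rw [hpart]
    refine isInvertible_of_charCoeff ?_
    rw [hJ]
    exact mul_ne_zero hκ (pow_ne_zero 2 hθ)
  -- the branch of equilibria
  set p := hX.implicitFunction hn hinv with hp
  have hp0 : p μ₀ = p₀ := hX.implicitFunction_apply_self hn hinv
  have hps : ContDiffAt ℝ ∞ p μ₀ := hX.contDiffAt_implicitFunction hn hinv
  have hpe : ∀ᶠ μ in 𝓝 μ₀, X μ (p μ) = 0 := by
    filter_upwards [hX.eventually_apply_implicitFunction hn hinv] with μ h1
    exact h1.trans h0
  have hJs : ContDiffAt ℝ ∞ (fun μ => charCoeff (fderiv ℝ (X μ) (p μ))) μ₀ := by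
    refine (contDiff_charCoeff (n := ⊤)).contDiffAt.comp μ₀ ?_
    refine ContDiffAt.fderiv (n := ∞) ?_ hps (by simp)
    rw [hp0]
    exact hX
  have hJ0 : charCoeff (fderiv ℝ (X μ₀) (p μ₀)) = (κ, θ ^ 2, κ * θ ^ 2) := by rw [hp0, hJ]
  set e : ℝ → ℝ × ℝ × ℝ := fun μ => charCoeff (fderiv ℝ (X μ) (p μ)) with he
  have he0 : e μ₀ = (κ, θ ^ 2, κ * θ ^ 2) := hJ0
  set P : ℝ × ℂ → ℂ := fun q => q.2 ^ 3 - (e q.1).1 * q.2 ^ 2 + (e q.1).2.1 * q.2 - (e q.1).2.2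
    with hP
  set z₀ : ℂ := θ * Complex.I with hz₀
  have hPs : ContDiffAt ℝ ∞ P (μ₀, z₀) := by
    have h1 : ContDiffAt ℝ ∞ (fun q : ℝ × ℂ => e q.1) (μ₀, z₀) := hJs.comp (μ₀, z₀) contDiffAt_fst
    have h2 : ContDiffAt ℝ ∞ (fun q : ℝ × ℂ => q.2) (μ₀, z₀) := contDiffAt_snd
    have hof : ∀ {g : ℝ × ℂ → ℝ}, ContDiffAt ℝ ∞ g (μ₀, z₀) →
        ContDiffAt ℝ ∞ (fun q => (g q : ℂ)) (μ₀, z₀) := fun {g} hg =>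
      Complex.ofRealCLM.contDiff.contDiffAt.comp (μ₀, z₀) hg
    exact (((h2.pow 3).sub ((hof h1.fst).mul (h2.pow 2))).add ((hof h1.snd.fst).mul h2)).sub
      (hof h1.snd.snd)
  have hP0 : P (μ₀, z₀) = 0 := by
    simp only [hP, he0, hz₀]
    push_cast
    linear_combination ((θ : ℂ) ^ 3 * Complex.I - κ * θ ^ 2) * Complex.I_sq
  -- `iθ` is a simple root of the characteristic polynomial
  have hPd : ∀ w, fderiv ℝ P (μ₀, z₀) (0, w) = -2 * θ * (θ + κ * Complex.I) * w := fun w => by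
    refine fderiv_eq_of_line (hPs.differentiableAt hn) ?_
    simp only [hP, Prod.smul_mk, Prod.mk_add_mk, smul_zero, add_zero, he0]
    have h1 : HasDerivAt (fun t : ℝ => z₀ + t • w) w 0 := by
      simpa using ((hasDerivAt_id (0 : ℝ)).smul_const w).const_add z₀
    refine ((((h1.fun_pow 3).fun_sub ((h1.fun_pow 2).const_mul (κ : ℂ))).fun_add
      (h1.const_mul ((θ ^ 2 : ℝ) : ℂ))).sub_const _).congr_deriv ?_
    simp only [zero_smul, add_zero, hz₀]
    push_cast
    linear_combination (3 * (θ : ℂ) ^ 2 * w) * Complex.I_sq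
  have hPinv : (fderiv ℝ P (μ₀, z₀) ∘L .inr ℝ ℝ ℂ).IsInvertible := by
    refine isInvertible_of_injective fun w hw => ?_
    have h1 : -2 * θ * (θ + κ * Complex.I) * w = 0 := (hPd w).symm.trans hw
    refine (mul_eq_zero.1 h1).resolve_left ?_
    refine mul_ne_zero (mul_ne_zero (by norm_num) (by exact_mod_cast hθ)) fun h2 => hθ ?_
    simpa using congrArg Complex.re h2
  refine ⟨p, hPs.implicitFunction hn hPinv, hps, hPs.contDiffAt_implicitFunction hn hPinv, hp0,
    hPs.implicitFunction_apply_self hn hPinv, ?_, ?_⟩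
  · filter_upwards [hpe, hPs.eventually_apply_implicitFunction hn hPinv] with μ h1 h2
    exact ⟨h1, (mem_eigenvalues_iff _ _).2 (h2.trans hP0)⟩
  · filter_upwards [hX.eventually_apply_eq_iff_implicitFunction hn hinv] with q h1 h2
    exact h1.1 (h2.trans h0.symm)

/-- The real part of a nonreal root of `(z - κ) (z² - t z + d)` is `t / 2`. -/
theorem re_eq_half_trace {z : ℂ} {κ t d : ℝ} (hz : z.im ≠ 0)
    (h : z ^ 3 - ((κ + t : ℝ) : ℂ) * z ^ 2 + ((κ * t + d : ℝ) : ℂ) * z - ((κ * d : ℝ) : ℂ) = 0) :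
    z.re = t / 2 := by
  have h1 : (z - κ) * (z ^ 2 - t * z + d) = 0 := by
    rw [← h]; push_cast; ring
  have h2 : z - κ ≠ 0 := fun h3 => hz (by simpa using congrArg Complex.im h3)
  have h3 := congrArg Complex.im ((mul_eq_zero.1 h1).resolve_left h2)
  simp only [sq, Complex.add_im, Complex.sub_im, Complex.mul_im, Complex.ofReal_re,
    Complex.ofReal_im, Complex.zero_im, zero_mul, add_zero] at h3
  have h4 : z.im * (2 * z.re - t) = 0 := by linear_combination h3
  have := (mul_eq_zero.1 h4).resolve_left hz
  linarith

namespace StraightChart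

variable {F G H : ℝ → ℝ → ℝ → ℝ → ℝ → ℝ} {k : ℕ} {m : ℝ → ℝ → ℝ → ℝ × ℝ}
  {S : StraightChart F G H k m}

theorem fderiv_drift (r μ y : ℝ) : fderiv ℝ S.drift (r, μ, y) (0, 0, 1) = S.driftY (r, μ, y) := by
  refine fderiv_eq_of_line (S.contDiff_drift.differentiable (by simp) _) ?_
  have h1 : HasDerivAt (fun t : ℝ => y + t) 1 0 := (hasDerivAt_id (0 : ℝ)).const_add y
  simpa [Function.comp_def] using (S.hasDerivAt_drift r μ y).comp_of_eq (0 : ℝ) h1 (by simp)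

/-- The equilibria on the slow manifold form a branch over `μ₂`, along which the trace of `∂U/∂u`
has the derivative `hopfJac / driftY`. -/
theorem exists_equilibria {r μ y : ℝ} (h0 : S.drift (r, μ, y) = 0) (hY : S.driftY (r, μ, y) ≠ 0) :
    ∃ g : ℝ → ℝ, ContinuousAt g μ ∧ g μ = y ∧ (∀ᶠ x in 𝓝 μ, S.drift (r, x, g x) = 0) ∧
      HasDerivAt (fun x => S.trB (r, x, g x)) (S.hopfJac (r, μ, y) / S.driftY (r, μ, y)) μ := by
  set f : ℝ × ℝ → ℝ := fun q => S.drift (r, q.1, q.2) with hf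
  have hn : ((k + 2 : ℕ) : ℕ∞ω) ≠ 0 := by simp
  have hfs : ContDiff ℝ (k + 2 : ℕ) f := S.contDiff_drift.comp (by fun_prop)
  have hcd : ContDiffAt ℝ (k + 2 : ℕ) f (μ, y) := hfs.contDiffAt
  have hpart : ∀ w, fderiv ℝ f (μ, y) (0, w) = w * S.driftY (r, μ, y) := fun w => by
    refine fderiv_eq_of_line (hfs.differentiable hn _) ?_
    have h1 : HasDerivAt (fun t : ℝ => y + t * w) w 0 := (hasDerivAt_mul_const w).const_add y
    have h2 := (S.hasDerivAt_drift r μ y).comp_of_eq (0 : ℝ) h1 (by simp)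
    rw [mul_comm]
    simpa [hf, Function.comp_def] using h2
  have hinv : (fderiv ℝ f (μ, y) ∘L .inr ℝ ℝ ℝ).IsInvertible := by
    refine isInvertible_of_injective fun w hw => ?_
    have h1 : w * S.driftY (r, μ, y) = 0 := (hpart w).symm.trans hw
    exact (mul_eq_zero.1 h1).resolve_right hY
  set g := hcd.implicitFunction hn hinv with hg
  have hg0 : g μ = y := hcd.implicitFunction_apply_self hn hinv
  have hgd : HasDerivAt g (deriv g μ) μ :=
    ((hcd.contDiffAt_implicitFunction hn hinv).differentiableAt hn).hasDerivAt
  have hge : ∀ᶠ x in 𝓝 μ, S.drift (r, x, g x) = 0 := by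
    filter_upwards [hcd.eventually_apply_implicitFunction hn hinv] with x hx
    exact hx.trans h0
  have hline : HasDerivAt (fun x => (r, x, g x)) (0, 1, deriv g μ) μ :=
    (hasDerivAt_const _ _).prodMk ((hasDerivAt_id _).prodMk hgd)
  have hsplit : ((0 : ℝ), (1 : ℝ), deriv g μ) = (0, 1, 0) + deriv g μ • (0, 0, 1) := by simp
  have d1 := ((S.contDiff_drift.differentiable hn) (r, μ, y)).hasFDerivAt.comp_hasDerivAt_of_eq μ
    hline (by simp [hg0])
  have d2 := ((S.contDiff_trB.differentiable hn) (r, μ, y)).hasFDerivAt.comp_hasDerivAt_of_eq μ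
    hline (by simp [hg0])
  rw [hsplit, map_add, map_smul, smul_eq_mul] at d1 d2
  rw [fderiv_drift] at d1
  have e1 := d1.unique ((hasDerivAt_const μ (0 : ℝ)).congr_of_eventuallyEq hge)
  refine ⟨g, hgd.continuousAt, hg0, hge, d2.congr_deriv ?_⟩
  rw [eq_div_iff hY, hopfJac]
  linear_combination (fderiv ℝ S.trB (r, μ, y) (0, 0, 1)) * e1

/-- Along the branch of equilibria, the real part of the eigenvalue is half the trace of `∂U/∂u`. -/
theorem exists_crossing {B τ r μ y θ : ℝ} (hτ : S.IsConjugate B τ) (hB : 0 < B) (hr : |r| < τ)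
    (hμ : |μ| < τ) (hy : |y| < τ) (hr0 : r ≠ 0) (h0 : S.drift (r, μ, y) = 0)
    (htr : S.trB (r, μ, y) = 0) (hdet : S.detB (r, μ, y) = θ ^ 2) (hθ : θ ≠ 0)
    (hY : S.driftY (r, μ, y) ≠ 0) (hJ : S.hopfJac (r, μ, y) ≠ 0) :
    ∃ (p : ℝ → ℝ × ℝ × ℝ) (ev : ℝ → ℂ), ContDiffAt ℝ ∞ p (r * μ) ∧ ContDiffAt ℝ ∞ ev (r * μ) ∧
      p (r * μ) = S.emb r μ y 0 ∧ ev (r * μ) = θ * Complex.I ∧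
      (∀ᶠ x in 𝓝 (r * μ), chartField F G H r x (p x) = 0 ∧
        ev x ∈ eigenvalues (fderiv ℝ (chartField F G H r x) (p x))) ∧
      (deriv ev (r * μ)).re ≠ 0 := by
  have hs : ∀ {x y : ℝ}, |x| < τ → |y| < τ → ContDiffAt ℝ ∞ (fun q : ℝ × ℝ × ℝ × ℝ =>
      chartField F G H r q.1 q.2) (r * x, S.emb r x y 0) := fun hx hy =>
    (hτ.2 r _ _ 0 0 hr hx hy (by simpa using hB.le) (by simpa using hB.le) _ rfl).2.2 hr0
  have hd : ∀ {x y : ℝ}, |x| < τ → |y| < τ →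
      DifferentiableAt ℝ (chartField F G H r (r * x)) (S.emb r x y 0) := fun {x y} hx hy =>
    DifferentiableAt.comp (g := fun q : ℝ × ℝ × ℝ × ℝ => chartField F G H r q.1 q.2)
      (f := fun p => (r * x, p)) _ ((hs hx hy).differentiableAt (by simp)) (by fun_prop)
  have hc := charCoeff_equilibrium hτ hB hr hμ hy h0 (hd hμ hy)
  rw [htr, hdet, add_zero, mul_zero, zero_add] at hc
  obtain ⟨p, ev, hp, hev, hp0, hev0, he, hu⟩ := exists_smooth_eigenvalue (hs hμ hy)
    (field_equilibrium hτ hB.le hr hμ hy h0) hc (mul_ne_zero hr0 hY) hθ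
  refine ⟨p, ev, hp, hev, hp0, hev0, he, ?_⟩
  obtain ⟨g, hgc, hg0, hgz, hgd⟩ := exists_equilibria h0 hY
  have hdiv : HasDerivAt (fun x : ℝ => x / r) (1 / r) (r * μ) := (hasDerivAt_id _).div_const r
  have hdivμ : r * μ / r = μ := by field_simp
  have hdc : Tendsto (fun x : ℝ => x / r) (𝓝 (r * μ)) (𝓝 μ) := by
    simpa only [hdivμ] using hdiv.continuousAt.tendsto
  have hgt : Tendsto (fun x => g (x / r)) (𝓝 (r * μ)) (𝓝 y) := by
    have := hgc.tendsto.comp hdc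
    rwa [hg0] at this
  -- in terms of `μ = r μ₂ = x`, the equilibria on the slow manifold are those with `μ₂ = x / r`
  have hemb : Tendsto (fun x => (x, S.emb r (x / r) (g (x / r)) 0)) (𝓝 (r * μ))
      (𝓝 (r * μ, S.emb r μ y 0)) := by
    have hc : Continuous fun q : ℝ × ℝ => S.emb r q.1 q.2 0 := by
      have := S.smooth_v.continuous
      unfold emb
      fun_prop
    have hgen : ∀ f : ℝ → ℝ → ℝ × ℝ × ℝ, (Continuous fun q : ℝ × ℝ => f q.1 q.2) →
        Tendsto (fun x => f (x / r) (g (x / r))) (𝓝 (r * μ)) (𝓝 (f μ y)) := fun f hf =>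
      (hf.tendsto (μ, y)).comp (hdc.prodMk_nhds hgt)
    exact tendsto_id.prodMk_nhds (hgen (fun x y => S.emb r x y 0) hc)
  have hre : (fun x => (ev x).re) =ᶠ[𝓝 (r * μ)] fun x => S.trB (r, x / r, g (x / r)) / 2 := by
    have him : ∀ᶠ x in 𝓝 (r * μ), (ev x).im ≠ 0 := by
      have : ContinuousAt (fun x => (ev x).im) (r * μ) :=
        Complex.continuous_im.continuousAt.comp hev.continuousAt
      exact this.eventually_ne (by simpa [hev0] using hθ)
    filter_upwards [he, him, hemb.eventually hu, hdc.abs.eventually (gt_mem_nhds hμ),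
      hgt.abs.eventually (gt_mem_nhds hy), hdc.eventually hgz] with x h1 h2 h3 h4 h5 h6
    have hrx : r * (x / r) = x := by field_simp
    -- by uniqueness, the smooth branch consists of the equilibria on the slow manifold
    have h7 := field_equilibrium hτ hB.le hr h4 h5 h6
    have h8 := charCoeff_equilibrium hτ hB hr h4 h5 h6 (hd h4 h5)
    rw [hrx] at h7 h8
    have h9 := (mem_eigenvalues_iff _ _).1 h1.2
    rw [h3 h7, h8] at h9
    exact re_eq_half_trace h2 h9
  have hd1 : HasDerivAt (fun x => (ev x).re) (deriv ev (r * μ)).re (r * μ) :=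
    Complex.reCLM.hasFDerivAt.comp_hasDerivAt _ (hev.differentiableAt (by simp)).hasDerivAt
  have hd2 := (hgd.comp_of_eq (r * μ) hdiv hdivμ.symm).div_const 2
  rw [hd1.unique (hd2.congr_of_eventuallyEq hre)]
  have : (1 / r) ≠ 0 := one_div_ne_zero hr0
  positivity

end StraightChart

end

section

/-! ### The family of periodic orbits -/

/-- The periodic continuation of a closed orbit solves the differential equation, also at the
multiples of the period, where the one-sided derivatives agree. -/
theorem hasDerivAt_periodic {E : Type*} [NormedAddCommGroup E] [NormedSpace ℝ E]
    {φ : ℝ → E} {f : E → E} {T : ℝ} (hT : 0 < T)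
    (hφ : ∀ t ∈ Icc 0 T, HasDerivAt φ (f (φ t)) t) (hclose : φ T = φ 0) (t : ℝ) :
    HasDerivAt (fun t => φ (T * Int.fract (t / T))) (f (φ (T * Int.fract (t / T)))) t := by
  set γ : ℝ → E := fun t => φ (T * Int.fract (t / T)) with hγ
  have heq : ∀ (n : ℤ), ∀ x ∈ Icc (n * T) ((n + 1) * T), γ x = φ (x - n * T) := by
    intro n x hx
    rcases hx.2.eq_or_lt with h | h
    · have h1 : x / T = ((n + 1 : ℤ) : ℝ) := by rw [h]; push_cast; field_simp
      have h2 : x - n * T = T := by rw [h]; ring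
      simp only [hγ, h1, Int.fract_intCast, mul_zero, h2, hclose]
    · have h1 : ⌊x / T⌋ = n := by
        rw [Int.floor_eq_iff, le_div_iff₀ hT, div_lt_iff₀ hT]
        exact ⟨hx.1, h⟩
      simp only [hγ, Int.fract, h1]
      congr 1
      field_simp
  have hd : ∀ (n : ℤ), ∀ x ∈ Icc (n * T) ((n + 1) * T),
      HasDerivWithinAt γ (f (γ x)) (Icc (n * T) ((n + 1) * T)) x := by
    intro n x hx
    refine HasDerivWithinAt.congr ?_ (heq n) (heq n x hx)
    rw [heq n x hx]
    have h1 := hφ (x - n * T) ⟨by linarith [hx.1], by linarith [hx.2]⟩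
    exact (h1.comp_sub_const x (n * T)).hasDerivWithinAt
  have hright : HasDerivWithinAt γ (f (γ t)) (Ici t) t := by
    have h1 := (le_div_iff₀ hT).1 (Int.floor_le (t / T))
    have h2 := (div_lt_iff₀ hT).1 (Int.lt_floor_add_one (t / T))
    exact (hd ⌊t / T⌋ t ⟨h1, h2.le⟩).mono_of_mem_nhdsWithin
      (mem_of_superset (Icc_mem_nhdsGE h2) (Icc_subset_Icc_left h1))
  have hleft : HasDerivWithinAt γ (f (γ t)) (Iic t) t := by
    have h1 := (div_le_iff₀ hT).1 (Int.le_ceil (t / T))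
    have h2 : ((⌈t / T⌉ - 1 : ℤ) : ℝ) * T < t := by
      rw [← lt_div_iff₀ hT]
      have := Int.ceil_lt_add_one (t / T)
      push_cast
      linarith
    have h3 : t ≤ (((⌈t / T⌉ - 1 : ℤ) : ℝ) + 1) * T := by push_cast; simpa using h1
    exact (hd (⌈t / T⌉ - 1) t ⟨h2.le, h3⟩).mono_of_mem_nhdsWithin
      (mem_of_superset (Icc_mem_nhdsLE h2) (Icc_subset_Icc_right h3))
  have := hleft.union hright
  rwa [Iic_union_Ici, hasDerivWithinAt_univ] at this

/-- Closed orbits `φ s` that are given, in terms of some angle `ψ`, by their points `P (s, ψ)` and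
times `t (s, ψ)` depend continuously on `s` and on the time: by compactness, `(s, ψ) ↦ (s, t / T)` is
a quotient map. -/
theorem continuous_closed_orbits {E β : Type*} [TopologicalSpace E] [TopologicalSpace β]
    [CompactSpace β] [T2Space β]
    {L : ℝ} (hL : 0 ≤ L) {φ : β → ℝ → E} {P : β × Icc 0 L → E} {t : β × Icc 0 L → ℝ} {T : β → ℝ}
    (hP : Continuous P) (ht : Continuous t) (hTc : Continuous T) (hT : ∀ s, 0 < T s)
    (h0 : ∀ s, t (s, ⟨0, le_rfl, hL⟩) = 0) (h1 : ∀ s, t (s, ⟨L, hL, le_rfl⟩) = T s)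
    (hmem : ∀ s ψ, t (s, ψ) ∈ Icc 0 (T s)) (hφ : ∀ s ψ, φ s (t (s, ψ)) = P (s, ψ))
    (hclose : ∀ s, φ s (T s) = φ s 0) :
    Continuous fun q : β × ℝ => φ q.1 (T q.1 * Int.fract (q.2 / T q.1)) := by
  have hTi : Continuous fun s => (T s)⁻¹ := hTc.inv₀ fun s => (hT s).ne'
  set Q : β × Icc 0 L → β × Icc (0 : ℝ) 1 := fun p => (p.1, ⟨t p * (T p.1)⁻¹,
    mul_nonneg (hmem p.1 p.2).1 (inv_nonneg.2 (hT p.1).le), by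
      rw [← div_eq_mul_inv]; exact div_le_one_of_le₀ (hmem p.1 p.2).2 (hT p.1).le⟩) with hQ
  have hQc : Continuous Q := continuous_fst.prodMk
    ((ht.mul (hTi.comp continuous_fst)).subtype_mk _)
  have hQs : Function.Surjective Q := by
    rintro ⟨s, x, hx⟩
    have hc : Continuous fun ψ => t (s, ψ) := ht.comp (by fun_prop)
    have hx' : T s * x ∈ Icc (IccExtend hL (fun ψ => t (s, ψ)) 0)
        (IccExtend hL (fun ψ => t (s, ψ)) L) := by
      rw [IccExtend_left, IccExtend_right, h0, h1]
      exact ⟨mul_nonneg (hT s).le hx.1, mul_le_of_le_one_right (hT s).le hx.2⟩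
    obtain ⟨ψ, hψ, hψx⟩ := intermediate_value_Icc hL hc.Icc_extend'.continuousOn hx'
    rw [IccExtend_of_mem _ _ hψ] at hψx
    refine ⟨(s, ⟨ψ, hψ⟩), Prod.ext rfl (Subtype.ext ?_)⟩
    simp only [hQ, hψx]
    rw [mul_comm (T s), mul_inv_cancel_right₀ (hT s).ne']
  have hq : Topology.IsQuotientMap Q := hQc.isClosedMap.isQuotientMap hQc hQs
  have hO : Continuous fun q : β × Icc (0 : ℝ) 1 => φ q.1 (T q.1 * q.2) := by
    rw [hq.continuous_iff]
    refine hP.congr fun p => ?_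
    simp only [Function.comp_apply, hQ]
    rw [mul_comm (T p.1), inv_mul_cancel_right₀ (hT p.1).ne']
    exact (hφ p.1 p.2).symm
  refine ContinuousOn.comp_fract (β := β × ℝ) (f := fun q x => φ q.1 (T q.1 * x))
    (s := fun q => q.2 / T q.1) ?_ ?_ fun q => by simp [hclose]
  · have h2 : Continuous fun q : (β × ℝ) × Icc (0 : ℝ) 1 => φ q.1.1 (T q.1.1 * q.2) :=
      hO.comp (by fun_prop : Continuous fun q : (β × ℝ) × Icc (0 : ℝ) 1 => (q.1.1, q.2))
    rw [continuousOn_iff_continuous_domRestrict]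
    exact h2.comp (Continuous.prodMk (continuous_fst.comp continuous_subtype_val)
      ((continuous_snd.comp continuous_subtype_val).subtype_mk fun q => q.2.2))
  · exact continuous_snd.div₀ (hTc.comp continuous_fst) fun q => (hT q.1).ne'

namespace StraightChart

variable {F G H : ℝ → ℝ → ℝ → ℝ → ℝ → ℝ} {k : ℕ} {m : ℝ → ℝ → ℝ → ℝ × ℝ}
  {S : StraightChart F G H k m} {c : ℝ} {hc : 0 < c}

/-- The zeros of the Melnikov function give a continuous family of periodic orbits, which shrink to
an equilibrium as `h → 0`. -/
theorem exists_cycles {B τ r h₁ θ : ℝ} {Y M : ℝ → ℝ} (hh₁ : 0 < h₁)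
    (hY : ContinuousOn Y (Icc 0 h₁)) (hM : ContinuousOn M (Icc 0 h₁))
    (hadm : ∀ h ∈ Icc 0 h₁, S.IsAdmissible hc B τ (h, Y h, r, M h) (S.sol hc (h, Y h, r, M h)))
    (hroot : ∀ h ∈ Icc 0 h₁, S.melnikov hc (h, Y h, r, M h) = 0)
    (hturn : (S.sol hc (0, Y 0, r, M 0) turn).2.2 = 2 * Real.pi / θ)
    (hq : ∀ ψ, (S.sol hc (0, Y 0, r, M 0) ψ).2.1 = 0) :
    ∃ (M' T : ℝ → ℝ) (γ : ℝ → ℝ → ℝ × ℝ × ℝ), Continuous M' ∧ Continuous T ∧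
      Continuous (fun q : ℝ × ℝ => γ q.1 q.2) ∧ M' 0 = r * M 0 ∧ T 0 = 2 * Real.pi / θ ∧
      (∀ t, γ 0 t = S.emb r (M 0) (Y 0) 0) ∧ ∀ s ∈ Ioo 0 h₁, 0 < T s ∧
        (∀ t, HasDerivAt (γ s) (chartField F G H r (M' s) (γ s t)) t) ∧
        (∀ t, γ s (t + T s) = γ s t) ∧ ∀ t ∈ Ioo 0 (T s), γ s t ≠ γ s 0 := by
  set π : Icc 0 h₁ → ℝ × ℝ × ℝ × ℝ := fun s => (s, Y s, r, M s) with hπ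
  set w : Icc 0 h₁ → C(Icc 0 (2 * Real.pi), ℝ × ℝ × ℝ) := fun s => S.sol hc (π s) with hw
  have ha : ∀ s, S.IsAdmissible hc B τ (π s) (w s) := fun s => hadm s s.2
  have hYc : Continuous fun s : Icc 0 h₁ => Y s := hY.domRestrict
  have hMc : Continuous fun s : Icc 0 h₁ => M s := hM.domRestrict
  have hπc : Continuous π :=
    continuous_subtype_val.prodMk (hYc.prodMk (continuous_const.prodMk hMc))
  have hwc : Continuous w := continuous_iff_continuousAt.2 fun s =>
    ContinuousAt.comp (g := S.sol hc) (ha s).polar.contDiffAt.1.continuousAt hπc.continuousAt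
  have hev : Continuous fun p : Icc 0 h₁ × Icc 0 (2 * Real.pi) => w p.1 p.2 :=
    (hwc.comp continuous_fst).eval continuous_snd
  have h0mem : (0 : ℝ) ∈ Icc 0 (2 * Real.pi) := ⟨le_rfl, two_pi_nonneg⟩
  have hw0 : ∀ s, w s ⟨0, h0mem⟩ = 0 := fun s => by
    have := (ha s).polar.start
    rwa [IccExtend_of_mem _ _ h0mem] at this
  have hw1 : ∀ s, (w s turn).1 = 0 ∧ (w s turn).2.1 = 0 := fun s => by
    have h2 := hroot s s.2
    have h3 : 1 - Real.exp (w s turn).1 = 0 := congrArg Prod.fst h2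
    exact ⟨Real.exp_eq_one_iff _ |>.1 (by linarith), congrArg Prod.snd h2⟩
  choose φ q t htc htm ht0 hq0 hψ hrc using fun s => (ha s).exists_orbit
  set T : Icc 0 h₁ → ℝ := fun s => (w s turn).2.2 with hT
  have htT : ∀ s, t s (2 * Real.pi) = T s := fun s => (hψ s turn).1
  have hTpos : ∀ s, 0 < T s := fun s => by
    rw [← htT, ← ht0 s]; exact htm s Real.two_pi_pos
  have hTc : Continuous T := (hev.comp (Continuous.prodMk_left turn)).snd.snd
  have hsurj : ∀ s, ∀ x ∈ Icc 0 (T s), ∃ ψ : Icc 0 (2 * Real.pi), t s ψ = x := by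
    intro s x hx
    obtain ⟨ψ, hψ, hψx⟩ := intermediate_value_Icc two_pi_nonneg (htc s).continuousOn
      (show x ∈ Icc (t s 0) (t s (2 * Real.pi)) by rw [ht0, htT]; exact hx)
    exact ⟨⟨ψ, hψ⟩, hψx⟩
  set P : Icc 0 h₁ × Icc 0 (2 * Real.pi) → ℝ × ℝ × ℝ := fun p => S.point (p.2, π p.1, w p.1 p.2)
    with hP
  have hPφ : ∀ s (ψ : Icc 0 (2 * Real.pi)), φ s (t s ψ) = P (s, ψ) := fun s ψ => (hψ s ψ).2.2.1
  have hPc : Continuous P := by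
    have h2 : Continuous S.point := by
      have := S.smooth_v.continuous
      have h3 := (contDiff_rad (n := 0)).continuous
      have h4 := (contDiff_slow (n := 0)).continuous
      unfold point emb
      fun_prop
    exact h2.comp (by fun_prop)
  have hP0 : ∀ s : Icc 0 h₁, φ s 0 = S.emb r (M s) (Y s) (-s, 0) := fun s => by
    have h2 := hPφ s ⟨0, h0mem⟩
    rw [ht0] at h2
    rw [h2]
    simp [hP, point, hw0, rad, slow, hπ]
  -- at zeros of the Melnikov function the orbits are closed
  have hclose : ∀ s, φ s (T s) = φ s 0 := fun s => by
    rw [hP0, ← htT]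
    refine (hPφ s turn).trans ?_
    simp only [hP, point, hw1, rad, slow, hπ]
    simp [turn]
  have hdφ : ∀ s, ∀ x ∈ Icc 0 (T s), HasDerivAt (φ s) (chartField F G H r (r * M s) (φ s x)) x := by
    intro s x hx
    obtain ⟨ψ, rfl⟩ := hsurj s x hx
    exact (hψ s ψ).2.2.2.1
  have hγc := continuous_closed_orbits two_pi_nonneg (φ := φ) (t := fun p => (w p.1 p.2).2.2) hPc
    hev.snd.snd hTc hTpos (fun s => by rw [hw0]; rfl) (fun s => rfl) (fun s ψ => by
      rw [← (hψ s ψ).1, ← htT]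
      exact ⟨(ht0 s).symm.trans_le ((htm s).monotone ψ.2.1), (htm s).monotone ψ.2.2⟩)
    (fun s ψ => by rw [← (hψ s ψ).1, hPφ]) hclose
  -- the family is continued to all `s` by its values at the ends of `[0, h₁]`
  have hpr : Continuous (projIcc 0 h₁ hh₁.le) := continuous_projIcc
  have hpr0 : projIcc 0 h₁ hh₁.le 0 = ⟨0, le_rfl, hh₁.le⟩ := projIcc_left _
  refine ⟨fun s => r * M (projIcc 0 h₁ hh₁.le s), fun s => T (projIcc 0 h₁ hh₁.le s),
    fun s x => φ (projIcc 0 h₁ hh₁.le s) (T (projIcc 0 h₁ hh₁.le s) *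
      Int.fract (x / T (projIcc 0 h₁ hh₁.le s))), (hMc.comp hpr).const_mul r, hTc.comp hpr,
    hγc.comp (by fun_prop : Continuous fun q : ℝ × ℝ => (projIcc 0 h₁ hh₁.le q.1, q.2)),
    by simp only [hpr0], ?_, fun x => ?_, fun s hs => ?_⟩
  · simp only [hpr0]; exact hturn
  · simp only [hpr0]
    set s : Icc 0 h₁ := ⟨0, le_rfl, hh₁.le⟩ with hs
    obtain ⟨ψ, e⟩ := hsurj s (T s * Int.fract (x / T s))
      ⟨mul_nonneg (hTpos s).le (Int.fract_nonneg _),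
        mul_le_of_le_one_right (hTpos s).le (Int.fract_lt_one _).le⟩
    rw [← e, hPφ]
    have h2 : (w s ψ).2.1 = 0 := hq ψ
    have h3 : S.point (ψ, π s, w s ψ) = S.emb r (M 0) (Y 0 + r * (w s ψ).2.1)
        (0 * Real.exp (w s ψ).1 * -Real.cos ψ, 0 * Real.exp (w s ψ).1 * -Real.sin ψ) := rfl
    refine h3.trans ?_
    rw [h2]
    simp [← Prod.zero_eq_mk]
  · beta_reduce
    rw [projIcc_of_mem hh₁.le ⟨hs.1.le, hs.2.le⟩]
    set σ : Icc 0 h₁ := ⟨s, hs.1.le, hs.2.le⟩ with hσ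
    refine ⟨hTpos σ, hasDerivAt_periodic (hTpos σ) (hdφ σ) (hclose σ), fun x => ?_, fun x hx => ?_⟩
    · rw [add_div, div_self (hTpos σ).ne', Int.fract_add_one]
    · have h2 : Int.fract (x / T σ) = x / T σ := Int.fract_eq_self.2
        ⟨div_nonneg hx.1.le (hTpos σ).le, (div_lt_one (hTpos σ)).2 hx.2⟩
      rw [h2, zero_div, Int.fract_zero, mul_zero, mul_div_cancel₀ _ (hTpos σ).ne', hP0]
      obtain ⟨ψ, rfl⟩ := hsurj σ x ⟨hx.1.le, hx.2.le⟩
      intro hcon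
      have hr := (ha σ).r_lt.trans_le (ha σ).conj.1
      have hμ := (ha σ).μ_lt.trans_le (ha σ).conj.1
      have hrad : ∀ ψ : Icc 0 (2 * Real.pi), 0 < rad (ψ, π σ, w σ ψ) := fun ψ =>
        mul_pos hs.1 (Real.exp_pos _)
      -- the period is minimal: the orbit returns to the half line of its starting point only at
      -- `2π`
      have e1 : straight m r (M σ) (φ σ (t σ ψ)) = (rad (ψ, π σ, w σ ψ) * -Real.cos ψ,
          rad (ψ, π σ, w σ ψ) * -Real.sin ψ) := by
        rw [hPφ]
        exact straight_emb hr hμ (((ha σ).slow_lt ψ).trans_le (ha σ).conj.1) _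
      have e2 : straight m r (M σ) (S.emb r (M σ) (Y σ) (-s, 0)) = (-s, 0) := by
        refine straight_emb hr hμ ?_ _
        have := ((ha σ).slow_lt ⟨0, h0mem⟩).trans_le (ha σ).conj.1
        rw [hw0] at this
        simpa [slow, hπ] using this
      rw [hcon, e2] at e1
      have e3 := congrArg Prod.fst e1
      have e4 := congrArg Prod.snd e1
      simp only at e3 e4
      have hsin : Real.sin (ψ : ℝ) = 0 := by
        have := (mul_eq_zero.1 e4.symm).resolve_left (hrad ψ).ne'
        linarith
      have hψπ := eq_pi_of_sin_eq_zero ((htm σ).lt_iff_lt.1 ((ht0 σ).trans_lt hx.1))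
        ((htm σ).lt_iff_lt.1 (hx.2.trans_eq (htT σ).symm)) hsin
      rw [hψπ, Real.cos_pi] at e3
      have := hrad ψ
      rw [hψπ] at this
      linarith [hs.1]

end StraightChart

end

section

/-! ### The Hopf bifurcation -/

theorem orderG_zero {G : ℝ → ℝ → ℝ → ℝ → ℝ → ℝ} (oG : OrderG G) : G 0 0 0 0 0 = 0 := by
  obtain ⟨C, hC⟩ := oG.bound
  simpa using hC.self_of_nhds

theorem exists_pos_of_eventually {P : ℝ → Prop} (h : ∀ᶠ x in 𝓝[>] (0 : ℝ), P x) : ∃ x > 0, P x := by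
  obtain ⟨x, h1, h2⟩ := (h.and self_mem_nhdsWithin).exists
  exact ⟨x, h2, h1⟩

theorem eventually_forall_Icc {P : ℝ → Prop} (h : ∀ᶠ r in 𝓝 (0 : ℝ), P r) :
    ∀ᶠ r₀ in 𝓝[>] (0 : ℝ), ∀ r ∈ Icc 0 r₀, P r := by
  obtain ⟨ε, hε, hP⟩ := Metric.eventually_nhds_iff.1 h
  filter_upwards [Ioo_mem_nhdsGT hε] with r₀ hr₀ r hr
  exact hP (by rw [Real.dist_0_eq_abs, abs_of_nonneg hr.1]; exact hr.2.trans_lt hr₀.2)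

namespace StraightChart

variable {F G H : ℝ → ℝ → ℝ → ℝ → ℝ → ℝ} {k : ℕ} {m : ℝ → ℝ → ℝ → ℝ × ℝ}
  {S : StraightChart F G H k m} {c : ℝ} {hc : 0 < c}

/-- The zeros `(h, Y h, r, M h)` of the Melnikov function give a Hopf bifurcation at `h = 0`. -/
theorem isHopfBifurcation {B τ τ' r h₁ θ : ℝ} {Y M : ℝ → ℝ} (hh₁ : 0 < h₁)
    (hY : ContinuousOn Y (Icc 0 h₁)) (hM : ContinuousOn M (Icc 0 h₁))
    (hadm : ∀ h ∈ Icc 0 h₁, S.IsAdmissible hc B τ' (h, Y h, r, M h) (S.sol hc (h, Y h, r, M h)))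
    (hroot : ∀ h ∈ Icc 0 h₁, S.melnikov hc (h, Y h, r, M h) = 0)
    (hturn : (S.sol hc (0, Y 0, r, M 0) turn).2.2 = 2 * Real.pi / θ)
    (hq : ∀ ψ, (S.sol hc (0, Y 0, r, M 0) ψ).2.1 = 0)
    (hτ : S.IsConjugate 1 τ) (hr : |r| < τ) (hμ : |M 0| < τ) (hy : |Y 0| < τ) (hr0 : r ≠ 0)
    (h0 : S.drift (r, M 0, Y 0) = 0) (htr : S.trB (r, M 0, Y 0) = 0)
    (hdet : S.detB (r, M 0, Y 0) = θ ^ 2) (hθ : 0 < θ)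
    (hdY : S.driftY (r, M 0, Y 0) ≠ 0) (hJ : S.hopfJac (r, M 0, Y 0) ≠ 0) :
    IsHopfBifurcation (fun μ => chartField F G H r μ) (r * M 0) (graphPt m r (M 0) (Y 0)) θ ∧
    eigenvalues (fderiv ℝ (chartField F G H r (r * M 0)) (graphPt m r (M 0) (Y 0))) =
      {θ * Complex.I, -(θ * Complex.I), ((r * S.driftY (r, M 0, Y 0) : ℝ) : ℂ)} := by
  rw [graphPt_eq (hr.trans_le hτ.1) (hμ.trans_le hτ.1) (hy.trans_le hτ.1)]
  have hs : ContDiffAt ℝ ∞ (fun q : ℝ × ℝ × ℝ × ℝ => chartField F G H r q.1 q.2)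
      (r * M 0, S.emb r (M 0) (Y 0) 0) :=
    (hτ.2 r _ _ 0 0 hr hμ hy (by simp) (by simp) _ rfl).2.2 hr0
  have hd : DifferentiableAt ℝ (chartField F G H r (r * M 0)) (S.emb r (M 0) (Y 0) 0) :=
    DifferentiableAt.comp (g := fun q : ℝ × ℝ × ℝ × ℝ => chartField F G H r q.1 q.2)
      (f := fun p => (r * M 0, p)) _ (hs.differentiableAt (by simp)) (by fun_prop)
  have hcc := charCoeff_equilibrium hτ one_pos hr hμ hy h0 hd
  rw [htr, hdet, add_zero, mul_zero, zero_add] at hcc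
  set κ := r * S.driftY (r, M 0, Y 0) with hκ
  have hκ0 : κ ≠ 0 := mul_ne_zero hr0 hdY
  have hev := eigenvalues_eq hcc
  have hne1 : (θ : ℂ) * Complex.I ≠ -(θ * Complex.I) := fun h => by
    have := congrArg Complex.im h
    simp at this
    linarith
  have hne2 : (θ : ℂ) * Complex.I ≠ (κ : ℂ) := fun h => by
    have := congrArg Complex.im h
    simp at this
    exact hθ.ne' this
  obtain ⟨M', T, γ, c1, c2, c3, c4⟩ := exists_cycles hh₁ hY hM hadm hroot hturn hq
  refine ⟨⟨hθ, hs, field_equilibrium hτ zero_le_one hr hμ hy h0, ?_, ?_,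
    exists_crossing hτ one_pos hr hμ hy hr0 h0 htr hdet hθ.ne' hdY hJ,
    h₁, M', T, γ, hh₁, c1.continuousOn, c2.continuousOn, c3.continuousOn, c4⟩, hev⟩
  · simp only [hev, Multiset.insert_eq_cons]
    rw [Multiset.count_cons_self, Multiset.count_cons_of_ne hne1, Multiset.count_singleton,
      if_neg hne2]
  · intro z hz h1 h2
    simp only [hev, Multiset.insert_eq_cons, Multiset.mem_cons, Multiset.mem_singleton] at hz
    rcases hz with h | h | h
    · exact absurd h h1
    · exact absurd h h2
    · rw [h, Complex.ofReal_re]; exact hκ0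

end StraightChart

/-- The bifurcation for all small `r`: the curve on which the trace of `∂U/∂u` vanishes at an
equilibrium is the zero branch of the Melnikov function at `h = 0`. -/
theorem StraightChart.exists_hopf {F G H : ℝ → ℝ → ℝ → ℝ → ℝ → ℝ} {k : ℕ}
    {m : ℝ → ℝ → ℝ → ℝ × ℝ} (S : StraightChart F G H k m) (hlam : lam G ≠ 0) {ν R h₁ : ℝ}
    (hν : 0 < ν) (hR : 0 < R) (hh₁ : 0 < h₁) :
    ∃ η > 0, η < ν ∧ η ≤ R ∧ ∃ r₀ > 0, r₀ ≤ R ∧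
      ∃ (D : ℝ × ℝ × ℝ × ℝ → ℝ × ℝ) (Y M : ℝ → ℝ → ℝ), IsMelnikov F G H k ν m h₁ η r₀ D ∧
        IsZeroBranch k h₁ η r₀ D Y M ∧ ∃ C : ℝ, ∀ r ∈ Ioc 0 r₀, ∃ θ κ : ℝ,
          IsHopfBifurcation (fun μ => chartField F G H r μ) (r * M 0 r)
            (graphPt m r (M 0 r) (Y 0 r)) θ ∧
          eigenvalues (fderiv ℝ (chartField F G H r (r * M 0 r)) (graphPt m r (M 0 r) (Y 0 r))) =
            {θ * Complex.I, -(θ * Complex.I), (κ : ℂ)} ∧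
          |θ - 1| ≤ C * r ∧ |κ - lam G * r| ≤ C * r ^ 2 := by
  obtain ⟨c, hc, B, τ', hc1, hη⟩ := S.exists_isMelnikov hν hh₁
  obtain ⟨Z, C, hZc, hZ0, hZ⟩ := S.exists_hopf_curve hlam hc1
  obtain ⟨τ, hτ, hconj⟩ := S.exists_isConjugate 1
  have hsmall : ∀ {b : ℝ}, 0 < b → ∀ᶠ x in 𝓝[>] (0 : ℝ), x < b := fun hb =>
    mem_nhdsWithin_of_mem_nhds (Iio_mem_nhds hb)
  obtain ⟨η, hη0, hη, hην, hηR, hητ⟩ := exists_pos_of_eventually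
    (hη.and ((hsmall hν).and ((hsmall hR).and (hsmall hτ))))
  have hZη : ∀ᶠ r in 𝓝 (0 : ℝ), ‖Z r‖ < η :=
    hZc.norm.eventually (gt_mem_nhds (by simpa [hZ0] using hη0))
  obtain ⟨r₀, hr₀, ⟨Y, M, hmel, hbr, hadm⟩, hcurve, hrR, hrτ⟩ := exists_pos_of_eventually
    (hη.and ((eventually_forall_Icc (hZ.and hZη)).and
      ((hsmall hR).and (hsmall hτ))))
  refine ⟨η, hη0, hην, hηR.le, r₀, hr₀, hrR.le, S.melnikov hc, Y, M, hmel, hbr, C, fun r hr => ?_⟩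
  have hrI : r ∈ Icc 0 r₀ := ⟨hr.1.le, hr.2⟩
  have h0I : (0 : ℝ) ∈ Icc 0 h₁ := ⟨le_rfl, hh₁.le⟩
  obtain ⟨h1, h2⟩ := hcurve r hrI
  obtain ⟨y, hy⟩ : ∃ y, y = (Z r).1 := ⟨_, rfl⟩
  obtain ⟨μ, hμ⟩ : ∃ μ, μ = (Z r).2 := ⟨_, rfl⟩
  have hZ1 : |y| < η := by rw [hy]; exact (norm_fst_le (Z r)).trans_lt h2
  have hZ2 : |μ| < η := by rw [hμ]; exact (norm_snd_le (Z r)).trans_lt h2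
  obtain ⟨e1, e2, e3, e4, e5, e6, e7, e8, e9⟩ := h1 (r, μ, y) (by rw [hy, hμ])
  obtain ⟨θ, hθ⟩ : ∃ θ, θ = √(S.detB (r, μ, y)) := ⟨_, rfl⟩
  rw [← hθ] at e6
  have hθ2 : S.detB (r, μ, y) = θ ^ 2 := by rw [hθ]; exact (Real.sq_sqrt (by linarith)).symm
  have hθ0 : 0 ≤ θ := hθ ▸ Real.sqrt_nonneg _
  have hθl : 3 / 4 < θ := by nlinarith
  have hθu : θ < 5 / 4 := by nlinarith
  obtain ⟨w, hw, hw1, hw2⟩ := S.exists_isPolar_equilibrium hc e1 e2 (fun ψ => (e3 ψ).1)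
    (fun ψ => (e3 ψ).2) hθ2 hθl hθu
  have hsol := hw.sol_eq
  -- uniqueness of the zero branch identifies it with the curve of Hopf points at `h = 0`
  have hzero : S.melnikov hc (0, y, r, μ) = 0 := by
    simp only [StraightChart.melnikov, hsol, hw1]
    simp
  obtain ⟨hYZ, hMZ⟩ := hbr.unique 0 y r μ ⟨h0I, abs_le.1 hZ1.le, hrI, abs_le.1 hZ2.le⟩ hzero
  rw [hYZ, hMZ] at e1 e2 e7 e8 e9 hθ2 hsol
  rw [hYZ] at hZ1
  rw [hMZ] at hZ2
  have hslice : ContinuousOn (fun h : ℝ => (h, r)) (Icc 0 h₁) := by fun_prop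
  have hmaps : MapsTo (fun h : ℝ => (h, r)) (Icc 0 h₁) (Icc 0 h₁ ×ˢ Icc 0 r₀) :=
    fun h hh => ⟨hh, hrI⟩
  have habs : |r| < τ := by rw [abs_of_pos hr.1]; exact hr.2.trans_lt hrτ
  obtain ⟨g1, g2⟩ := StraightChart.isHopfBifurcation (S := S) (Y := fun h => Y h r)
    (M := fun h => M h r) hh₁ (hbr.smooth_Y.continuousOn.comp hslice hmaps)
    (hbr.smooth_M.continuousOn.comp hslice hmaps)
    (fun h hh => hadm _ (hbr.mem_box h hh r hrI)) (fun h hh => hbr.root h hh r hrI)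
    (by simp only [hsol, hw1]) (by simp only [hsol]; exact hw2) hconj habs (hZ2.trans hητ)
    (hZ1.trans hητ) hr.1.ne' e1 e2 hθ2 (by linarith) e9 e8
  rw [abs_of_pos hr.1] at e6 e7
  refine ⟨θ, _, g1, g2, e6, ?_⟩
  · rw [show r * S.driftY (r, M 0 r, Y 0 r) - lam G * r = r * (S.driftY (r, M 0 r, Y 0 r) - lam G) by
      ring, abs_mul, abs_of_pos hr.1]
    nlinarith [mul_le_mul_of_nonneg_left e7 hr.1.le]

end

end

end DudCanard

theorem mainTheorem4 (F G H : ℝ → ℝ → ℝ → ℝ → ℝ → ℝ)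
    (hF : DudCanard.AnalyticInSpace F) (hG : DudCanard.AnalyticInSpace G)
    (hH : DudCanard.AnalyticInSpace H)
    (oF : DudCanard.OrderF F) (oG : DudCanard.OrderG G) (oH : DudCanard.OrderH H)
    (hlam : DudCanard.lam G ≠ 0) :
    DudCanard.eigenvalues (fderiv ℝ (DudCanard.chartField F G H 0 0) 0) =
      {Complex.I, -Complex.I, 0} ∧
    ∀ k : ℕ, ∃ ν > 0, ∃ δ > 0, ∃ R > 0, ∃ m : ℝ → ℝ → ℝ → ℝ × ℝ,
      DudCanard.IsSlowManifold F G H k ν δ R m ∧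
      ∀ h₁ > 0, ∃ η > 0, η < ν ∧ η ≤ δ ∧ ∃ r₀ > 0, r₀ ≤ R ∧
        ∃ (D : ℝ × ℝ × ℝ × ℝ → ℝ × ℝ) (Y M : ℝ → ℝ → ℝ),
          DudCanard.IsMelnikov F G H k ν m h₁ η r₀ D ∧
          DudCanard.IsZeroBranch k h₁ η r₀ D Y M ∧
          ∃ C : ℝ, ∀ r ∈ Set.Ioc 0 r₀, ∃ θ κ : ℝ,
            DudCanard.IsHopfBifurcation (fun μ => DudCanard.chartField F G H r μ) (r * M 0 r)
              (DudCanard.graphPt m r (M 0 r) (Y 0 r)) θ ∧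
            DudCanard.eigenvalues (fderiv ℝ (DudCanard.chartField F G H r (r * M 0 r))
              (DudCanard.graphPt m r (M 0 r) (Y 0 r))) =
              {θ * Complex.I, -(θ * Complex.I), (κ : ℂ)} ∧
            |θ - 1| ≤ C * r ∧ |κ - DudCanard.lam G * r| ≤ C * r ^ 2 := by
  refine ⟨DudCanard.eigenvalues_limit (DudCanard.orderG_zero oG), fun k => ?_⟩
  obtain ⟨N⟩ := DudCanard.exists_chartData hF hG hH oF oG oH
  obtain ⟨ν, hν, R, hR, m, hm, σ, hσ, -, -, v, hv, hmv⟩ := DudCanard.exists_slowManifold N hlam k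
  obtain ⟨S, -⟩ := DudCanard.exists_straightChart N hσ hv hmv
  exact ⟨ν, hν, R, hR, R, hR, m, hm, fun h₁ hh₁ => S.exists_hopf hlam hν hR hh₁⟩
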